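/- Let $M$ be a smooth ($\sigma$-compact, Hausdorff) manifold of dimension $n\ge 3$, let $p\in[2,\infty)$, and let $g$ be a continuous Riemannian metric on $M$ of class $W^{1,p}_{\mathrm{loc}}$ (in every smooth chart the components $g_{ij}$ have weak first partial derivatives in $L^p_{\mathrm{loc}}$). Assume: - $g$ is complete, i.e. $M$ with the distance $d_g$ (infimum of $g$-lengths of $C^1$ curves) is complete; - $g$ is asymptotically flat: there are a compact set $K'\subset M$ and a diffeomorphism $\Phi:M\setminus K'\to\mathbb R^n\setminus\overline{B_1(0)}$ in whose coordinates $g_{ij}$ is $C^2$ and, for some $\tau>(n-2)/2$, $g_{ij}=\delta_{ij}+O(|x|^{-\tau})$, $\partial_kg_{ij}=O(|x|^{-\tau-1})$, $\partial_k\partial_\ell g_{ij}=O(|x|^{-\tau-2})$ as $|x|\to\infty$, and the scalar curvature satisfies $R[g]\in L^1(M\setminus K',\mu_g)$; - $g$ is smooth on $M\setminus K$ for a compact set $K\subset M$; - the distributional scalar curvature is nonnegative, $R[g]\ge0$ in $\mathcal D'(M)$: in every smooth chart $(U,\psi)$ and for every $0\le f\in C_c^\infty(\psi(U))$, $$\int_{\psi(U)}\bigl(-V^k\partial_kf+Ff\bigr)\,dx\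 \ge 0,$$ where (summing over repeated indices, with weak derivatives) $\Gamma^k_{ij}=\tfrac12g^{kl}(\partial_ig_{jl}+\partial_jg_{il}-\partial_lg_{ij})$, $V^k=g^{ij}\Gamma^k_{ij}-g^{ik}\Gamma^j_{ij}$ and $F=-(\partial_mg^{ij})\Gamma^m_{ij}+(\partial_jg^{ij})\Gamma^m_{im}+g^{ij}\Gamma^m_{ij}\Gamma^k_{km}-g^{ij}\Gamma^m_{ik}\Gamma^k_{jm}$. Choose finitely many smooth charts $\psi_i:U_i\to B_1(0)\subset\mathbb R^n$ ($i=1,\dots,m$) with $K\subset\bigcup_iU_i$; a smooth partition of unity $\eta_{\mathcal C},\eta_1,\dots,\eta_m\geq 0$ on $M$ with $\operatorname{supp}\eta_{\mathcal C}\subset M\setminus K$ and $\operatorname{supp}\eta_i\subset U_i$; functions $\chi_i\in C_c^\infty(U_i)$ equal to $1$ on a neighbourhood of $\operatorname{supp}\eta_i$; and a smooth $\rho\ge0$ on $\mathbb R^n$ supported in the closed unit ball with $\int\rho=1$, and put $\rho_\varepsilon(x)=\varepsilon^{-n}\rho(x/\varepsilon)$. Define $$g_\varepsilon:=\eta_{\mathcal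 C}\,g+\sum_{i=1}^m\chi_i\,\psi_i^*\Bigl[\bigl((\psi_i)_*(\eta_ig)\bigr)*\rho_\varepsilon\Bigr],$$ with component-wise convolution. Then, for every such choice, $g_\varepsilon$ is a smooth Riemannian metric on $M$ for all sufficiently small $\varepsilon>0$, and the negative part $R[g_\varepsilon]_-=\max(-R[g_\varepsilon],0)$ of its scalar curvature satisfies $$\|R[g_\varepsilon]_-\|_{L^{p/2}(M,\mu_g)}\longrightarrow0\qquad\text{as }\varepsilon\to0^+,$$ where $\mu_g$ is the Riemannian volume measure of $g$. -/

import Mathlib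

open MeasureTheory Filter Topology Set
open scoped Manifold ContDiff Distributions ENNReal

noncomputable section

namespace LowRegPMT

/-! ### Coordinates -/

/-- The model space `ℝⁿ` with its Euclidean norm. -/
abbrev Euc (n : ℕ) := EuclideanSpace ℝ (Fin n)

/-- The `i`-th standard basis vector of `ℝⁿ`. -/
def stdVec {n : ℕ} (i : Fin n) : Euc n := EuclideanSpace.single i 1

/-- The bilinear form `dx^a ⊗ dx^b : (v, w) ↦ v_a w_b`. -/
def dxTensor {n : ℕ} (a b : Fin n) : Euc n →L[ℝ] Euc n →L[ℝ] ℝ :=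
  ContinuousLinearMap.smulRight (EuclideanSpace.proj a : Euc n →L[ℝ] ℝ)
    (EuclideanSpace.proj b : Euc n →L[ℝ] ℝ)

/-- The classical partial derivative `∂ₖ u`. -/
def pderiv {n : ℕ} (k : Fin n) (u : Euc n → ℝ) (y : Euc n) : ℝ := fderiv ℝ u y (stdVec k)

section Manifold

variable {n : ℕ} {M : Type*} [TopologicalSpace M] [ChartedSpace (Euc n) M]

/-- A topological chart of `M`. -/
abbrev Chart (n : ℕ) (M : Type*) [TopologicalSpace M] := OpenPartialHomeomorph M (Euc n)

/-- A smooth chart of `M`: an element of the maximal smooth atlas. -/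
def IsSmoothChart (e : Chart n M) : Prop := e ∈ IsManifold.maximalAtlas 𝓘(ℝ, Euc n) ∞ M

variable (n M) in
/-- A (rough) `(0,2)`-tensor field on `M`. -/
abbrev TensorField02 := ∀ x : M,
  TangentSpace 𝓘(ℝ, Euc n) x →L[ℝ] TangentSpace 𝓘(ℝ, Euc n) x →L[ℝ] ℝ

/-- A continuous (`C⁰`) Riemannian metric on `M`. -/
abbrev C0Metric (n : ℕ) (M : Type*) [TopologicalSpace M] [ChartedSpace (Euc n) M]
    [IsManifold 𝓘(ℝ, Euc n) ∞ M] :=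
  Bundle.ContinuousRiemannianMetric (Euc n) (fun x : M => TangentSpace 𝓘(ℝ, Euc n) x)

/-- A smooth Riemannian metric on `M`. -/
abbrev SmoothMetric (n : ℕ) (M : Type*) [TopologicalSpace M] [ChartedSpace (Euc n) M]
    [IsManifold 𝓘(ℝ, Euc n) ∞ M] :=
  Bundle.ContMDiffRiemannianMetric 𝓘(ℝ, Euc n) ∞ (Euc n) (fun x : M => TangentSpace 𝓘(ℝ, Euc n) x)

/-- The push-forward `ψ_* τ` of a `(0,2)`-tensor field to the target of the chart `ψ`, a field of
bilinear forms on `ℝⁿ`: `(ψ_* τ)_y (v, w) = τ (D(ψ⁻¹)_y v, D(ψ⁻¹)_y w)`. -/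
def chartPush (τ : TensorField02 n M) (e : Chart n M) (y : Euc n) :
    Euc n →L[ℝ] Euc n →L[ℝ] ℝ :=
  let A : Euc n →L[ℝ] TangentSpace 𝓘(ℝ, Euc n) (e.symm y) :=
    mfderiv 𝓘(ℝ, Euc n) 𝓘(ℝ, Euc n) e.symm y
  (ContinuousLinearMap.precomp ℝ A).comp ((τ (e.symm y)).comp A)

/-- The pull-back `ψ^* B` of a field of bilinear forms on `ℝⁿ` along a chart `ψ`, at points of the
chart domain: `(ψ^* B)_x (v, w) = B_{ψ(x)} (Dψ_x v, Dψ_x w)`. -/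
def chartPull (B : Euc n → Euc n →L[ℝ] Euc n →L[ℝ] ℝ) (e : Chart n M) : TensorField02 n M :=
  fun x =>
    let A : TangentSpace 𝓘(ℝ, Euc n) x →L[ℝ] Euc n := mfderiv 𝓘(ℝ, Euc n) 𝓘(ℝ, Euc n) e x
    (ContinuousLinearMap.precomp ℝ A).comp ((B (e x)).comp A)

/-- The matrix `(g_{ij}(y))` of a `(0,2)`-tensor field in the chart `e`, at `y ∈ e.target`. -/
def coordMatrix (τ : TensorField02 n M) (e : Chart n M) (y : Euc n) : Matrix (Fin n) (Fin n) ℝ :=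
  Matrix.of fun i j => chartPush τ e y (stdVec i) (stdVec j)

/-- The component function `g_{ij}`. -/
def gLow (τ : TensorField02 n M) (e : Chart n M) (i j : Fin n) (y : Euc n) : ℝ :=
  coordMatrix τ e y i j

/-- The component function `g^{ij}` of the inverse metric. -/
def gUp (τ : TensorField02 n M) (e : Chart n M) (i j : Fin n) (y : Euc n) : ℝ :=
  (coordMatrix τ e y)⁻¹ i j

end Manifold

/-! ### Classical scalar curvature -/

section Classical

variable {n : ℕ}

/-- `Γ^k_{ij} = ½ g^{kl} (∂_i g_{jl} + ∂_j g_{il} - ∂_l g_{ij})` as an algebraic expression in the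
numbers `gi i j = g^{ij}` and `dg k i j = ∂_k g_{ij}`. -/
def christoffel (gi : Fin n → Fin n → ℝ) (dg : Fin n → Fin n → Fin n → ℝ) (k i j : Fin n) : ℝ :=
  (1 / 2) * ∑ l, gi k l * (dg i j l + dg j i l - dg l i j)

variable {M : Type*} [TopologicalSpace M] [ChartedSpace (Euc n) M]

/-- The classical Christoffel symbol `Γ^k_{ij}` of a differentiable metric in a chart. -/
def chartChristoffel (τ : TensorField02 n M) (e : Chart n M) (k i j : Fin n) (y : Euc n) : ℝ :=
  christoffel (fun a b => gUp τ e a b y) (fun c a b => pderiv c (gLow τ e a b) y) k i j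

/-- The classical Ricci tensor in a chart:
`Ric_{ij} = ∂_m Γ^m_{ij} - ∂_j Γ^m_{im} + Γ^m_{ms} Γ^s_{ij} - Γ^m_{js} Γ^s_{im}`. -/
def chartRicci (τ : TensorField02 n M) (e : Chart n M) (i j : Fin n) (y : Euc n) : ℝ :=
  (∑ m, (pderiv m (chartChristoffel τ e m i j) y - pderiv j (chartChristoffel τ e m i m) y)) +
    ∑ m, ∑ s, (chartChristoffel τ e m m s y * chartChristoffel τ e s i j y -
      chartChristoffel τ e m j s y * chartChristoffel τ e s i m y)

/-- The classical scalar curvature in a chart, `R = g^{ij} Ric_{ij}`. -/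
def chartScalarCurvature (τ : TensorField02 n M) (e : Chart n M) (y : Euc n) : ℝ :=
  ∑ i, ∑ j, gUp τ e i j y * chartRicci τ e i j y

/-- The classical scalar curvature `R[τ](x)` of a metric `τ` that is `C²` near `x`, computed in the
preferred chart at `x` (the value does not depend on the chart). -/
def scalarCurvature (τ : TensorField02 n M) (x : M) : ℝ :=
  chartScalarCurvature τ (chartAt (Euc n) x) (chartAt (Euc n) x x)

end Classical

/-! ### Weak derivatives and distributional scalar curvature -/

section Weak

variable {n : ℕ}

/-- `w` is the weak partial derivative `∂ₖ u` on the open set `Ω`. -/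
def IsWeakPartial (Ω : TopologicalSpace.Opens (Euc n)) (k : Fin n) (u w : Euc n → ℝ) : Prop :=
  LocallyIntegrableOn u Ω ∧ LocallyIntegrableOn w Ω ∧
    ∀ φ : 𝓓(Ω, ℝ), ∫ y in (Ω : Set (Euc n)), u y * pderiv k φ y =
      -∫ y in (Ω : Set (Euc n)), w y * φ y

open Classical in
/-- The weak partial derivative `∂ₖ u` on `Ω` (unique up to null sets), when there is one. -/
def weakPartial (Ω : TopologicalSpace.Opens (Euc n)) (k : Fin n) (u : Euc n → ℝ) : Euc n → ℝ :=
  if h : ∃ w, IsWeakPartial Ω k u w then h.choose else 0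

variable {M : Type*} [TopologicalSpace M] [ChartedSpace (Euc n) M]

/-- The target of a chart as an open subset of `ℝⁿ`. -/
def chartTarget (e : Chart n M) : TopologicalSpace.Opens (Euc n) := ⟨e.target, e.open_target⟩

/-- A continuous metric is of class `W^{1,p}_loc` if in every smooth chart its components have weak
first partial derivatives lying in `L^p` on compact subsets of the chart target. -/
def MemW1pLoc (τ : TensorField02 n M) (p : ℝ) : Prop :=
  ∀ e : Chart n M, IsSmoothChart e → ∀ i j k : Fin n,
    ∃ w : Euc n → ℝ, IsWeakPartial (chartTarget e) k (gLow τ e i j) w ∧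
      ∀ C ⊆ e.target, IsCompact C →
        MemLp (gLow τ e i j) (ENNReal.ofReal p) (volume.restrict C) ∧
        MemLp w (ENNReal.ofReal p) (volume.restrict C)

/-- The Christoffel symbols of a `C⁰ ∩ W^{1,2}_loc` metric in a chart (weak derivatives). -/
def weakChristoffel (τ : TensorField02 n M) (e : Chart n M) (k i j : Fin n) (y : Euc n) : ℝ :=
  christoffel (fun a b => gUp τ e a b y)
    (fun c a b => weakPartial (chartTarget e) c (gLow τ e a b) y) k i j

/-- `V^k = g^{ij} Γ^k_{ij} - g^{ik} Γ^j_{ij}`. -/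
def fieldV (τ : TensorField02 n M) (e : Chart n M) (k : Fin n) (y : Euc n) : ℝ :=
  ∑ i, ∑ j, (gUp τ e i j y * weakChristoffel τ e k i j y -
    gUp τ e i k y * weakChristoffel τ e j i j y)

/-- `F = -(∂_m g^{ij}) Γ^m_{ij} + (∂_j g^{ij}) Γ^m_{im} + g^{ij} Γ^m_{ij} Γ^k_{km}
  - g^{ij} Γ^m_{ik} Γ^k_{jm}`. -/
def fieldF (τ : TensorField02 n M) (e : Chart n M) (y : Euc n) : ℝ :=
  let Γ := fun k i j => weakChristoffel τ e k i j y
  let dUp := fun m i j => weakPartial (chartTarget e) m (gUp τ e i j) y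
  (∑ i, ∑ j, ∑ m, (-(dUp m i j * Γ m i j) + dUp j i j * Γ m i m)) +
    ∑ i, ∑ j, ∑ m, ∑ k, (gUp τ e i j y * Γ m i j * Γ k k m - gUp τ e i j y * Γ m i k * Γ k j m)

/-- The distributional scalar curvature `R = ∂_k V^k + F` of a `C⁰ ∩ W^{1,2}_loc` metric, evaluated
on the density `f |dx¹ ∧ ⋯ ∧ dxⁿ|` compactly supported in the chart `e`:
`⟨R, f |dx|⟩ = ∫ (-V^k ∂_k f + F f) dx`. -/
def distScalarCurvature (τ : TensorField02 n M) (e : Chart n M) (f : 𝓓(chartTarget e, ℝ)) : ℝ :=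
  ∫ y in e.target, (-(∑ k, fieldV τ e k y * pderiv k f y) + fieldF τ e y * f y)

/-- `R[τ] ≥ 0` in `𝓓'(M)`: the pairing with nonnegative compactly supported smooth densities is
nonnegative. By a partition of unity every such density is a finite sum of nonnegative densities
supported in charts, so these are the ones tested. -/
def ScalarCurvatureNonneg (τ : TensorField02 n M) : Prop :=
  ∀ e : Chart n M, IsSmoothChart e → ∀ f : 𝓓(chartTarget e, ℝ), (∀ y, 0 ≤ f y) →
    0 ≤ distScalarCurvature τ e f

end Weak

/-! ### Volume, distance, asymptotic flatness -/

section Global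

variable {n : ℕ} {M : Type*} [TopologicalSpace M] [ChartedSpace (Euc n) M]
  [IsManifold 𝓘(ℝ, Euc n) ∞ M]

/-- The Riemannian volume measure `μ_g`, assembled from the chart densities
`√det(g_{ij}) |dx¹ ∧ ⋯ ∧ dxⁿ|` with a partition of unity subordinate to the charts of the atlas
(the result does not depend on the partition). -/
def riemannianVolume [T2Space M] [SigmaCompactSpace M] [MeasurableSpace M]
    (g : C0Metric n M) : Measure M :=
  let η := (SmoothPartitionOfUnity.exists_isSubordinate_chartAt_source 𝓘(ℝ, Euc n) M).choose
  Measure.sum fun c : M =>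
    Measure.map (chartAt (Euc n) c).symm
      ((volume.restrict (chartAt (Euc n) c).target).withDensity fun y =>
        ENNReal.ofReal (η c ((chartAt (Euc n) c).symm y) *
          √(coordMatrix g.inner (chartAt (Euc n) c) y).det))

open scoped Bundle in
/-- The distance `d_g` (with value `∞` between distinct components). -/
def metricEDist (g : C0Metric n M) (x y : M) : ℝ≥0∞ :=
  letI : Bundle.RiemannianBundle (fun x : M => TangentSpace 𝓘(ℝ, Euc n) x) := ⟨g.toRiemannianMetric⟩
  Manifold.riemannianEDist 𝓘(ℝ, Euc n) x y

/-- `(M, d_g)` is complete: every Cauchy sequence converges. -/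
def IsCompleteMetric (g : C0Metric n M) : Prop :=
  ∀ u : ℕ → M, (∀ δ : ℝ≥0∞, 0 < δ → ∃ N, ∀ k ≥ N, ∀ l ≥ N, metricEDist g (u k) (u l) < δ) →
    ∃ x, Tendsto (fun k => metricEDist g (u k) x) atTop (𝓝 0)

/-- Asymptotic flatness, with one end. -/
def IsAsymptoticallyFlat [T2Space M] [SigmaCompactSpace M] [MeasurableSpace M]
    (g : C0Metric n M) : Prop :=
  ∃ K : Set M, IsCompact K ∧
    ∃ Φ : Chart n M, IsSmoothChart Φ ∧ Φ.source = Kᶜ ∧ Φ.target = (Metric.closedBall 0 1)ᶜ ∧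
      (∀ i j, ContDiffOn ℝ 2 (gLow g.inner Φ i j) Φ.target) ∧
      (∃ τ : ℝ, ((n : ℝ) - 2) / 2 < τ ∧ ∀ i j : Fin n,
        ((fun x => gLow g.inner Φ i j x - if i = j then 1 else 0)
          =O[Bornology.cobounded (Euc n)] fun x => ‖x‖ ^ (-τ)) ∧
        (∀ k, pderiv k (gLow g.inner Φ i j)
          =O[Bornology.cobounded (Euc n)] fun x => ‖x‖ ^ (-τ - 1)) ∧
        (∀ k l, pderiv k (pderiv l (gLow g.inner Φ i j))
          =O[Bornology.cobounded (Euc n)] fun x => ‖x‖ ^ (-τ - 2))) ∧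
      IntegrableOn (scalarCurvature g.inner) Kᶜ (riemannianVolume g)

/-- `g` is smooth on the set `U`. -/
def IsSmoothMetricOn (g : C0Metric n M) (U : Set M) : Prop :=
  ContMDiffOn 𝓘(ℝ, Euc n) (𝓘(ℝ, Euc n).prod 𝓘(ℝ, Euc n →L[ℝ] Euc n →L[ℝ] ℝ)) ∞
    (fun x => Bundle.TotalSpace.mk' (Euc n →L[ℝ] Euc n →L[ℝ] ℝ)
      (E := fun x : M => TangentSpace 𝓘(ℝ, Euc n) x →L[ℝ] TangentSpace 𝓘(ℝ, Euc n) x →L[ℝ] ℝ)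
      x (g.inner x)) U

end Global

/-! ### The regularised metrics -/

section Regularisation

variable {n : ℕ} {M : Type*} [TopologicalSpace M] [ChartedSpace (Euc n) M]

/-- The choices entering the regularisation near a compact set `K`: finitely many smooth charts
`ψ_i : U_i → B₁(0)` covering `K`, a partition of unity `η_𝒞, η_1, …, η_m` subordinate to
`M = (M ∖ K) ∪ U_1 ∪ ⋯ ∪ U_m`, cut-off functions `χ_i ∈ C_c^∞(U_i)` that are `1` near `supp η_i`,
and a mollifier `ρ`. -/
structure RegularisationData (n : ℕ) (M : Type*) [TopologicalSpace M] [ChartedSpace (Euc n) M]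
    (K : Set M) where
  m : ℕ
  ψ : Fin m → Chart n M
  ψ_smooth : ∀ i, IsSmoothChart (ψ i)
  ψ_target : ∀ i, (ψ i).target ⊆ Metric.ball 0 1
  covers : K ⊆ ⋃ i, (ψ i).source
  ηC : M → ℝ
  η : Fin m → M → ℝ
  ηC_smooth : ContMDiff 𝓘(ℝ, Euc n) 𝓘(ℝ, ℝ) ∞ ηC
  η_smooth : ∀ i, ContMDiff 𝓘(ℝ, Euc n) 𝓘(ℝ, ℝ) ∞ (η i)
  ηC_nonneg : ∀ x, 0 ≤ ηC x
  η_nonneg : ∀ i x, 0 ≤ η i x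
  sum_eq_one : ∀ x, ηC x + ∑ i, η i x = 1
  ηC_supp : tsupport ηC ⊆ Kᶜ
  η_supp : ∀ i, tsupport (η i) ⊆ (ψ i).source
  χ : Fin m → M → ℝ
  χ_smooth : ∀ i, ContMDiff 𝓘(ℝ, Euc n) 𝓘(ℝ, ℝ) ∞ (χ i)
  χ_compact : ∀ i, HasCompactSupport (χ i)
  χ_supp : ∀ i, tsupport (χ i) ⊆ (ψ i).source
  χ_eq_one : ∀ i, ∀ᶠ x in 𝓝ˢ (tsupport (η i)), χ i x = 1
  ρ : Euc n → ℝ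
  ρ_smooth : ContDiff ℝ ∞ ρ
  ρ_nonneg : ∀ y, 0 ≤ ρ y
  ρ_supp : tsupport ρ ⊆ Metric.closedBall 0 1
  ρ_integral : ∫ y, ρ y = 1

namespace RegularisationData

variable {K : Set M} (D : RegularisationData n M K)

/-- `ρ_ε(y) = ε⁻ⁿ ρ(y / ε)`. -/
def mollifier (ε : ℝ) (y : Euc n) : ℝ := (ε ^ n)⁻¹ * D.ρ (ε⁻¹ • y)

/-- The `(a,b)` component of `(ψ_i)_* (η_i τ)`, extended by zero to `ℝⁿ`. -/
def localised (τ : TensorField02 n M) (i : Fin D.m) (a b : Fin n) : Euc n → ℝ :=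
  (D.ψ i).target.indicator fun y => D.η i ((D.ψ i).symm y) * gLow τ (D.ψ i) a b y

/-- The component-wise convolution `((ψ_i)_* (η_i τ)) * ρ_ε`, a field of bilinear forms on `ℝⁿ`. -/
def mollified (τ : TensorField02 n M) (ε : ℝ) (i : Fin D.m) (y : Euc n) :
    Euc n →L[ℝ] Euc n →L[ℝ] ℝ :=
  ∑ a, ∑ b, convolution (D.localised τ i a b) (D.mollifier ε)
      (ContinuousLinearMap.lsmul ℝ ℝ) volume y •
    dxTensor a b

/-- The regularised tensor field
`τ_ε = η_𝒞 τ + ∑_i χ_i (ψ_i)^* [((ψ_i)_* (η_i τ)) * ρ_ε]`. -/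
def regularise (τ : TensorField02 n M) (ε : ℝ) : TensorField02 n M := fun x =>
  D.ηC x • τ x + ∑ i, D.χ i x • chartPull (D.mollified τ ε i) (D.ψ i) x

end RegularisationData

end Regularisation

end LowRegPMT

end

open MeasureTheory Filter Topology Set
open scoped Manifold ContDiff Distributions ENNReal

noncomputable section

namespace LowRegPMT

/-! ### Convolution estimates in `L^q` -/

section Convolution

variable {n : ℕ}

/-! In a chart the scalar curvature of a metric `k` is `A(k⁻¹) ∂²k` plus terms at most quadratic in
`∂k`, where `A` has components `k^{sc} k^{rd} - k^{rs} k^{cd}`. The regularised metrics converge to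
`g` in `C⁰ ∩ W^{1,p}` on compact sets, so the quadratic terms converge in `L^{p/2}`. The only
difficulty is the second derivatives, which have no limit in any `L^q`.

They are handled by comparison with the curvature regularised in the same way as the metric, `η_𝒞
R[g] + ∑ χ_i ψ_i^*((η_i R[g]) * ρ_ε)`. For small `ε` this is a nonnegative function. The value of
`(η_i R[g]) * ρ_ε` at `z` is the pairing of `R[g]` with the nonnegative test function `η_i ρ_ε(z -
·)` (`mollCurv_nonneg`), and off `K`, where `g` is smooth, weak nonnegativity is pointwise
(`mScal_nonneg`). So it suffices that the difference from `R[g_ε]` tends to `0` in `L^{p/2}`. This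
is needed only near the supports of the `η_i`; elsewhere `g_ε = g` near points outside `K`.

Inside the `i`-th chart, `sub_mollifiedCurvature` shows that `η_i R[g_ε] - (η_i R[g]) * ρ_ε` equals
`A(g_ε) ∂²d_i` up to `o(1)` in `L^{p/2}`, with the defect `d_i = η_i g_ε - (η_i g) * ρ_ε`. Three
facts enter. A `W^{1,p}` convergence with rate `O(ε)` in `L^p`, recorded in `SobConv`, beats the
second derivatives of a mollification, which are `o(1/ε)` (`sub_mul_conv_pderiv`). The Friedrichs
commutator of a `W^{1,p}` coefficient with `∂ ∘ (· * ρ_ε)` converges in `L^{p/2}`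
(`lpTo_commutator`). Finally, all the limits cancel. Where `g` is smooth, `local_smooth` gives the
analogous statement with defect `η_𝒞 (g_ε - g)`.

The principal terms `A(g_ε) ∂²d_i` need not be small one by one, but they cancel in the sum. Each
defect tends to `0` in `W^{1,p}`, so moving `A ∂²d_i` to another chart costs only terms of lower
order (`transport_symbD2`). In one common chart the defects add up to zero identically: `∑ χ_i ψ_i^*
d_i + η_𝒞 (g_ε - g) = g_ε - g_ε = 0`, by the definition of `g_ε` and `∑ η_i + η_𝒞 = 1`. This is the
core of `lpTo_curvature`, and it uses the coordinate invariance `mScal_pullback`.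

On compact subsets of a chart `μ_g` is dominated by Lebesgue measure (`riemannianVolume_map_le`),
which turns the chart estimates into the norm on `M`. That `g_ε` is a metric follows from uniform
convergence on the compact supports of the `χ_i`, outside which `g_ε = g`. -/

/-- Scalar convolution on `ℝⁿ`. -/
def conv (f σ : Euc n → ℝ) : Euc n → ℝ :=
  convolution f σ (ContinuousLinearMap.lsmul ℝ ℝ) volume

/-- The rescaled kernel `σ_ε(y) = ε⁻ⁿ σ(y / ε)`. -/
def scaleKernel (σ : Euc n → ℝ) (ε : ℝ) (y : Euc n) : ℝ := (ε ^ n)⁻¹ * σ (ε⁻¹ • y)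

theorem conv_apply (f σ : Euc n → ℝ) (x : Euc n) : conv f σ x = ∫ t, f t * σ (x - t) := by
  simp [conv, convolution]

theorem conv_apply_swap (f σ : Euc n → ℝ) (x : Euc n) : conv f σ x = ∫ t, f (x - t) * σ t := by
  simp [conv, convolution_eq_swap]

theorem integral_scaleKernel (σ : Euc n → ℝ) {ε : ℝ} (hε : 0 < ε) :
    ∫ y, scaleKernel σ ε y = ∫ y, σ y := by
  unfold scaleKernel
  rw [integral_const_mul, Measure.integral_comp_inv_smul]
  have : (0:ℝ) < ε ^ n := by positivity
  simp [abs_of_pos this]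
  field_simp

theorem lintegral_scaleKernel (σ : Euc n → ℝ) {ε : ℝ} (hε : 0 < ε) (hσ : Integrable σ) :
    ∫⁻ y, ‖scaleKernel σ ε y‖ₑ = ∫⁻ y, ‖σ y‖ₑ := by
  have h1 : Integrable (scaleKernel σ ε) :=
    (hσ.comp_smul (inv_ne_zero hε.ne')).const_mul _
  have h2 := integral_scaleKernel (fun y => ‖σ y‖) hε
  rw [← ofReal_integral_norm_eq_lintegral_enorm h1, ← ofReal_integral_norm_eq_lintegral_enorm hσ,
    ← h2]
  congr 2
  ext y
  simp [scaleKernel, abs_of_pos hε]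

/-- Minkowski's integral inequality for an integral against a finite signed density. -/
theorem eLpNorm_integral_mul_le {q : ℝ≥0∞} (hq : 1 ≤ q) (hq' : q ≠ ⊤)
    {Y : Type*} [MeasurableSpace Y] {μ : Measure Y} [SFinite μ] {σ : Y → ℝ}
    (hσ : Integrable σ μ) {H : Y → Euc n → ℝ}
    (hH : AEStronglyMeasurable (Function.uncurry H) (μ.prod volume)) {C : ℝ≥0∞}
    (hC : ∀ y, σ y ≠ 0 → eLpNorm (H y) q volume ≤ C) :
    eLpNorm (fun x => ∫ y, H y x * σ y ∂μ) q volume ≤ C * ∫⁻ y, ‖σ y‖ₑ ∂μ := by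
  set m : ℝ≥0∞ := ∫⁻ y, ‖σ y‖ₑ ∂μ with hm
  have hmtop : m ≠ ⊤ := hσ.2.ne
  have hq0 : q ≠ 0 := (zero_lt_one.trans_le hq).ne'
  set r := q.toReal with hr
  have hr1 : 1 ≤ r := by
    rw [hr, ← ENNReal.toReal_one]; exact ENNReal.toReal_mono hq' hq
  have hr0 : 0 < r := by linarith
  set ν : Measure Y := μ.withDensity fun y => ‖σ y‖ₑ with hν
  have hνu : ν univ = m := by rw [hν, withDensity_apply _ MeasurableSet.univ]; simp [hm]
  have hσm : AEMeasurable (fun y => ‖σ y‖ₑ) μ := hσ.1.enorm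
  have hswap : AEStronglyMeasurable (fun z : Euc n × Y => H z.2 z.1) (volume.prod μ) :=
    hH.prod_swap
  -- Jensen's inequality for the measure `|σ| μ` of total mass `m`; integrating it in `x` and
  -- exchanging the integrals gives the claim.
  have key : ∀ᵐ x, ‖∫ y, H y x * σ y ∂μ‖ₑ ^ r ≤ m ^ (r - 1) * ∫⁻ y, ‖H y x‖ₑ ^ r * ‖σ y‖ₑ ∂μ := by
    filter_upwards [hswap.prodMk_left] with x hx
    have hxν : AEStronglyMeasurable (fun y => H y x) ν :=
      hx.mono_ac (withDensity_absolutelyContinuous _ _)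
    have h1 := eLpNorm_le_eLpNorm_mul_rpow_measure_univ hq hxν
    rw [eLpNorm_one_eq_lintegral_enorm, eLpNorm_eq_lintegral_rpow_enorm_toReal hq0 hq', hνu,
      ← hr] at h1
    have e1 : ∫⁻ y, ‖H y x‖ₑ ∂ν = ∫⁻ y, ‖H y x‖ₑ * ‖σ y‖ₑ ∂μ := by
      rw [hν, lintegral_withDensity_eq_lintegral_mul₀ hσm hx.enorm]
      simp [mul_comm]
    have e2 : ∫⁻ y, ‖H y x‖ₑ ^ r ∂ν = ∫⁻ y, ‖H y x‖ₑ ^ r * ‖σ y‖ₑ ∂μ := by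
      rw [hν, lintegral_withDensity_eq_lintegral_mul₀ hσm (hx.enorm.pow_const r)]
      simp [mul_comm]
    rw [e1, e2] at h1
    have h2 : ‖∫ y, H y x * σ y ∂μ‖ₑ ≤ ∫⁻ y, ‖H y x‖ₑ * ‖σ y‖ₑ ∂μ := by
      refine (enorm_integral_le_lintegral_enorm _).trans ?_
      simp [enorm_mul]
    calc ‖∫ y, H y x * σ y ∂μ‖ₑ ^ r
        ≤ ((∫⁻ y, ‖H y x‖ₑ ^ r * ‖σ y‖ₑ ∂μ) ^ (1 / r) * m ^ (1 / (1:ℝ≥0∞).toReal - 1 / r)) ^ r := by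
          gcongr; exact h2.trans h1
      _ = _ := by
          rw [ENNReal.mul_rpow_of_nonneg _ _ hr0.le, ← ENNReal.rpow_mul, ← ENNReal.rpow_mul]
          have : 1 / r * r = 1 := by field_simp
          rw [this, ENNReal.rpow_one, mul_comm]
          congr 2
          simp; field_simp
  rw [eLpNorm_eq_lintegral_rpow_enorm_toReal hq0 hq', ← hr]
  have hHm : AEMeasurable (fun z : Euc n × Y => ‖H z.2 z.1‖ₑ ^ r * ‖σ z.2‖ₑ)
      (volume.prod μ) :=
    (hswap.enorm.pow_const r).mul hσ.1.comp_snd.enorm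
  have h3 : ∫⁻ x, ‖∫ y, H y x * σ y ∂μ‖ₑ ^ r ≤ (C * m) ^ r := by
    calc ∫⁻ x, ‖∫ y, H y x * σ y ∂μ‖ₑ ^ r
        ≤ ∫⁻ x, m ^ (r - 1) * ∫⁻ y, ‖H y x‖ₑ ^ r * ‖σ y‖ₑ ∂μ := lintegral_mono_ae key
      _ = m ^ (r - 1) * ∫⁻ x, ∫⁻ y, ‖H y x‖ₑ ^ r * ‖σ y‖ₑ ∂μ :=
          lintegral_const_mul' _ _ (ENNReal.rpow_ne_top_of_nonneg (by linarith) hmtop)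
      _ = m ^ (r - 1) * ∫⁻ y, ∫⁻ x, ‖H y x‖ₑ ^ r * ‖σ y‖ₑ ∂volume ∂μ := by
          rw [lintegral_lintegral_swap hHm]
      _ ≤ m ^ (r - 1) * ∫⁻ y, C ^ r * ‖σ y‖ₑ ∂μ := by
          gcongr with y
          rw [lintegral_mul_const' _ _ enorm_ne_top]
          -- No bound on `H y` is available where `σ` vanishes. Asking for it only on the support of
          -- `σ` is what allows small translations to be used later.
          by_cases hy : σ y = 0
          · simp [hy]
          gcongr
          have := hC y hy
          rw [eLpNorm_eq_lintegral_rpow_enorm_toReal hq0 hq', ← hr] at this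
          calc ∫⁻ x, ‖H y x‖ₑ ^ r = ((∫⁻ x, ‖H y x‖ₑ ^ r) ^ (1 / r)) ^ r := by
                rw [← ENNReal.rpow_mul]; simp [hr0.ne']
            _ ≤ C ^ r := by gcongr
      _ = (C * m) ^ r := by
          rw [lintegral_const_mul'' _ hσm, ENNReal.mul_rpow_of_nonneg _ _ hr0.le, ← hm, mul_left_comm]
          congr 1
          rcases eq_or_ne m 0 with h0 | h0
          · simp [h0, hr0]
          conv_lhs => rw [← ENNReal.rpow_one m, ← ENNReal.rpow_mul, ← ENNReal.rpow_add _ _ h0 hmtop]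
          congr 1; ring
  calc (∫⁻ x, ‖∫ y, H y x * σ y ∂μ‖ₑ ^ r) ^ (1 / r) ≤ ((C * m) ^ r) ^ (1 / r) := by gcongr
    _ = C * m := by rw [← ENNReal.rpow_mul]; simp [hr0.ne']

theorem aestronglyMeasurable_comp_sub {f : Euc n → ℝ} (hf : AEStronglyMeasurable f volume) :
    AEStronglyMeasurable (Function.uncurry fun y x : Euc n => f (x - y)) (volume.prod volume) := by
  have := (hf.comp_quasiMeasurePreserving
    (quasiMeasurePreserving_sub (volume : Measure (Euc n)) volume)).prod_swap
  exact this

theorem MemLp.comp_sub_right' {q : ℝ≥0∞} {f : Euc n → ℝ} (hf : MemLp f q volume) (y : Euc n) :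
    MemLp (fun x => f (x - y)) q volume :=
  hf.comp_measurePreserving (measurePreserving_sub_right volume y)

theorem eLpNorm_comp_sub_right {q : ℝ≥0∞} {f : Euc n → ℝ} (hf : AEStronglyMeasurable f volume)
    (y : Euc n) : eLpNorm (fun x => f (x - y)) q volume = eLpNorm f q volume :=
  eLpNorm_comp_measurePreserving hf (measurePreserving_sub_right volume y)

/-- Continuity of translations in `L^q`. -/
theorem tendsto_eLpNorm_translate {q : ℝ≥0∞} (hq : 1 ≤ q) (hq' : q ≠ ⊤) {f : Euc n → ℝ}
    (hf : MemLp f q volume) :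
    Tendsto (fun y => eLpNorm (fun x => f (x - y) - f x) q volume) (𝓝 0) (𝓝 0) := by
  have : Fact (1 ≤ q) := ⟨hq⟩
  -- The translations form a continuous family for the compact-open topology, so continuity of
  -- composition with measure-preserving maps on `L^q` applies at `y = 0`.
  let g : Euc n → C(Euc n, Euc n) := fun y => ⟨fun x => x - y, by fun_prop⟩
  have hg : Continuous g :=
    (ContinuousMap.curry ⟨fun z : Euc n × Euc n => z.2 - z.1, by fun_prop⟩).continuous
  have hmp : ∀ y, MeasurePreserving (g y) (volume : Measure (Euc n)) volume :=
    fun y => measurePreserving_sub_right volume y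
  have h := Filter.Tendsto.compMeasurePreservingLp (l := 𝓝 (0 : Euc n)) (f := fun _ => hf.toLp f)
    (f₀ := hf.toLp f) tendsto_const_nhds (hg.tendsto 0) hmp (hmp 0) hq'
  rw [Lp.tendsto_Lp_iff_tendsto_eLpNorm'] at h
  refine h.congr fun y => eLpNorm_congr_ae ?_
  have h1 := Lp.coeFn_compMeasurePreserving (hf.toLp f) (hmp y)
  have h2 := Lp.coeFn_compMeasurePreserving (hf.toLp f) (hmp 0)
  have h3 := (hmp y).quasiMeasurePreserving.ae_eq_comp hf.coeFn_toLp
  have h4 := (hmp 0).quasiMeasurePreserving.ae_eq_comp hf.coeFn_toLp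
  filter_upwards [h1, h2, h3, h4] with x h1 h2 h3 h4
  rw [Pi.sub_apply, h1, h2, h3, h4]
  simp [g]

theorem conv_integrand_integrable {f σ : Euc n → ℝ} (hf : LocallyIntegrable f volume)
    (hσ : Continuous σ) (hσ' : HasCompactSupport σ) (x : Euc n) :
    Integrable fun t => f (x - t) * σ t := by
  have h := (hσ'.convolutionExists_right (ContinuousLinearMap.lsmul ℝ ℝ) hf hσ) x
  have := h.integrable_swap
  simpa using this

theorem scaleKernel_continuous {σ : Euc n → ℝ} (hσ : Continuous σ) (ε : ℝ) :
    Continuous (scaleKernel σ ε) := by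
  unfold scaleKernel; fun_prop

theorem scaleKernel_hasCompactSupport {σ : Euc n → ℝ} (hσ : HasCompactSupport σ) {ε : ℝ}
    (hε : 0 < ε) : HasCompactSupport (scaleKernel σ ε) := by
  have : HasCompactSupport fun y => σ (ε⁻¹ • y) :=
    hσ.comp_homeomorph (Homeomorph.smulOfNeZero ε⁻¹ (inv_ne_zero hε.ne'))
  exact this.mul_left

theorem scaleKernel_norm_le {σ : Euc n → ℝ} {R : ℝ} (hσ : tsupport σ ⊆ Metric.closedBall 0 R)
    {ε : ℝ} (hε : 0 < ε) {y : Euc n} (hy : scaleKernel σ ε y ≠ 0) : ‖y‖ ≤ R * ε := by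
  have h1 : σ (ε⁻¹ • y) ≠ 0 := fun h => hy (by simp [scaleKernel, h])
  have h2 := hσ (subset_tsupport _ h1)
  rw [mem_closedBall_zero_iff, norm_smul, norm_inv, Real.norm_of_nonneg hε.le] at h2
  rwa [inv_mul_le_iff₀ hε, mul_comm] at h2

theorem locallyIntegrable_of_memLp {q : ℝ≥0∞} (hq : 1 ≤ q) {f : Euc n → ℝ}
    (hf : MemLp f q volume) : LocallyIntegrable f volume :=
  hf.locallyIntegrable hq

/-- Convolution with a rescaled kernel converges in `L^q` to a multiple of the function. -/
theorem tendsto_conv_scaleKernel {q : ℝ≥0∞} (hq : 1 ≤ q) (hq' : q ≠ ⊤) {f σ : Euc n → ℝ}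
    (hf : MemLp f q volume) (hσ : Continuous σ) (hσ' : HasCompactSupport σ) :
    Tendsto (fun ε => eLpNorm (fun x => conv f (scaleKernel σ ε) x - (∫ y, σ y) * f x) q volume)
      (𝓝[>] 0) (𝓝 0) := by
  have hσi : Integrable σ := hσ.integrable_of_hasCompactSupport hσ'
  set m : ℝ≥0∞ := ∫⁻ y, ‖σ y‖ₑ with hm
  have hmtop : m ≠ ⊤ := hσi.2.ne
  obtain ⟨R, hR⟩ := hσ'.isCompact.isBounded.subset_closedBall (0 : Euc n)
  rw [ENNReal.tendsto_nhds_zero]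
  intro δ hδ
  -- The bound will be `δ' m`, where `m` is the scale-invariant `L¹` norm of the kernel. Dividing by
  -- `m + 1` avoids a case distinction at `m = 0`.
  obtain ⟨δ', hδ', hδm⟩ : ∃ δ' : ℝ≥0∞, 0 < δ' ∧ δ' * m ≤ δ := by
    rcases eq_or_ne δ ⊤ with rfl | hδt
    · exact ⟨1, by simp, by simp⟩
    refine ⟨δ / (m + 1), ENNReal.div_pos hδ.ne' (by simp [hmtop]), ?_⟩
    calc δ / (m + 1) * m ≤ δ / (m + 1) * (m + 1) := by gcongr; simp
      _ = δ := ENNReal.div_mul_cancel (by simp) (by simp [hmtop])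
  have h1 := (ENNReal.tendsto_nhds_zero.1 (tendsto_eLpNorm_translate hq hq' hf)) δ' hδ'
  obtain ⟨r, hr, hball⟩ := Metric.eventually_nhds_iff.1 h1
  have h2 : ∀ᶠ ε in 𝓝[>] (0:ℝ), R * ε < r := by
    have : Tendsto (fun ε : ℝ => R * ε) (𝓝[>] 0) (𝓝 (R * 0)) :=
      (tendsto_nhdsWithin_of_tendsto_nhds tendsto_id).const_mul R
    rw [mul_zero] at this
    exact this.eventually (gt_mem_nhds hr)
  filter_upwards [h2, self_mem_nhdsWithin] with ε hε2 hε
  have hε : 0 < ε := hε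
  have hli := locallyIntegrable_of_memLp hq hf
  have hsc := scaleKernel_continuous hσ ε
  have hss := scaleKernel_hasCompactSupport hσ' hε
  -- The kernel may have any integral. Subtracting `(∫ σ) f` leaves only differences of translates
  -- of `f`; the case `∫ σ = 0` is needed for derivatives of mollifiers.
  have heq : (fun x => conv f (scaleKernel σ ε) x - (∫ y, σ y) * f x) =
      fun x => ∫ y, (f (x - y) - f x) * scaleKernel σ ε y := by
    ext x
    rw [conv_apply_swap, ← integral_scaleKernel σ hε, mul_comm, ← integral_const_mul,
      ← integral_sub (conv_integrand_integrable hli hsc hss x)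
        ((hsc.integrable_of_hasCompactSupport hss).const_mul _)]
    simp [sub_mul]
  rw [heq]
  refine (eLpNorm_integral_mul_le hq hq' (hsc.integrable_of_hasCompactSupport hss)
    (H := fun y x => f (x - y) - f x) ?_ (C := δ') ?_).trans ?_
  · exact (aestronglyMeasurable_comp_sub hf.1).sub hf.1.comp_snd
  · intro y hy
    apply hball
    rw [dist_zero_right]
    exact (scaleKernel_norm_le hR hε hy).trans_lt hε2
  · rw [lintegral_scaleKernel σ hε hσi]; exact hδm

theorem conv_memLp {q : ℝ≥0∞} (hq : 1 ≤ q) (hq' : q ≠ ⊤) {f σ : Euc n → ℝ}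
    (hf : MemLp f q volume) (hσ : Continuous σ) (hσ' : HasCompactSupport σ) :
    MemLp (conv f σ) q volume := by
  have hc : Continuous (conv f σ) :=
    hσ'.continuous_convolution_right _ (locallyIntegrable_of_memLp hq hf) hσ
  refine ⟨hc.aestronglyMeasurable, ?_⟩
  have heq : conv f σ = fun x => ∫ y, f (x - y) * σ y := by ext x; exact conv_apply_swap f σ x
  rw [heq]
  have hσi : Integrable σ := hσ.integrable_of_hasCompactSupport hσ'
  refine (eLpNorm_integral_mul_le hq hq' hσi (H := fun y x => f (x - y))
    (aestronglyMeasurable_comp_sub hf.1) (C := eLpNorm f q volume)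
    fun y _ => (eLpNorm_comp_sub_right hf.1 y).le).trans_lt ?_
  exact ENNReal.mul_lt_top hf.2 hσi.2

end Convolution

/-! ### Convergence of families in `L^q` -/

section LpTo

variable {n : ℕ}

/-- The family `F ε` converges to `f` in `L^q(ℝⁿ)` as `ε → 0⁺`. -/
structure LpTo (q : ℝ≥0∞) (F : ℝ → Euc n → ℝ) (f : Euc n → ℝ) : Prop where
  memLp : MemLp f q volume
  eventually_memLp : ∀ᶠ ε in 𝓝[>] (0 : ℝ), MemLp (F ε) q volume
  tendsto : Tendsto (fun ε => eLpNorm (fun x => F ε x - f x) q volume) (𝓝[>] 0) (𝓝 0)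

variable {q : ℝ≥0∞} {F H : ℝ → Euc n → ℝ} {f h : Euc n → ℝ}

theorem LpTo.congr (hF : LpTo q F f) (he : ∀ᶠ ε in 𝓝[>] (0 : ℝ), F ε =ᵐ[volume] H ε)
    (hf : f =ᵐ[volume] h) : LpTo q H h := by
  refine ⟨hF.memLp.ae_eq hf, ?_, ?_⟩
  · filter_upwards [hF.eventually_memLp, he] with ε h1 h2 using h1.ae_eq h2
  · refine hF.tendsto.congr' ?_
    filter_upwards [he] with ε h2
    apply eLpNorm_congr_ae
    filter_upwards [h2, hf] with x h3 h4
    rw [h3, h4]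

theorem LpTo.congr_left (hF : LpTo q F f) (he : ∀ᶠ ε in 𝓝[>] (0 : ℝ), ∀ x, F ε x = H ε x) :
    LpTo q H f :=
  hF.congr (he.mono fun _ h => Eventually.of_forall h) (ae_eq_refl f)

theorem LpTo.const (hf : MemLp f q volume) : LpTo q (fun _ => f) f :=
  ⟨hf, Eventually.of_forall fun _ => hf, by simp⟩

theorem LpTo.add (hq : 1 ≤ q) (hF : LpTo q F f) (hH : LpTo q H h) :
    LpTo q (fun ε x => F ε x + H ε x) (fun x => f x + h x) := by
  refine ⟨hF.memLp.add hH.memLp, ?_, ?_⟩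
  · filter_upwards [hF.eventually_memLp, hH.eventually_memLp] with ε h1 h2 using h1.add h2
  · have hlim := hF.tendsto.add hH.tendsto
    rw [add_zero] at hlim
    refine tendsto_of_tendsto_of_tendsto_of_le_of_le' tendsto_const_nhds hlim
      (Eventually.of_forall fun _ => zero_le) ?_
    filter_upwards [hF.eventually_memLp, hH.eventually_memLp] with ε h1 h2
    calc eLpNorm (fun x => F ε x + H ε x - (f x + h x)) q volume
        = eLpNorm ((fun x => F ε x - f x) + fun x => H ε x - h x) q volume := by
          congr 1; ext x; simp; ring
      _ ≤ _ := eLpNorm_add_le (h1.sub hF.memLp).1 (h2.sub hH.memLp).1 hq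

theorem LpTo.neg (hF : LpTo q F f) : LpTo q (fun ε x => -F ε x) (fun x => -f x) := by
  refine ⟨hF.memLp.neg, hF.eventually_memLp.mono fun _ h => h.neg, ?_⟩
  refine hF.tendsto.congr fun ε => ?_
  rw [← eLpNorm_neg]
  congr 1; ext x; simp; ring

theorem LpTo.sub (hq : 1 ≤ q) (hF : LpTo q F f) (hH : LpTo q H h) :
    LpTo q (fun ε x => F ε x - H ε x) (fun x => f x - h x) := by
  simpa [sub_eq_add_neg] using hF.add hq hH.neg

theorem LpTo.sum (hq : 1 ≤ q) {ι : Type*} (s : Finset ι) {F : ι → ℝ → Euc n → ℝ}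
    {f : ι → Euc n → ℝ} (h : ∀ i ∈ s, LpTo q (F i) (f i)) :
    LpTo q (fun ε x => ∑ i ∈ s, F i ε x) (fun x => ∑ i ∈ s, f i x) := by
  classical
  induction s using Finset.induction_on with
  | empty => simpa using LpTo.const (n := n) (f := fun _ => (0:ℝ)) MemLp.zero
  | insert a s ha ih =>
    simp only [Finset.sum_insert ha]
    exact (h a (by simp)).add hq (ih fun i hi => h i (by simp [hi]))

/-- Hölder's inequality applied to `FH - fh = (F - f)(H - h) + (F - f)h + f(H - h)`. -/
theorem LpTo.mul {a b c : ℝ≥0∞} [hc' : ENNReal.HolderTriple a b c] (hc : 1 ≤ c)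
    (hF : LpTo a F f) (hH : LpTo b H h) :
    LpTo c (fun ε x => F ε x * H ε x) (fun x => f x * h x) := by
  refine ⟨hH.memLp.mul hF.memLp, ?_, ?_⟩
  · filter_upwards [hF.eventually_memLp, hH.eventually_memLp] with ε h1 h2 using h2.mul h1
  · have hlim : Tendsto (fun ε => eLpNorm (fun x => F ε x - f x) a volume *
        eLpNorm (fun x => H ε x - h x) b volume + (eLpNorm (fun x => F ε x - f x) a volume *
        eLpNorm h b volume + eLpNorm f a volume * eLpNorm (fun x => H ε x - h x) b volume))
        (𝓝[>] 0) (𝓝 (0 * 0 + (0 * eLpNorm h b volume + eLpNorm f a volume * 0))) :=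
      (ENNReal.Tendsto.mul hF.tendsto (by simp) hH.tendsto (by simp)).add
        ((ENNReal.Tendsto.mul_const hF.tendsto (Or.inr hH.memLp.2.ne)).add
          (ENNReal.Tendsto.const_mul hH.tendsto (Or.inr hF.memLp.2.ne)))
    simp only [mul_zero, zero_mul, add_zero] at hlim
    refine tendsto_of_tendsto_of_tendsto_of_le_of_le' tendsto_const_nhds hlim
      (Eventually.of_forall fun _ => zero_le) ?_
    filter_upwards [hF.eventually_memLp, hH.eventually_memLp] with ε h1 h2
    have m1 := h1.sub hF.memLp
    have m2 := h2.sub hH.memLp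
    calc eLpNorm (fun x => F ε x * H ε x - f x * h x) c volume
        = eLpNorm ((F ε - f) • (H ε - h) + ((F ε - f) • h + f • (H ε - h))) c volume := by
          congr 1; ext x; simp; ring
      _ ≤ eLpNorm ((F ε - f) • (H ε - h)) c volume +
          eLpNorm ((F ε - f) • h + f • (H ε - h)) c volume :=
          eLpNorm_add_le (m1.1.smul m2.1) ((m1.1.smul hH.memLp.1).add (hF.memLp.1.smul m2.1)) hc
      _ ≤ eLpNorm ((F ε - f) • (H ε - h)) c volume + (eLpNorm ((F ε - f) • h) c volume +
          eLpNorm (f • (H ε - h)) c volume) := by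
          gcongr
          exact eLpNorm_add_le (m1.1.smul hH.memLp.1) (hF.memLp.1.smul m2.1) hc
      _ ≤ _ := by
          gcongr
          · exact eLpNorm_smul_le_mul_eLpNorm m2.1 m1.1
          · exact eLpNorm_smul_le_mul_eLpNorm hH.memLp.1 m1.1
          · exact eLpNorm_smul_le_mul_eLpNorm m2.1 hF.memLp.1

theorem LpTo.const_mul (hq : 1 ≤ q) (c : ℝ) (hF : LpTo q F f) :
    LpTo q (fun ε x => c * F ε x) (fun x => c * f x) := by
  have : ENNReal.HolderTriple ⊤ q q := ⟨by simp⟩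
  exact LpTo.mul hq (LpTo.const (memLp_top_const c)) hF

theorem LpTo.of_tendsto_zero (h1 : ∀ᶠ ε in 𝓝[>] (0 : ℝ), MemLp (F ε) q volume)
    (h2 : Tendsto (fun ε => eLpNorm (F ε) q volume) (𝓝[>] 0) (𝓝 0)) :
    LpTo q F (fun _ => 0) :=
  ⟨MemLp.zero, h1, by simpa using h2⟩

/-- On a fixed compact support, `L^P` convergence implies `L^Q` convergence for `Q ≤ P`. -/
theorem LpTo.mono_exponent {P Q : ℝ≥0∞} (hQP : Q ≤ P) {S : Set (Euc n)} (hS : IsCompact S)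
    (hF : LpTo P F f) (h1 : ∀ᶠ ε in 𝓝[>] (0 : ℝ), ∀ x ∉ S, F ε x = 0) (h2 : ∀ x ∉ S, f x = 0) :
    LpTo Q F f := by
  have hSm := hS.measurableSet
  have key : ∀ u : Euc n → ℝ, (∀ x ∉ S, u x = 0) → AEStronglyMeasurable u volume →
      eLpNorm u Q volume ≤ eLpNorm u P volume * volume S ^ (1 / Q.toReal - 1 / P.toReal) := by
    intro u hu hm
    have e : S.indicator u = u := by
      ext x; by_cases hx : x ∈ S <;> simp [hx, hu]
    have := eLpNorm_le_eLpNorm_mul_rpow_measure_univ (μ := volume.restrict S) hQP hm.restrict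
    rwa [← eLpNorm_indicator_eq_eLpNorm_restrict hSm, ← eLpNorm_indicator_eq_eLpNorm_restrict hSm,
      e, Measure.restrict_apply_univ] at this
  by_cases hQ0 : Q = 0
  · subst hQ0
    exact ⟨by simpa using hF.memLp.1, hF.eventually_memLp.mono fun ε h => by simpa using h.1,
      by simp⟩
  have hfin : volume S ^ (1 / Q.toReal - 1 / P.toReal) ≠ ⊤ := by
    refine ENNReal.rpow_ne_top_of_nonneg ?_ hS.measure_lt_top.ne
    rcases eq_or_ne P ⊤ with rfl | hP
    · simp
    · have : Q ≠ ⊤ := ne_top_of_le_ne_top hP hQP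
      have h0 : 0 < Q.toReal := ENNReal.toReal_pos hQ0 this
      have h1 : Q.toReal ≤ P.toReal := ENNReal.toReal_mono hP hQP
      rw [sub_nonneg]
      exact one_div_le_one_div_of_le h0 h1
  refine ⟨⟨hF.memLp.1, ?_⟩, ?_, ?_⟩
  · exact (key f h2 hF.memLp.1).trans_lt (ENNReal.mul_lt_top hF.memLp.2 hfin.lt_top)
  · filter_upwards [hF.eventually_memLp, h1] with ε h3 h4
    exact ⟨h3.1, (key _ h4 h3.1).trans_lt (ENNReal.mul_lt_top h3.2 hfin.lt_top)⟩
  · have hlim := ENNReal.Tendsto.mul_const hF.tendsto (Or.inr hfin)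
    rw [zero_mul] at hlim
    refine tendsto_of_tendsto_of_tendsto_of_le_of_le' tendsto_const_nhds hlim
      (Eventually.of_forall fun _ => zero_le) ?_
    filter_upwards [hF.eventually_memLp, h1] with ε h3 h4
    exact key _ (fun x hx => by rw [h4 x hx, h2 x hx, sub_zero]) (h3.sub hF.memLp).1

theorem MemLp.of_continuous_bounded {f : Euc n → ℝ} (hf : Continuous f) {C : ℝ}
    (hC : ∀ x, |f x| ≤ C) : MemLp f ⊤ volume :=
  memLp_top_of_bound hf.aestronglyMeasurable C (Eventually.of_forall hC)

theorem MemLp.of_continuous_compact {f : Euc n → ℝ} (hf : Continuous f)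
    (hs : HasCompactSupport f) : MemLp f q volume :=
  hf.memLp_of_hasCompactSupport hs

/-- The set where the bound holds is closed and of full measure, hence dense, hence everything. -/
theorem norm_le_of_eLpNorm_top {f : Euc n → ℝ} (hf : Continuous f) {C : ℝ≥0∞}
    (h : eLpNorm f ⊤ volume ≤ C) (x : Euc n) : ‖f x‖ₑ ≤ C := by
  rw [eLpNorm_exponent_top] at h
  have h1 : ∀ᵐ y ∂(volume : Measure (Euc n)), ‖f y‖ₑ ≤ C :=
    (ae_le_eLpNormEssSup).mono fun y hy => hy.trans h
  have hcl : IsClosed {y | ‖f y‖ₑ ≤ C} := isClosed_le hf.enorm continuous_const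
  have hd : Dense {y | ‖f y‖ₑ ≤ C} := Measure.dense_of_ae h1
  have := hd.closure_eq ▸ hcl.closure_eq
  exact (this ▸ mem_univ x : x ∈ {y | ‖f y‖ₑ ≤ C})

/-- Convergence in `L^∞` of continuous functions is uniform convergence. -/
theorem LpTo.eventually_abs_sub_le (hF : LpTo ⊤ F f) (hf : Continuous f)
    (hFc : ∀ᶠ ε in 𝓝[>] (0 : ℝ), Continuous (F ε)) {δ : ℝ} (hδ : 0 < δ) :
    ∀ᶠ ε in 𝓝[>] (0 : ℝ), ∀ x, |F ε x - f x| ≤ δ := by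
  have h1 := (ENNReal.tendsto_nhds_zero.1 hF.tendsto) (ENNReal.ofReal δ) (by simpa using hδ)
  filter_upwards [h1, hFc] with ε h2 h3 x
  have := norm_le_of_eLpNorm_top (h3.sub hf) h2 x
  rw [← ofReal_norm] at this
  simpa using (ENNReal.ofReal_le_ofReal_iff hδ.le).1 this

theorem LpTo.of_forall_abs_sub_le (hf : MemLp f ⊤ volume)
    (hFc : ∀ᶠ ε in 𝓝[>] (0 : ℝ), Continuous (F ε))
    (h : ∀ δ : ℝ, 0 < δ → ∀ᶠ ε in 𝓝[>] (0 : ℝ), ∀ x, |F ε x - f x| ≤ δ) :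
    LpTo ⊤ F f := by
  have key : ∀ δ : ℝ, 0 < δ → ∀ᶠ ε in 𝓝[>] (0 : ℝ),
      eLpNorm (fun x => F ε x - f x) ⊤ volume ≤ ENNReal.ofReal δ := by
    intro δ hδ
    filter_upwards [h δ hδ] with ε hε
    rw [eLpNorm_exponent_top]
    refine eLpNormEssSup_le_of_ae_enorm_bound (Eventually.of_forall fun x => ?_)
    rw [← ofReal_norm]
    exact ENNReal.ofReal_le_ofReal (hε x)
  refine ⟨hf, ?_, ?_⟩
  · filter_upwards [key 1 one_pos, hFc] with ε h1 h2
    have h3 : MemLp (fun x => F ε x - f x) ⊤ volume :=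
      ⟨(h2.aestronglyMeasurable.sub hf.1), h1.trans_lt (by simp)⟩
    have e : (fun x => F ε x - f x) + f = F ε := by ext x; simp
    exact e ▸ h3.add hf
  · rw [ENNReal.tendsto_nhds_zero]
    intro δ hδ
    rcases eq_or_ne δ ⊤ with rfl | hδt
    · simp
    filter_upwards [key δ.toReal (ENNReal.toReal_pos hδ.ne' hδt)] with ε h1
    rwa [ENNReal.ofReal_toReal hδt] at h1

/-- Once `F ε` is uniformly within `c / 2` of `f` it stays away from zero, and then `1/F - 1/f = (f
- F)/(F f)` is uniformly small. -/
theorem LpTo.inv {c : ℝ} (hF : LpTo ⊤ F f) (hf : Continuous f)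
    (hFc : ∀ᶠ ε in 𝓝[>] (0 : ℝ), Continuous (F ε)) (hc : 0 < c) (hfc : ∀ x, c ≤ |f x|) :
    (∀ᶠ ε in 𝓝[>] (0 : ℝ), ∀ x, c / 2 ≤ |F ε x|) ∧
      LpTo ⊤ (fun ε x => (F ε x)⁻¹) (fun x => (f x)⁻¹) := by
  have hlow : ∀ᶠ ε in 𝓝[>] (0 : ℝ), ∀ x, c / 2 ≤ |F ε x| := by
    filter_upwards [hF.eventually_abs_sub_le hf hFc (half_pos hc)] with ε h1 x
    have h2 := abs_sub_abs_le_abs_sub (f x) (F ε x)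
    rw [abs_sub_comm] at h2
    linarith [h1 x, hfc x]
  have hf0 : ∀ x, f x ≠ 0 := fun x h => by have := hfc x; rw [h, abs_zero] at this; linarith
  refine ⟨hlow, ?_⟩
  refine LpTo.of_forall_abs_sub_le ?_ ?_ fun δ hδ => ?_
  · refine MemLp.of_continuous_bounded (hf.inv₀ hf0) (C := c⁻¹) fun x => ?_
    rw [abs_inv]; exact inv_anti₀ hc (hfc x)
  · filter_upwards [hlow, hFc] with ε h1 h2
    exact h2.inv₀ fun x h => by have := h1 x; rw [h, abs_zero] at this; linarith
  · filter_upwards [hlow, hF.eventually_abs_sub_le hf hFc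
      (show 0 < δ * (c / 2 * c) by positivity)] with ε h1 h2 x
    have hF0 : F ε x ≠ 0 := fun h => by have := h1 x; rw [h, abs_zero] at this; linarith
    rw [inv_sub_inv hF0 (hf0 x), abs_div, abs_mul, abs_sub_comm,
      div_le_iff₀ (mul_pos (abs_pos.2 hF0) (abs_pos.2 (hf0 x)))]
    refine (h2 x).trans ?_
    gcongr
    · exact h1 x
    · exact hfc x

end LpTo

/-! ### Partial derivatives, classical and weak -/

section Pderiv

variable {n : ℕ} {k : Fin n} {f h : Euc n → ℝ} {x : Euc n}

theorem pderiv_congr (hfh : f =ᶠ[𝓝 x] h) : pderiv k f x = pderiv k h x := by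
  simp only [pderiv, hfh.fderiv_eq]

theorem pderiv_add (hf : DifferentiableAt ℝ f x) (hh : DifferentiableAt ℝ h x) :
    pderiv k (fun y => f y + h y) x = pderiv k f x + pderiv k h x := by
  simp [pderiv, fderiv_fun_add hf hh]

theorem pderiv_sub (hf : DifferentiableAt ℝ f x) (hh : DifferentiableAt ℝ h x) :
    pderiv k (fun y => f y - h y) x = pderiv k f x - pderiv k h x := by
  simp [pderiv, fderiv_fun_sub hf hh]

theorem pderiv_neg : pderiv k (fun y => -f y) x = -pderiv k f x := by
  simp [pderiv]

theorem pderiv_mul (hf : DifferentiableAt ℝ f x) (hh : DifferentiableAt ℝ h x) :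
    pderiv k (fun y => f y * h y) x = pderiv k f x * h x + f x * pderiv k h x := by
  simp [pderiv, fderiv_fun_mul hf hh]; ring

theorem pderiv_const (c : ℝ) : pderiv k (fun _ : Euc n => c) x = 0 := by
  simp [pderiv]

theorem pderiv_sum {ι : Type*} (s : Finset ι) {F : ι → Euc n → ℝ}
    (hF : ∀ i ∈ s, DifferentiableAt ℝ (F i) x) :
    pderiv k (fun y => ∑ i ∈ s, F i y) x = ∑ i ∈ s, pderiv k (F i) x := by
  simp [pderiv, fderiv_fun_sum hF]

theorem pderiv_inv (hf : DifferentiableAt ℝ f x) (h0 : f x ≠ 0) :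
    pderiv k (fun y => (f y)⁻¹) x = -(pderiv k f x) * ((f x)⁻¹ * (f x)⁻¹) := by
  have h1 : HasFDerivAt (fun y => (f y)⁻¹) ((-(f x ^ 2)⁻¹) • fderiv ℝ f x) x :=
    (hasDerivAt_inv h0).comp_hasFDerivAt x hf.hasFDerivAt
  rw [pderiv, h1.fderiv, pderiv, smul_apply, smul_eq_mul]
  field_simp

theorem contDiff_pderiv (hf : ContDiff ℝ ∞ f) : ContDiff ℝ ∞ (pderiv k f) := by
  have h1 : ContDiff ℝ ∞ (fderiv ℝ f) := hf.fderiv_right (m := ∞) (by simp)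
  exact h1.clm_apply contDiff_const

theorem contDiffAt_pderiv (hf : ContDiffAt ℝ ∞ f x) : ContDiffAt ℝ ∞ (pderiv k f) x := by
  have h1 : ContDiffAt ℝ ∞ (fderiv ℝ f) x := hf.fderiv_right (m := ∞) (by simp)
  exact h1.clm_apply contDiffAt_const

theorem contDiffOn_pderiv {s : Set (Euc n)} (hs : IsOpen s) (hf : ContDiffOn ℝ ∞ f s) :
    ContDiffOn ℝ ∞ (pderiv k f) s := fun _ hx =>
  (contDiffAt_pderiv (hf.contDiffAt (hs.mem_nhds hx))).contDiffWithinAt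

theorem tsupport_pderiv_subset : tsupport (pderiv k f) ⊆ tsupport f := by
  refine closure_minimal ?_ isClosed_closure
  intro y hy
  by_contra hc
  refine hy ?_
  have : f =ᶠ[𝓝 y] fun _ => 0 := notMem_tsupport_iff_eventuallyEq.1 hc
  rw [pderiv_congr this, pderiv_const]

theorem hasCompactSupport_pderiv (hf : HasCompactSupport f) : HasCompactSupport (pderiv k f) :=
  hf.mono' ((subset_tsupport _).trans tsupport_pderiv_subset)

theorem pderiv_comm (i j : Fin n) (hf : ContDiffAt ℝ ∞ f x) :
    pderiv i (pderiv j f) x = pderiv j (pderiv i f) x := by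
  have hd : DifferentiableAt ℝ (fderiv ℝ f) x :=
    (hf.fderiv_right (m := ∞) (by simp)).differentiableAt (by simp)
  have hs : IsSymmSndFDerivAt ℝ f x :=
    hf.isSymmSndFDerivAt (by
      simpa using (WithTop.coe_le_coe.2 (le_top : (2 : ℕ∞) ≤ ⊤) : ((2 : ℕ∞) : WithTop ℕ∞) ≤ _))
  have key : ∀ i j : Fin n, pderiv i (pderiv j f) x = fderiv ℝ (fderiv ℝ f) x (stdVec i) (stdVec j) := by
    intro i j
    have h1 : HasFDerivAt (fun y => fderiv ℝ f y (stdVec j))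
        ((fderiv ℝ (fderiv ℝ f) x).flip (stdVec j)) x := by
      simpa using hd.hasFDerivAt.clm_apply (hasFDerivAt_const (stdVec j) x)
    change fderiv ℝ (fun y => fderiv ℝ f y (stdVec j)) x (stdVec i) = _
    rw [h1.fderiv]; rfl
  rw [key, key]; exact hs _ _

/-- A continuous linear form evaluated at `v` is `∑ vₖ` times its value at basis vectors. -/
theorem fderiv_apply_eq_sum_pderiv (v : Euc n) : fderiv ℝ f x v = ∑ k, v k * pderiv k f x := by
  have hv : v = ∑ k, v k • stdVec k := by
    ext i
    simp [stdVec, Finset.sum_apply, Pi.single_apply]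
  conv_lhs => rw [hv]
  simp [pderiv]

theorem integral_mul_pderiv (hf : ContDiff ℝ 1 f) (hh : ContDiff ℝ 1 h) (hs : HasCompactSupport h) :
    ∫ y, f y * pderiv k h y = -∫ y, pderiv k f y * h y := by
  have c1 : Continuous fun y => fderiv ℝ f y (stdVec k) :=
    (hf.continuous_fderiv (by simp)).clm_apply continuous_const
  have c2 : Continuous fun y => fderiv ℝ h y (stdVec k) :=
    (hh.continuous_fderiv (by simp)).clm_apply continuous_const
  refine integral_mul_fderiv_eq_neg_fderiv_mul_of_integrable ?_ ?_ ?_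
    (fun y _ => hf.differentiable (by simp) y) (fun y _ => hh.differentiable (by simp) y)
  · exact (c1.mul hh.continuous).integrable_of_hasCompactSupport hs.mul_left
  · exact (hf.continuous.mul c2).integrable_of_hasCompactSupport (hasCompactSupport_pderiv hs).mul_left
  · exact (hf.continuous.mul hh.continuous).integrable_of_hasCompactSupport hs.mul_left

/-- `v` is the weak partial derivative `∂ₖ u` on all of `ℝⁿ`. -/
def HasWeakPartial (k : Fin n) (u v : Euc n → ℝ) : Prop :=
  ∀ φ : Euc n → ℝ, ContDiff ℝ ∞ φ → HasCompactSupport φ →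
    ∫ y, u y * pderiv k φ y = -∫ y, v y * φ y

theorem pderiv_comp_sub_left {σ : Euc n → ℝ} (hσ : Differentiable ℝ σ) (z y : Euc n) :
    pderiv k (fun t => σ (z - t)) y = -pderiv k σ (z - y) := by
  have h1 : HasFDerivAt (fun t => σ (z - t)) ((fderiv ℝ σ (z - y)).comp
      (-ContinuousLinearMap.id ℝ (Euc n))) y :=
    (hσ (z - y)).hasFDerivAt.comp y ((hasFDerivAt_id y).const_sub z)
  rw [pderiv, h1.fderiv]
  simp [pderiv]

theorem hasCompactSupport_comp_sub_left {σ : Euc n → ℝ} (hσ' : HasCompactSupport σ) (z : Euc n) :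
    HasCompactSupport fun t => σ (z - t) :=
  hσ'.comp_homeomorph (Homeomorph.subLeft z)

/-- The test function is `t ↦ σ (z - t)`; the sign from reflecting it cancels the sign of
integration by parts. -/
theorem HasWeakPartial.conv_pderiv {u v σ : Euc n → ℝ} (h : HasWeakPartial k u v)
    (hσ : ContDiff ℝ ∞ σ) (hσ' : HasCompactSupport σ) : conv u (pderiv k σ) = conv v σ := by
  ext z
  have h1 := h (fun t => σ (z - t)) (by fun_prop) (hasCompactSupport_comp_sub_left hσ' z)
  simp only [pderiv_comp_sub_left (hσ.differentiable (by simp)), mul_neg, integral_neg, neg_inj] at h1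
  rw [conv_apply, conv_apply, h1]

theorem contDiff_conv {u σ : Euc n → ℝ} (hu : LocallyIntegrable u volume) (hσ : ContDiff ℝ ∞ σ)
    (hσ' : HasCompactSupport σ) : ContDiff ℝ ∞ (conv u σ) :=
  hσ'.contDiff_convolution_right _ hu hσ

theorem pderiv_conv {u σ : Euc n → ℝ} (hu : LocallyIntegrable u volume) (hσ : ContDiff ℝ ∞ σ)
    (hσ' : HasCompactSupport σ) : pderiv k (conv u σ) = conv u (pderiv k σ) := by
  ext z
  have h1 := hσ'.hasFDerivAt_convolution_right (ContinuousLinearMap.lsmul ℝ ℝ) hu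
    (hσ.of_le (by simp)) z
  change fderiv ℝ (convolution u σ (ContinuousLinearMap.lsmul ℝ ℝ) volume) z (stdVec k) = _
  rw [h1.fderiv, convolution_precompR_apply _ hu (hσ'.fderiv ℝ)
    (hσ.continuous_fderiv (by simp))]
  rfl

theorem contDiff_scaleKernel {σ : Euc n → ℝ} (hσ : ContDiff ℝ ∞ σ) (ε : ℝ) :
    ContDiff ℝ ∞ (scaleKernel σ ε) := by
  unfold scaleKernel; fun_prop

/-- Each derivative of a mollifier costs a factor `1/ε`, to be compensated by the rate `O(ε)` in
`SobConv`. -/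
theorem pderiv_scaleKernel {σ : Euc n → ℝ} (ε : ℝ) (hσ : ContDiff ℝ ∞ σ) :
    pderiv k (scaleKernel σ ε) = fun y => ε⁻¹ * scaleKernel (pderiv k σ) ε y := by
  ext y
  have hd : DifferentiableAt ℝ σ (ε⁻¹ • y) := hσ.differentiable (by simp) _
  have h1 : HasFDerivAt (fun y => σ (ε⁻¹ • y)) ((fderiv ℝ σ (ε⁻¹ • y)).comp
      (ε⁻¹ • ContinuousLinearMap.id ℝ (Euc n))) y :=
    hd.hasFDerivAt.comp y ((hasFDerivAt_id y).const_smul ε⁻¹)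
  have h2 := h1.const_mul (ε ^ n)⁻¹
  change fderiv ℝ (fun y => (ε ^ n)⁻¹ * σ (ε⁻¹ • y)) y (stdVec k) = _
  rw [h2.fderiv]
  simp [scaleKernel, pderiv]; ring

theorem conv_const_mul (c : ℝ) (u σ : Euc n → ℝ) :
    conv u (fun y => c * σ y) = fun x => c * conv u σ x := by
  ext x
  simp only [conv_apply]
  rw [← integral_const_mul]
  congr 1; ext t; ring

/-- Applied to a mollifier, this improves derivatives of mollified functions from `O(1/ε)` to
`o(1/ε)`. Applied to a product with a test function, it is integration by parts. -/
theorem integral_pderiv_eq_zero {σ : Euc n → ℝ} (hσ : ContDiff ℝ ∞ σ) (hσ' : HasCompactSupport σ) :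
    ∫ y, pderiv k σ y = 0 := by
  have := integral_mul_pderiv (k := k) (f := fun _ => (1:ℝ)) contDiff_const (hσ.of_le (by simp)) hσ'
  simpa [pderiv_const] using this

end Pderiv

/-! ### First-order Sobolev convergence with rate -/

section Sobolev

variable {n : ℕ} {P Q : ℝ≥0∞}

/-- Exponents with `2 ≤ P < ∞` and `Q = P / 2`. -/
class ExponentPair (P Q : ℝ≥0∞) : Prop where
  holder : ENNReal.HolderTriple P P Q
  one_le : 1 ≤ Q
  ne_top : P ≠ ⊤

theorem ExponentPair.le [h : ExponentPair P Q] : Q ≤ P :=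
  have := h.holder; ENNReal.HolderTriple.le P P Q

theorem ExponentPair.one_le' [h : ExponentPair P Q] : 1 ≤ P := h.one_le.trans h.le

theorem ExponentPair.ne_top' [h : ExponentPair P Q] : Q ≠ ⊤ := ne_top_of_le_ne_top h.ne_top h.le

theorem LpTo.mul_half [e : ExponentPair P Q] {F H : ℝ → Euc n → ℝ} {f h : Euc n → ℝ}
    (hF : LpTo P F f) (hH : LpTo P H h) : LpTo Q (fun ε x => F ε x * H ε x) (fun x => f x * h x) :=
  have := e.holder; LpTo.mul e.one_le hF hH

theorem LpTo.bdd_mul {q : ℝ≥0∞} (hq : 1 ≤ q) {F H : ℝ → Euc n → ℝ} {f h : Euc n → ℝ}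
    (hF : LpTo ⊤ F f) (hH : LpTo q H h) : LpTo q (fun ε x => F ε x * H ε x) (fun x => f x * h x) :=
  have : ENNReal.HolderTriple ⊤ q q := ⟨by simp⟩; LpTo.mul hq hF hH

/-- The smooth functions `F ε` converge to `f` uniformly, with rate `O(ε)` in `L^P`, and their
partial derivatives converge to `f'` in `L^P`. -/
structure SobConv (P : ℝ≥0∞) (F : ℝ → Euc n → ℝ) (f : Euc n → ℝ) (f' : Fin n → Euc n → ℝ) :
    Prop where
  smooth : ∀ᶠ ε in 𝓝[>] (0 : ℝ), ContDiff ℝ ∞ (F ε)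
  cont : Continuous f
  unif : LpTo ⊤ F f
  rate : ∃ c : ℝ≥0∞, c ≠ ⊤ ∧ ∀ᶠ ε in 𝓝[>] (0 : ℝ),
    eLpNorm (fun x => F ε x - f x) P volume ≤ c * ENNReal.ofReal ε
  deriv : ∀ k, LpTo P (fun ε => pderiv k (F ε)) (f' k)

namespace SobConv

variable {F H : ℝ → Euc n → ℝ} {f h : Euc n → ℝ} {f' h' : Fin n → Euc n → ℝ}

theorem eventually_continuous (hF : SobConv P F f f') :
    ∀ᶠ ε in 𝓝[>] (0 : ℝ), Continuous (F ε) := hF.smooth.mono fun _ h => h.continuous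

theorem of_smooth (hf : ContDiff ℝ ∞ f) (hb : MemLp f ⊤ volume)
    (hd : ∀ k, MemLp (pderiv k f) P volume) :
    SobConv P (fun _ => f) f (fun k => pderiv k f) :=
  ⟨Eventually.of_forall fun _ => hf, hf.continuous, LpTo.const hb, ⟨0, by simp, by simp⟩,
    fun k => LpTo.const (hd k)⟩

theorem of_compact (hf : ContDiff ℝ ∞ f) (hs : HasCompactSupport f) :
    SobConv P (fun _ => f) f (fun k => pderiv k f) :=
  of_smooth hf (MemLp.of_continuous_compact hf.continuous hs) fun _ =>
    MemLp.of_continuous_compact (contDiff_pderiv hf).continuous (hasCompactSupport_pderiv hs)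

theorem const (c : ℝ) : SobConv (n := n) P (fun _ _ => c) (fun _ => c) (fun _ _ => 0) := by
  have h0 : ∀ k : Fin n, pderiv k (fun _ : Euc n => c) = fun _ => 0 := fun k => by
    ext x; exact pderiv_const c
  have := of_smooth (P := P) (n := n) (f := fun _ => c) contDiff_const (memLp_top_const c)
    (fun k => by rw [h0]; exact MemLp.zero)
  simpa only [h0] using this

theorem congr (hF : SobConv P F f f') (he : ∀ᶠ ε in 𝓝[>] (0 : ℝ), ∀ x, F ε x = H ε x)
    (hf : ∀ x, f x = h x) (hf' : ∀ k, f' k =ᵐ[volume] h' k) : SobConv P H h h' := by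
  have he' : ∀ᶠ ε in 𝓝[>] (0 : ℝ), F ε = H ε := he.mono fun _ h => funext h
  obtain rfl : f = h := funext hf
  refine ⟨?_, hF.cont, hF.unif.congr_left he, ?_, fun k => ?_⟩
  · filter_upwards [hF.smooth, he'] with ε h1 h2 using h2 ▸ h1
  · obtain ⟨c, hc, h1⟩ := hF.rate
    exact ⟨c, hc, by filter_upwards [h1, he'] with ε h1 h2 using h2 ▸ h1⟩
  · exact (hF.deriv k).congr (he'.mono fun ε h => by rw [h]) (hf' k)

theorem add (hP : 1 ≤ P) (hF : SobConv P F f f') (hH : SobConv P H h h') :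
    SobConv P (fun ε x => F ε x + H ε x) (fun x => f x + h x) (fun k x => f' k x + h' k x) := by
  refine ⟨?_, hF.cont.add hH.cont, hF.unif.add le_top hH.unif, ?_, fun k => ?_⟩
  · filter_upwards [hF.smooth, hH.smooth] with ε h1 h2 using h1.add h2
  · obtain ⟨c, hc, h1⟩ := hF.rate
    obtain ⟨d, hd, h2⟩ := hH.rate
    refine ⟨c + d, by simp [hc, hd], ?_⟩
    filter_upwards [h1, h2, hF.eventually_continuous, hH.eventually_continuous] with ε h1 h2 h3 h4
    rw [add_mul]
    calc _ = eLpNorm ((fun x => F ε x - f x) + fun x => H ε x - h x) P volume := by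
          congr 1; ext x; simp; ring
      _ ≤ _ := (eLpNorm_add_le (h3.sub hF.cont).aestronglyMeasurable
          (h4.sub hH.cont).aestronglyMeasurable hP).trans (add_le_add h1 h2)
  · refine ((hF.deriv k).add hP (hH.deriv k)).congr_left ?_
    filter_upwards [hF.smooth, hH.smooth] with ε h1 h2 x
    exact (pderiv_add (h1.differentiable (by simp) x) (h2.differentiable (by simp) x)).symm

/-- The rate survives products because `FH - fh = H(F - f) + f(H - h)` with `H` and `f` bounded; the
derivatives pair a uniform limit with an `L^P` limit. -/
theorem mul (hP : 1 ≤ P) (hF : SobConv P F f f') (hH : SobConv P H h h') :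
    SobConv P (fun ε x => F ε x * H ε x) (fun x => f x * h x)
      (fun k x => f' k x * h x + f x * h' k x) := by
  refine ⟨?_, hF.cont.mul hH.cont, hF.unif.bdd_mul le_top hH.unif, ?_, fun k => ?_⟩
  · filter_upwards [hF.smooth, hH.smooth] with ε h1 h2 using h1.mul h2
  · obtain ⟨c, hc, h1⟩ := hF.rate
    obtain ⟨d, hd, h2⟩ := hH.rate
    -- The family `H ε` is eventually within `1` of `h` in the supremum norm.
    have hHb : ∀ᶠ ε in 𝓝[>] (0 : ℝ), eLpNorm (H ε) ⊤ volume ≤ 1 + eLpNorm h ⊤ volume := by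
      filter_upwards [(ENNReal.tendsto_nhds_zero.1 hH.unif.tendsto) 1 one_pos,
        hH.eventually_continuous] with ε h3 h4
      calc eLpNorm (H ε) ⊤ volume = eLpNorm ((fun x => H ε x - h x) + h) ⊤ volume := by
            congr 1; ext x; simp
        _ ≤ _ := (eLpNorm_add_le (h4.sub hH.cont).aestronglyMeasurable
          hH.cont.aestronglyMeasurable le_top).trans (by gcongr; exact h3)
    refine ⟨(1 + eLpNorm h ⊤ volume) * c + eLpNorm f ⊤ volume * d, ?_, ?_⟩
    · exact ENNReal.add_ne_top.2 ⟨ENNReal.mul_ne_top (ENNReal.add_ne_top.2 ⟨by simp, hH.unif.memLp.2.ne⟩) hc,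
        ENNReal.mul_ne_top hF.unif.memLp.2.ne hd⟩
    filter_upwards [h1, h2, hF.eventually_continuous, hH.eventually_continuous, hHb]
      with ε h1 h2 h3 h4 h5
    have m1 : Continuous (F ε - f) := h3.sub hF.cont
    have m2 : Continuous (H ε - h) := h4.sub hH.cont
    have : ENNReal.HolderTriple ⊤ P P := ⟨by simp⟩
    calc eLpNorm (fun x => F ε x * H ε x - f x * h x) P volume
        = eLpNorm (H ε • (F ε - f) + f • (H ε - h)) P volume := by
          congr 1; ext x; simp; ring
      _ ≤ eLpNorm (H ε • (F ε - f)) P volume + eLpNorm (f • (H ε - h)) P volume :=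
          eLpNorm_add_le (h4.smul m1).aestronglyMeasurable
            (hF.cont.smul m2).aestronglyMeasurable hP
      _ ≤ eLpNorm (H ε) ⊤ volume * eLpNorm (F ε - f) P volume +
          eLpNorm f ⊤ volume * eLpNorm (H ε - h) P volume := by
          gcongr
          · exact eLpNorm_smul_le_mul_eLpNorm m1.aestronglyMeasurable h4.aestronglyMeasurable
          · exact eLpNorm_smul_le_mul_eLpNorm m2.aestronglyMeasurable hF.cont.aestronglyMeasurable
      _ ≤ (1 + eLpNorm h ⊤ volume) * (c * ENNReal.ofReal ε) +
          eLpNorm f ⊤ volume * (d * ENNReal.ofReal ε) := by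
          gcongr
          · exact h1
          · exact h2
      _ = _ := by ring
  · have h1 := (hH.unif.bdd_mul hP (hF.deriv k)).add hP (hF.unif.bdd_mul hP (hH.deriv k))
    refine (h1.congr (H := fun ε => pderiv k fun x => F ε x * H ε x) ?_
      (Eventually.of_forall fun x => ?_))
    · filter_upwards [hF.smooth, hH.smooth] with ε h1 h2
      refine Eventually.of_forall fun x => ?_
      rw [pderiv_mul (h1.differentiable (by simp) x) (h2.differentiable (by simp) x)]
      ring
    · ring

theorem const_mul (hP : 1 ≤ P) (c : ℝ) (hF : SobConv P F f f') :
    SobConv P (fun ε x => c * F ε x) (fun x => c * f x) (fun k x => c * f' k x) := by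
  simpa using (const c).mul hP hF

theorem neg (hP : 1 ≤ P) (hF : SobConv P F f f') :
    SobConv P (fun ε x => -F ε x) (fun x => -f x) (fun k x => -f' k x) := by
  simpa using hF.const_mul hP (-1)

theorem sub (hP : 1 ≤ P) (hF : SobConv P F f f') (hH : SobConv P H h h') :
    SobConv P (fun ε x => F ε x - H ε x) (fun x => f x - h x) (fun k x => f' k x - h' k x) := by
  simpa [sub_eq_add_neg] using hF.add hP (hH.neg hP)

theorem sum (hP : 1 ≤ P) {ι : Type*} (s : Finset ι) {F : ι → ℝ → Euc n → ℝ}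
    {f : ι → Euc n → ℝ} {f' : ι → Fin n → Euc n → ℝ} (h : ∀ i ∈ s, SobConv P (F i) (f i) (f' i)) :
    SobConv P (fun ε x => ∑ i ∈ s, F i ε x) (fun x => ∑ i ∈ s, f i x)
      (fun k x => ∑ i ∈ s, f' i k x) := by
  classical
  induction s using Finset.induction_on with
  | empty => simpa using const (n := n) (P := P) 0
  | insert a s ha ih =>
    simp only [Finset.sum_insert ha]
    exact (h a (by simp)).add hP (ih fun i hi => h i (by simp [hi]))

theorem inv (hP : 1 ≤ P) (hF : SobConv P F f f') {c : ℝ} (hc : 0 < c) (hfc : ∀ x, c ≤ |f x|) :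
    SobConv P (fun ε x => (F ε x)⁻¹) (fun x => (f x)⁻¹)
      (fun k x => -(f' k x) * ((f x)⁻¹ * (f x)⁻¹)) := by
  obtain ⟨hlow, hinv⟩ := hF.unif.inv hF.cont hF.eventually_continuous hc hfc
  have hf0 : ∀ x, f x ≠ 0 := fun x h => by have := hfc x; rw [h, abs_zero] at this; linarith
  have hF0 : ∀ᶠ ε in 𝓝[>] (0 : ℝ), ∀ x, F ε x ≠ 0 := hlow.mono fun ε h1 x h => by
    have := h1 x; rw [h, abs_zero] at this; linarith
  refine ⟨?_, hF.cont.inv₀ hf0, hinv, ?_, fun k => ?_⟩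
  · filter_upwards [hF.smooth, hF0] with ε h1 h2 using h1.inv h2
  · obtain ⟨d, hd, h1⟩ := hF.rate
    -- In `|1/F - 1/f| = |F - f| / (|F| |f|)` the lower bounds are `c / 2` for `|F|` and `c` for
    -- `|f|`.
    refine ⟨ENNReal.ofReal ((c / 2 * c)⁻¹) * d, ENNReal.mul_ne_top (by simp) hd, ?_⟩
    filter_upwards [h1, hlow, hF0, hF.eventually_continuous] with ε h1 h2 h3 h4
    rw [mul_assoc]
    refine le_trans ?_ (mul_le_mul_right h1 _)
    refine eLpNorm_le_mul_eLpNorm_of_ae_le_mul (Eventually.of_forall fun x => ?_) P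
    rw [inv_sub_inv (h3 x) (hf0 x), Real.norm_eq_abs, abs_div, abs_mul, abs_sub_comm,
      Real.norm_eq_abs, div_eq_inv_mul]
    gcongr
    · exact h2 x
    · exact hfc x
  · refine ((hinv.bdd_mul le_top hinv).bdd_mul hP (hF.deriv k).neg).congr ?_
      (Eventually.of_forall fun x => by ring)
    filter_upwards [hF.smooth, hF0] with ε h1 h2
    refine Eventually.of_forall fun x => ?_
    rw [pderiv_inv (h1.differentiable (by simp) x) (h2 x)]
    ring

end SobConv

end Sobolev

/-! ### Translation moduli and weak derivatives of Sobolev limits -/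

section Translation

variable {n : ℕ} {P : ℝ≥0∞}

theorem eLpNorm_fderiv_apply_le (hP : 1 ≤ P) {F : Euc n → ℝ} (hF : ContDiff ℝ ∞ F) (y : Euc n) :
    eLpNorm (fun x => fderiv ℝ F x y) P volume ≤
      ENNReal.ofReal ‖y‖ * ∑ k, eLpNorm (pderiv k F) P volume := by
  have e : (fun x => fderiv ℝ F x y) = ∑ k, (y k) • pderiv k F := by
    ext x; simp [fderiv_apply_eq_sum_pderiv]
  rw [e, Finset.mul_sum]
  refine (eLpNorm_sum_le (fun k _ =>
    ((contDiff_pderiv hF).continuous.const_smul _).aestronglyMeasurable) hP).trans ?_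
  refine Finset.sum_le_sum fun k _ => ?_
  rw [eLpNorm_const_smul, ← ofReal_norm]
  gcongr
  exact EuclideanSpace.norm_eq y ▸ PiLp.norm_apply_le y k

/-- Write `F(x - y) - F(x)` as `-∫₀¹ DF(x - ty) y dt` and apply Minkowski's integral inequality;
every translate of `DF · y` has the same norm. -/
theorem eLpNorm_translate_sub_le_of_smooth (hP : 1 ≤ P) (hP' : P ≠ ⊤) {F : Euc n → ℝ}
    (hF : ContDiff ℝ ∞ F) (y : Euc n) :
    eLpNorm (fun x => F (x - y) - F x) P volume ≤
      ENNReal.ofReal ‖y‖ * ∑ k, eLpNorm (pderiv k F) P volume := by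
  have hc : Continuous fun z : ℝ × Euc n => -(fderiv ℝ F (z.2 - z.1 • y) y) := by
    have := hF.continuous_fderiv (by simp)
    fun_prop
  have e : (fun x => F (x - y) - F x) = fun x =>
      ∫ t, (-(fderiv ℝ F (x - t • y) y)) * (1:ℝ) ∂(volume.restrict (Ioc (0:ℝ) 1)) := by
    ext x
    have hd : ∀ t ∈ uIcc (0:ℝ) 1, HasDerivAt (fun t : ℝ => F (x - t • y))
        (-(fderiv ℝ F (x - t • y) y)) t := by
      intro t _
      have h1 : HasDerivAt (fun t : ℝ => x - t • y) (-y) t := by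
        simpa using ((hasDerivAt_id t).smul_const y).const_sub x
      have := ((hF.differentiable (by simp) (x - t • y)).hasFDerivAt.comp_hasDerivAt t h1)
      rw [map_neg] at this
      exact this
    have h2 := intervalIntegral.integral_eq_sub_of_hasDerivAt hd
      ((hc.comp (by fun_prop : Continuous fun t : ℝ => (t, x))).intervalIntegrable _ _)
    simp only [one_smul, zero_smul, sub_zero] at h2
    rw [← h2, intervalIntegral.integral_of_le zero_le_one]
    simp
  rw [e]
  refine (eLpNorm_integral_mul_le hP hP' (σ := fun _ => (1:ℝ))
    (H := fun t x => -(fderiv ℝ F (x - t • y) y)) (integrable_const _) hc.aestronglyMeasurable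
    (C := ENNReal.ofReal ‖y‖ * ∑ k, eLpNorm (pderiv k F) P volume) ?_).trans ?_
  · intro t _
    have h3 : Continuous fun x => fderiv ℝ F x y := by
      have := hF.continuous_fderiv (by simp); fun_prop
    have h4 := eLpNorm_comp_sub_right (q := P) h3.aestronglyMeasurable (t • y)
    calc _ = eLpNorm (fun x => fderiv ℝ F (x - t • y) y) P volume := eLpNorm_neg _ _ _
      _ ≤ _ := h4.trans_le (eLpNorm_fderiv_apply_le hP hF y)
  · simp

/-- An `L^P` limit of smooth functions with `L^P` convergent gradients has `L^P` translation
modulus `O(|y|)`. -/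
theorem eLpNorm_translate_sub_le_of_tendsto (hP : 1 ≤ P) (hP' : P ≠ ⊤) {F : ℝ → Euc n → ℝ}
    {f : Euc n → ℝ} {f' : Fin n → Euc n → ℝ} (hsm : ∀ᶠ ε in 𝓝[>] (0 : ℝ), ContDiff ℝ ∞ (F ε))
    (hf : Continuous f)
    (h0 : Tendsto (fun ε => eLpNorm (fun x => F ε x - f x) P volume) (𝓝[>] 0) (𝓝 0))
    (hd : ∀ k, LpTo P (fun ε => pderiv k (F ε)) (f' k)) (y : Euc n) :
    eLpNorm (fun x => f (x - y) - f x) P volume ≤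
      ENNReal.ofReal ‖y‖ * ∑ k, eLpNorm (f' k) P volume := by
  have hlim : Tendsto (fun ε => eLpNorm (fun x => F ε x - f x) P volume +
      (ENNReal.ofReal ‖y‖ * ∑ k, (eLpNorm (fun x => pderiv k (F ε) x - f' k x) P volume +
        eLpNorm (f' k) P volume) + eLpNorm (fun x => F ε x - f x) P volume)) (𝓝[>] 0)
      (𝓝 (0 + (ENNReal.ofReal ‖y‖ * ∑ k, (0 + eLpNorm (f' k) P volume) + 0))) := by
    refine h0.add ((ENNReal.Tendsto.const_mul ?_ (by simp)).add h0)
    exact tendsto_finsetSum _ fun k _ => (hd k).tendsto.add tendsto_const_nhds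
  simp only [zero_add, add_zero] at hlim
  refine ge_of_tendsto hlim ?_
  filter_upwards [hsm, eventually_all.2 fun k => (hd k).eventually_memLp]
    with ε h1 h2
  have hm : Continuous (F ε - f) := h1.continuous.sub hf
  have hm2 : Continuous fun x => F ε (x - y) - f (x - y) := hm.comp (continuous_id.sub continuous_const)
  have hm3 : Continuous fun x => F ε (x - y) - F ε x :=
    (h1.continuous.comp (continuous_id.sub continuous_const)).sub h1.continuous
  calc eLpNorm (fun x => f (x - y) - f x) P volume
      = eLpNorm (-(fun x => F ε (x - y) - f (x - y)) + ((fun x => F ε (x - y) - F ε x) +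
        (F ε - f))) P volume := by congr 1; ext x; simp
    _ ≤ eLpNorm (-(fun x => F ε (x - y) - f (x - y))) P volume +
        (eLpNorm (fun x => F ε (x - y) - F ε x) P volume + eLpNorm (F ε - f) P volume) :=
        (eLpNorm_add_le hm2.neg.aestronglyMeasurable (hm3.add hm).aestronglyMeasurable hP).trans
          (by gcongr; exact eLpNorm_add_le hm3.aestronglyMeasurable hm.aestronglyMeasurable hP)
    _ ≤ _ := by
        rw [eLpNorm_neg]
        gcongr
        · exact (eLpNorm_comp_sub_right (f := F ε - f) hm.aestronglyMeasurable y).le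
        · refine (eLpNorm_translate_sub_le_of_smooth hP hP' h1 y).trans ?_
          gcongr with k _
          calc eLpNorm (pderiv k (F ε)) P volume
              = eLpNorm ((fun x => pderiv k (F ε) x - f' k x) + f' k) P volume := by
                congr 1; ext x; simp
            _ ≤ _ := eLpNorm_add_le ((h2 k).sub (hd k).memLp).1 (hd k).memLp.1 hP
        · exact le_rfl

namespace SobConv

variable {F H : ℝ → Euc n → ℝ} {f h : Euc n → ℝ} {f' h' : Fin n → Euc n → ℝ}

theorem lpTo_zero (hF : SobConv P F f f') :
    Tendsto (fun ε => eLpNorm (fun x => F ε x - f x) P volume) (𝓝[>] 0) (𝓝 0) := by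
  obtain ⟨c, hc, h⟩ := hF.rate
  have hlim : Tendsto (fun ε : ℝ => c * ENNReal.ofReal ε) (𝓝[>] 0) (𝓝 (c * ENNReal.ofReal 0)) :=
    ENNReal.Tendsto.const_mul (tendsto_nhdsWithin_of_tendsto_nhds
      (ENNReal.continuous_ofReal.tendsto 0)) (Or.inr hc)
  rw [ENNReal.ofReal_zero, mul_zero] at hlim
  exact tendsto_of_tendsto_of_tendsto_of_le_of_le' tendsto_const_nhds hlim
    (Eventually.of_forall fun _ => zero_le) h

/-- A limit in `SobConv` has `L^P` translation modulus `O(|y|)`. -/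
theorem eLpNorm_translate_sub_le (hP : 1 ≤ P) (hP' : P ≠ ⊤) (hF : SobConv P F f f') (y : Euc n) :
    eLpNorm (fun x => f (x - y) - f x) P volume ≤
      ENNReal.ofReal ‖y‖ * ∑ k, eLpNorm (f' k) P volume :=
  eLpNorm_translate_sub_le_of_tendsto hP hP' hF.smooth hF.cont hF.lpTo_zero hF.deriv y

end SobConv

theorem tendsto_integral_mul_of_lpTo {q : ℝ≥0∞} (hq : 1 ≤ q) {F : ℝ → Euc n → ℝ} {f φ : Euc n → ℝ}
    (hF : LpTo q F f) (hφ : Continuous φ) (hs : HasCompactSupport φ) :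
    Tendsto (fun ε => ∫ y, F ε y * φ y) (𝓝[>] 0) (𝓝 (∫ y, f y * φ y)) := by
  have hconj : ENNReal.HolderConjugate q (q.conjExponent) := ENNReal.HolderConjugate.conjExponent hq
  have hH : LpTo 1 (fun ε x => F ε x * φ x) (fun x => f x * φ x) :=
    LpTo.mul le_rfl hF (LpTo.const (MemLp.of_continuous_compact hφ hs) (q := q.conjExponent))
  refine tendsto_integral_of_L1' _ hH.memLp.1 ?_ hH.tendsto
  exact hH.eventually_memLp.mono fun ε h => memLp_one_iff_integrable.1 h

/-- Integration by parts holds for each smooth `F ε`, and both sides pass to the limit against a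
fixed test function. Thus the limit gradient `f'` depends only on `f`, up to null sets. -/
theorem SobConv.hasWeakPartial (hP : 1 ≤ P) {F : ℝ → Euc n → ℝ} {f : Euc n → ℝ}
    {f' : Fin n → Euc n → ℝ} (hF : SobConv P F f f') (k : Fin n) : HasWeakPartial k f (f' k) := by
  intro φ hφ hs
  have h1 := tendsto_integral_mul_of_lpTo le_top hF.unif (contDiff_pderiv (k := k) hφ).continuous
    (hasCompactSupport_pderiv hs)
  have h2 := (tendsto_integral_mul_of_lpTo hP (hF.deriv k) hφ.continuous hs).neg
  refine tendsto_nhds_unique h1 (h2.congr' ?_)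
  filter_upwards [hF.smooth] with ε h
  exact (integral_mul_pderiv (h.of_le (by simp)) (hφ.of_le (by simp)) hs).symm

/-- Weak partial derivatives on an open set are unique there. -/
theorem ae_eq_of_weak_partial {U : Set (Euc n)} (hU : IsOpen U) {v w : Euc n → ℝ}
    (hv : LocallyIntegrableOn v U) (hw : LocallyIntegrableOn w U)
    (h : ∀ φ : Euc n → ℝ, ContDiff ℝ ∞ φ → HasCompactSupport φ → tsupport φ ⊆ U →
      ∫ y, v y * φ y = ∫ y, w y * φ y) : ∀ᵐ y, y ∈ U → v y = w y := by
  have h1 := hU.ae_eq_zero_of_integral_contDiff_smul_eq_zero (hv.sub hw) (fun φ hφ hs ht => ?_)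
  · filter_upwards [h1] with y hy hyU
    have := hy hyU
    simpa [sub_eq_zero] using this
  · have key : ∀ u : Euc n → ℝ, LocallyIntegrableOn u U → Integrable fun y => u y * φ y := by
      intro u hu
      have h2 : IntegrableOn u (tsupport φ) := hu.integrableOn_compact_subset ht hs
      have h3 : IntegrableOn (fun y => u y * φ y) (tsupport φ) :=
        h2.mul_continuousOn hφ.continuous.continuousOn hs
      refine (integrableOn_iff_integrable_of_support_subset ?_).1 h3
      exact (Function.support_mul_subset_right _ _).trans (subset_tsupport _)
    have := h φ hφ hs ht
    simp only [smul_eq_mul, Pi.sub_apply, mul_sub]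
    rw [integral_sub (by simpa [mul_comm] using key v hv) (by simpa [mul_comm] using key w hw)]
    simp only [mul_comm (φ _)]
    rw [this, sub_self]

theorem HasWeakPartial.ae_unique {k : Fin n} {u v w : Euc n → ℝ} (hv : LocallyIntegrable v)
    (hw : LocallyIntegrable w) (h1 : HasWeakPartial k u v) (h2 : HasWeakPartial k u w) :
    v =ᵐ[volume] w := by
  have := ae_eq_of_weak_partial isOpen_univ (hv.locallyIntegrableOn univ)
    (hw.locallyIntegrableOn univ) (fun φ hφ hs _ => by
      have := (h1 φ hφ hs).symm.trans (h2 φ hφ hs); simpa using this)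
  filter_upwards [this] with y hy using hy (mem_univ y)

/-- Two different approximations of one function have the same limit gradient. This is what makes
the gradients of the defects `η g_ε - (η g) * ρ_ε` tend to zero. -/
theorem SobConv.deriv_unique (hP : 1 ≤ P) {F H : ℝ → Euc n → ℝ} {f : Euc n → ℝ}
    {f' h' : Fin n → Euc n → ℝ} (hF : SobConv P F f f') (hH : SobConv P H f h') (k : Fin n) :
    f' k =ᵐ[volume] h' k :=
  HasWeakPartial.ae_unique ((hF.deriv k).memLp.locallyIntegrable hP)
    ((hH.deriv k).memLp.locallyIntegrable hP) (hF.hasWeakPartial hP k) (hH.hasWeakPartial hP k)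

end Translation

/-! ### Mollification and the commutator estimate -/

section Mollification

variable {n : ℕ} {P Q : ℝ≥0∞}

theorem tendsto_scaleKernel_radius (R : ℝ) {r : ℝ} (hr : 0 < r) :
    ∀ᶠ ε in 𝓝[>] (0:ℝ), R * ε < r := by
  have : Tendsto (fun ε : ℝ => R * ε) (𝓝[>] 0) (𝓝 (R * 0)) :=
    (tendsto_nhdsWithin_of_tendsto_nhds tendsto_id).const_mul R
  rw [mul_zero] at this
  exact this.eventually (gt_mem_nhds hr)

/-- A mollifier: smooth, nonnegative, supported in the unit ball, of integral one. -/
structure IsMollifier (ρ : Euc n → ℝ) : Prop where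
  smooth : ContDiff ℝ ∞ ρ
  nonneg : ∀ y, 0 ≤ ρ y
  supp : tsupport ρ ⊆ Metric.closedBall 0 1
  integral : ∫ y, ρ y = 1

variable {ρ : Euc n → ℝ}

theorem IsMollifier.compact (hρ : IsMollifier ρ) : HasCompactSupport ρ :=
  HasCompactSupport.of_support_subset_isCompact (isCompact_closedBall 0 1)
    ((subset_tsupport _).trans hρ.supp)

theorem IsMollifier.scale_contDiff (hρ : IsMollifier ρ) (ε : ℝ) :
    ContDiff ℝ ∞ (scaleKernel ρ ε) := contDiff_scaleKernel hρ.smooth ε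

theorem IsMollifier.scale_compact (hρ : IsMollifier ρ) {ε : ℝ} (hε : 0 < ε) :
    HasCompactSupport (scaleKernel ρ ε) := scaleKernel_hasCompactSupport hρ.compact hε

theorem IsMollifier.scale_nonneg (hρ : IsMollifier ρ) {ε : ℝ} (hε : 0 < ε) (y : Euc n) :
    0 ≤ scaleKernel ρ ε y := by
  have := hρ.nonneg (ε⁻¹ • y); unfold scaleKernel; positivity

theorem IsMollifier.scale_norm_le (hρ : IsMollifier ρ) {ε : ℝ} (hε : 0 < ε) {y : Euc n}
    (hy : scaleKernel ρ ε y ≠ 0) : ‖y‖ ≤ ε := by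
  simpa using scaleKernel_norm_le hρ.supp hε hy

theorem conv_sub_eq_integral (hρ : IsMollifier ρ) {ε : ℝ} (hε : 0 < ε) {f : Euc n → ℝ}
    (hf : LocallyIntegrable f) (x : Euc n) :
    conv f (scaleKernel ρ ε) x - f x = ∫ y, (f (x - y) - f x) * scaleKernel ρ ε y := by
  have hsc := (hρ.scale_contDiff ε).continuous
  have hss := hρ.scale_compact hε
  have h1 : ∫ y, f x * scaleKernel ρ ε y = f x := by
    rw [integral_const_mul, integral_scaleKernel ρ hε, hρ.integral, mul_one]
  conv_lhs => rw [conv_apply_swap, ← h1]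
  rw [← integral_sub (conv_integrand_integrable hf hsc hss x)
      ((hsc.integrable_of_hasCompactSupport hss).const_mul _)]
  simp [sub_mul]

theorem lpTo_conv (hρ : IsMollifier ρ) {q : ℝ≥0∞} (hq : 1 ≤ q) (hq' : q ≠ ⊤) {f : Euc n → ℝ}
    (hf : MemLp f q volume) : LpTo q (fun ε => conv f (scaleKernel ρ ε)) f := by
  refine ⟨hf, ?_, ?_⟩
  · filter_upwards [self_mem_nhdsWithin] with ε hε
    exact conv_memLp hq hq' hf (hρ.scale_contDiff ε).continuous (hρ.scale_compact hε)
  · simpa [hρ.integral] using tendsto_conv_scaleKernel hq hq' hf hρ.smooth.continuous hρ.compact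

theorem lpTo_conv_top (hρ : IsMollifier ρ) {u : Euc n → ℝ} (hu : Continuous u)
    (hs : HasCompactSupport u) : LpTo ⊤ (fun ε => conv u (scaleKernel ρ ε)) u := by
  have hli : LocallyIntegrable u := hu.locallyIntegrable
  refine LpTo.of_forall_abs_sub_le (MemLp.of_continuous_compact hu hs) ?_ fun δ hδ => ?_
  · filter_upwards [self_mem_nhdsWithin] with ε hε
    exact (contDiff_conv hli (hρ.scale_contDiff ε) (hρ.scale_compact hε)).continuous
  have huc := hs.uniformContinuous_of_continuous hu
  obtain ⟨r, hr, h1⟩ := Metric.uniformContinuous_iff.1 huc δ hδ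
  filter_upwards [tendsto_scaleKernel_radius 1 hr, self_mem_nhdsWithin] with ε h2 hε x
  have hε : 0 < ε := hε
  rw [one_mul] at h2
  rw [conv_sub_eq_integral hρ hε hli]
  have hsc := (hρ.scale_contDiff ε).continuous
  have hi : Integrable (scaleKernel ρ ε) :=
    hsc.integrable_of_hasCompactSupport (hρ.scale_compact hε)
  rw [← Real.norm_eq_abs]
  calc ‖∫ y, (u (x - y) - u x) * scaleKernel ρ ε y‖ ≤ ∫ y, δ * scaleKernel ρ ε y := by
        refine norm_integral_le_of_norm_le (hi.const_mul δ) (Eventually.of_forall fun y => ?_)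
        rw [norm_mul, Real.norm_of_nonneg (hρ.scale_nonneg hε y)]
        by_cases hy : scaleKernel ρ ε y = 0
        · simp [hy]
        refine mul_le_mul_of_nonneg_right ?_ (hρ.scale_nonneg hε y)
        have h3 := hρ.scale_norm_le hε hy
        have := h1 (a := x - y) (b := x) (by rw [dist_eq_norm]; simpa using h3.trans_lt h2)
        rw [dist_eq_norm] at this
        exact this.le
    _ = δ := by rw [integral_const_mul, integral_scaleKernel ρ hε, hρ.integral, mul_one]

/-- The mollification error averages `u(x - y) - u(x)` over `|y| ≤ ε`, so a translation modulus
`O(|y|)` becomes an error `O(ε)`. -/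
theorem eLpNorm_conv_sub_le (hρ : IsMollifier ρ) {q : ℝ≥0∞} (hq : 1 ≤ q) (hq' : q ≠ ⊤)
    {u : Euc n → ℝ} (hu : MemLp u q volume) {C : ℝ≥0∞}
    (hC : ∀ y, eLpNorm (fun x => u (x - y) - u x) q volume ≤ ENNReal.ofReal ‖y‖ * C) {ε : ℝ}
    (hε : 0 < ε) :
    eLpNorm (fun x => conv u (scaleKernel ρ ε) x - u x) q volume ≤ C * ENNReal.ofReal ε := by
  have hi : Integrable (scaleKernel ρ ε) :=
    (hρ.scale_contDiff ε).continuous.integrable_of_hasCompactSupport (hρ.scale_compact hε)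
  have h1 : ∫⁻ y, ‖scaleKernel ρ ε y‖ₑ = 1 := by
    rw [← ofReal_integral_norm_eq_lintegral_enorm hi]
    simp only [Real.norm_of_nonneg (hρ.scale_nonneg hε _)]
    rw [integral_scaleKernel ρ hε, hρ.integral, ENNReal.ofReal_one]
  simp only [conv_sub_eq_integral hρ hε (hu.locallyIntegrable hq)]
  refine (eLpNorm_integral_mul_le hq hq' hi (H := fun y x => u (x - y) - u x)
    ((aestronglyMeasurable_comp_sub hu.1).sub hu.1.comp_snd)
    (C := C * ENNReal.ofReal ε) fun y hy => ?_).trans (by rw [h1, mul_one])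
  refine (hC y).trans ?_
  rw [mul_comm]
  gcongr
  exact hρ.scale_norm_le hε hy

/-- Mollifications of a compactly supported continuous `W^{1,P}` function. -/
theorem SobConv.conv (hρ : IsMollifier ρ) (hP : 1 ≤ P) (hP' : P ≠ ⊤) {u : Euc n → ℝ}
    {v : Fin n → Euc n → ℝ} (hu : Continuous u) (hs : HasCompactSupport u)
    (hv : ∀ k, MemLp (v k) P volume) (hw : ∀ k, HasWeakPartial k u (v k)) :
    SobConv P (fun ε => conv u (scaleKernel ρ ε)) u v := by
  have huP : MemLp u P volume := MemLp.of_continuous_compact hu hs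
  have hd : ∀ ε : ℝ, 0 < ε → ∀ k, pderiv k (LowRegPMT.conv u (scaleKernel ρ ε)) =
      LowRegPMT.conv (v k) (scaleKernel ρ ε) := fun ε hε k => by
    rw [pderiv_conv hu.locallyIntegrable (hρ.scale_contDiff ε) (hρ.scale_compact hε),
      (hw k).conv_pderiv (hρ.scale_contDiff ε) (hρ.scale_compact hε)]
  have hsm : ∀ᶠ ε in 𝓝[>] (0:ℝ), ContDiff ℝ ∞ (LowRegPMT.conv u (scaleKernel ρ ε)) := by
    filter_upwards [self_mem_nhdsWithin] with ε hε
    exact contDiff_conv hu.locallyIntegrable (hρ.scale_contDiff ε) (hρ.scale_compact hε)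
  have hderiv : ∀ k, LpTo P (fun ε => pderiv k (LowRegPMT.conv u (scaleKernel ρ ε))) (v k) :=
    fun k => (lpTo_conv hρ hP hP' (hv k)).congr_left (by
      filter_upwards [self_mem_nhdsWithin] with ε hε x
      rw [hd ε hε])
  refine ⟨hsm, hu, lpTo_conv_top hρ hu hs, ?_, hderiv⟩
  refine ⟨∑ k, eLpNorm (v k) P volume, by simp [ENNReal.sum_eq_top, fun k => (hv k).2.ne], ?_⟩
  filter_upwards [self_mem_nhdsWithin] with ε hε
  refine eLpNorm_conv_sub_le hρ hP hP' huP (fun y => ?_) hε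
  exact eLpNorm_translate_sub_le_of_tendsto hP hP' hsm hu (lpTo_conv hρ hP hP' huP).tendsto
    hderiv y

theorem LpTo.squeeze_zero {q : ℝ≥0∞} {F : ℝ → Euc n → ℝ} {b : ℝ → ℝ≥0∞}
    (hm : ∀ᶠ ε in 𝓝[>] (0 : ℝ), AEStronglyMeasurable (F ε) volume)
    (hb : ∀ᶠ ε in 𝓝[>] (0 : ℝ), eLpNorm (F ε) q volume ≤ b ε)
    (hlim : Tendsto b (𝓝[>] 0) (𝓝 0)) : LpTo q F (fun _ => 0) := by
  have h2 : Tendsto (fun ε => eLpNorm (F ε) q volume) (𝓝[>] 0) (𝓝 0) :=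
    tendsto_of_tendsto_of_tendsto_of_le_of_le' tendsto_const_nhds hlim
      (Eventually.of_forall fun _ => zero_le) hb
  refine LpTo.of_tendsto_zero ?_ h2
  filter_upwards [hm, h2.eventually (gt_mem_nhds (one_pos))] with ε h3 h4
  exact ⟨h3, h4.trans (by simp)⟩

theorem eLpNorm_mul_le_half [e : ExponentPair P Q] {f g : Euc n → ℝ}
    (hg : AEStronglyMeasurable g volume) (hf : AEStronglyMeasurable f volume) :
    eLpNorm (fun x => f x * g x) Q volume ≤ eLpNorm f P volume * eLpNorm g P volume :=
  have := e.holder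
  eLpNorm_smul_le_mul_eLpNorm (φ := f) (f := g) hg hf

/-- `(F_ε - f) ∂ᵣ(v * ρ_ε) → 0` in `L^Q`: the factors are `O(ε)` and `o(1/ε)` in `L^P`. -/
theorem SobConv.sub_mul_conv_pderiv [e : ExponentPair P Q] (hρ : IsMollifier ρ)
    {F : ℝ → Euc n → ℝ} {f : Euc n → ℝ} {f' : Fin n → Euc n → ℝ} (hF : SobConv P F f f')
    {v : Euc n → ℝ} (hv : MemLp v P volume) (r : Fin n) :
    LpTo Q (fun ε x => (F ε x - f x) * LowRegPMT.conv v (pderiv r (scaleKernel ρ ε)) x)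
      (fun _ => 0) := by
  have := e.holder
  have hP : 1 ≤ P := e.one_le'
  have hli := hv.locallyIntegrable hP
  obtain ⟨c, hc, hrate⟩ := hF.rate
  have hσ : ContDiff ℝ ∞ (pderiv r ρ) := contDiff_pderiv hρ.smooth
  have hσs : HasCompactSupport (pderiv r ρ) := hasCompactSupport_pderiv hρ.compact
  -- Since `∂ᵣρ` has integral zero, convolution with its rescalings tends to `0` in `L^P`; after the
  -- factor `1/ε` the derivative of the mollification is `o(1/ε)`.
  have h0 := tendsto_conv_scaleKernel hP e.ne_top hv hσ.continuous hσs
  simp only [integral_pderiv_eq_zero hρ.smooth hρ.compact, zero_mul, sub_zero] at h0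
  have hcont : ∀ ε : ℝ, 0 < ε → Continuous (LowRegPMT.conv v (pderiv r (scaleKernel ρ ε))) :=
    fun ε hε => (contDiff_conv hli (contDiff_pderiv (hρ.scale_contDiff ε))
      (hasCompactSupport_pderiv (hρ.scale_compact hε))).continuous
  have hlim := ENNReal.Tendsto.const_mul (a := c) h0 (Or.inr hc)
  rw [mul_zero] at hlim
  refine LpTo.squeeze_zero ?_ ?_ hlim
  · filter_upwards [hF.eventually_continuous, self_mem_nhdsWithin] with ε h1 hε
    exact ((h1.sub hF.cont).mul (hcont ε hε)).aestronglyMeasurable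
  filter_upwards [hrate, hF.eventually_continuous, self_mem_nhdsWithin] with ε h1 h2 hε
  have hε : 0 < ε := hε
  have h3 : LowRegPMT.conv v (pderiv r (scaleKernel ρ ε)) =
      ε⁻¹ • LowRegPMT.conv v (scaleKernel (pderiv r ρ) ε) := by
    rw [pderiv_scaleKernel ε hρ.smooth, conv_const_mul]; rfl
  calc _ ≤ eLpNorm (F ε - f) P volume *
        eLpNorm (LowRegPMT.conv v (pderiv r (scaleKernel ρ ε))) P volume :=
        eLpNorm_smul_le_mul_eLpNorm (hcont ε hε).aestronglyMeasurable
          (h2.sub hF.cont).aestronglyMeasurable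
    _ ≤ c * ENNReal.ofReal ε * (ENNReal.ofReal ε⁻¹ *
        eLpNorm (LowRegPMT.conv v (scaleKernel (pderiv r ρ) ε)) P volume) := by
        gcongr
        · exact h1
        · rw [h3, eLpNorm_const_smul, ← ofReal_norm, Real.norm_of_nonneg (inv_pos.2 hε).le]
    _ = _ := by
        have : ENNReal.ofReal ε * ENNReal.ofReal ε⁻¹ = 1 := by
          rw [← ENNReal.ofReal_mul hε.le, mul_inv_cancel₀ hε.ne', ENNReal.ofReal_one]
        rw [mul_assoc, ← mul_assoc (ENNReal.ofReal ε), this, one_mul]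

/-- The Friedrichs commutator `a ∂ᵣ(v * ρ_ε) - ∂ᵣ((a v) * ρ_ε)`. -/
def commutator (a v ρ : Euc n → ℝ) (r : Fin n) (ε : ℝ) (x : Euc n) : ℝ :=
  a x * conv v (pderiv r (scaleKernel ρ ε)) x -
    conv (fun y => a y * v y) (pderiv r (scaleKernel ρ ε)) x

/-- The commutator is the integral of `(a(x) - a(x - y)) v(x - y)` against `∂ᵣρ_ε(y)`. On `|y| ≤ ε`
the difference of `a` is `O(ε)` in `L^P`, while `∂ᵣρ_ε` has `L¹` norm `O(1/ε)`. The resulting bound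
does not depend on `ε`, which makes a density argument in `v` possible. -/
theorem eLpNorm_commutator_le [e : ExponentPair P Q] (hρ : IsMollifier ρ) {a : Euc n → ℝ}
    (ha : MemLp a ⊤ volume) {C : ℝ≥0∞}
    (hC : ∀ y, eLpNorm (fun x => a (x - y) - a x) P volume ≤ ENNReal.ofReal ‖y‖ * C)
    {v : Euc n → ℝ} (hv : MemLp v P volume) (r : Fin n) {ε : ℝ} (hε : 0 < ε) :
    eLpNorm (commutator a v ρ r ε) Q volume ≤
      C * (∫⁻ y, ‖pderiv r ρ y‖ₑ) * eLpNorm v P volume := by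
  have := e.holder
  have hP : 1 ≤ P := e.one_le'
  have hτ : ENNReal.HolderTriple ⊤ P P := ⟨by simp⟩
  have hli := hv.locallyIntegrable hP
  have hav : MemLp (fun y => a y * v y) P volume := hv.mul ha
  have hli2 := hav.locallyIntegrable hP
  have hσ : ContDiff ℝ ∞ (pderiv r ρ) := contDiff_pderiv hρ.smooth
  have hσs : HasCompactSupport (pderiv r ρ) := hasCompactSupport_pderiv hρ.compact
  have hκ : Continuous (pderiv r (scaleKernel ρ ε)) :=
    (contDiff_pderiv (hρ.scale_contDiff ε)).continuous
  have hκs : HasCompactSupport (pderiv r (scaleKernel ρ ε)) :=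
    hasCompactSupport_pderiv (hρ.scale_compact hε)
  have hκi : Integrable (pderiv r (scaleKernel ρ ε)) volume :=
    hκ.integrable_of_hasCompactSupport hκs
  have heq : commutator a v ρ r ε = fun x =>
      ∫ y, ((a (x - y) - a x) * v (x - y)) * (-pderiv r (scaleKernel ρ ε) y) := by
    ext x
    rw [commutator, conv_apply_swap, conv_apply_swap, ← integral_const_mul,
      ← integral_sub ((conv_integrand_integrable hli hκ hκs x).const_mul _)
        (conv_integrand_integrable hli2 hκ hκs x)]
    congr 1; ext y; ring
  rw [heq]
  refine (eLpNorm_integral_mul_le e.one_le e.ne_top' (σ := fun y => -pderiv r (scaleKernel ρ ε) y)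
    hκi.neg (H := fun y x => (a (x - y) - a x) * v (x - y))
    (((aestronglyMeasurable_comp_sub ha.1).sub ha.1.comp_snd).mul
      (aestronglyMeasurable_comp_sub hv.1))
    (C := ENNReal.ofReal ε * C * eLpNorm v P volume) fun y hy => ?_).trans ?_
  · have hy' : ‖y‖ ≤ ε := by
      have h1 : y ∈ tsupport (scaleKernel ρ ε) :=
        tsupport_pderiv_subset (subset_tsupport _ (neg_ne_zero.1 hy))
      have h2 : tsupport (scaleKernel ρ ε) ⊆ Metric.closedBall 0 ε :=
        closure_minimal (fun z hz => by
          simpa using hρ.scale_norm_le hε hz) Metric.isClosed_closedBall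
      simpa using h2 h1
    have hva := MemLp.comp_sub_right' hv y
    have haa := MemLp.comp_sub_right' ha y
    calc eLpNorm (fun x => (a (x - y) - a x) * v (x - y)) Q volume
        ≤ eLpNorm (fun x => a (x - y) - a x) P volume * eLpNorm (fun x => v (x - y)) P volume :=
          eLpNorm_mul_le_half hva.1 (haa.1.sub ha.1)
      _ ≤ _ := by
          rw [eLpNorm_comp_sub_right hv.1]
          gcongr
          refine (hC y).trans ?_
          gcongr
  · have h1 : ∫⁻ y, ‖-pderiv r (scaleKernel ρ ε) y‖ₑ =
        ENNReal.ofReal ε⁻¹ * ∫⁻ y, ‖pderiv r ρ y‖ₑ := by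
      simp only [enorm_neg, pderiv_scaleKernel ε hρ.smooth, enorm_mul]
      rw [lintegral_const_mul' _ _ enorm_ne_top, lintegral_scaleKernel _ hε
        (hσ.continuous.integrable_of_hasCompactSupport hσs), ← ofReal_norm,
        Real.norm_of_nonneg (inv_pos.2 hε).le]
    have h2 : ENNReal.ofReal ε * ENNReal.ofReal ε⁻¹ = 1 := by
      rw [← ENNReal.ofReal_mul hε.le, mul_inv_cancel₀ hε.ne', ENNReal.ofReal_one]
    rw [h1]
    refine le_of_eq ?_
    calc _ = (ENNReal.ofReal ε * ENNReal.ofReal ε⁻¹) *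
          (C * (∫⁻ y, ‖pderiv r ρ y‖ₑ) * eLpNorm v P volume) := by ring
      _ = _ := by rw [h2, one_mul]

theorem commutator_add {a v w : Euc n → ℝ} (hρ : IsMollifier ρ) (r : Fin n) {ε : ℝ} (hε : 0 < ε)
    (hv : LocallyIntegrable v) (hw : LocallyIntegrable w)
    (hav : LocallyIntegrable fun y => a y * v y) (haw : LocallyIntegrable fun y => a y * w y) :
    commutator a (fun y => v y + w y) ρ r ε =
      fun x => commutator a v ρ r ε x + commutator a w ρ r ε x := by
  have hκ : Continuous (pderiv r (scaleKernel ρ ε)) :=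
    (contDiff_pderiv (hρ.scale_contDiff ε)).continuous
  have hκs : HasCompactSupport (pderiv r (scaleKernel ρ ε)) :=
    hasCompactSupport_pderiv (hρ.scale_compact hε)
  have key : ∀ f g : Euc n → ℝ, LocallyIntegrable f → LocallyIntegrable g → ∀ x,
      conv (fun y => f y + g y) (pderiv r (scaleKernel ρ ε)) x =
      conv f (pderiv r (scaleKernel ρ ε)) x + conv g (pderiv r (scaleKernel ρ ε)) x := by
    intro f g hf hg x
    simp only [conv_apply_swap]
    rw [← integral_add (conv_integrand_integrable hf hκ hκs x)
      (conv_integrand_integrable hg hκ hκs x)]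
    simp [add_mul]
  ext x
  simp only [commutator, mul_add]
  rw [key v w hv hw, key _ _ hav haw]
  ring

theorem hasCompactSupport_conv {u σ : Euc n → ℝ} (hu : HasCompactSupport u)
    (hσ : HasCompactSupport σ) : HasCompactSupport (conv u σ) :=
  HasCompactSupport.convolution _ hu hσ

/-- For smooth `w` the derivative can be moved off the kernel in both terms, and the commutator
converges to `a ∂ᵣw - ∂ᵣ(a w) = -(∂ᵣa) w`. -/
theorem SobConv.commutator_smooth [e : ExponentPair P Q] (hρ : IsMollifier ρ)
    {F : ℝ → Euc n → ℝ} {a : Euc n → ℝ} {a' : Fin n → Euc n → ℝ} (hF : SobConv P F a a')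
    {w : Euc n → ℝ} (hw : ContDiff ℝ ∞ w) (hws : HasCompactSupport w) (r : Fin n) :
    LpTo Q (commutator a w ρ r) (fun x => -(a' r x * w x)) := by
  have := e.holder
  have hP : 1 ≤ P := e.one_le'
  have hW := (SobConv.of_compact (P := P) hw hws)
  have h1 : HasWeakPartial r w (pderiv r w) := hW.hasWeakPartial hP r
  have h2 := (hF.mul hP hW).hasWeakPartial hP r
  have hdw : ∀ q, MemLp (pderiv r w) q volume := fun q =>
    MemLp.of_continuous_compact (contDiff_pderiv hw).continuous (hasCompactSupport_pderiv hws)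
  have hwq : ∀ q, MemLp w q volume := fun q => MemLp.of_continuous_compact hw.continuous hws
  have l1 : LpTo Q (fun ε x => a x * LowRegPMT.conv (pderiv r w) (scaleKernel ρ ε) x)
      (fun x => a x * pderiv r w x) :=
    (LpTo.const hF.unif.memLp).bdd_mul e.one_le (lpTo_conv hρ e.one_le e.ne_top' (hdw Q))
  have m2 : MemLp (fun x => a' r x * w x + a x * pderiv r w x) Q volume :=
    ((hwq P).mul (hF.deriv r).memLp).add l1.memLp
  have l2 := lpTo_conv hρ e.one_le e.ne_top' m2
  refine (l1.sub e.one_le l2).congr ?_ (Eventually.of_forall fun x => by ring)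
  filter_upwards [self_mem_nhdsWithin] with ε hε
  refine Eventually.of_forall fun x => ?_
  simp only [commutator]
  rw [h1.conv_pderiv (hρ.scale_contDiff ε) (hρ.scale_compact hε),
    h2.conv_pderiv (hρ.scale_contDiff ε) (hρ.scale_compact hε)]

/-- The Friedrichs commutator converges to `-(∂ᵣ a) v` in `L^{P/2}` for `a ∈ W^{1,P}`,
`v ∈ L^P`. -/
theorem SobConv.lpTo_commutator [e : ExponentPair P Q] (hρ : IsMollifier ρ)
    {F : ℝ → Euc n → ℝ} {a : Euc n → ℝ} {a' : Fin n → Euc n → ℝ} (hF : SobConv P F a a')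
    {v : Euc n → ℝ} (hv : MemLp v P volume) (hvs : HasCompactSupport v) (r : Fin n) :
    LpTo Q (commutator a v ρ r) (fun x => -(a' r x * v x)) := by
  have := e.holder
  have hP : 1 ≤ P := e.one_le'
  have hτ : ENNReal.HolderTriple ⊤ P P := ⟨by simp⟩
  have hli := hv.locallyIntegrable hP
  set C := ∑ k, eLpNorm (a' k) P volume with hCdef
  have hCtop : C ≠ ⊤ := by simp [hCdef, ENNReal.sum_eq_top, fun k => (hF.deriv k).memLp.2.ne]
  have hC := hF.eLpNorm_translate_sub_le hP e.ne_top
  set m := ∫⁻ y, ‖pderiv r ρ y‖ₑ with hm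
  have hmtop : m ≠ ⊤ := ((contDiff_pderiv hρ.smooth).continuous.integrable_of_hasCompactSupport
    (hasCompactSupport_pderiv hρ.compact)).2.ne
  have ha := hF.unif.memLp
  have hbound : ∀ u : Euc n → ℝ, MemLp u P volume → ∀ ε : ℝ, 0 < ε →
      eLpNorm (commutator a u ρ r ε) Q volume ≤ C * m * eLpNorm u P volume :=
    fun u hu ε hε => eLpNorm_commutator_le hρ ha hC hu r hε
  have hmeas : ∀ u : Euc n → ℝ, MemLp u P volume → ∀ ε : ℝ, 0 < ε →
      AEStronglyMeasurable (commutator a u ρ r ε) volume := fun u hu ε hε =>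
    (ha.1.mul (contDiff_conv (hu.locallyIntegrable hP) (contDiff_pderiv (hρ.scale_contDiff ε))
      (hasCompactSupport_pderiv (hρ.scale_compact hε))).continuous.aestronglyMeasurable).sub
      (contDiff_conv ((hu.mul ha (r := P)).locallyIntegrable hP)
        (contDiff_pderiv (hρ.scale_contDiff ε))
        (hasCompactSupport_pderiv (hρ.scale_compact hε))).continuous.aestronglyMeasurable
  have hlimM : MemLp (fun x => -(a' r x * v x)) Q volume := (hv.mul (hF.deriv r).memLp).neg
  have hcM : ∀ u : Euc n → ℝ, MemLp u P volume → ∀ ε : ℝ, 0 < ε →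
      MemLp (commutator a u ρ r ε) Q volume := fun u hu ε hε =>
    ⟨hmeas u hu ε hε, (hbound u hu ε hε).trans_lt
      (ENNReal.mul_lt_top (ENNReal.mul_lt_top hCtop.lt_top hmtop.lt_top) hu.2)⟩
  refine ⟨hlimM, ?_, ?_⟩
  · filter_upwards [self_mem_nhdsWithin] with ε hε using hcM v hv ε hε
  -- The factor `D` controls, per unit of `‖v - w‖` in `L^P`, both the commutator of `v - w` and its
  -- expected limit.
  set D := C * m + eLpNorm (a' r) P volume with hD
  have hDtop : D ≠ ⊤ :=
    ENNReal.add_ne_top.2 ⟨ENNReal.mul_ne_top hCtop hmtop, (hF.deriv r).memLp.2.ne⟩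
  have happ : Tendsto (fun δ => D * eLpNorm (fun x => LowRegPMT.conv v (scaleKernel ρ δ) x - v x) P
      volume) (𝓝[>] 0) (𝓝 0) := by
    have := ENNReal.Tendsto.const_mul (a := D) (lpTo_conv hρ hP e.ne_top hv).tendsto (Or.inr hDtop)
    rwa [mul_zero] at this
  rw [ENNReal.tendsto_nhds_zero]
  intro η hη
  have hη2 : 0 < η / 2 := ENNReal.half_pos hη.ne'
  -- Density: `v` is replaced by its own mollification `w` at a fixed scale `δ`, so close to `v`
  -- that the error is at most `η / 2` for every `ε`; the smooth case handles `w`.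
  obtain ⟨δ, hδ, hδ0⟩ := ((ENNReal.tendsto_nhds_zero.1 happ _ hη2).and self_mem_nhdsWithin).exists
  have hδ0 : 0 < δ := hδ0
  set w := LowRegPMT.conv v (scaleKernel ρ δ) with hw
  have hws : HasCompactSupport w := hasCompactSupport_conv hvs (hρ.scale_compact hδ0)
  have hwc : ContDiff ℝ ∞ w := contDiff_conv hli (hρ.scale_contDiff δ) (hρ.scale_compact hδ0)
  have hwM : MemLp w P volume := MemLp.of_continuous_compact hwc.continuous hws
  have hz : MemLp (fun x => v x - w x) P volume := hv.sub hwM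
  have hzn : eLpNorm (fun x => v x - w x) P volume = eLpNorm (fun x => w x - v x) P volume :=
    eLpNorm_sub_comm v w P volume
  have h1 := hF.commutator_smooth (Q := Q) hρ hwc hws r
  filter_upwards [(ENNReal.tendsto_nhds_zero.1 h1.tendsto) _ hη2, self_mem_nhdsWithin]
    with ε h2 hε
  have hε : 0 < ε := hε
  have hsplit : commutator a v ρ r ε = fun x => commutator a w ρ r ε x +
      commutator a (fun x => v x - w x) ρ r ε x := by
    rw [← commutator_add hρ r hε (hwM.locallyIntegrable hP) (hz.locallyIntegrable hP)
      ((hwM.mul ha (r := P)).locallyIntegrable hP) ((hz.mul ha (r := P)).locallyIntegrable hP)]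
    simp
  rw [hsplit]
  have mm : MemLp (fun x => a' r x * (v x - w x)) Q volume := hz.mul (hF.deriv r).memLp
  have mw : MemLp (fun x => -(a' r x * w x)) Q volume := (hwM.mul (hF.deriv r).memLp).neg
  have hb1 := hbound _ hz ε hε
  have hb2 : eLpNorm (fun x => a' r x * (v x - w x)) Q volume ≤
      eLpNorm (a' r) P volume * eLpNorm (fun x => v x - w x) P volume :=
    eLpNorm_mul_le_half hz.1 (hF.deriv r).memLp.1
  obtain ⟨A₁, hA₁⟩ : ∃ A₁ : Euc n → ℝ, A₁ = fun x => commutator a w ρ r ε x - -(a' r x * w x) :=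
    ⟨_, rfl⟩
  obtain ⟨A₂, hA₂⟩ : ∃ A₂, A₂ = commutator a (fun x => v x - w x) ρ r ε := ⟨_, rfl⟩
  obtain ⟨A₃, hA₃⟩ : ∃ A₃ : Euc n → ℝ, A₃ = fun x => a' r x * (v x - w x) := ⟨_, rfl⟩
  have M₁ : MemLp A₁ Q volume := hA₁ ▸ (hcM w hwM ε hε).sub mw
  have M₂ : MemLp A₂ Q volume := hA₂ ▸ hcM _ hz ε hε
  have M₃ : MemLp A₃ Q volume := hA₃ ▸ mm
  rw [← hA₂] at hb1
  rw [← hA₃] at hb2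
  rw [← hA₁] at h2
  calc _ = eLpNorm (A₁ + (A₂ + A₃)) Q volume := by
        congr 1; ext x; simp only [hA₁, hA₂, hA₃, Pi.add_apply]; ring
    _ ≤ eLpNorm A₁ Q volume + (eLpNorm A₂ Q volume + eLpNorm A₃ Q volume) :=
        (eLpNorm_add_le M₁.1 (M₂.add M₃).1 e.one_le).trans
          (add_le_add le_rfl (eLpNorm_add_le M₂.1 M₃.1 e.one_le))
    _ ≤ η / 2 + (C * m * eLpNorm (fun x => v x - w x) P volume +
        eLpNorm (a' r) P volume * eLpNorm (fun x => v x - w x) P volume) := by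
        exact add_le_add h2 (add_le_add hb1 hb2)
    _ ≤ η / 2 + η / 2 := by
        rw [← add_mul, hzn]
        gcongr
    _ = η := ENNReal.add_halves η

end Mollification

/-! ### Transport along a change of coordinates -/

section Transport

variable {n : ℕ} {P Q : ℝ≥0∞}

/-- A diffeomorphism between open subsets of `ℝⁿ`. -/
structure IsSmoothTransition (φ : OpenPartialHomeomorph (Euc n) (Euc n)) : Prop where
  smooth : ContDiffOn ℝ ∞ φ φ.source
  smooth_symm : ContDiffOn ℝ ∞ φ.symm φ.target

variable {φ : OpenPartialHomeomorph (Euc n) (Euc n)}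

/-- A diffeomorphism distorts Lebesgue measure by a bounded factor on compact sets. -/
theorem IsSmoothTransition.map_restrict_le (hφ : IsSmoothTransition φ) {S : Set (Euc n)}
    (hS : IsCompact S) (hSφ : S ⊆ φ.source) :
    ∃ c : ℝ≥0∞, c ≠ ⊤ ∧ c ≠ 0 ∧ (volume.restrict S).map φ ≤ c • volume := by
  have hT : IsCompact (φ '' S) := hS.image_of_continuousOn (φ.continuousOn.mono hSφ)
  have hTt : φ '' S ⊆ φ.target := by
    rintro _ ⟨x, hx, rfl⟩; exact φ.map_source (hSφ hx)
  have hdet : ContinuousOn (fun y => |(fderiv ℝ φ.symm y).det|) (φ '' S) := by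
    have h1 : ContinuousOn (fderiv ℝ φ.symm) φ.target :=
      hφ.smooth_symm.continuousOn_fderiv_of_isOpen φ.open_target (by simp)
    exact (ContinuousLinearMap.continuous_det.comp_continuousOn (h1.mono hTt)).abs
  obtain ⟨C, hC⟩ := (hT.image_of_continuousOn hdet).isBounded.bddAbove
  -- The supremum of the Jacobian of the inverse is raised to at least `1`, because a nonzero factor
  -- is needed when the `L^q` norm of a scaled measure is computed.
  refine ⟨ENNReal.ofReal (max C 1), by simp, by simp, ?_⟩
  have hae : AEMeasurable φ (volume.restrict S) :=
    (φ.continuousOn.mono hSφ).aemeasurable hS.measurableSet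
  refine Measure.le_iff.2 fun B hB => ?_
  rw [Measure.map_apply_of_aemeasurable hae hB, Measure.restrict_apply' hS.measurableSet]
  have hset : φ ⁻¹' B ∩ S = φ.symm '' (φ '' S ∩ B) := by
    ext x
    constructor
    · rintro ⟨hxB, hxS⟩
      exact ⟨φ x, ⟨mem_image_of_mem _ hxS, hxB⟩, φ.left_inv (hSφ hxS)⟩
    · rintro ⟨_, ⟨⟨z, hz, rfl⟩, hzB⟩, rfl⟩
      rw [φ.left_inv (hSφ hz)]
      exact ⟨hzB, hz⟩
  have hXm : MeasurableSet (φ '' S ∩ B) := hT.measurableSet.inter hB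
  have hd : ∀ y ∈ φ '' S ∩ B, HasFDerivWithinAt φ.symm (fderiv ℝ φ.symm y) (φ '' S ∩ B) y :=
    fun y hy => ((hφ.smooth_symm.contDiffAt (φ.open_target.mem_nhds
      (hTt hy.1))).differentiableAt (by simp)).hasFDerivAt.hasFDerivWithinAt
  have hinj : InjOn φ.symm (φ '' S ∩ B) :=
    φ.symm.injOn.mono fun y hy => hTt hy.1
  rw [hset, ← lintegral_abs_det_fderiv_eq_addHaar_image volume hXm hd hinj]
  calc ∫⁻ y in φ '' S ∩ B, ENNReal.ofReal |(fderiv ℝ φ.symm y).det|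
      ≤ ∫⁻ y in φ '' S ∩ B, ENNReal.ofReal (max C 1) := by
        refine setLIntegral_mono' hXm fun y hy => ENNReal.ofReal_le_ofReal ?_
        exact (hC (mem_image_of_mem _ hy.1)).trans (le_max_left _ _)
    _ ≤ _ := by
        rw [setLIntegral_const]
        exact mul_le_mul_right (measure_mono inter_subset_right) _

/-- Only domination of the image measure by Lebesgue measure enters. The same estimate serves for
coordinate changes on `ℝⁿ` and for the passage from a chart to the Riemannian volume on `M`. -/
theorem eLpNorm_comp_le {X : Type*} [MeasurableSpace X] {μ : Measure X} {T : X → Euc n}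
    (hT : AEMeasurable T μ) {c : ℝ≥0∞} (hc0 : c ≠ 0) (hμ : μ.map T ≤ c • volume)
    {q : ℝ≥0∞} {f : Euc n → ℝ} (hf : AEStronglyMeasurable f volume) :
    AEStronglyMeasurable (fun x => f (T x)) μ ∧
    eLpNorm (fun x => f (T x)) q μ ≤ c ^ (1 / q).toReal * eLpNorm f q volume := by
  have hac : μ.map T ≪ volume := (Measure.absolutelyContinuous_of_le hμ).trans
    (Measure.smul_absolutelyContinuous)
  have hfT : AEStronglyMeasurable f (μ.map T) := hf.mono_ac hac
  refine ⟨hfT.comp_aemeasurable hT, ?_⟩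
  calc eLpNorm (fun x => f (T x)) q μ = eLpNorm f q (μ.map T) :=
        (eLpNorm_map_measure hfT hT).symm
    _ ≤ eLpNorm f q (c • volume) := eLpNorm_mono_measure _ hμ
    _ = _ := by rw [eLpNorm_smul_measure_of_ne_zero hc0, smul_eq_mul]

/-- The function `α · (f ∘ φ)`, where `α` is a cut-off supported in the source of `φ`. -/
def transport (α : Euc n → ℝ) (φ : OpenPartialHomeomorph (Euc n) (Euc n)) (f : Euc n → ℝ)
    (y : Euc n) : ℝ := α y * f (φ y)

/-- The Jacobian matrix `∂ₖ φ^r`. -/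
def jac (φ : OpenPartialHomeomorph (Euc n) (Euc n)) (r k : Fin n) (y : Euc n) : ℝ :=
  pderiv k (fun z => φ z r) y

/-- A smooth cut-off with compact support inside the source of `φ`. -/
structure IsCutoff (φ : OpenPartialHomeomorph (Euc n) (Euc n)) (α : Euc n → ℝ) : Prop where
  smooth : ContDiff ℝ ∞ α
  compact : HasCompactSupport α
  supp : tsupport α ⊆ φ.source

variable {α : Euc n → ℝ}

theorem contDiff_mul_of_tsupport {U : Set (Euc n)} (hU : IsOpen U) (hα : ContDiff ℝ ∞ α)
    (hs : tsupport α ⊆ U) {g : Euc n → ℝ} (hg : ContDiffOn ℝ ∞ g U) :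
    ContDiff ℝ ∞ (fun y => α y * g y) := by
  rw [contDiff_iff_contDiffAt]
  intro y
  by_cases hy : y ∈ tsupport α
  · exact hα.contDiffAt.mul (hg.contDiffAt (hU.mem_nhds (hs hy)))
  · have : (fun y => α y * g y) =ᶠ[𝓝 y] fun _ => 0 := by
      filter_upwards [notMem_tsupport_iff_eventuallyEq.1 hy] with z hz
      simp [hz]
    exact contDiffAt_const.congr_of_eventuallyEq this

theorem continuous_mul_of_tsupport {U : Set (Euc n)} (hU : IsOpen U) (hα : Continuous α)
    (hs : tsupport α ⊆ U) {g : Euc n → ℝ} (hg : ContinuousOn g U) :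
    Continuous (fun y => α y * g y) := by
  rw [continuous_iff_continuousAt]
  intro y
  by_cases hy : y ∈ tsupport α
  · exact hα.continuousAt.mul (hg.continuousAt (hU.mem_nhds (hs hy)))
  · have : (fun y => α y * g y) =ᶠ[𝓝 y] fun _ => 0 := by
      filter_upwards [notMem_tsupport_iff_eventuallyEq.1 hy] with z hz
      simp [hz]
    exact continuousAt_const.congr this.symm

theorem IsSmoothTransition.comp_apply (hφ : IsSmoothTransition φ) (r : Fin n) :
    ContDiffOn ℝ ∞ (fun z => φ z r) φ.source :=
  (EuclideanSpace.proj (𝕜 := ℝ) r).contDiff.comp_contDiffOn hφ.smooth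

theorem IsSmoothTransition.jac_contDiffOn (hφ : IsSmoothTransition φ) (r k : Fin n) :
    ContDiffOn ℝ ∞ (jac φ r k) φ.source :=
  contDiffOn_pderiv φ.open_source (hφ.comp_apply r)

theorem IsCutoff.mul (hα : IsCutoff φ α) {g : Euc n → ℝ} (hg : ContDiffOn ℝ ∞ g φ.source) :
    IsCutoff φ (fun y => α y * g y) :=
  ⟨contDiff_mul_of_tsupport φ.open_source hα.smooth hα.supp hg, hα.compact.mul_right,
    (closure_mono (Function.support_mul_subset_left _ _)).trans hα.supp⟩

theorem IsCutoff.pderiv (hα : IsCutoff φ α) (k : Fin n) : IsCutoff φ (pderiv k α) :=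
  ⟨contDiff_pderiv hα.smooth, hasCompactSupport_pderiv hα.compact,
    tsupport_pderiv_subset.trans hα.supp⟩

theorem transport_contDiff (hφ : IsSmoothTransition φ) (hα : IsCutoff φ α) {f : Euc n → ℝ}
    (hf : ContDiff ℝ ∞ f) : ContDiff ℝ ∞ (transport α φ f) :=
  contDiff_mul_of_tsupport φ.open_source hα.smooth hα.supp (hf.comp_contDiffOn hφ.smooth)

theorem transport_continuous (hα : IsCutoff φ α) {f : Euc n → ℝ}
    (hf : Continuous f) : Continuous (transport α φ f) :=
  continuous_mul_of_tsupport φ.open_source hα.smooth.continuous hα.supp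
    (hf.comp_continuousOn φ.continuousOn)

/-- The cut-off is bounded and its support is compact in the source of `φ`, where Lebesgue measure
is distorted by a bounded factor. The constant is independent of `f`. -/
theorem transport_bound (hφ : IsSmoothTransition φ) (hα : IsCutoff φ α) (q : ℝ≥0∞) :
    ∃ C : ℝ≥0∞, C ≠ ⊤ ∧ ∀ f : Euc n → ℝ, AEStronglyMeasurable f volume →
      AEStronglyMeasurable (transport α φ f) volume ∧
      eLpNorm (transport α φ f) q volume ≤ C * eLpNorm f q volume := by
  obtain ⟨c, hc, hc0, hle⟩ := hφ.map_restrict_le hα.compact.isCompact hα.supp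
  have hSm : MeasurableSet (tsupport α) := (isClosed_tsupport α).measurableSet
  have hae : AEMeasurable φ (volume.restrict (tsupport α)) :=
    (φ.continuousOn.mono hα.supp).aemeasurable hSm
  obtain ⟨A, hA⟩ := hα.compact.exists_bound_of_continuous hα.smooth.continuous
  refine ⟨ENNReal.ofReal A * c ^ (1 / q).toReal, ENNReal.mul_ne_top (by simp)
    (ENNReal.rpow_ne_top_of_nonneg (by simp) hc), fun f hf => ?_⟩
  obtain ⟨h1, h2⟩ := eLpNorm_comp_le hae hc0 hle (q := q) hf
  have hind : (tsupport α).indicator (transport α φ f) = transport α φ f := by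
    refine indicator_eq_self.2 fun y hy => subset_tsupport _ ?_
    intro h0; exact hy (by simp [transport, h0])
  have hm : AEStronglyMeasurable (transport α φ f) (volume.restrict (tsupport α)) :=
    hα.smooth.continuous.aestronglyMeasurable.mul h1
  constructor
  · rw [← hind]; exact (aestronglyMeasurable_indicator_iff hSm).2 hm
  · rw [← hind, eLpNorm_indicator_eq_eLpNorm_restrict hSm, mul_assoc]
    refine le_trans ?_ (mul_le_mul_right h2 _)
    refine eLpNorm_le_mul_eLpNorm_of_ae_le_mul (Eventually.of_forall fun y => ?_) q
    rw [transport, norm_mul]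
    gcongr
    exact hA y

theorem LpTo.transport (hφ : IsSmoothTransition φ) (hα : IsCutoff φ α) {q : ℝ≥0∞}
    {F : ℝ → Euc n → ℝ} {f : Euc n → ℝ} (hF : LpTo q F f) :
    LpTo q (fun ε => transport α φ (F ε)) (transport α φ f) := by
  obtain ⟨C, hC, h⟩ := transport_bound hφ hα q
  have hM : ∀ u : Euc n → ℝ, MemLp u q volume → MemLp (LowRegPMT.transport α φ u) q volume :=
    fun u hu => ⟨(h u hu.1).1, (h u hu.1).2.trans_lt (ENNReal.mul_lt_top hC.lt_top hu.2)⟩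
  refine ⟨hM f hF.memLp, hF.eventually_memLp.mono fun ε h => hM _ h, ?_⟩
  have hlim := ENNReal.Tendsto.const_mul (a := C) hF.tendsto (Or.inr hC)
  rw [mul_zero] at hlim
  refine tendsto_of_tendsto_of_tendsto_of_le_of_le' tendsto_const_nhds hlim
    (Eventually.of_forall fun _ => zero_le) ?_
  filter_upwards [hF.eventually_memLp] with ε h1
  have := (h _ (h1.sub hF.memLp).1).2
  refine le_trans (le_of_eq ?_) this
  congr 1; ext y; simp [LowRegPMT.transport]; ring

/-- Product and chain rule, arranged so that a derivative of a transported function is again a sum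
of transported functions, with cut-offs `∂ₖα` and `α ∂ₖφ^r`. The formula can therefore be iterated.
-/
theorem pderiv_transport (hφ : IsSmoothTransition φ) (hα : IsCutoff φ α) {f : Euc n → ℝ}
    (hf : ContDiff ℝ ∞ f) (k : Fin n) (y : Euc n) :
    pderiv k (transport α φ f) y = transport (pderiv k α) φ f y +
      ∑ r, transport (fun y => α y * jac φ r k y) φ (pderiv r f) y := by
  by_cases hy : y ∈ tsupport α
  · have hys := hα.supp hy
    have hd : DifferentiableAt ℝ φ y :=
      (hφ.smooth.contDiffAt (φ.open_source.mem_nhds hys)).differentiableAt (by simp)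
    have hfd : DifferentiableAt ℝ f (φ y) := hf.differentiable (by simp) _
    have h1 : pderiv k (fun z => f (φ z)) y = ∑ r, jac φ r k y * pderiv r f (φ y) := by
      have h2 : HasFDerivAt (fun z => f (φ z)) ((fderiv ℝ f (φ y)).comp (fderiv ℝ φ y)) y :=
        hfd.hasFDerivAt.comp y hd.hasFDerivAt
      rw [pderiv, h2.fderiv, ContinuousLinearMap.comp_apply, fderiv_apply_eq_sum_pderiv]
      refine Finset.sum_congr rfl fun r _ => ?_
      have h3 : HasFDerivAt (fun z => φ z r)
          ((EuclideanSpace.proj (𝕜 := ℝ) r).comp (fderiv ℝ φ y)) y :=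
        (EuclideanSpace.proj (𝕜 := ℝ) r).hasFDerivAt.comp y hd.hasFDerivAt
      have h4 : jac φ r k y = (fderiv ℝ φ y (stdVec k)) r := by
        rw [jac, pderiv, h3.fderiv]; rfl
      rw [h4]
    have h4 := pderiv_mul (k := k) (hα.smooth.differentiable (by simp) y) (hfd.comp y hd)
    simp only [Function.comp_apply] at h4
    change pderiv k (fun y => α y * f (φ y)) y = _
    have h5 : pderiv k (f ∘ φ) y = _ := h1
    rw [h4, h5, Finset.mul_sum]
    simp only [transport, mul_assoc]
  · have h0 : α =ᶠ[𝓝 y] fun _ => 0 := notMem_tsupport_iff_eventuallyEq.1 hy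
    have h1 : transport α φ f =ᶠ[𝓝 y] fun _ => 0 := by
      filter_upwards [h0] with z hz; simp [transport, hz]
    rw [pderiv_congr h1, pderiv_const]
    simp [transport, pderiv_congr h0, pderiv_const, h0.self_of_nhds]

theorem transport_eq_zero {f : Euc n → ℝ} {y : Euc n} (hy : y ∉ tsupport α) :
    transport α φ f y = 0 := by
  simp [transport, image_eq_zero_of_notMem_tsupport hy]

theorem LpTo.transport_mono (hφ : IsSmoothTransition φ) (hα : IsCutoff φ α) {q q' : ℝ≥0∞}
    (hq : q' ≤ q) {F : ℝ → Euc n → ℝ} {f : Euc n → ℝ} (hF : LpTo q F f) :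
    LpTo q' (fun ε => LowRegPMT.transport α φ (F ε)) (LowRegPMT.transport α φ f) :=
  (hF.transport hφ hα).mono_exponent hq hα.compact.isCompact
    (Eventually.of_forall fun _ _ hx => transport_eq_zero hx) fun _ hx => transport_eq_zero hx

theorem SobConv.transport (hP : 1 ≤ P) (hφ : IsSmoothTransition φ) (hα : IsCutoff φ α)
    {F : ℝ → Euc n → ℝ} {f : Euc n → ℝ} {f' : Fin n → Euc n → ℝ} (hF : SobConv P F f f') :
    SobConv P (fun ε => transport α φ (F ε)) (transport α φ f) (fun k y =>
      LowRegPMT.transport (LowRegPMT.pderiv k α) φ f y +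
      ∑ r, LowRegPMT.transport (fun y => α y * jac φ r k y) φ (f' r) y) := by
  refine ⟨?_, transport_continuous hα hF.cont, hF.unif.transport hφ hα, ?_, fun k => ?_⟩
  · filter_upwards [hF.smooth] with ε h using transport_contDiff hφ hα h
  · obtain ⟨c, hc, h⟩ := hF.rate
    obtain ⟨C, hC, hb⟩ := transport_bound hφ hα P
    refine ⟨C * c, ENNReal.mul_ne_top hC hc, ?_⟩
    filter_upwards [h, hF.eventually_continuous] with ε h1 h2
    calc _ = eLpNorm (LowRegPMT.transport α φ (fun x => F ε x - f x)) P volume := by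
          congr 1; ext y; simp [LowRegPMT.transport]; ring
      _ ≤ _ := (hb _ (h2.sub hF.cont).aestronglyMeasurable).2
      _ ≤ _ := by rw [mul_assoc]; exact mul_le_mul_right h1 _
  · have h1 := hF.unif.transport_mono hφ (hα.pderiv k) (le_top : P ≤ ⊤)
    have h2 := LpTo.sum hP Finset.univ fun r _ =>
      (hF.deriv r).transport hφ (hα.mul (hφ.jac_contDiffOn r k))
    refine (h1.add hP h2).congr_left ?_
    filter_upwards [hF.smooth] with ε h y
    exact (pderiv_transport hφ hα h k y).symm

/-- The second derivatives of `α · (d ∘ φ)` agree, up to terms of lower order, with the second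
derivatives of `d`, transported. -/
theorem SobConv.second_deriv_transport [e : ExponentPair P Q] (hφ : IsSmoothTransition φ)
    (hα : IsCutoff φ α) {d : ℝ → Euc n → ℝ} (hd : SobConv P d (fun _ => 0) (fun _ _ => 0))
    (k l : Fin n) :
    LpTo Q (fun ε y => LowRegPMT.pderiv k (LowRegPMT.pderiv l (LowRegPMT.transport α φ (d ε))) y -
      ∑ r, ∑ s, α y * jac φ s l y * jac φ r k y *
        LowRegPMT.pderiv r (LowRegPMT.pderiv s (d ε)) (φ y)) (fun _ => 0) := by
  have hQ := e.one_le
  have hQP : Q ≤ P := e.le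
  have z : ∀ β : Euc n → ℝ, LowRegPMT.transport β φ (fun _ => (0:ℝ)) = fun _ => 0 := fun β => by
    ext y; simp [LowRegPMT.transport]
  have hJ := fun r k => hφ.jac_contDiffOn r k
  -- The three families of terms in which a derivative falls on the cut-off or the Jacobian. They
  -- involve at most one derivative of `d`, so they tend to zero; only the doubly differentiated
  -- terms remain.
  have t1 := hd.unif.transport_mono hφ ((hα.pderiv l).pderiv k) (le_top : Q ≤ ⊤)
  have t2 := LpTo.sum hQ Finset.univ fun r _ =>
    (hd.deriv r).transport_mono hφ ((hα.pderiv l).mul (hJ r k)) hQP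
  have t3 := LpTo.sum hQ Finset.univ fun s _ =>
    (hd.deriv s).transport_mono hφ ((hα.mul (hJ s l)).pderiv k) hQP
  have t := (t1.add hQ t2).add hQ t3
  simp only [z, Finset.sum_const_zero, add_zero] at t
  refine t.congr_left ?_
  filter_upwards [hd.smooth] with ε h y
  have hfun : LowRegPMT.pderiv l (LowRegPMT.transport α φ (d ε)) = fun y =>
      LowRegPMT.transport (LowRegPMT.pderiv l α) φ (d ε) y + ∑ s,
      LowRegPMT.transport (fun y => α y * jac φ s l y) φ (LowRegPMT.pderiv s (d ε)) y :=
    funext fun y => pderiv_transport hφ hα h l y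
  have hs1 := (transport_contDiff hφ (hα.pderiv l) h).differentiable (by simp) y
  have hs2 : ∀ s, DifferentiableAt ℝ (LowRegPMT.transport (fun y => α y * jac φ s l y) φ
      (LowRegPMT.pderiv s (d ε))) y := fun s =>
    (transport_contDiff hφ (hα.mul (hJ s l)) (contDiff_pderiv h)).differentiable (by simp) y
  rw [hfun, pderiv_add hs1 (DifferentiableAt.fun_sum fun s _ => hs2 s),
    pderiv_sum _ fun s _ => hs2 s, pderiv_transport hφ (hα.pderiv l) h]
  simp only [pderiv_transport hφ (hα.mul (hJ _ l)) (contDiff_pderiv h), Finset.sum_add_distrib]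
  rw [Finset.sum_comm (f := fun s r => LowRegPMT.transport (fun y => α y * jac φ s l y *
    jac φ r k y) φ (LowRegPMT.pderiv r (LowRegPMT.pderiv s (d ε))) y)]
  simp only [LowRegPMT.transport]
  ring

end Transport

/-! ### Scalar curvature of a matrix field on `ℝⁿ` -/

section MatrixField

variable {n : ℕ}

/-- The components of the inverse matrix field. -/
def mUp (k : Euc n → Matrix (Fin n) (Fin n) ℝ) (a b : Fin n) (y : Euc n) : ℝ := (k y)⁻¹ a b

/-- The partial derivatives of the components of a matrix field. -/
def mDeriv (k : Euc n → Matrix (Fin n) (Fin n) ℝ) (c a b : Fin n) (y : Euc n) : ℝ :=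
  pderiv c (fun z => k z a b) y

/-- The Christoffel symbols of a matrix field. -/
def mChr (k : Euc n → Matrix (Fin n) (Fin n) ℝ) (m i j : Fin n) (y : Euc n) : ℝ :=
  christoffel (fun a b => mUp k a b y) (fun c a b => mDeriv k c a b y) m i j

/-- The Ricci tensor of a matrix field. -/
def mRic (k : Euc n → Matrix (Fin n) (Fin n) ℝ) (i j : Fin n) (y : Euc n) : ℝ :=
  (∑ m, (pderiv m (mChr k m i j) y - pderiv j (mChr k m i m) y)) +
    ∑ m, ∑ s, (mChr k m m s y * mChr k s i j y - mChr k m j s y * mChr k s i m y)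

/-- The scalar curvature of a matrix field. -/
def mScal (k : Euc n → Matrix (Fin n) (Fin n) ℝ) (y : Euc n) : ℝ :=
  ∑ i, ∑ j, mUp k i j y * mRic k i j y

theorem chartScalarCurvature_eq {M : Type*} [TopologicalSpace M] [ChartedSpace (Euc n) M]
    (τ : TensorField02 n M) (e : Chart n M) (y : Euc n) :
    chartScalarCurvature τ e y = mScal (coordMatrix τ e) y := rfl

/-- The algebraic expression `g^{ij} Γ^r_{ij} - g^{ir} Γ^j_{ij}`. -/
def algV (G : Fin n → Fin n → ℝ) (dk : Fin n → Fin n → Fin n → ℝ) (r : Fin n) : ℝ :=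
  ∑ i, ∑ j, (G i j * christoffel G dk r i j - G i r * christoffel G dk j i j)

/-- The algebraic expression of the zeroth order part of the distributional scalar curvature. -/
def algF (G : Fin n → Fin n → ℝ) (dG dk : Fin n → Fin n → Fin n → ℝ) : ℝ :=
  (∑ i, ∑ j, ∑ m, (-(dG m i j * christoffel G dk m i j) + dG j i j * christoffel G dk m i m)) +
    ∑ i, ∑ j, ∑ m, ∑ k, (G i j * christoffel G dk m i j * christoffel G dk k k m -
      G i j * christoffel G dk m i k * christoffel G dk k j m)

/-- The principal symbol `g^{sc} g^{rd} - g^{rs} g^{cd}` of the scalar curvature. -/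
def symb (G : Fin n → Fin n → ℝ) (r s c d : Fin n) : ℝ := G s c * G r d - G r s * G c d

theorem sum_rotate {f : Fin n → Fin n → Fin n → ℝ} :
    ∑ i, ∑ j, ∑ l, f i j l = ∑ l, ∑ i, ∑ j, f i j l := by
  calc ∑ i, ∑ j, ∑ l, f i j l = ∑ i, ∑ l, ∑ j, f i j l :=
        Finset.sum_congr rfl fun i _ => Finset.sum_comm
    _ = ∑ l, ∑ i, ∑ j, f i j l := Finset.sum_comm

/-- Expand the Christoffel symbols and relabel the indices. Symmetry of `G` makes two
first-derivative sums agree in the first trace and cancel in the second. This exhibits `V` as the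
principal symbol applied to `∂k`. -/
theorem algV_eq_symb {G : Fin n → Fin n → ℝ} {dk : Fin n → Fin n → Fin n → ℝ}
    (hG : ∀ i j, G i j = G j i) (r : Fin n) :
    algV G dk r = ∑ s, ∑ c, ∑ d, symb G r s c d * dk s c d := by
  have e1 : ∑ i, ∑ j, G i j * christoffel G dk r i j =
      ∑ i, ∑ j, ∑ l, G i j * G r l * dk i j l - 1 / 2 * ∑ i, ∑ j, ∑ l, G i j * G r l * dk l i j := by
    have a1 : ∑ i, ∑ j, ∑ l, G i j * G r l * dk j i l = ∑ i, ∑ j, ∑ l, G i j * G r l * dk i j l := by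
      rw [Finset.sum_comm]
      refine Finset.sum_congr rfl fun i _ => Finset.sum_congr rfl fun j _ =>
        Finset.sum_congr rfl fun l _ => ?_
      rw [hG i j]
    have a2 : ∑ i, ∑ j, G i j * christoffel G dk r i j = 1 / 2 * (∑ i, ∑ j, ∑ l, G i j * G r l * dk i j l
        + ∑ i, ∑ j, ∑ l, G i j * G r l * dk j i l - ∑ i, ∑ j, ∑ l, G i j * G r l * dk l i j) := by
      simp only [christoffel, Finset.mul_sum, ← Finset.sum_add_distrib, ← Finset.sum_sub_distrib]
      refine Finset.sum_congr rfl fun i _ => Finset.sum_congr rfl fun j _ =>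
        Finset.sum_congr rfl fun l _ => ?_
      ring
    rw [a2, a1]; ring
  have e2 : ∑ i, ∑ j, G i r * christoffel G dk j i j =
      1 / 2 * ∑ i, ∑ j, ∑ l, G i r * G j l * dk i j l := by
    have a1 : ∑ i, ∑ j, ∑ l, G i r * G j l * dk l i j = ∑ i, ∑ j, ∑ l, G i r * G j l * dk j i l := by
      refine Finset.sum_congr rfl fun i _ => ?_
      rw [Finset.sum_comm]
      refine Finset.sum_congr rfl fun j _ => Finset.sum_congr rfl fun l _ => ?_
      rw [hG l j]
    have a2 : ∑ i, ∑ j, G i r * christoffel G dk j i j = 1 / 2 * (∑ i, ∑ j, ∑ l, G i r * G j l * dk i j l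
        + ∑ i, ∑ j, ∑ l, G i r * G j l * dk j i l - ∑ i, ∑ j, ∑ l, G i r * G j l * dk l i j) := by
      simp only [christoffel, Finset.mul_sum, ← Finset.sum_add_distrib, ← Finset.sum_sub_distrib]
      refine Finset.sum_congr rfl fun i _ => Finset.sum_congr rfl fun j _ =>
        Finset.sum_congr rfl fun l _ => ?_
      ring
    rw [a2, a1]; ring
  have e3 : ∑ i, ∑ j, ∑ l, G i j * G r l * dk l i j = ∑ i, ∑ j, ∑ l, G i r * G j l * dk i j l := by
    rw [sum_rotate]
    refine Finset.sum_congr rfl fun i _ => Finset.sum_congr rfl fun j _ =>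
        Finset.sum_congr rfl fun l _ => ?_
    rw [hG i r]; ring
  have e4 : ∑ s, ∑ c, ∑ d, symb G r s c d * dk s c d = ∑ i, ∑ j, ∑ l, G i j * G r l * dk i j l -
      ∑ i, ∑ j, ∑ l, G i r * G j l * dk i j l := by
    simp only [← Finset.sum_sub_distrib, symb]
    refine Finset.sum_congr rfl fun i _ => Finset.sum_congr rfl fun j _ =>
        Finset.sum_congr rfl fun l _ => ?_
    rw [hG i r]; ring
  simp only [algV, Finset.sum_sub_distrib]
  rw [e1, e2, e3, e4]; ring

section Local

variable {k : Euc n → Matrix (Fin n) (Fin n) ℝ} {y : Euc n}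

/-- The matrix field is smooth and invertible near `y`. -/
structure IsRegularAt (k : Euc n → Matrix (Fin n) (Fin n) ℝ) (y : Euc n) : Prop where
  eventually_smooth : ∀ᶠ z in 𝓝 y, ∀ a b, ContDiffAt ℝ ∞ (fun z => k z a b) z
  det_ne : (k y).det ≠ 0

theorem contDiffAt_det (hk : ∀ a b, ContDiffAt ℝ ∞ (fun z => k z a b) y) :
    ContDiffAt ℝ ∞ (fun z => (k z).det) y := by
  simp only [Matrix.det_apply']
  exact ContDiffAt.sum fun σ _ => contDiffAt_const.mul (contDiffAt_prod fun i _ => hk _ _)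

theorem contDiffAt_adjugate (hk : ∀ a b, ContDiffAt ℝ ∞ (fun z => k z a b) y) (a b : Fin n) :
    ContDiffAt ℝ ∞ (fun z => (k z).adjugate a b) y := by
  simp only [Matrix.adjugate_apply]
  refine contDiffAt_det fun i j => ?_
  simp only [Matrix.updateRow_apply]
  split_ifs
  · exact contDiffAt_const
  · exact hk i j

theorem mUp_eq (k : Euc n → Matrix (Fin n) (Fin n) ℝ) (a b : Fin n) (z : Euc n) :
    mUp k a b z = ((k z).det)⁻¹ * (k z).adjugate a b := by
  simp [mUp, Matrix.inv_def, Ring.inverse_eq_inv]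

namespace IsRegularAt

theorem smooth (hk : IsRegularAt k y) (a b : Fin n) : ContDiffAt ℝ ∞ (fun z => k z a b) y :=
  hk.eventually_smooth.self_of_nhds a b

theorem up (hk : IsRegularAt k y) (a b : Fin n) : ContDiffAt ℝ ∞ (mUp k a b) y := by
  have : mUp k a b = fun z => ((k z).det)⁻¹ * (k z).adjugate a b := funext (mUp_eq k a b)
  rw [this]
  exact ((contDiffAt_det hk.smooth).inv hk.det_ne).mul (contDiffAt_adjugate hk.smooth a b)

theorem deriv (hk : IsRegularAt k y) (c a b : Fin n) : ContDiffAt ℝ ∞ (mDeriv k c a b) y :=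
  contDiffAt_pderiv (hk.smooth a b)

theorem chr (hk : IsRegularAt k y) (m i j : Fin n) : ContDiffAt ℝ ∞ (mChr k m i j) y := by
  unfold mChr christoffel
  exact contDiffAt_const.mul (ContDiffAt.sum fun l _ => (hk.up m l).mul
    (((hk.deriv i j l).add (hk.deriv j i l)).sub (hk.deriv l i j)))

theorem eventually (hk : IsRegularAt k y) : ∀ᶠ z in 𝓝 y, IsRegularAt k z := by
  have h1 : ∀ᶠ z in 𝓝 y, (k z).det ≠ 0 :=
    (contDiffAt_det hk.smooth).continuousAt.eventually_ne hk.det_ne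
  filter_upwards [h1, hk.eventually_smooth.eventually_nhds] with z h3 h4 using ⟨h4, h3⟩

end IsRegularAt

theorem mDeriv_congr {k' : Euc n → Matrix (Fin n) (Fin n) ℝ} (h : k =ᶠ[𝓝 y] k') (c a b : Fin n) :
    mDeriv k c a b y = mDeriv k' c a b y :=
  pderiv_congr (h.mono fun z hz => by simp only [hz])

theorem mUp_congr {k' : Euc n → Matrix (Fin n) (Fin n) ℝ} (h : k y = k' y) (a b : Fin n) :
    mUp k a b y = mUp k' a b y := by simp only [mUp, h]

theorem mChr_congr {k' : Euc n → Matrix (Fin n) (Fin n) ℝ} (h : k =ᶠ[𝓝 y] k') (m i j : Fin n) :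
    mChr k m i j y = mChr k' m i j y := by
  simp only [mChr, mDeriv_congr h, mUp_congr h.self_of_nhds]

theorem mScal_congr {k' : Euc n → Matrix (Fin n) (Fin n) ℝ} (h : k =ᶠ[𝓝 y] k') :
    mScal k y = mScal k' y := by
  have h1 : ∀ m i j, mChr k m i j =ᶠ[𝓝 y] mChr k' m i j := fun m i j =>
    h.eventually_nhds.mono fun z hz => mChr_congr hz m i j
  have h2 : ∀ i j, mRic k i j y = mRic k' i j y := fun i j => by
    simp only [mRic, pderiv_congr (h1 _ _ _), mChr_congr h]
  simp only [mScal, h2, mUp_congr h.self_of_nhds]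

/-- The scalar curvature in divergence form, `R = ∂ᵣ V^r + F`. -/
theorem mScal_eq_div (hk : IsRegularAt k y) :
    mScal k y = ∑ r, pderiv r (fun z => algV (fun a b => mUp k a b z)
      (fun c a b => mDeriv k c a b z) r) y + algF (fun a b => mUp k a b y)
      (fun c a b => pderiv c (mUp k a b) y) (fun c a b => mDeriv k c a b y) := by
  have dU : ∀ a b, DifferentiableAt ℝ (mUp k a b) y := fun a b =>
    (hk.up a b).differentiableAt (by simp)
  have dC : ∀ m i j, DifferentiableAt ℝ (mChr k m i j) y := fun m i j =>
    (hk.chr m i j).differentiableAt (by simp)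
  have hV : ∀ r, pderiv r (fun z => algV (fun a b => mUp k a b z)
      (fun c a b => mDeriv k c a b z) r) y = ∑ i, ∑ j,
      ((pderiv r (mUp k i j) y * mChr k r i j y + mUp k i j y * pderiv r (mChr k r i j) y) -
      (pderiv r (mUp k i r) y * mChr k j i j y + mUp k i r y * pderiv r (mChr k j i j) y)) := by
    intro r
    change pderiv r (fun z => ∑ i, ∑ j, (mUp k i j z * mChr k r i j z -
      mUp k i r z * mChr k j i j z)) y = _
    have d1 : ∀ i j, DifferentiableAt ℝ (fun z => mUp k i j z * mChr k r i j z) y :=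
      fun i j => (dU i j).mul (dC r i j)
    have d2 : ∀ i j, DifferentiableAt ℝ (fun z => mUp k i r z * mChr k j i j z) y :=
      fun i j => (dU i r).mul (dC j i j)
    have d3 : ∀ i j, DifferentiableAt ℝ (fun z => mUp k i j z * mChr k r i j z -
        mUp k i r z * mChr k j i j z) y := fun i j => (d1 i j).sub (d2 i j)
    rw [pderiv_sum _ fun i _ => DifferentiableAt.fun_sum fun j _ => d3 i j]
    refine Finset.sum_congr rfl fun i _ => ?_
    rw [pderiv_sum _ fun j _ => d3 i j]
    refine Finset.sum_congr rfl fun j _ => ?_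
    rw [pderiv_sub (d1 i j) (d2 i j), pderiv_mul (dU i j) (dC r i j),
      pderiv_mul (dU i r) (dC j i j)]
  simp only [hV]
  change _ = _ + ((∑ i, ∑ j, ∑ m, (-(pderiv m (mUp k i j) y * mChr k m i j y) +
    pderiv j (mUp k i j) y * mChr k m i m y)) +
    ∑ i, ∑ j, ∑ m, ∑ l, (mUp k i j y * mChr k m i j y * mChr k l l m y -
      mUp k i j y * mChr k m i l y * mChr k l j m y))
  have hL : mScal k y = (∑ i, ∑ j, ∑ m, (mUp k i j y * pderiv m (mChr k m i j) y -
      mUp k i j y * pderiv j (mChr k m i m) y)) + ∑ i, ∑ j, ∑ m, ∑ l,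
      (mUp k i j y * mChr k m i j y * mChr k l l m y -
      mUp k i j y * mChr k m i l y * mChr k l j m y) := by
    simp only [mScal, mRic, mul_add, Finset.mul_sum, Finset.sum_add_distrib, mul_sub]
    congr 1
    refine Finset.sum_congr rfl fun i _ => Finset.sum_congr rfl fun j _ => ?_
    simp only [Finset.sum_sub_distrib]
    congr 1
    · rw [Finset.sum_comm]
      exact Finset.sum_congr rfl fun m _ => Finset.sum_congr rfl fun l _ => by ring
    · rw [Finset.sum_comm]
      exact Finset.sum_congr rfl fun m _ => Finset.sum_congr rfl fun l _ => by ring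
  -- The divergence index is renamed: in the first product it becomes the upper index of `Γ`, in the
  -- second it becomes `j` while the old `j` becomes the contracted index.
  have hD : ∑ r, ∑ i, ∑ j,
      ((pderiv r (mUp k i j) y * mChr k r i j y + mUp k i j y * pderiv r (mChr k r i j) y) -
      (pderiv r (mUp k i r) y * mChr k j i j y + mUp k i r y * pderiv r (mChr k j i j) y)) =
      ∑ i, ∑ j, ∑ m, ((pderiv m (mUp k i j) y * mChr k m i j y + mUp k i j y *
      pderiv m (mChr k m i j) y) - (pderiv j (mUp k i j) y * mChr k m i m y +
      mUp k i j y * pderiv j (mChr k m i m) y)) := by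
    simp only [Finset.sum_sub_distrib]
    congr 1
    · rw [← sum_rotate]
    · rw [Finset.sum_comm]
  rw [hL, hD, ← add_assoc]
  congr 1
  simp only [← Finset.sum_add_distrib]
  refine Finset.sum_congr rfl fun i _ => Finset.sum_congr rfl fun j _ =>
    Finset.sum_congr rfl fun l _ => ?_
  ring

end Local

end MatrixField

/-! ### Coordinate invariance of the scalar curvature -/

section Invariance

variable {n : ℕ}

theorem sum_christoffel {k G : Matrix (Fin n) (Fin n) ℝ} (hG : k * G = 1)
    (dk : Fin n → Fin n → Fin n → ℝ) (b i j : Fin n) :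
    ∑ a, k b a * christoffel G dk a i j = 1 / 2 * (dk i j b + dk j i b - dk b i j) := by
  have h1 : ∑ a, k b a * christoffel G dk a i j =
      1 / 2 * ∑ l, (k * G) b l * (dk i j l + dk j i l - dk l i j) := by
    simp only [christoffel, Matrix.mul_apply, Finset.mul_sum, Finset.sum_mul]
    rw [Finset.sum_comm]
    exact Finset.sum_congr rfl fun _ _ => Finset.sum_congr rfl fun _ _ => by ring
  rw [h1, hG]
  simp [Matrix.one_apply]

/-- Transformation law of the Christoffel symbols, as an algebraic identity. -/
theorem christoffel_pullback {J k G G' : Matrix (Fin n) (Fin n) ℝ}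
    {H dk dk' : Fin n → Fin n → Fin n → ℝ} (hk : ∀ a b, k a b = k b a)
    (hH : ∀ i j a, H i j a = H j i a) (hG : k * G = 1)
    (hG' : G' * (J * k * J.transpose) = 1)
    (hdk' : ∀ i j l, dk' i j l = ∑ a, ∑ b, (H i j a * k a b * J l b + J j a * k a b * H i l b +
      J j a * J l b * ∑ c, J i c * dk c a b)) (i j a : Fin n) :
    ∑ m, christoffel G' dk' m i j * J m a =
      H i j a + ∑ b, ∑ c, J i b * (J j c * christoffel G dk a b c) := by
  -- `P` collects the second derivatives of the coordinate change and `Q` the derivatives of the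
  -- metric; `P` is symmetric in its first two indices.
  set P : Fin n → Fin n → Fin n → ℝ := fun i j l => ∑ a, ∑ b, H i j a * k a b * J l b with hP
  set Q : Fin n → Fin n → Fin n → ℝ := fun i j l =>
    ∑ a, ∑ b, ∑ c, J j a * J l b * (J i c * dk c a b) with hQ
  have hPs : ∀ i j l, P i j l = P j i l := fun i j l => by simp only [hP, hH i j]
  have hd : ∀ i j l, dk' i j l = P i j l + P i l j + Q i j l := by
    intro i j l
    rw [hdk']
    simp only [Finset.sum_add_distrib, hP, hQ, Finset.mul_sum]
    congr 2
    rw [Finset.sum_comm]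
    exact Finset.sum_congr rfl fun b _ => Finset.sum_congr rfl fun c _ => by rw [hk c b]; ring
  set T : Fin n → ℝ := fun a => H i j a + ∑ b, ∑ c, J i b * (J j c * christoffel G dk a b c) with hT
  have key : ∀ l, 1 / 2 * (dk' i j l + dk' j i l - dk' l i j) = ((J * k).mulVec T) l := by
    intro l
    have e1 : ∀ b, ∑ a, k b a * T a = ∑ a, k b a * H i j a + ∑ p, ∑ q, J i p * (J j q *
        (1 / 2 * (dk p q b + dk q p b - dk b p q))) := by
      intro b
      simp only [hT, mul_add, Finset.sum_add_distrib, Finset.mul_sum]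
      congr 1
      rw [← sum_rotate]
      refine Finset.sum_congr rfl fun p _ => Finset.sum_congr rfl fun q _ => ?_
      rw [← sum_christoffel hG]
      simp only [Finset.mul_sum]
      exact Finset.sum_congr rfl fun _ _ => by ring
    have e2 : ((J * k).mulVec T) l = ∑ b, J l b * ∑ a, k b a * T a := by
      rw [← Matrix.mulVec_mulVec]; rfl
    rw [e2]
    simp only [e1, mul_add, Finset.sum_add_distrib]
    have e3 : ∑ b, J l b * ∑ a, k b a * H i j a = P i j l := by
      simp only [hP, Finset.mul_sum]
      rw [Finset.sum_comm]
      exact Finset.sum_congr rfl fun b _ => Finset.sum_congr rfl fun c _ => by rw [hk c b]; ring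
    have e4 : ∑ b, J l b * ∑ p, ∑ q, J i p * (J j q *
        (1 / 2 * (dk p q b + dk q p b - dk b p q))) = 1 / 2 * (Q i j l + Q j i l - Q l i j) := by
      have q1 : Q i j l = ∑ b, ∑ p, ∑ q, J l b * (J i p * (J j q * dk p q b)) := by
        simp only [hQ]
        rw [← sum_rotate]
        exact Finset.sum_congr rfl fun _ _ => Finset.sum_congr rfl fun _ _ =>
          Finset.sum_congr rfl fun _ _ => by ring
      have q2 : Q j i l = ∑ b, ∑ p, ∑ q, J l b * (J i p * (J j q * dk q p b)) := by
        simp only [hQ]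
        rw [Finset.sum_comm]
        exact Finset.sum_congr rfl fun _ _ => Finset.sum_congr rfl fun _ _ =>
          Finset.sum_congr rfl fun _ _ => by ring
      have q3 : Q l i j = ∑ b, ∑ p, ∑ q, J l b * (J i p * (J j q * dk b p q)) := by
        simp only [hQ]
        rw [sum_rotate]
        exact Finset.sum_congr rfl fun _ _ => Finset.sum_congr rfl fun _ _ =>
          Finset.sum_congr rfl fun _ _ => by ring
      rw [q1, q2, q3]
      simp only [Finset.mul_sum, ← Finset.sum_add_distrib, ← Finset.sum_sub_distrib]
      exact Finset.sum_congr rfl fun _ _ => Finset.sum_congr rfl fun _ _ =>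
        Finset.sum_congr rfl fun _ _ => by ring
    -- Of the six `P` terms in the Koszul combination, four cancel by symmetry and two copies of `P
    -- i j l` survive.
    rw [e3, e4, hd, hd, hd, hPs j i l, hPs l i j, hPs l j i]
    ring
  have hv : (fun m => christoffel G' dk' m i j) = G'.mulVec ((J * k).mulVec T) := by
    funext m
    simp only [Matrix.mulVec, dotProduct] at key ⊢
    simp only [← key, christoffel, Finset.mul_sum]
    exact Finset.sum_congr rfl fun _ _ => by ring
  -- For square matrices a one-sided inverse is two-sided, so the factors of `G' (J k Jᵀ) = 1` may
  -- be permuted cyclically.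
  have h1 : J.transpose * (G' * (J * k)) = 1 := by
    rw [mul_eq_one_comm, mul_assoc]; exact hG'
  have h2 : J.transpose.mulVec (fun m => christoffel G' dk' m i j) = T := by
    rw [hv, Matrix.mulVec_mulVec, Matrix.mulVec_mulVec, mul_assoc, h1, Matrix.one_mulVec]
  have h3 := congrFun h2 a
  simp only [Matrix.mulVec, dotProduct, Matrix.transpose_apply] at h3
  exact (Finset.sum_congr rfl fun _ _ => mul_comm _ _).trans h3

/-- The symbol is a combination of products of two inverse metrics, hence a contravariant tensor of
rank four. This makes `A ∂²` invariant to leading order. -/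
theorem symb_pullback {J G : Matrix (Fin n) (Fin n) ℝ} (p q a b : Fin n) :
    symb (J.transpose * G * J) p q a b =
      ∑ r, ∑ s, ∑ c, ∑ d, symb G r s c d * (J r p * J s q * J c a * J d b) := by
  have e : ∀ p q, (J.transpose * G * J) p q = ∑ s, ∑ c, G s c * (J s p * J c q) := by
    intro p q
    simp only [Matrix.mul_apply, Matrix.transpose_apply, Finset.sum_mul]
    rw [Finset.sum_comm]
    exact Finset.sum_congr rfl fun _ _ => Finset.sum_congr rfl fun _ _ => by ring
  have e2 : ∀ f h : Fin n → Fin n → ℝ, (∑ i, ∑ j, f i j) * (∑ k, ∑ l, h k l) =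
      ∑ i, ∑ j, ∑ k, ∑ l, f i j * h k l := fun f h => by
    rw [Finset.sum_mul]
    refine Finset.sum_congr rfl fun i _ => ?_
    rw [Finset.sum_mul]
    refine Finset.sum_congr rfl fun j _ => ?_
    rw [Finset.mul_sum]
    exact Finset.sum_congr rfl fun k _ => Finset.mul_sum _ _ _
  simp only [symb, e, e2, sub_mul, Finset.sum_sub_distrib]
  congr 1
  · calc _ = ∑ s, ∑ c, ∑ r, ∑ d, G s c * G r d * (J r p * J s q * J c a * J d b) :=
          Finset.sum_congr rfl fun _ _ => Finset.sum_congr rfl fun _ _ =>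
            Finset.sum_congr rfl fun _ _ => Finset.sum_congr rfl fun _ _ => by ring
      _ = _ := sum_rotate
  · exact Finset.sum_congr rfl fun _ _ => Finset.sum_congr rfl fun _ _ =>
        Finset.sum_congr rfl fun _ _ => Finset.sum_congr rfl fun _ _ => by ring

variable {y : Euc n}

theorem pderiv_comp {φ : Euc n → Euc n} {f : Euc n → ℝ} (hd : DifferentiableAt ℝ φ y)
    (hfd : DifferentiableAt ℝ f (φ y)) (k : Fin n) :
    pderiv k (fun z => f (φ z)) y = ∑ r, pderiv k (fun z => φ z r) y * pderiv r f (φ y) := by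
  have h2 : HasFDerivAt (fun z => f (φ z)) ((fderiv ℝ f (φ y)).comp (fderiv ℝ φ y)) y :=
    hfd.hasFDerivAt.comp y hd.hasFDerivAt
  rw [pderiv, h2.fderiv, ContinuousLinearMap.comp_apply, fderiv_apply_eq_sum_pderiv]
  refine Finset.sum_congr rfl fun r _ => ?_
  have h3 : HasFDerivAt (fun z => φ z r)
      ((EuclideanSpace.proj (𝕜 := ℝ) r).comp (fderiv ℝ φ y)) y :=
    (EuclideanSpace.proj (𝕜 := ℝ) r).hasFDerivAt.comp y hd.hasFDerivAt
  have h4 : pderiv k (fun z => φ z r) y = (fderiv ℝ φ y (stdVec k)) r := by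
    rw [pderiv, h3.fderiv]; rfl
  rw [h4]

/-- The entrywise partial derivative of a matrix field. -/
def dMat (c : Fin n) (A : Euc n → Matrix (Fin n) (Fin n) ℝ) (y : Euc n) :
    Matrix (Fin n) (Fin n) ℝ :=
  Matrix.of fun i j => pderiv c (fun z => A z i j) y

/-- Entrywise differentiability of a matrix field. -/
def DiffMat (A : Euc n → Matrix (Fin n) (Fin n) ℝ) (y : Euc n) : Prop :=
  ∀ i j, DifferentiableAt ℝ (fun z => A z i j) y

section dMat

variable {A B : Euc n → Matrix (Fin n) (Fin n) ℝ} {c : Fin n}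

theorem dMat_congr (h : A =ᶠ[𝓝 y] B) : dMat c A y = dMat c B y := by
  ext i j
  exact pderiv_congr (h.mono fun z hz => by simp only [hz])

theorem DiffMat.mul (hA : DiffMat A y) (hB : DiffMat B y) : DiffMat (fun z => A z * B z) y := by
  intro i j
  simp only [Matrix.mul_apply]
  exact DifferentiableAt.fun_sum fun l _ => (hA i l).mul (hB l j)

theorem dMat_mul (hA : DiffMat A y) (hB : DiffMat B y) :
    dMat c (fun z => A z * B z) y = dMat c A y * B y + A y * dMat c B y := by
  ext i j
  simp only [dMat, Matrix.mul_apply, Matrix.of_apply, Matrix.add_apply]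
  have hd : ∀ l, DifferentiableAt ℝ (fun z => A z i l * B z l j) y :=
    fun l => (hA i l).mul (hB l j)
  rw [pderiv_sum _ fun l _ => hd l, ← Finset.sum_add_distrib]
  exact Finset.sum_congr rfl fun l _ => pderiv_mul (hA i l) (hB l j)

theorem dMat_add (hA : DiffMat A y) (hB : DiffMat B y) :
    dMat c (fun z => A z + B z) y = dMat c A y + dMat c B y := by
  ext i j
  exact pderiv_add (hA i j) (hB i j)

theorem DiffMat.sum_smul {f : Fin n → Euc n → ℝ} {C : Fin n → Euc n → Matrix (Fin n) (Fin n) ℝ}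
    (hf : ∀ b, DifferentiableAt ℝ (f b) y) (hC : ∀ b, DiffMat (C b) y) :
    DiffMat (fun z => ∑ b, f b z • C b z) y := by
  intro i j
  simp only [Matrix.sum_apply, Matrix.smul_apply, smul_eq_mul]
  exact DifferentiableAt.fun_sum fun b _ => (hf b).mul (hC b i j)

theorem dMat_sum_smul {f : Fin n → Euc n → ℝ} {C : Fin n → Euc n → Matrix (Fin n) (Fin n) ℝ}
    (hf : ∀ b, DifferentiableAt ℝ (f b) y) (hC : ∀ b, DiffMat (C b) y) :
    dMat c (fun z => ∑ b, f b z • C b z) y =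
      ∑ b, (pderiv c (f b) y • C b y + f b y • dMat c (C b) y) := by
  ext i j
  simp only [dMat, Matrix.of_apply, Matrix.sum_apply, Matrix.smul_apply, smul_eq_mul,
    Matrix.add_apply]
  have hd : ∀ b, DifferentiableAt ℝ (fun z => f b z * C b z i j) y :=
    fun b => (hf b).mul (hC b i j)
  rw [pderiv_sum _ fun b _ => hd b]
  exact Finset.sum_congr rfl fun b _ => pderiv_mul (hf b) (hC b i j)

theorem DiffMat.comp {φ : Euc n → Euc n} (hφ : DifferentiableAt ℝ φ y) (hA : DiffMat A (φ y)) :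
    DiffMat (fun z => A (φ z)) y := fun i j => (hA i j).comp y hφ

theorem dMat_comp {φ : Euc n → Euc n} (hφ : DifferentiableAt ℝ φ y) (hA : DiffMat A (φ y)) :
    dMat c (fun z => A (φ z)) y = ∑ b, pderiv c (fun z => φ z b) y • dMat b A (φ y) := by
  ext i j
  simp only [dMat, Matrix.of_apply, Matrix.sum_apply, Matrix.smul_apply, smul_eq_mul]
  exact pderiv_comp hφ (hA i j) c

end dMat

/-- The Jacobian matrix `J i a = ∂ᵢ φᵃ`. -/
def jacMat (φ : Euc n → Euc n) (z : Euc n) : Matrix (Fin n) (Fin n) ℝ :=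
  Matrix.of fun i a => pderiv i (fun w => φ w a) z

/-- The connection matrix `(ωᵢ)_{jm} = Γ^m_{ij}`. -/
def conn (k : Euc n → Matrix (Fin n) (Fin n) ℝ) (i : Fin n) (z : Euc n) :
    Matrix (Fin n) (Fin n) ℝ :=
  Matrix.of fun j m => mChr k m i j z

/-- The curvature matrix of the connection. -/
def curv (k : Euc n → Matrix (Fin n) (Fin n) ℝ) (c i : Fin n) (z : Euc n) :
    Matrix (Fin n) (Fin n) ℝ :=
  dMat c (conn k i) z - dMat i (conn k c) z + conn k i z * conn k c z - conn k c z * conn k i z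

theorem mChr_symm {k : Euc n → Matrix (Fin n) (Fin n) ℝ} (hs : ∀ᶠ z in 𝓝 y, (k z).IsSymm)
    (m i j : Fin n) : mChr k m i j y = mChr k m j i y := by
  have h : ∀ l i j, mDeriv k l i j y = mDeriv k l j i y := fun l i j =>
    pderiv_congr (hs.mono fun z hz => (hz.apply i j).symm)
  simp only [mChr, christoffel, h _ i j]
  congr 1
  exact Finset.sum_congr rfl fun l _ => by ring

/-- Ricci as a trace of the curvature matrices; symmetry of the lower indices of `Γ` reconciles the
two index conventions. The transformation law then reduces to matrix algebra. -/
theorem mRic_eq_curv {k : Euc n → Matrix (Fin n) (Fin n) ℝ} (hs : ∀ᶠ z in 𝓝 y, (k z).IsSymm)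
    (i j : Fin n) : mRic k i j y = ∑ m, curv k m j y i m := by
  have h1 : ∀ m i j, mChr k m i j =ᶠ[𝓝 y] mChr k m j i := fun m i j =>
    hs.eventually_nhds.mono fun z hz => mChr_symm hz m i j
  have e : ∀ m, curv k m j y i m = pderiv m (mChr k m i j) y - pderiv j (mChr k m i m) y +
      ∑ s, (mChr k m m s y * mChr k s i j y - mChr k m j s y * mChr k s i m y) := by
    intro m
    simp only [curv, Matrix.sub_apply, Matrix.add_apply, Matrix.mul_apply, dMat, conn,
      Matrix.of_apply]
    rw [pderiv_congr (h1 m i j), pderiv_congr (h1 m i m), Finset.sum_sub_distrib, ← add_sub_assoc]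
    congr 1
    · congr 1
      exact Finset.sum_congr rfl fun s _ => by rw [(h1 s i j).self_of_nhds]; ring
    · exact Finset.sum_congr rfl fun s _ => by rw [(h1 s i m).self_of_nhds]; ring
  simp only [e, mRic, Finset.sum_add_distrib]

theorem IsRegularAt.diffMat {k : Euc n → Matrix (Fin n) (Fin n) ℝ} (hk : IsRegularAt k y) :
    DiffMat k y := fun i j => (hk.smooth i j).differentiableAt (by simp)

theorem IsRegularAt.diffMat_conn {k : Euc n → Matrix (Fin n) (Fin n) ℝ} (hk : IsRegularAt k y)
    (i : Fin n) : DiffMat (conn k i) y := fun j m => (hk.chr m i j).differentiableAt (by simp)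

/-! ### Transformation laws of connection, curvature, Ricci and scalar curvature -/

section Pullback

variable {k k' : Euc n → Matrix (Fin n) (Fin n) ℝ} {φ : Euc n → Euc n}

theorem contDiffAt_coord (hφ : ContDiffAt ℝ ∞ φ y) (a : Fin n) :
    ContDiffAt ℝ ∞ (fun z => φ z a) y :=
  (EuclideanSpace.proj (𝕜 := ℝ) a).contDiff.contDiffAt.comp y hφ

theorem contDiffAt_jacMat (hφ : ContDiffAt ℝ ∞ φ y) (i a : Fin n) :
    ContDiffAt ℝ ∞ (fun z => jacMat φ z i a) y := contDiffAt_pderiv (contDiffAt_coord hφ a)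

theorem diffMat_jacMat (hφ : ContDiffAt ℝ ∞ φ y) : DiffMat (jacMat φ) y := fun i a =>
  (contDiffAt_jacMat hφ i a).differentiableAt (by simp)

theorem dMat_jacMat_comm (hφ : ContDiffAt ℝ ∞ φ y) (i j a : Fin n) :
    dMat i (jacMat φ) y j a = dMat j (jacMat φ) y i a :=
  pderiv_comm i j (contDiffAt_coord hφ a)

theorem IsRegularAt.pullback (hk : IsRegularAt k (φ y)) (hφ : ∀ᶠ z in 𝓝 y, ContDiffAt ℝ ∞ φ z)
    (hdet : (jacMat φ y).det ≠ 0)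
    (hk' : ∀ᶠ z in 𝓝 y, k' z = jacMat φ z * k (φ z) * (jacMat φ z).transpose) :
    IsRegularAt k' y := by
  refine ⟨?_, ?_⟩
  · have hc := hφ.self_of_nhds.continuousAt
    filter_upwards [hφ, hc.eventually hk.eventually_smooth, hk'.eventually_nhds] with z h1 h2 h3 a b
    have : ContDiffAt ℝ ∞ (fun z => (jacMat φ z * k (φ z) * (jacMat φ z).transpose) a b) z := by
      simp only [Matrix.mul_apply, Matrix.transpose_apply]
      exact ContDiffAt.sum fun j _ => (ContDiffAt.sum fun i _ =>
        (contDiffAt_jacMat h1 _ _).mul ((h2 _ _).comp z h1)).mul (contDiffAt_jacMat h1 _ _)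
    exact this.congr_of_eventuallyEq (h3.mono fun w hw => by simp only [hw])
  · rw [hk'.self_of_nhds, Matrix.det_mul, Matrix.det_mul, Matrix.det_transpose]
    exact mul_ne_zero (mul_ne_zero hdet hk.det_ne) hdet

/-- The law for the Christoffel symbols in matrix form: a gauge transformation `ω' J = dJ + J φ^*ω`.
-/
theorem conn_pullback (hk : IsRegularAt k (φ y)) (hs : ∀ᶠ z in 𝓝 (φ y), (k z).IsSymm)
    (hφ : ∀ᶠ z in 𝓝 y, ContDiffAt ℝ ∞ φ z) (hdet : (jacMat φ y).det ≠ 0)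
    (hk' : ∀ᶠ z in 𝓝 y, k' z = jacMat φ z * k (φ z) * (jacMat φ z).transpose) (i : Fin n) :
    conn k' i y * jacMat φ y = dMat i (jacMat φ) y +
      ∑ b, jacMat φ y i b • (jacMat φ y * conn k b (φ y)) := by
  have hφ0 := hφ.self_of_nhds
  have hd := hφ0.differentiableAt (by simp)
  have hreg' := hk.pullback hφ hdet hk'
  have e0 := hk'.self_of_nhds
  ext j a
  have h := christoffel_pullback (J := jacMat φ y) (k := k (φ y)) (G := (k (φ y))⁻¹)
    (G' := (k' y)⁻¹) (H := fun i j a => dMat i (jacMat φ) y j a)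
    (dk := fun c a b => mDeriv k c a b (φ y)) (dk' := fun c a b => mDeriv k' c a b y)
    (fun a b => hs.self_of_nhds.apply b a) (dMat_jacMat_comm hφ0)
    (Matrix.mul_nonsing_inv _ (isUnit_iff_ne_zero.2 hk.det_ne))
    (by rw [← e0]; exact Matrix.nonsing_inv_mul _ (isUnit_iff_ne_zero.2 hreg'.det_ne)) ?_ i j a
  · simp only [Matrix.mul_apply, Matrix.add_apply, Matrix.sum_apply, Matrix.smul_apply,
      smul_eq_mul, Finset.mul_sum]
    exact h
  · intro i j l
    have hJ := diffMat_jacMat hφ0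
    have hkφ : DiffMat (fun z => k (φ z)) y := hk.diffMat.comp hd
    have hT : DiffMat (fun z => (jacMat φ z).transpose) y := fun a b => hJ b a
    have e1 : mDeriv k' i j l y = (dMat i k' y) j l := rfl
    have e2 : dMat i (fun z => (jacMat φ z).transpose) y = (dMat i (jacMat φ) y).transpose := rfl
    rw [e1, dMat_congr hk', dMat_mul (hJ.mul hkφ) hT, dMat_mul hJ hkφ, e2,
      dMat_comp hd hk.diffMat]
    simp only [Matrix.add_apply, Matrix.mul_apply, Matrix.transpose_apply, Matrix.sum_apply,
      Matrix.smul_apply, smul_eq_mul, add_mul, Finset.sum_mul, Finset.mul_sum,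
      Finset.sum_add_distrib]
    rw [add_assoc, add_assoc, add_comm (∑ a, ∑ b, jacMat φ y j a * k (φ y) a b * _)]
    congr 1
    · rw [Finset.sum_comm]
    · congr 1
      · rw [Finset.sum_comm, sum_rotate]
        exact Finset.sum_congr rfl fun _ _ => Finset.sum_congr rfl fun _ _ =>
          Finset.sum_congr rfl fun _ _ => by simp only [jacMat, dMat, mDeriv, Matrix.of_apply]; ring
      · rw [Finset.sum_comm]

/-- Differentiate the gauge law `ω' J = dJ + J W`, with `W` the pulled-back connection, and
antisymmetrise. The second derivatives of `J` drop out, and after eliminating `dJ` by the gauge law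
itself what remains is `Ω' J = J φ^*Ω`. -/
theorem curv_pullback (hk : IsRegularAt k (φ y)) (hs : ∀ᶠ z in 𝓝 (φ y), (k z).IsSymm)
    (hφ : ∀ᶠ z in 𝓝 y, ContDiffAt ℝ ∞ φ z) (hdet : (jacMat φ y).det ≠ 0)
    (hk' : ∀ᶠ z in 𝓝 y, k' z = jacMat φ z * k (φ z) * (jacMat φ z).transpose) (c i : Fin n) :
    curv k' c i y * jacMat φ y = jacMat φ y *
      ∑ a, ∑ b, (jacMat φ y c a * jacMat φ y i b) • curv k a b (φ y) := by
  have hφ0 := hφ.self_of_nhds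
  have hd := hφ0.differentiableAt (by simp)
  have hreg' := hk.pullback hφ hdet hk'
  have hJ := diffMat_jacMat hφ0
  set W : Fin n → Euc n → Matrix (Fin n) (Fin n) ℝ := fun i z => ∑ b, jacMat φ z i b •
    conn k b (φ z) with hW
  have hc : ∀ b, DiffMat (fun z => conn k b (φ z)) y := fun b => (hk.diffMat_conn b).comp hd
  have hWd : ∀ i, DiffMat (W i) y := fun i => DiffMat.sum_smul (fun b => hJ i b) hc
  have hev : ∀ i, (fun z => conn k' i z * jacMat φ z) =ᶠ[𝓝 y] fun z =>
      dMat i (jacMat φ) z + jacMat φ z * W i z := by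
    intro i
    have hcont := hφ0.continuousAt
    have hdet' : ∀ᶠ z in 𝓝 y, (jacMat φ z).det ≠ 0 :=
      (contDiffAt_det (fun a b => contDiffAt_jacMat hφ0 a b)).continuousAt.eventually_ne hdet
    filter_upwards [hcont.eventually hk.eventually, hcont.eventually hs.eventually_nhds,
      hφ.eventually_nhds, hdet', hk'.eventually_nhds] with z h1 h2 h3 h4 h5
    rw [conn_pullback h1 h2 h3 h4 h5 i, hW]
    simp only [Finset.mul_sum, Matrix.mul_smul]
  have hdd : ∀ i, DiffMat (dMat i (jacMat φ)) y := fun i a b =>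
    (contDiffAt_pderiv (contDiffAt_jacMat hφ0 a b)).differentiableAt (by simp)
  have hD : ∀ c i, dMat c (conn k' i) y * jacMat φ y + conn k' i y * dMat c (jacMat φ) y =
      dMat c (dMat i (jacMat φ)) y + (dMat c (jacMat φ) y * W i y + jacMat φ y * dMat c (W i) y) := by
    intro c i
    rw [← dMat_mul (hreg'.diffMat_conn i) hJ, dMat_congr (hev i),
      dMat_add (hdd i) (hJ.mul (hWd i)), dMat_mul hJ (hWd i)]
  -- The gauge law solved for `dJ`, so that first derivatives of the Jacobian can be eliminated.
  have hsub : ∀ c, dMat c (jacMat φ) y = conn k' c y * jacMat φ y - jacMat φ y * W c y := by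
    intro c
    exact eq_sub_of_add_eq (hev c).self_of_nhds.symm
  have hcomm : dMat c (dMat i (jacMat φ)) y = dMat i (dMat c (jacMat φ)) y := by
    ext a b
    exact pderiv_comm c i (contDiffAt_jacMat hφ0 a b)
  -- The curvature of the pulled-back connection is the pulled-back curvature: the terms with `dJ`
  -- cancel because `∂_c J_i` is symmetric in `c` and `i`.
  have hWW : dMat c (W i) y - dMat i (W c) y + W i y * W c y - W c y * W i y =
      ∑ a, ∑ b, (jacMat φ y c a * jacMat φ y i b) • curv k a b (φ y) := by
    have hdW : ∀ c i, dMat c (W i) y = ∑ b, dMat c (jacMat φ) y i b • conn k b (φ y) +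
        ∑ a, ∑ b, (jacMat φ y c a * jacMat φ y i b) • dMat a (conn k b) (φ y) := by
      intro c i
      rw [hW, dMat_sum_smul (fun b => hJ i b) hc, Finset.sum_add_distrib]
      congr 1
      rw [Finset.sum_comm]
      refine Finset.sum_congr rfl fun b _ => ?_
      rw [dMat_comp hd (hk.diffMat_conn b), Finset.smul_sum]
      refine Finset.sum_congr rfl fun a _ => ?_
      rw [smul_smul, mul_comm]; rfl
    have hmul : ∀ c i, W c y * W i y = ∑ a, ∑ b, (jacMat φ y c a * jacMat φ y i b) •
        (conn k a (φ y) * conn k b (φ y)) := by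
      intro c i
      simp only [hW, Finset.sum_mul_sum, Matrix.smul_mul, Matrix.mul_smul, smul_smul]
      exact Finset.sum_congr rfl fun _ _ => Finset.sum_congr rfl fun _ _ => by rw [mul_comm]
    have hsw : ∀ f : Fin n → Fin n → Matrix (Fin n) (Fin n) ℝ,
        ∑ a, ∑ b, (jacMat φ y i a * jacMat φ y c b) • f a b =
        ∑ a, ∑ b, (jacMat φ y c a * jacMat φ y i b) • f b a := by
      intro f
      rw [Finset.sum_comm]
      exact Finset.sum_congr rfl fun _ _ => Finset.sum_congr rfl fun _ _ => by rw [mul_comm]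
    rw [hdW c i, hdW i c, hmul i c, hmul c i, hsw, hsw]
    simp only [dMat_jacMat_comm hφ0 i c, curv, smul_sub, smul_add, Finset.sum_sub_distrib,
      Finset.sum_add_distrib]
    abel
  rw [← hWW]
  have h1 := hD c i
  have h2 := hD i c
  rw [hcomm] at h1
  have h3 : dMat i (dMat c (jacMat φ)) y = dMat i (conn k' c) y * jacMat φ y + conn k' c y *
      dMat i (jacMat φ) y - (dMat i (jacMat φ) y * W c y + jacMat φ y * dMat i (W c) y) := by
    rw [h2]; abel
  rw [h3, hsub c, hsub i] at h1
  have h4 : dMat c (conn k' i) y * jacMat φ y = dMat i (conn k' c) y * jacMat φ y + conn k' c y *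
      (conn k' i y * jacMat φ y - jacMat φ y * W i y) -
      ((conn k' i y * jacMat φ y - jacMat φ y * W i y) * W c y + jacMat φ y * dMat i (W c) y) +
      ((conn k' c y * jacMat φ y - jacMat φ y * W c y) * W i y + jacMat φ y * dMat c (W i) y) -
      conn k' i y * (conn k' c y * jacMat φ y - jacMat φ y * W c y) := by
    rw [← h1]; abel
  simp only [curv, sub_mul, add_mul]
  rw [h4]
  noncomm_ring

/-- Solving the curvature law gives a conjugation by `J`. In the trace over the first form index,
the Jacobian of that index contracts with `J⁻¹` to the identity. -/
theorem mRic_pullback (hk : IsRegularAt k (φ y)) (hs : ∀ᶠ z in 𝓝 (φ y), (k z).IsSymm)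
    (hφ : ∀ᶠ z in 𝓝 y, ContDiffAt ℝ ∞ φ z) (hdet : (jacMat φ y).det ≠ 0)
    (hk' : ∀ᶠ z in 𝓝 y, k' z = jacMat φ z * k (φ z) * (jacMat φ z).transpose) :
    Matrix.of (fun i j => mRic k' i j y) = jacMat φ y * Matrix.of (fun i j => mRic k i j (φ y)) *
      (jacMat φ y).transpose := by
  have hs' : ∀ᶠ z in 𝓝 y, (k' z).IsSymm := by
    filter_upwards [hφ.self_of_nhds.continuousAt.eventually hs, hk'] with z h1 h2
    rw [h2, Matrix.IsSymm, Matrix.transpose_mul, Matrix.transpose_mul, Matrix.transpose_transpose,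
      h1.eq, mul_assoc]
  set J := jacMat φ y
  have hu : IsUnit J.det := isUnit_iff_ne_zero.2 hdet
  have hJ1 : J⁻¹ * J = 1 := Matrix.nonsing_inv_mul _ hu
  have hJ2 : J * J⁻¹ = 1 := Matrix.mul_nonsing_inv _ hu
  have hcv : ∀ m j, curv k' m j y = J * (∑ a, ∑ b, (J m a * J j b) • curv k a b (φ y)) * J⁻¹ := by
    intro m j
    rw [← curv_pullback hk hs hφ hdet hk' m j, mul_assoc, hJ2, mul_one]
  ext i j
  simp only [Matrix.of_apply]
  rw [mRic_eq_curv hs']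
  have e1 : ∀ m, curv k' m j y i m = ∑ a, ∑ b, ∑ d, J⁻¹ d m * J m a * (J j b *
      (J * curv k a b (φ y)) i d) := by
    intro m
    rw [hcv, Finset.mul_sum, Finset.sum_mul, Matrix.sum_apply]
    refine Finset.sum_congr rfl fun a _ => ?_
    rw [Finset.mul_sum, Finset.sum_mul, Matrix.sum_apply]
    refine Finset.sum_congr rfl fun b _ => ?_
    rw [Matrix.mul_smul, Matrix.smul_mul, Matrix.smul_apply, Matrix.mul_apply, smul_eq_mul,
      Finset.mul_sum]
    exact Finset.sum_congr rfl fun d _ => by ring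
  have e2 : ∑ m, curv k' m j y i m = ∑ a, ∑ b, J j b * (J * curv k a b (φ y)) i a := by
    simp only [e1]
    rw [Finset.sum_comm]
    refine Finset.sum_congr rfl fun a _ => ?_
    rw [Finset.sum_comm]
    refine Finset.sum_congr rfl fun b _ => ?_
    rw [Finset.sum_comm]
    simp only [← Finset.sum_mul, ← Matrix.mul_apply, hJ1, Matrix.one_apply]
    simp
  rw [e2]
  simp only [Matrix.mul_apply, Matrix.transpose_apply, Matrix.of_apply, mRic_eq_curv hs,
    Finset.sum_mul, Finset.mul_sum]
  rw [Finset.sum_comm]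
  refine Finset.sum_congr rfl fun b _ => ?_
  rw [Finset.sum_comm]
  exact Finset.sum_congr rfl fun _ _ => Finset.sum_congr rfl fun _ _ => by ring

/-- Coordinate invariance of the scalar curvature. -/
theorem mScal_pullback (hk : IsRegularAt k (φ y)) (hs : ∀ᶠ z in 𝓝 (φ y), (k z).IsSymm)
    (hφ : ∀ᶠ z in 𝓝 y, ContDiffAt ℝ ∞ φ z) (hdet : (jacMat φ y).det ≠ 0)
    (hk' : ∀ᶠ z in 𝓝 y, k' z = jacMat φ z * k (φ z) * (jacMat φ z).transpose) :
    mScal k' y = mScal k (φ y) := by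
  have e : ∀ (k : Euc n → Matrix (Fin n) (Fin n) ℝ) y, mScal k y =
      ((k y)⁻¹.transpose * Matrix.of fun i j => mRic k i j y).trace := by
    intro k y
    simp only [mScal, Matrix.trace, Matrix.diag_apply, Matrix.mul_apply, Matrix.transpose_apply,
      Matrix.of_apply]
    rw [Finset.sum_comm]; rfl
  set J := jacMat φ y with hJ
  have hu : IsUnit J.det := isUnit_iff_ne_zero.2 hdet
  have hJ1 : J⁻¹ * J = 1 := Matrix.nonsing_inv_mul _ hu
  have hJ2 : J.transpose * J⁻¹.transpose = 1 := by
    rw [← Matrix.transpose_mul, hJ1, Matrix.transpose_one]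
  rw [e, e, mRic_pullback hk hs hφ hdet hk', hk'.self_of_nhds, ← hJ, Matrix.mul_inv_rev,
    Matrix.mul_inv_rev, Matrix.transpose_mul, Matrix.transpose_mul, ← Matrix.transpose_nonsing_inv,
    Matrix.transpose_transpose]
  set R := Matrix.of fun i j => mRic k i j (φ y)
  rw [Matrix.trace_mul_comm]
  have e3 : J * R * J.transpose * (J⁻¹.transpose * (k (φ y))⁻¹.transpose * J⁻¹) =
      J * (R * (k (φ y))⁻¹.transpose) * J⁻¹ := by
    calc _ = J * R * (J.transpose * J⁻¹.transpose) * (k (φ y))⁻¹.transpose * J⁻¹ := by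
          simp only [mul_assoc]
      _ = _ := by rw [hJ2, mul_one]; simp only [mul_assoc]
  rw [e3, Matrix.trace_mul_comm, ← mul_assoc, hJ1, one_mul, Matrix.trace_mul_comm]

end Pullback

end Invariance

/-! ### Tensor fields in charts -/

section Charts

variable {n : ℕ} {M : Type*} [TopologicalSpace M] [ChartedSpace (Euc n) M]

theorem chartPush_apply (τ : TensorField02 n M) (e : Chart n M) (y v w : Euc n) :
    chartPush τ e y v w = τ (e.symm y) (mfderiv 𝓘(ℝ, Euc n) 𝓘(ℝ, Euc n) e.symm y v)
      (mfderiv 𝓘(ℝ, Euc n) 𝓘(ℝ, Euc n) e.symm y w) := rfl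

theorem euc_eq_sum (v : Euc n) : v = ∑ i, v i • stdVec i := by
  ext j
  simp [stdVec, Finset.sum_apply, Pi.single_apply]

theorem bilin_eq_sum (B : Euc n →L[ℝ] Euc n →L[ℝ] ℝ) (v w : Euc n) :
    B v w = ∑ a, ∑ b, v a * w b * B (stdVec a) (stdVec b) := by
  conv_lhs => rw [euc_eq_sum v, euc_eq_sum w]
  simp only [map_sum, map_smul, sum_apply, smul_apply, smul_eq_mul,
    Finset.mul_sum]
  rw [Finset.sum_comm]
  exact Finset.sum_congr rfl fun _ _ => Finset.sum_congr rfl fun _ _ => by ring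

theorem bilin_eq_sum_dxTensor (B : Euc n →L[ℝ] Euc n →L[ℝ] ℝ) :
    B = ∑ a, ∑ b, B (stdVec a) (stdVec b) • dxTensor a b := by
  ext v w
  rw [bilin_eq_sum]
  simp only [sum_apply, smul_apply, dxTensor, smul_eq_mul]
  exact Finset.sum_congr rfl fun _ _ => Finset.sum_congr rfl fun _ _ => by
    simp; ring

theorem contDiffAt_smul_vec {F : Type*} [NormedAddCommGroup F] [NormedSpace ℝ F] {f : Euc n → ℝ}
    {r : WithTop ℕ∞} {y : Euc n} (hf : ContDiffAt ℝ r f y) (c : F) :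
    ContDiffAt ℝ r (fun z => f z • c) y := hf.smul contDiffAt_const

theorem contDiffAt_bilin_iff {B : Euc n → Euc n →L[ℝ] Euc n →L[ℝ] ℝ} {r : WithTop ℕ∞} {y : Euc n} :
    ContDiffAt ℝ r B y ↔ ∀ a b, ContDiffAt ℝ r (fun z => B z (stdVec a) (stdVec b)) y := by
  constructor
  · intro h a b
    exact (h.clm_apply contDiffAt_const).clm_apply contDiffAt_const
  · intro h
    have : B = fun z => ∑ a, ∑ b, B z (stdVec a) (stdVec b) • dxTensor a b :=
      funext fun z => bilin_eq_sum_dxTensor (B z)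
    rw [this]
    refine ContDiffAt.sum fun a _ => ContDiffAt.sum fun b _ => ?_
    exact contDiffAt_smul_vec (h a b) _

variable [IsManifold 𝓘(ℝ, Euc n) ∞ M]

/-- A `(0,2)`-tensor field as a section of the bundle of bilinear forms. -/
def tensorSection (τ : TensorField02 n M) (x : M) :
    Bundle.TotalSpace (Euc n →L[ℝ] Euc n →L[ℝ] ℝ)
      (fun x : M => TangentSpace 𝓘(ℝ, Euc n) x →L[ℝ] TangentSpace 𝓘(ℝ, Euc n) x →L[ℝ] ℝ) :=
  Bundle.TotalSpace.mk' (Euc n →L[ℝ] Euc n →L[ℝ] ℝ) x (τ x)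

/-- In the trivialisation over the preferred chart the tensor is represented by its push-forward,
since the inverse trivialisation of the tangent bundle is the derivative of the inverse chart.
Smoothness of sections thereby becomes smoothness of components. -/
theorem inCoordinates_eq_chartPush (τ : TensorField02 n M) (x₀ : M) {y : Euc n}
    (hy : y ∈ (chartAt (Euc n) x₀).target) :
    ContinuousLinearMap.inCoordinates (Euc n) (fun x : M => TangentSpace 𝓘(ℝ, Euc n) x)
      (Euc n →L[ℝ] ℝ) (fun x : M => TangentSpace 𝓘(ℝ, Euc n) x →L[ℝ] ℝ) x₀
      ((chartAt (Euc n) x₀).symm y) x₀ ((chartAt (Euc n) x₀).symm y)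
      (τ ((chartAt (Euc n) x₀).symm y)) = chartPush τ (chartAt (Euc n) x₀) y := by
  have hx : (chartAt (Euc n) x₀).symm y ∈ (chartAt (Euc n) x₀).source :=
    (chartAt (Euc n) x₀).map_target hy
  have h1 := TangentBundle.symmL_trivializationAt (I := 𝓘(ℝ, Euc n)) (𝕜 := ℝ) hx
  have h2 : extChartAt 𝓘(ℝ, Euc n) x₀ ((chartAt (Euc n) x₀).symm y) = y := by
    simpa using (chartAt (Euc n) x₀).right_inv hy
  ext v w
  rw [inCoordinates_apply_eq₂ hx hx (mem_univ _), chartPush_apply]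
  have h3 : ∀ v : Euc n, (trivializationAt (Euc n) (TangentSpace 𝓘(ℝ, Euc n)) x₀).symm
      ((chartAt (Euc n) x₀).symm y) v =
      mfderiv 𝓘(ℝ, Euc n) 𝓘(ℝ, Euc n) (chartAt (Euc n) x₀).symm y v := by
    intro v
    rw [← Bundle.Trivialization.symmL_apply (R := ℝ), h1, h2]
    · simp only [modelWithCornersSelf_coe, range_id, mfderivWithin_univ]
      rfl
    · exact hx
  rw [h3, h3]
  simp

theorem contMDiffAt_tensorSection_iff (τ : TensorField02 n M) (x₀ : M) (r : WithTop ℕ∞) :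
    ContMDiffAt 𝓘(ℝ, Euc n) (𝓘(ℝ, Euc n).prod 𝓘(ℝ, Euc n →L[ℝ] Euc n →L[ℝ] ℝ)) r
      (tensorSection τ) x₀ ↔
    ∀ a b, ContDiffAt ℝ r (gLow τ (chartAt (Euc n) x₀) a b) (chartAt (Euc n) x₀ x₀) := by
  set e := chartAt (Euc n) x₀
  have hx0 : x₀ ∈ e.source := mem_chart_source _ _
  unfold tensorSection
  rw [Bundle.contMDiffAt_section, contMDiffAt_iff_source]
  simp only [modelWithCornersSelf_coe, range_id, contMDiffWithinAt_univ]
  have h1 : extChartAt 𝓘(ℝ, Euc n) x₀ x₀ = e x₀ := by simp [e]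
  rw [h1, contMDiffAt_iff_contDiffAt]
  have h2 : ((fun x => (trivializationAt (Euc n →L[ℝ] Euc n →L[ℝ] ℝ) (fun x : M =>
      TangentSpace 𝓘(ℝ, Euc n) x →L[ℝ] TangentSpace 𝓘(ℝ, Euc n) x →L[ℝ] ℝ) x₀
      (Bundle.TotalSpace.mk' (Euc n →L[ℝ] Euc n →L[ℝ] ℝ) x (τ x))).2) ∘
      (extChartAt 𝓘(ℝ, Euc n) x₀).symm) =ᶠ[𝓝 (e x₀)] chartPush τ e := by
    filter_upwards [e.open_target.mem_nhds (e.map_source hx0)] with y hy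
    rw [← inCoordinates_eq_chartPush τ x₀ hy]
    simp [hom_trivializationAt_apply]
  refine Iff.trans ⟨fun h => h.congr_of_eventuallyEq h2.symm, fun h => h.congr_of_eventuallyEq h2⟩ ?_
  exact contDiffAt_bilin_iff

end Charts

/-! ### Change of charts -/

section ChangeOfCharts

set_option linter.unusedSectionVars false

variable {n : ℕ} {M : Type*} [TopologicalSpace M] [ChartedSpace (Euc n) M]

/-- The tangent spaces at `x` and `x'` are distinct types that both unfold to `Euc n`; stating the
vectors in `Euc n` avoids casts along `x = x'`. -/
theorem TensorField02.congr_point (τ : TensorField02 n M) {x x' : M} (h : x = x') (v w : Euc n) :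
    τ x v w = τ x' v w := by
  subst h; rfl

theorem gLow_congr {τ τ' : TensorField02 n M} {e : Chart n M} {y : Euc n}
    (h : τ (e.symm y) = τ' (e.symm y)) (a b : Fin n) : gLow τ e a b y = gLow τ' e a b y := by
  simp only [gLow, coordMatrix, Matrix.of_apply, chartPush_apply, h]

theorem coordMatrix_congr {τ τ' : TensorField02 n M} {e : Chart n M} {y : Euc n}
    (h : τ (e.symm y) = τ' (e.symm y)) : coordMatrix τ e y = coordMatrix τ' e y := by
  ext a b
  exact gLow_congr h a b

theorem coordMatrix_isSymm {τ : TensorField02 n M} (e : Chart n M)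
    (hτ : ∀ x v w, τ x v w = τ x w v) (y : Euc n) : (coordMatrix τ e y).IsSymm := by
  ext a b
  simp only [Matrix.transpose_apply, coordMatrix, Matrix.of_apply, chartPush_apply]
  exact hτ _ _ _

theorem IsSmoothChart.restr {e : Chart n M} (he : IsSmoothChart e) {s : Set M} (hs : IsOpen s) :
    IsSmoothChart (e.restr s) := restr_mem_maximalAtlas _ he hs

variable {e e' : Chart n M}

theorem transition_symm (e e' : Chart n M) :
    (e'.symm.trans e).symm = e.symm.trans e' := by
  rw [OpenPartialHomeomorph.trans_symm_eq_symm_trans_symm, OpenPartialHomeomorph.symm_symm]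

theorem mem_transition_source {y : Euc n} :
    y ∈ (e'.symm.trans e).source ↔ y ∈ e'.target ∧ e'.symm y ∈ e.source := by
  simp

theorem symm_transition {y : Euc n} (hy : y ∈ (e'.symm.trans e).source) :
    e.symm ((e'.symm.trans e) y) = e'.symm y := e.left_inv (mem_transition_source.1 hy).2

variable [IsManifold 𝓘(ℝ, Euc n) ∞ M]

theorem IsSmoothChart.chartAt (x : M) : IsSmoothChart (chartAt (Euc n) x) :=
  IsManifold.chart_mem_maximalAtlas x

theorem contDiffOn_transition (he : IsSmoothChart e) (he' : IsSmoothChart e') :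
    ContDiffOn ℝ ∞ (e'.symm.trans e) (e'.symm.trans e).source := by
  intro y hy
  obtain ⟨h1, h2⟩ := mem_transition_source.1 hy
  have h3 : ContMDiffAt 𝓘(ℝ, Euc n) 𝓘(ℝ, Euc n) ∞ (e ∘ e'.symm) y :=
    (contMDiffAt_of_mem_maximalAtlas he h2).comp y (contMDiffAt_symm_of_mem_maximalAtlas he' h1)
  exact (contMDiffAt_iff_contDiffAt.1 h3).contDiffWithinAt

theorem isSmoothTransition (he : IsSmoothChart e) (he' : IsSmoothChart e') :
    IsSmoothTransition (e'.symm.trans e) := by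
  refine ⟨contDiffOn_transition he he', ?_⟩
  have := contDiffOn_transition he' he
  rw [← transition_symm] at this
  exact this

/-- Near `y` the inverse chart factors as `e'.symm = e.symm ∘ φ`, and the chain rule applies. -/
theorem chartPush_transition (τ : TensorField02 n M) (he : IsSmoothChart e)
    (he' : IsSmoothChart e') {y : Euc n} (hy : y ∈ (e'.symm.trans e).source) (v w : Euc n) :
    chartPush τ e' y v w = chartPush τ e ((e'.symm.trans e) y) (fderiv ℝ (e'.symm.trans e) y v)
      (fderiv ℝ (e'.symm.trans e) y w) := by
  set φ := e'.symm.trans e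
  have hφ : ContDiffAt ℝ ∞ φ y :=
    (contDiffOn_transition he he').contDiffAt (φ.open_source.mem_nhds hy)
  have hφy : φ y ∈ e.target := e.map_source (mem_transition_source.1 hy).2
  have hev : e'.symm =ᶠ[𝓝 y] e.symm ∘ φ := by
    filter_upwards [φ.open_source.mem_nhds hy] with z hz using (symm_transition hz).symm
  have h1 : MDifferentiableAt 𝓘(ℝ, Euc n) 𝓘(ℝ, Euc n) e.symm (φ y) :=
    (contMDiffAt_symm_of_mem_maximalAtlas he hφy).mdifferentiableAt (by simp)
  have h2 : MDifferentiableAt 𝓘(ℝ, Euc n) 𝓘(ℝ, Euc n) φ y :=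
    (hφ.differentiableAt (by simp)).mdifferentiableAt
  have h3 : ∀ v : Euc n, (mfderiv 𝓘(ℝ, Euc n) 𝓘(ℝ, Euc n) e'.symm y v : Euc n) =
      (mfderiv 𝓘(ℝ, Euc n) 𝓘(ℝ, Euc n) e.symm (φ y) (fderiv ℝ φ y v) : Euc n) := by
    intro v
    have h4 := mfderiv_comp_apply (I := 𝓘(ℝ, Euc n)) (I' := 𝓘(ℝ, Euc n)) (I'' := 𝓘(ℝ, Euc n))
      y h1 h2 v
    rw [mfderiv_eq_fderiv] at h4
    have h5 := hev.mfderiv_eq (I := 𝓘(ℝ, Euc n)) (I' := 𝓘(ℝ, Euc n))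
    exact (congrArg (fun L : Euc n →L[ℝ] Euc n => L v) h5).trans h4
  rw [chartPush_apply, chartPush_apply]
  refine (τ.congr_point (symm_transition hy).symm _ _).trans ?_
  exact congrArg₂ (fun v w : Euc n => τ (e.symm (φ y)) v w) (h3 v) (h3 w)

theorem fderiv_stdVec_apply {φ : Euc n → Euc n} {y : Euc n} (hφ : DifferentiableAt ℝ φ y)
    (i a : Fin n) : (fderiv ℝ φ y (stdVec i)) a = jacMat φ y i a := by
  have h3 : HasFDerivAt (fun z => φ z a)
      ((EuclideanSpace.proj (𝕜 := ℝ) a).comp (fderiv ℝ φ y)) y :=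
    (EuclideanSpace.proj (𝕜 := ℝ) a).hasFDerivAt.comp y hφ.hasFDerivAt
  simp only [jacMat, Matrix.of_apply, pderiv, h3.fderiv]
  rfl

theorem bilin_jacMat {φ : Euc n → Euc n} {y : Euc n} (hφ : DifferentiableAt ℝ φ y)
    (B : Euc n →L[ℝ] Euc n →L[ℝ] ℝ) (i j : Fin n) :
    B (fderiv ℝ φ y (stdVec i)) (fderiv ℝ φ y (stdVec j)) =
      (jacMat φ y * Matrix.of (fun a b => B (stdVec a) (stdVec b)) * (jacMat φ y).transpose) i j := by
  rw [bilin_eq_sum]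
  simp only [fderiv_stdVec_apply hφ, Matrix.mul_apply, Matrix.transpose_apply, Finset.sum_mul,
    Matrix.of_apply]
  rw [Finset.sum_comm]
  exact Finset.sum_congr rfl fun _ _ => Finset.sum_congr rfl fun _ _ => by ring

theorem coordMatrix_transition (τ : TensorField02 n M) (he : IsSmoothChart e)
    (he' : IsSmoothChart e') {y : Euc n} (hy : y ∈ (e'.symm.trans e).source) :
    coordMatrix τ e' y = jacMat (e'.symm.trans e) y * coordMatrix τ e ((e'.symm.trans e) y) *
      (jacMat (e'.symm.trans e) y).transpose := by
  have hφ : ContDiffAt ℝ ∞ (e'.symm.trans e) y :=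
    (contDiffOn_transition he he').contDiffAt ((e'.symm.trans e).open_source.mem_nhds hy)
  ext i j
  rw [coordMatrix, Matrix.of_apply, chartPush_transition τ he he' hy,
    bilin_jacMat (hφ.differentiableAt (by simp))]
  rfl

theorem jacMat_mul_symm {φ : OpenPartialHomeomorph (Euc n) (Euc n)} (hφ : IsSmoothTransition φ)
    {y : Euc n} (hy : y ∈ φ.source) : jacMat φ y * jacMat φ.symm (φ y) = 1 := by
  have h1 : DifferentiableAt ℝ φ y :=
    (hφ.smooth.contDiffAt (φ.open_source.mem_nhds hy)).differentiableAt (by simp)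
  have h2 : DifferentiableAt ℝ φ.symm (φ y) := (hφ.smooth_symm.contDiffAt
    (φ.open_target.mem_nhds (φ.map_source hy))).differentiableAt (by simp)
  ext i j
  have h3 := pderiv_comp (f := fun z => φ.symm z j) h1
    ((EuclideanSpace.proj (𝕜 := ℝ) j).differentiableAt.comp _ h2) i
  have h4 : (fun z => φ.symm (φ z) j) =ᶠ[𝓝 y] fun z => z j := by
    filter_upwards [φ.open_source.mem_nhds hy] with z hz
    rw [φ.left_inv hz]
  rw [pderiv_congr h4] at h3
  have h5 : pderiv i (fun z : Euc n => z j) y = (1 : Matrix (Fin n) (Fin n) ℝ) i j := by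
    have : HasFDerivAt (fun z : Euc n => z j) (EuclideanSpace.proj (𝕜 := ℝ) j) y :=
      (EuclideanSpace.proj (𝕜 := ℝ) j).hasFDerivAt
    rw [pderiv, this.fderiv]
    simp [stdVec, Matrix.one_apply, eq_comm]
  rw [← h5, h3]
  simp [Matrix.mul_apply, jacMat]

theorem det_jacMat_ne_zero {φ : OpenPartialHomeomorph (Euc n) (Euc n)} (hφ : IsSmoothTransition φ)
    {y : Euc n} (hy : y ∈ φ.source) : (jacMat φ y).det ≠ 0 := by
  intro h
  have := congrArg Matrix.det (jacMat_mul_symm hφ hy)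
  rw [Matrix.det_mul, h, zero_mul, Matrix.det_one] at this
  exact zero_ne_one this

theorem contDiffAt_gLow_transition {τ : TensorField02 n M} (he : IsSmoothChart e)
    (he' : IsSmoothChart e') {y : Euc n} (hy : y ∈ (e'.symm.trans e).source) {r : WithTop ℕ∞}
    (hr : r ≤ (∞ : WithTop ℕ∞)) (h : ∀ a b, ContDiffAt ℝ r (gLow τ e a b) ((e'.symm.trans e) y)) (a b : Fin n) :
    ContDiffAt ℝ r (gLow τ e' a b) y := by
  set φ := e'.symm.trans e with hφdef
  have hφ : ContDiffAt ℝ ∞ φ y :=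
    (contDiffOn_transition he he').contDiffAt (φ.open_source.mem_nhds hy)
  have hJ : ∀ i c, ContDiffAt ℝ r (fun z => jacMat φ z i c) y := fun i c =>
    (contDiffAt_jacMat hφ i c).of_le hr
  have h1 : ContDiffAt ℝ r (fun z => ∑ d, (∑ c, jacMat φ z a c * gLow τ e c d (φ z)) *
      jacMat φ z b d) y :=
    ContDiffAt.sum fun d _ => (ContDiffAt.sum fun c _ => (hJ a c).mul
      ((h c d).comp y (hφ.of_le hr))).mul (hJ b d)
  refine h1.congr_of_eventuallyEq ?_
  filter_upwards [φ.open_source.mem_nhds hy] with z hz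
  rw [gLow, coordMatrix_transition τ he he' hz]
  simp only [Matrix.mul_apply, Matrix.transpose_apply]
  rfl

/-- Regularity of a tensor field can be tested in any smooth chart. -/
theorem contMDiffAt_tensorSection_iff_chart (τ : TensorField02 n M) (he : IsSmoothChart e)
    {y : Euc n} (hy : y ∈ e.target) {r : WithTop ℕ∞} (hr : r ≤ (∞ : WithTop ℕ∞)) :
    ContMDiffAt 𝓘(ℝ, Euc n) (𝓘(ℝ, Euc n).prod 𝓘(ℝ, Euc n →L[ℝ] Euc n →L[ℝ] ℝ)) r
      (tensorSection τ) (e.symm y) ↔ ∀ a b, ContDiffAt ℝ r (gLow τ e a b) y := by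
  set x := e.symm y with hx
  have hxe : x ∈ e.source := e.map_target hy
  have hxc : x ∈ (chartAt (Euc n) x).source := mem_chart_source _ _
  rw [contMDiffAt_tensorSection_iff]
  constructor
  · intro h
    have h1 : y ∈ (e.symm.trans (chartAt (Euc n) x)).source := mem_transition_source.2 ⟨hy, hxc⟩
    exact contDiffAt_gLow_transition (IsSmoothChart.chartAt x) he h1 hr h
  · intro h
    have h1 : chartAt (Euc n) x x ∈ ((chartAt (Euc n) x).symm.trans e).source := by
      refine mem_transition_source.2 ⟨(chartAt (Euc n) x).map_source hxc, ?_⟩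
      rwa [(chartAt (Euc n) x).left_inv hxc]
    refine contDiffAt_gLow_transition he (IsSmoothChart.chartAt x) h1 hr ?_
    have h2 : ((chartAt (Euc n) x).symm.trans e) (chartAt (Euc n) x x) = y := by
      change e ((chartAt (Euc n) x).symm (chartAt (Euc n) x x)) = y
      rw [(chartAt (Euc n) x).left_inv hxc, hx, e.right_inv hy]
    rw [h2]
    exact h

theorem chartPush_chartPull (B : Euc n → Euc n →L[ℝ] Euc n →L[ℝ] ℝ) (he : IsSmoothChart e)
    {y : Euc n} (hy : y ∈ e.target) : chartPush (chartPull B e) e y = B y := by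
  have hx : e.symm y ∈ e.source := e.map_target hy
  have h1 : MDifferentiableAt 𝓘(ℝ, Euc n) 𝓘(ℝ, Euc n) e (e.symm y) :=
    (contMDiffAt_of_mem_maximalAtlas he hx).mdifferentiableAt (by simp)
  have h2 : MDifferentiableAt 𝓘(ℝ, Euc n) 𝓘(ℝ, Euc n) e.symm y :=
    (contMDiffAt_symm_of_mem_maximalAtlas he hy).mdifferentiableAt (by simp)
  have h3 : ∀ v : Euc n, mfderiv 𝓘(ℝ, Euc n) 𝓘(ℝ, Euc n) e (e.symm y)
      (mfderiv 𝓘(ℝ, Euc n) 𝓘(ℝ, Euc n) e.symm y v) = v := by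
    intro v
    have h4 := mfderiv_comp_apply (I := 𝓘(ℝ, Euc n)) (I' := 𝓘(ℝ, Euc n)) (I'' := 𝓘(ℝ, Euc n))
      y h1 h2 v
    have h5 : e ∘ e.symm =ᶠ[𝓝 y] id := by
      filter_upwards [e.open_target.mem_nhds hy] with z hz using e.right_inv hz
    have h6 := h5.mfderiv_eq (I := 𝓘(ℝ, Euc n)) (I' := 𝓘(ℝ, Euc n))
    rw [mfderiv_id] at h6
    exact h4.symm.trans (congrArg (fun L : Euc n →L[ℝ] Euc n => L v) h6)
  ext v w
  rw [chartPush_apply]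
  change B (e (e.symm y)) (mfderiv 𝓘(ℝ, Euc n) 𝓘(ℝ, Euc n) e (e.symm y)
    (mfderiv 𝓘(ℝ, Euc n) 𝓘(ℝ, Euc n) e.symm y v)) (mfderiv 𝓘(ℝ, Euc n) 𝓘(ℝ, Euc n) e (e.symm y)
    (mfderiv 𝓘(ℝ, Euc n) 𝓘(ℝ, Euc n) e.symm y w)) = _
  rw [e.right_inv hy]
  exact congrArg₂ (fun v w : Euc n => B y v w) (h3 v) (h3 w)

theorem isRegularAt_of_contMDiff {τ : TensorField02 n M} (he : IsSmoothChart e) {y : Euc n}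
    (hy : y ∈ e.target) (hτ : ∀ᶠ x in 𝓝 (e.symm y), ContMDiffAt 𝓘(ℝ, Euc n)
      (𝓘(ℝ, Euc n).prod 𝓘(ℝ, Euc n →L[ℝ] Euc n →L[ℝ] ℝ)) ∞ (tensorSection τ) x)
    (hdet : (coordMatrix τ e y).det ≠ 0) : IsRegularAt (coordMatrix τ e) y := by
  refine ⟨?_, hdet⟩
  have hc : ContinuousAt e.symm y := e.continuousAt_symm hy
  filter_upwards [hc.eventually hτ, e.open_target.mem_nhds hy] with z h1 h2
  exact (contMDiffAt_tensorSection_iff_chart τ he h2 le_rfl).1 h1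

/-- The scalar curvature can be computed in any smooth chart. -/
theorem scalarCurvature_eq_mScal {τ : TensorField02 n M} (he : IsSmoothChart e) {y : Euc n}
    (hy : y ∈ e.target) (hτ : ∀ᶠ x in 𝓝 (e.symm y), ContMDiffAt 𝓘(ℝ, Euc n)
      (𝓘(ℝ, Euc n).prod 𝓘(ℝ, Euc n →L[ℝ] Euc n →L[ℝ] ℝ)) ∞ (tensorSection τ) x)
    (hs : ∀ x v w, τ x v w = τ x w v) (hdet : (coordMatrix τ e y).det ≠ 0) :
    scalarCurvature τ (e.symm y) = mScal (coordMatrix τ e) y := by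
  set x := e.symm y with hx
  have hxe : x ∈ e.source := e.map_target hy
  have hxc : x ∈ (chartAt (Euc n) x).source := mem_chart_source _ _
  set c := chartAt (Euc n) x
  have h1 : c x ∈ (c.symm.trans e).source := by
    refine mem_transition_source.2 ⟨c.map_source hxc, ?_⟩
    rwa [c.left_inv hxc]
  have h2 : (c.symm.trans e) (c x) = y := by
    change e (c.symm (c x)) = y
    rw [c.left_inv hxc, hx, e.right_inv hy]
  have hreg : IsRegularAt (coordMatrix τ e) ((c.symm.trans e) (c x)) := by
    rw [h2]; exact isRegularAt_of_contMDiff he hy hτ hdet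
  have hT := isSmoothTransition he (IsSmoothChart.chartAt x)
  have hsrc := (c.symm.trans e).open_source.mem_nhds h1
  rw [scalarCurvature, chartScalarCurvature_eq,
    mScal_pullback hreg (Eventually.of_forall fun z => coordMatrix_isSymm e hs z)
    (φ := c.symm.trans e) (k' := coordMatrix τ c) ?_ (det_jacMat_ne_zero hT h1) ?_, h2]
  · filter_upwards [hsrc] with z hz
    exact hT.smooth.contDiffAt ((c.symm.trans e).open_source.mem_nhds hz)
  · filter_upwards [hsrc] with z hz
    exact coordMatrix_transition τ he (IsSmoothChart.chartAt x) hz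

end ChangeOfCharts

/-! ### Limits of curvature expressions -/

section CurvatureLimits

variable {n : ℕ} {P Q : ℝ≥0∞}

theorem conv_sum {ι : Type*} (s : Finset ι) {f : ι → Euc n → ℝ} {σ : Euc n → ℝ}
    (hf : ∀ i ∈ s, LocallyIntegrable (f i)) (hσ : Continuous σ) (hs : HasCompactSupport σ)
    (x : Euc n) : conv (fun y => ∑ i ∈ s, f i y) σ x = ∑ i ∈ s, conv (f i) σ x := by
  simp only [conv_apply_swap, Finset.sum_mul]
  exact integral_finsetSum _ fun i hi => conv_integrand_integrable (hf i hi) hσ hs x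

theorem conv_add {f g σ : Euc n → ℝ} (hf : LocallyIntegrable f) (hg : LocallyIntegrable g)
    (hσ : Continuous σ) (hs : HasCompactSupport σ) (x : Euc n) :
    conv (fun y => f y + g y) σ x = conv f σ x + conv g σ x := by
  simp only [conv_apply_swap, add_mul]
  exact integral_add (conv_integrand_integrable hf hσ hs x) (conv_integrand_integrable hg hσ hs x)

theorem conv_eq_zero {u σ : Euc n → ℝ} {δ : ℝ} (hσ : ∀ w, σ w ≠ 0 → ‖w‖ ≤ δ) {z : Euc n}
    (hz : z ∉ Metric.cthickening δ (tsupport u)) : conv u σ z = 0 := by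
  rw [conv_apply]
  refine integral_eq_zero_of_ae (Eventually.of_forall fun y => ?_)
  by_cases hu : u y = 0
  · simp [hu]
  by_cases hs : σ (z - y) = 0
  · simp [hs]
  refine absurd (Metric.mem_cthickening_of_dist_le z y δ _ (subset_tsupport _ hu) ?_) hz
  rw [dist_eq_norm]
  exact hσ _ hs

variable {ρ : Euc n → ℝ}

theorem IsMollifier.scale_pderiv_norm_le (hρ : IsMollifier ρ) {ε : ℝ} (hε : 0 < ε) {r : Fin n}
    {w : Euc n} (hw : pderiv r (scaleKernel ρ ε) w ≠ 0) : ‖w‖ ≤ ε := by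
  have h1 : tsupport (scaleKernel ρ ε) ⊆ Metric.closedBall 0 ε :=
    closure_minimal (fun y hy => by simpa using hρ.scale_norm_le hε hy) Metric.isClosed_closedBall
  simpa using h1 (tsupport_pderiv_subset (subset_tsupport _ hw))

/-- The derivative in direction `t` of the principal symbol. -/
def dsymb (G : Fin n → Fin n → ℝ) (dG : Fin n → Fin n → Fin n → ℝ) (t r s c d : Fin n) : ℝ :=
  dG t s c * G r d + G s c * dG t r d - (dG t r s * G c d + G r s * dG t c d)

/-- The terms of lower order in `η R - A ∂² (η k)`. -/
def lowTerms (G : Fin n → Fin n → ℝ) (dG dk : Fin n → Fin n → Fin n → ℝ) (k : Fin n → Fin n → ℝ)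
    (e : ℝ) (de : Fin n → ℝ) (dde : Fin n → Fin n → ℝ) : ℝ :=
  ∑ r, ∑ s, ∑ c, ∑ d, (e * dsymb G dG r r s c d * dk s c d -
    symb G r s c d * (dde r s * k c d + de s * dk r c d + de r * dk s c d)) + algF G dG dk * e

theorem mUp_symm {k : Euc n → Matrix (Fin n) (Fin n) ℝ} {y : Euc n} (h : (k y).IsSymm)
    (a b : Fin n) : mUp k a b y = mUp k b a y := by
  have : ((k y)⁻¹).IsSymm := by rw [Matrix.IsSymm, Matrix.transpose_nonsing_inv, h.eq]
  exact (this.apply a b).symm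

/-- The curvature term `A ∂² w`. -/
def symbD2 (k : Euc n → Matrix (Fin n) (Fin n) ℝ) (w : Fin n → Fin n → Euc n → ℝ) (y : Euc n) : ℝ :=
  ∑ r, ∑ s, ∑ c, ∑ d, symb (fun a b => mUp k a b y) r s c d * pderiv r (pderiv s (w c d)) y

/-- Insert `V = A ∂k` into `R = div V + F` and expand `∂²(η k)`. The terms `η A ∂²k` cancel, so no
second derivative of the metric is left. -/
theorem sub_symbD2_eq_lowTerms {k : Euc n → Matrix (Fin n) (Fin n) ℝ} {y : Euc n}
    (hk : IsRegularAt k y) (hs : ∀ᶠ z in 𝓝 y, (k z).IsSymm) {η : Euc n → ℝ}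
    (hη : ContDiff ℝ ∞ η) :
    η y * mScal k y - symbD2 k (fun c d z => η z * k z c d) y =
      lowTerms (fun a b => mUp k a b y) (fun c a b => pderiv c (mUp k a b) y)
        (fun c a b => mDeriv k c a b y) (k y) (η y) (fun r => pderiv r η y)
        (fun r s => pderiv r (pderiv s η) y) := by
  have dU : ∀ a b, DifferentiableAt ℝ (mUp k a b) y := fun a b =>
    (hk.up a b).differentiableAt (by simp)
  have dS : ∀ r s c d, DifferentiableAt ℝ (fun z => symb (fun a b => mUp k a b z) r s c d) y :=
    fun r s c d => ((dU s c).mul (dU r d)).sub ((dU r s).mul (dU c d))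
  have eS : ∀ r s c d, pderiv r (fun z => symb (fun a b => mUp k a b z) r s c d) y =
      dsymb (fun a b => mUp k a b y) (fun c a b => pderiv c (mUp k a b) y) r r s c d := by
    intro r s c d
    simp only [symb, dsymb]
    have d1 : DifferentiableAt ℝ (fun z => mUp k s c z * mUp k r d z) y := (dU s c).mul (dU r d)
    have d2 : DifferentiableAt ℝ (fun z => mUp k r s z * mUp k c d z) y := (dU r s).mul (dU c d)
    rw [pderiv_sub d1 d2, pderiv_mul (dU s c) (dU r d), pderiv_mul (dU r s) (dU c d)]
  have dD : ∀ s c d, DifferentiableAt ℝ (mDeriv k s c d) y := fun s c d =>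
    (hk.deriv s c d).differentiableAt (by simp)
  have hV : ∀ r, pderiv r (fun z => algV (fun a b => mUp k a b z)
      (fun c a b => mDeriv k c a b z) r) y = ∑ s, ∑ c, ∑ d,
      (dsymb (fun a b => mUp k a b y) (fun c a b => pderiv c (mUp k a b) y) r r s c d *
        mDeriv k s c d y + symb (fun a b => mUp k a b y) r s c d * pderiv r (mDeriv k s c d) y) := by
    intro r
    have h1 : (fun z => algV (fun a b => mUp k a b z) (fun c a b => mDeriv k c a b z) r) =ᶠ[𝓝 y]
        fun z => ∑ s, ∑ c, ∑ d, symb (fun a b => mUp k a b z) r s c d * mDeriv k s c d z := by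
      filter_upwards [hs] with z hz
      exact algV_eq_symb (mUp_symm hz) r
    have d1 : ∀ s c d, DifferentiableAt ℝ
        (fun z => symb (fun a b => mUp k a b z) r s c d * mDeriv k s c d z) y :=
      fun s c d => (dS r s c d).mul (dD s c d)
    rw [pderiv_congr h1, pderiv_sum _ fun s _ => DifferentiableAt.fun_sum fun c _ =>
      DifferentiableAt.fun_sum fun d _ => d1 s c d]
    refine Finset.sum_congr rfl fun s _ => ?_
    rw [pderiv_sum _ fun c _ => DifferentiableAt.fun_sum fun d _ => d1 s c d]
    refine Finset.sum_congr rfl fun c _ => ?_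
    rw [pderiv_sum _ fun d _ => d1 s c d]
    refine Finset.sum_congr rfl fun d _ => ?_
    rw [pderiv_mul (dS r s c d) (dD s c d), eS]
  have hη1 : ∀ z, DifferentiableAt ℝ η z := fun z => hη.differentiable (by simp) z
  have h2 : ∀ r s c d, pderiv r (pderiv s fun z => η z * k z c d) y =
      pderiv r (pderiv s η) y * k y c d + pderiv s η y * mDeriv k r c d y +
      (pderiv r η y * mDeriv k s c d y + η y * pderiv r (mDeriv k s c d) y) := by
    intro r s c d
    have h1 : (pderiv s fun z => η z * k z c d) =ᶠ[𝓝 y] fun z =>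
        pderiv s η z * k z c d + η z * mDeriv k s c d z := by
      filter_upwards [hk.eventually] with z hz
      exact pderiv_mul (hη1 z) ((hz.smooth c d).differentiableAt (by simp))
    have d0 : DifferentiableAt ℝ (pderiv s η) y :=
      (contDiff_pderiv hη).differentiable (by simp) y
    have d1 : DifferentiableAt ℝ (fun z => pderiv s η z * k z c d) y := d0.mul (hk.diffMat c d)
    have d2 : DifferentiableAt ℝ (fun z => η z * mDeriv k s c d z) y := (hη1 y).mul (dD s c d)
    rw [pderiv_congr h1, pderiv_add d1 d2, pderiv_mul d0 (hk.diffMat c d),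
      pderiv_mul (hη1 y) (dD s c d)]
    rfl
  rw [mScal_eq_div hk]
  unfold symbD2 lowTerms
  simp only [hV, h2]
  rw [mul_add, Finset.mul_sum, add_sub_right_comm, ← Finset.sum_sub_distrib, mul_comm (η y) (algF _ _ _)]
  congr 1
  refine Finset.sum_congr rfl fun r _ => ?_
  simp only [Finset.mul_sum, ← Finset.sum_sub_distrib]
  refine Finset.sum_congr rfl fun s _ => Finset.sum_congr rfl fun c _ =>
    Finset.sum_congr rfl fun d _ => ?_
  ring

/-- A family of smooth metrics on `ℝⁿ` converging, with its inverses, in `C⁰ ∩ W^{1,P}`. -/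
structure MetricConv (P : ℝ≥0∞) (k : ℝ → Euc n → Matrix (Fin n) (Fin n) ℝ)
    (κ : Euc n → Matrix (Fin n) (Fin n) ℝ) (κ' γ' : Fin n → Fin n → Fin n → Euc n → ℝ) : Prop where
  low : ∀ a b, SobConv P (fun ε y => k ε y a b) (fun y => κ y a b) (fun c => κ' c a b)
  up : ∀ a b, SobConv P (fun ε => mUp (k ε) a b) (mUp κ a b) (fun c => γ' c a b)
  symm : ∀ᶠ ε in 𝓝[>] (0 : ℝ), ∀ y, (k ε y).IsSymm
  symm_lim : ∀ y, (κ y).IsSymm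
  det_ne : ∀ᶠ ε in 𝓝[>] (0 : ℝ), ∀ y, (k ε y).det ≠ 0

namespace MetricConv

variable {k : ℝ → Euc n → Matrix (Fin n) (Fin n) ℝ} {κ : Euc n → Matrix (Fin n) (Fin n) ℝ}
  {κ' γ' : Fin n → Fin n → Fin n → Euc n → ℝ}

theorem regular (h : MetricConv P k κ κ' γ') :
    ∀ᶠ ε in 𝓝[>] (0 : ℝ), ∀ y, IsRegularAt (k ε) y := by
  have h1 : ∀ᶠ ε in 𝓝[>] (0 : ℝ), ∀ a b, ContDiff ℝ ∞ (fun y => k ε y a b) :=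
    eventually_all.2 fun a => eventually_all.2 fun b => (h.low a b).smooth
  filter_upwards [h1, h.det_ne] with ε h2 h3 y
  exact ⟨Eventually.of_forall fun z a b => (h2 a b).contDiffAt, h3 y⟩

theorem symb (hP : 1 ≤ P) (h : MetricConv P k κ κ' γ') (r s c d : Fin n) :
    SobConv P (fun ε y => LowRegPMT.symb (fun a b => mUp (k ε) a b y) r s c d)
      (fun y => LowRegPMT.symb (fun a b => mUp κ a b y) r s c d)
      (fun t y => dsymb (fun a b => mUp κ a b y) (fun c a b => γ' c a b y) t r s c d) :=
  ((h.up s c).mul hP (h.up r d)).sub hP ((h.up r s).mul hP (h.up c d))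

theorem christoffel (hP : 1 ≤ P) (h : MetricConv P k κ κ' γ') (m i j : Fin n) :
    LpTo P (fun ε y => LowRegPMT.christoffel (fun a b => mUp (k ε) a b y)
      (fun c a b => mDeriv (k ε) c a b y) m i j)
      (fun y => LowRegPMT.christoffel (fun a b => mUp κ a b y) (fun c a b => κ' c a b y) m i j) :=
  LpTo.const_mul hP _ (LpTo.sum hP _ fun l _ => (h.up m l).unif.bdd_mul hP
    ((((h.low j l).deriv i).add hP ((h.low i l).deriv j)).sub hP ((h.low i j).deriv l)))

theorem algV (hP : 1 ≤ P) (h : MetricConv P k κ κ' γ') (r : Fin n) :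
    LpTo P (fun ε y => LowRegPMT.algV (fun a b => mUp (k ε) a b y)
      (fun c a b => mDeriv (k ε) c a b y) r)
      (fun y => LowRegPMT.algV (fun a b => mUp κ a b y) (fun c a b => κ' c a b y) r) :=
  LpTo.sum hP _ fun i _ => LpTo.sum hP _ fun j _ =>
    ((h.up i j).unif.bdd_mul hP (h.christoffel hP r i j)).sub hP
      ((h.up i r).unif.bdd_mul hP (h.christoffel hP j i j))

/-- Every summand is a bounded, uniformly convergent factor times two first-order factors that
converge in `L^P`; their product converges in `L^Q` because `Q = P / 2`. -/
theorem algF [e : ExponentPair P Q] (h : MetricConv P k κ κ' γ') :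
    LpTo Q (fun ε y => LowRegPMT.algF (fun a b => mUp (k ε) a b y)
      (fun c a b => pderiv c (mUp (k ε) a b) y) (fun c a b => mDeriv (k ε) c a b y))
      (fun y => LowRegPMT.algF (fun a b => mUp κ a b y) (fun c a b => γ' c a b y)
        (fun c a b => κ' c a b y)) := by
  have hP : 1 ≤ P := e.one_le'
  have hQ := e.one_le
  have hc := h.christoffel hP
  refine LpTo.add hQ (LpTo.sum hQ _ fun i _ => LpTo.sum hQ _ fun j _ => LpTo.sum hQ _ fun m _ =>
    LpTo.add hQ (LpTo.neg ?_) ?_) (LpTo.sum hQ _ fun i _ => LpTo.sum hQ _ fun j _ =>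
    LpTo.sum hQ _ fun m _ => LpTo.sum hQ _ fun l _ => LpTo.sub hQ ?_ ?_)
  · exact ((h.up i j).deriv m).mul_half (hc m i j)
  · exact ((h.up i j).deriv j).mul_half (hc m i m)
  · exact ((h.up i j).unif.bdd_mul hP (hc m i j)).mul_half (hc l l m)
  · exact ((h.up i j).unif.bdd_mul hP (hc m i l)).mul_half (hc l j m)

theorem lowTerms [e : ExponentPair P Q] (h : MetricConv P k κ κ' γ') {η : Euc n → ℝ}
    (hη : ContDiff ℝ ∞ η) (hs : HasCompactSupport η) :
    LpTo Q (fun ε y => LowRegPMT.lowTerms (fun a b => mUp (k ε) a b y)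
      (fun c a b => pderiv c (mUp (k ε) a b) y) (fun c a b => mDeriv (k ε) c a b y) (k ε y) (η y)
      (fun r => pderiv r η y) (fun r s => pderiv r (pderiv s η) y))
      (fun y => LowRegPMT.lowTerms (fun a b => mUp κ a b y) (fun c a b => γ' c a b y)
        (fun c a b => κ' c a b y) (κ y) (η y)
        (fun r => pderiv r η y) (fun r s => pderiv r (pderiv s η) y)) := by
  have hP : 1 ≤ P := e.one_le'
  have hQ := e.one_le
  have hq : ∀ (q : ℝ≥0∞) {f : Euc n → ℝ}, ContDiff ℝ ∞ f → HasCompactSupport f →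
      LpTo q (fun _ => f) f := fun q f hf hfs =>
    LpTo.const (MemLp.of_continuous_compact hf.continuous hfs)
  have hd : ∀ r, ContDiff ℝ ∞ (pderiv r η) := fun r => contDiff_pderiv hη
  have hds : ∀ r, HasCompactSupport (pderiv r η) := fun r => hasCompactSupport_pderiv hs
  have hz : ∀ r, ∀ y ∉ tsupport (pderiv r η), pderiv r η y = 0 := fun r y hy =>
    image_eq_zero_of_notMem_tsupport hy
  -- Terms with a single derivative of the metric converge in `L^P`; the compact support of `∂η`
  -- brings them down to `L^Q`.
  have h1 : ∀ s r c d, LpTo Q (fun ε y => pderiv s η y * mDeriv (k ε) r c d y)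
      (fun y => pderiv s η y * κ' r c d y) := fun s r c d =>
    ((hq ⊤ (hd s) (hds s)).bdd_mul hP ((h.low c d).deriv r)).mono_exponent e.le
      (hds s).isCompact (Eventually.of_forall fun ε y hy => by simp [hz s y hy])
      (fun y hy => by simp [hz s y hy])
  refine LpTo.add hQ (LpTo.sum hQ _ fun r _ => LpTo.sum hQ _ fun s _ => LpTo.sum hQ _ fun c _ =>
    LpTo.sum hQ _ fun d _ => LpTo.sub hQ ?_ ((h.symb hP r s c d).unif.bdd_mul hQ
    (LpTo.add hQ (LpTo.add hQ ?_ (h1 s r c d)) (h1 r s c d)))) ?_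
  · exact ((hq ⊤ hη hs).bdd_mul hP ((h.symb hP r s c d).deriv r)).congr
      (by
        filter_upwards [h.regular] with ε hε
        refine Eventually.of_forall fun y => ?_
        have dU : ∀ a b, DifferentiableAt ℝ (mUp (k ε) a b) y := fun a b =>
          ((hε y).up a b).differentiableAt (by simp)
        have d1 : DifferentiableAt ℝ (fun z => mUp (k ε) s c z * mUp (k ε) r d z) y :=
          (dU s c).mul (dU r d)
        have d2 : DifferentiableAt ℝ (fun z => mUp (k ε) r s z * mUp (k ε) c d z) y :=
          (dU r s).mul (dU c d)
        simp only [LowRegPMT.symb, dsymb]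
        rw [pderiv_sub d1 d2, pderiv_mul (dU s c) (dU r d), pderiv_mul (dU r s) (dU c d)])
      (ae_eq_refl _) |>.mul_half ((h.low c d).deriv s)
  · have h2 := (h.low c d).unif.bdd_mul hQ (hq Q (contDiff_pderiv (hd s))
      (hasCompactSupport_pderiv (hds s)) (f := pderiv r (pderiv s η)))
    simpa only [mul_comm] using h2
  · have h2 := (hq ⊤ hη hs).bdd_mul hQ (h.algF (Q := Q))
    simpa only [mul_comm] using h2

theorem sub_symbD2 [e : ExponentPair P Q] (h : MetricConv P k κ κ' γ') {η : Euc n → ℝ}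
    (hη : ContDiff ℝ ∞ η) (hs : HasCompactSupport η) :
    LpTo Q (fun ε y => η y * mScal (k ε) y - symbD2 (k ε) (fun c d z => η z * k ε z c d) y)
      (fun y => LowRegPMT.lowTerms (fun a b => mUp κ a b y) (fun c a b => γ' c a b y)
        (fun c a b => κ' c a b y) (κ y) (η y)
        (fun r => pderiv r η y) (fun r s => pderiv r (pderiv s η) y)) := by
  refine (h.lowTerms hη hs).congr_left ?_
  filter_upwards [h.regular, h.symm] with ε h1 h2 y
  exact (sub_symbD2_eq_lowTerms (h1 y) (Eventually.of_forall h2) hη).symm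

end MetricConv

end CurvatureLimits

/-! ### Comparison of curvatures -/

section CurvatureComparison

variable {n : ℕ} {P Q : ℝ≥0∞}

/-- For a test function `φ` supported in `U` the product `φ u` is smooth with compact support, so
its derivative integrates to zero. Hence the classical derivative is also a weak one on `U`. -/
theorem HasWeakPartial.ae_eq_pderiv {U : Set (Euc n)} (hU : IsOpen U) {u v : Euc n → ℝ} {k : Fin n}
    (hu : ContDiffOn ℝ ∞ u U) (h : HasWeakPartial k u v) (hv : LocallyIntegrable v) :
    ∀ᵐ y, y ∈ U → v y = pderiv k u y := by
  refine ae_eq_of_weak_partial hU (hv.locallyIntegrableOn U)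
    ((contDiffOn_pderiv hU hu).continuousOn.locallyIntegrableOn hU.measurableSet)
    fun φ hφ hs ht => ?_
  have h1 := h φ hφ hs
  have h2 : ContDiff ℝ ∞ fun y => φ y * u y := contDiff_mul_of_tsupport hU hφ ht hu
  have h3 := integral_pderiv_eq_zero (k := k) h2 hs.mul_right
  have h4 : ∀ y, pderiv k (fun y => φ y * u y) y = u y * pderiv k φ y + pderiv k u y * φ y := by
    intro y
    by_cases hy : y ∈ tsupport φ
    · rw [pderiv_mul (hφ.differentiable (by simp) y)
        ((hu.contDiffAt (hU.mem_nhds (ht hy))).differentiableAt (by simp))]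
      ring
    · have h0 : φ =ᶠ[𝓝 y] fun _ => 0 := notMem_tsupport_iff_eventuallyEq.1 hy
      have h5 : (fun y => φ y * u y) =ᶠ[𝓝 y] fun _ => 0 := by
        filter_upwards [h0] with z hz; simp [hz]
      rw [pderiv_congr h5, pderiv_congr h0, pderiv_const, h0.self_of_nhds]; simp
  have i2 : Integrable fun y => pderiv k u y * φ y := by
    have : Continuous fun y => φ y * pderiv k u y :=
      (contDiff_mul_of_tsupport hU hφ ht (contDiffOn_pderiv hU hu)).continuous
    simpa only [mul_comm] using this.integrable_of_hasCompactSupport hs.mul_right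
  have i1 : Integrable fun y => u y * pderiv k φ y := by
    have : Continuous fun y => pderiv k φ y * u y :=
      (contDiff_mul_of_tsupport hU (contDiff_pderiv hφ) (tsupport_pderiv_subset.trans ht)
        hu).continuous
    simpa only [mul_comm] using
      this.integrable_of_hasCompactSupport (hasCompactSupport_pderiv hs).mul_right
  simp only [h4] at h3
  rw [integral_add i1 i2, h1] at h3
  linarith

theorem symbD2_sub {k : Euc n → Matrix (Fin n) (Fin n) ℝ} {v w : Fin n → Fin n → Euc n → ℝ}
    (hv : ∀ c d, ContDiff ℝ ∞ (v c d)) (hw : ∀ c d, ContDiff ℝ ∞ (w c d)) (y : Euc n) :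
    symbD2 k (fun c d z => v c d z - w c d z) y = symbD2 k v y - symbD2 k w y := by
  simp only [symbD2, ← Finset.sum_sub_distrib]
  refine Finset.sum_congr rfl fun r _ => Finset.sum_congr rfl fun s _ =>
    Finset.sum_congr rfl fun c _ => Finset.sum_congr rfl fun d _ => ?_
  have h1 : pderiv s (fun z => v c d z - w c d z) = fun z => pderiv s (v c d) z - pderiv s (w c d) z :=
    funext fun z => pderiv_sub ((hv c d).differentiable (by simp) z)
      ((hw c d).differentiable (by simp) z)
  rw [h1, pderiv_sub ((contDiff_pderiv (hv c d)).differentiable (by simp) y)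
    ((contDiff_pderiv (hw c d)).differentiable (by simp) y), mul_sub]

namespace MetricConv

variable {k : ℝ → Euc n → Matrix (Fin n) (Fin n) ℝ} {κ : Euc n → Matrix (Fin n) (Fin n) ℝ}
  {κ' γ' : Fin n → Fin n → Fin n → Euc n → ℝ}

/-- Near the support of `θ` the limit metric is smooth, so the limit gradients agree a.e. with the
classical ones and the pointwise identity for smooth metrics applies. Off the support both sides
vanish. -/
theorem sub_limit_eq_lowTerms (hP : 1 ≤ P) (h : MetricConv P k κ κ' γ') {θ : Euc n → ℝ}
    (hθ : ContDiff ℝ ∞ θ) (hκ : ∀ y ∈ tsupport θ, IsRegularAt κ y) :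
    (fun y => LowRegPMT.lowTerms (fun a b => mUp κ a b y) (fun c a b => γ' c a b y)
        (fun c a b => κ' c a b y) (κ y) (θ y)
        (fun r => pderiv r θ y) (fun r s => pderiv r (pderiv s θ) y)) =ᵐ[volume]
      fun y => θ y * mScal κ y - symbD2 κ (fun c d z => θ z * κ z c d) y := by
  set U : Set (Euc n) := {y | IsRegularAt κ y} with hUdef
  have hU : IsOpen U := isOpen_iff_mem_nhds.2 fun y hy => IsRegularAt.eventually hy
  have e1 : ∀ᵐ y, ∀ c a b, y ∈ U → κ' c a b y = mDeriv κ c a b y := by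
    refine ae_all_iff.2 fun c => ae_all_iff.2 fun a => ae_all_iff.2 fun b => ?_
    exact HasWeakPartial.ae_eq_pderiv hU
      (fun y hy => (IsRegularAt.smooth hy a b).contDiffWithinAt)
      ((h.low a b).hasWeakPartial hP c) (((h.low a b).deriv c).memLp.locallyIntegrable hP)
  have e2 : ∀ᵐ y, ∀ c a b, y ∈ U → γ' c a b y = pderiv c (mUp κ a b) y := by
    refine ae_all_iff.2 fun c => ae_all_iff.2 fun a => ae_all_iff.2 fun b => ?_
    exact HasWeakPartial.ae_eq_pderiv hU
      (fun y hy => (IsRegularAt.up hy a b).contDiffWithinAt)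
      ((h.up a b).hasWeakPartial hP c) (((h.up a b).deriv c).memLp.locallyIntegrable hP)
  filter_upwards [e1, e2] with y h1 h2
  by_cases hy : y ∈ tsupport θ
  · have hyU : y ∈ U := hκ y hy
    rw [sub_symbD2_eq_lowTerms (hκ y hy) (Eventually.of_forall h.symm_lim) hθ]
    simp only [h1 _ _ _ hyU, h2 _ _ _ hyU]
  · have h0 : θ =ᶠ[𝓝 y] fun _ => 0 := notMem_tsupport_iff_eventuallyEq.1 hy
    have hz : ∀ r, pderiv r θ =ᶠ[𝓝 y] fun _ => 0 := fun r => by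
      filter_upwards [h0.eventually_nhds] with z hz
      rw [pderiv_congr hz, pderiv_const]
    have hw : ∀ r s c d, pderiv r (pderiv s fun z => θ z * κ z c d) y = 0 := by
      intro r s c d
      have h3 : (pderiv s fun z => θ z * κ z c d) =ᶠ[𝓝 y] fun _ => 0 := by
        filter_upwards [h0.eventually_nhds] with z hz
        have : (fun z => θ z * κ z c d) =ᶠ[𝓝 z] fun _ => 0 := by
          filter_upwards [hz] with x hx; simp [hx]
        rw [pderiv_congr this, pderiv_const]
      rw [pderiv_congr h3, pderiv_const]
    have hz2 : ∀ r s, pderiv r (pderiv s θ) y = 0 := fun r s => by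
      rw [pderiv_congr (hz s), pderiv_const]
    unfold LowRegPMT.lowTerms symbD2
    simp only [hw, hz2, h0.self_of_nhds, (hz _).self_of_nhds]
    simp

/-- Convergence of the scalar curvature, up to principal terms, where the limit is smooth. -/
theorem local_smooth [e : ExponentPair P Q] (h : MetricConv P k κ κ' γ') {θ : Euc n → ℝ}
    (hθ : ContDiff ℝ ∞ θ) (hs : HasCompactSupport θ) (hκ : ∀ y ∈ tsupport θ, IsRegularAt κ y) :
    LpTo Q (fun ε y => θ y * (mScal (k ε) y - mScal κ y) -
      symbD2 (k ε) (fun c d z => θ z * k ε z c d - θ z * κ z c d) y) (fun _ => 0) := by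
  have hP : 1 ≤ P := e.one_le'
  have hQ := e.one_le
  have h1 := h.sub_symbD2 (Q := Q) hθ hs
  have h2 := (LpTo.const h1.memLp).congr (Eventually.of_forall fun _ =>
    h.sub_limit_eq_lowTerms hP hθ hκ) (ae_eq_refl _)
  set U : Set (Euc n) := {y | IsRegularAt κ y} with hUdef
  have hU : IsOpen U := isOpen_iff_mem_nhds.2 fun y hy => IsRegularAt.eventually hy
  have hκθ : ∀ c d, ContDiff ℝ ∞ fun z => θ z * κ z c d := fun c d =>
    contDiff_mul_of_tsupport hU hθ hκ fun y hy => (IsRegularAt.smooth hy c d).contDiffWithinAt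
  have hκθs : ∀ c d, HasCompactSupport fun z => θ z * κ z c d := fun c d => hs.mul_right
  -- The functions `∂²(θ κ)` are fixed, smooth and compactly supported, so uniform convergence of
  -- the symbol is enough; the coefficient of the principal term may be `k ε` instead of `κ`.
  have h3 : LpTo Q (fun ε y => symbD2 (k ε) (fun c d z => θ z * κ z c d) y)
      (fun y => symbD2 κ (fun c d z => θ z * κ z c d) y) :=
    LpTo.sum hQ _ fun r _ => LpTo.sum hQ _ fun s _ => LpTo.sum hQ _ fun c _ =>
      LpTo.sum hQ _ fun d _ => (h.symb hP r s c d).unif.bdd_mul hQ (LpTo.const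
        (MemLp.of_continuous_compact (contDiff_pderiv (contDiff_pderiv (hκθ c d))).continuous
        (hasCompactSupport_pderiv (hasCompactSupport_pderiv (hκθs c d)))))
  have h4 := LpTo.const h3.memLp
  refine (((h1.sub hQ h2).add hQ h3).sub hQ h4).congr ?_ (Eventually.of_forall fun y => by simp)
  filter_upwards [h.regular] with ε hε
  refine Eventually.of_forall fun y => ?_
  have h5 : ∀ c d, ContDiff ℝ ∞ fun z => θ z * k ε z c d := fun c d =>
    hθ.mul (contDiff_iff_contDiffAt.2 fun z => (hε z).smooth c d)
  beta_reduce
  rw [symbD2_sub h5 hκθ]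
  ring

end MetricConv

/-- The mollified density `∑ᵣ (η V^r) * ∂ᵣρ_ε + (-V^r ∂ᵣη + F η) * ρ_ε`. -/
def mollifiedCurvature (ρ η : Euc n → ℝ) (V : Fin n → Euc n → ℝ) (F : Euc n → ℝ) (ε : ℝ)
    (z : Euc n) : ℝ :=
  ∑ r, conv (fun y => η y * V r y) (pderiv r (scaleKernel ρ ε)) z +
    conv (fun y => -(∑ r, V r y * pderiv r η y) + F y * η y) (scaleKernel ρ ε) z

variable {ρ : Euc n → ℝ}

/-- The derivative moves from the kernel to `w`, leaving the mollification of an `L^P` function.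
Compact support then lowers the exponent to `Q`. -/
theorem LpTo.conv_pderiv_of_sobolev [e : ExponentPair P Q] (hρ : IsMollifier ρ) {F : ℝ → Euc n → ℝ}
    {w : Euc n → ℝ} {w' : Fin n → Euc n → ℝ} (hw : SobConv P F w w') (hs : HasCompactSupport w)
    (r : Fin n) : LpTo Q (fun ε => conv w (pderiv r (scaleKernel ρ ε))) (w' r) := by
  have hP : 1 ≤ P := e.one_le'
  have h1 := SobConv.conv hρ hP e.ne_top hw.cont hs (fun k => (hw.deriv k).memLp)
    (fun k => hw.hasWeakPartial hP k)
  -- The weak derivative vanishes off the support of `w` only almost everywhere. It is replaced by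
  -- its indicator, since lowering the exponent asks for exact vanishing outside a compact set.
  have hw0 : ∀ᵐ y, y ∈ (tsupport w)ᶜ → w' r y = 0 := by
    have h2 : ContDiffOn ℝ ∞ w (tsupport w)ᶜ := fun y hy =>
      ((contDiffAt_const (c := (0:ℝ))).congr_of_eventuallyEq
        (notMem_tsupport_iff_eventuallyEq.1 hy)).contDiffWithinAt
    filter_upwards [HasWeakPartial.ae_eq_pderiv (isClosed_tsupport w).isOpen_compl h2
      (hw.hasWeakPartial hP r) ((hw.deriv r).memLp.locallyIntegrable hP)] with y hy hy'
    have h0 : w =ᶠ[𝓝 y] fun _ => 0 := notMem_tsupport_iff_eventuallyEq.1 hy'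
    rw [hy hy', pderiv_congr h0, pderiv_const]
  set S := Metric.cthickening 1 (tsupport w)
  have hS : IsCompact S := hs.isCompact.cthickening
  have hTS : tsupport w ⊆ S := Metric.self_subset_cthickening _
  have h3 : LpTo P (fun ε => conv w (pderiv r (scaleKernel ρ ε)))
      ((tsupport w).indicator (w' r)) := by
    refine (h1.deriv r).congr ?_ ?_
    · filter_upwards [self_mem_nhdsWithin] with ε hε
      rw [pderiv_conv hw.cont.locallyIntegrable (hρ.scale_contDiff ε) (hρ.scale_compact hε)]
    · filter_upwards [hw0] with y hy
      by_cases h : y ∈ tsupport w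
      · rw [indicator_of_mem h]
      · rw [indicator_of_notMem h, hy h]
  refine (h3.mono_exponent e.le hS ?_ fun y hy => ?_).congr (Eventually.of_forall fun _ =>
    ae_eq_refl _) ?_
  · filter_upwards [tendsto_scaleKernel_radius 1 one_pos, self_mem_nhdsWithin] with ε h4 hε y hy
    exact conv_eq_zero (δ := 1) (fun v hv => (hρ.scale_pderiv_norm_le hε hv).trans
      (by linarith)) hy
  · exact indicator_of_notMem (fun h => hy (hTS h)) _
  · filter_upwards [hw0] with y hy
    by_cases h : y ∈ tsupport w
    · rw [indicator_of_mem h]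
    · rw [indicator_of_notMem h, hy h]

namespace MetricConv

variable {k : ℝ → Euc n → Matrix (Fin n) (Fin n) ℝ} {κ : Euc n → Matrix (Fin n) (Fin n) ℝ}
  {κ' γ' : Fin n → Fin n → Fin n → Euc n → ℝ}

/-- The localised curvature, its mollification, and the principal terms of the difference. -/
theorem sub_mollifiedCurvature [e : ExponentPair P Q] (hρ : IsMollifier ρ)
    (h : MetricConv P k κ κ' γ') {η : Euc n → ℝ} (hη : ContDiff ℝ ∞ η) (hs : HasCompactSupport η) :
    LpTo Q (fun ε y => η y * mScal (k ε) y - mollifiedCurvature ρ η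
      (fun r y => LowRegPMT.algV (fun a b => mUp κ a b y) (fun c a b => κ' c a b y) r)
      (fun y => LowRegPMT.algF (fun a b => mUp κ a b y) (fun c a b => γ' c a b y)
        (fun c a b => κ' c a b y)) ε y -
      symbD2 (k ε) (fun c d z => η z * k ε z c d -
        conv (fun y => η y * κ y c d) (scaleKernel ρ ε) z) y) (fun _ => 0) := by
  have hP : 1 ≤ P := e.one_le'
  have hQ := e.one_le
  have hd : ∀ r, ContDiff ℝ ∞ (pderiv r η) := fun r => contDiff_pderiv hη
  have hds : ∀ r, HasCompactSupport (pderiv r η) := fun r => hasCompactSupport_pderiv hs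
  set S : Fin n → Fin n → Fin n → Fin n → Euc n → ℝ := fun r s c d y =>
    LowRegPMT.symb (fun a b => mUp κ a b y) r s c d with hS
  set S' : Fin n → Fin n → Fin n → Fin n → Fin n → Euc n → ℝ := fun r s c d t y =>
    dsymb (fun a b => mUp κ a b y) (fun c a b => γ' c a b y) t r s c d with hS'
  have hSc : ∀ r s c d, SobConv P (fun ε y => LowRegPMT.symb (fun a b => mUp (k ε) a b y) r s c d)
      (S r s c d) (S' r s c d) := h.symb hP
  set V : Fin n → Euc n → ℝ := fun r y =>
    LowRegPMT.algV (fun a b => mUp κ a b y) (fun c a b => κ' c a b y) r with hV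
  set F : Euc n → ℝ := fun y => LowRegPMT.algF (fun a b => mUp κ a b y) (fun c a b => γ' c a b y)
        (fun c a b => κ' c a b y) with hF
  have hVS : ∀ r y, V r y = ∑ s, ∑ c, ∑ d, S r s c d y * κ' s c d y := fun r y =>
    algV_eq_symb (mUp_symm (h.symm_lim y)) r
  have hVm : ∀ r, MemLp (V r) P volume := fun r => (h.algV hP r).memLp
  have hFm : MemLp F Q volume := (h.algF (Q := Q)).memLp
  -- the localised components and their derivatives
  have hu : ∀ c d, SobConv P (fun ε y => η y * k ε y c d) (fun y => η y * κ y c d)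
      (fun s y => pderiv s η y * κ y c d + η y * κ' s c d y) := fun c d =>
    (SobConv.of_compact hη hs).mul hP (h.low c d)
  set v : Fin n → Fin n → Fin n → Euc n → ℝ := fun s c d y =>
    pderiv s η y * κ y c d + η y * κ' s c d y with hv
  have hvm : ∀ s c d, MemLp (v s c d) P volume := fun s c d => ((hu c d).deriv s).memLp
  have hvs : ∀ s c d, HasCompactSupport (v s c d) := fun s c d =>
    ((hds s).mul_right).add hs.mul_right
  have hus : ∀ c d, HasCompactSupport fun y => η y * κ y c d := fun c d => hs.mul_right
  have huw : ∀ c d s, HasWeakPartial s (fun y => η y * κ y c d) (v s c d) := fun c d s =>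
    (hu c d).hasWeakPartial hP s
  have h1 := h.sub_symbD2 (Q := Q) hη hs
  -- the three contributions of the principal part
  have hA : ∀ r s c d, LpTo Q (fun ε y =>
      (LowRegPMT.symb (fun a b => mUp (k ε) a b y) r s c d - S r s c d y) *
        conv (v s c d) (pderiv r (scaleKernel ρ ε)) y) (fun _ => 0) := fun r s c d =>
    (hSc r s c d).sub_mul_conv_pderiv hρ (hvm s c d) r
  -- The limit coefficient `S`, which is only `W^{1,P}`, is commuted past the mollification; in the
  -- limit this costs `-(∂S) v`.
  have hB : ∀ r s c d, LpTo Q (commutator (S r s c d) (v s c d) ρ r)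
      (fun y => -(S' r s c d r y * v s c d y)) := fun r s c d =>
    (hSc r s c d).lpTo_commutator hρ (hvm s c d) (hvs s c d) r
  have hw : ∀ r s c d, SobConv P
      (fun ε y => LowRegPMT.symb (fun a b => mUp (k ε) a b y) r s c d * pderiv s η y * k ε y c d)
      (fun y => S r s c d y * pderiv s η y * κ y c d)
      (fun t y => (S' r s c d t y * pderiv s η y + S r s c d y * pderiv t (pderiv s η) y) * κ y c d +
        S r s c d y * pderiv s η y * κ' t c d y) := fun r s c d =>
    ((hSc r s c d).mul hP (SobConv.of_compact (hd s) (hds s))).mul hP (h.low c d)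
  have hws : ∀ r s c d, HasCompactSupport fun y => S r s c d y * pderiv s η y * κ y c d :=
    fun r s c d => ((hds s).mul_left).mul_right
  -- Correction for `η V`, which involves `η ∂κ`, whereas `v = ∂(η κ)` also contains `(∂η) κ`. The
  -- product `S ∂η κ` is itself `W^{1,P}`, so the derivative of its mollification converges.
  have hC : ∀ r s c d, LpTo Q
      (fun ε => conv (fun y => S r s c d y * pderiv s η y * κ y c d) (pderiv r (scaleKernel ρ ε)))
      (fun y => (S' r s c d r y * pderiv s η y + S r s c d y * pderiv r (pderiv s η) y) * κ y c d +
        S r s c d y * pderiv s η y * κ' r c d y) := fun r s c d =>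
    LpTo.conv_pderiv_of_sobolev hρ (hw r s c d) (hws r s c d) r
  -- the zeroth order part
  have hVd : ∀ r, MemLp (fun y => V r y * pderiv r η y) Q volume := fun r => by
    have h2 := (LpTo.const (hVm r)).mul_half (Q := Q) (LpTo.const
      (MemLp.of_continuous_compact (hd r).continuous (hds r)))
    exact h2.memLp
  have hFη : MemLp (fun y => F y * η y) Q volume := by
    have h2 := (LpTo.const (MemLp.of_continuous_compact hη.continuous hs (q := ⊤))).bdd_mul hQ
      (LpTo.const hFm)
    simpa only [mul_comm] using h2.memLp
  have hWm : MemLp (fun y => -(∑ r, V r y * pderiv r η y) + F y * η y) Q volume :=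
    (memLp_finsetSum _ fun r _ => hVd r).neg.add hFη
  have hD := lpTo_conv hρ hQ (e.ne_top') hWm
  have hsum := (h1.add hQ (LpTo.sum hQ Finset.univ fun r _ => LpTo.sum hQ Finset.univ fun s _ =>
    LpTo.sum hQ Finset.univ fun c _ => LpTo.sum hQ Finset.univ fun d _ =>
      ((hA r s c d).add hQ (hB r s c d)).add hQ (hC r s c d))).sub hQ hD
  refine hsum.congr ?_ (Eventually.of_forall fun y => ?_)
  · filter_upwards [h.regular, self_mem_nhdsWithin] with ε hreg hε
    refine Eventually.of_forall fun y => ?_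
    have hε : 0 < ε := hε
    have hκc : ∀ r, Continuous (pderiv r (scaleKernel ρ ε)) := fun r =>
      (contDiff_pderiv (hρ.scale_contDiff ε)).continuous
    have hκs : ∀ r, HasCompactSupport (pderiv r (scaleKernel ρ ε)) := fun r =>
      hasCompactSupport_pderiv (hρ.scale_compact hε)
    have h5 : ∀ c d, ContDiff ℝ ∞ fun z => η z * k ε z c d := fun c d =>
      hη.mul (contDiff_iff_contDiffAt.2 fun z => (hreg z).smooth c d)
    have h6 : ∀ c d, ContDiff ℝ ∞ (conv (fun y => η y * κ y c d) (scaleKernel ρ ε)) := fun c d =>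
      contDiff_conv (hu c d).cont.locallyIntegrable (hρ.scale_contDiff ε) (hρ.scale_compact hε)
    have h7 : ∀ r s c d, pderiv r (pderiv s (conv (fun y => η y * κ y c d) (scaleKernel ρ ε))) y =
        conv (v s c d) (pderiv r (scaleKernel ρ ε)) y := by
      intro r s c d
      rw [pderiv_conv (hu c d).cont.locallyIntegrable (hρ.scale_contDiff ε) (hρ.scale_compact hε),
        (huw c d s).conv_pderiv (hρ.scale_contDiff ε) (hρ.scale_compact hε),
        pderiv_conv ((hvm s c d).locallyIntegrable hP) (hρ.scale_contDiff ε) (hρ.scale_compact hε)]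
    have hSv : ∀ r s c d, LocallyIntegrable fun y => S r s c d y * v s c d y := fun r s c d =>
      ((hSc r s c d).unif.bdd_mul hP (LpTo.const (hvm s c d))).memLp.locallyIntegrable hP
    have hSw : ∀ r s c d, LocallyIntegrable fun y => S r s c d y * pderiv s η y * κ y c d :=
      fun r s c d => (hw r s c d).cont.locallyIntegrable
    have hSn : ∀ r s c d, LocallyIntegrable fun y => -(S r s c d y * pderiv s η y * κ y c d) :=
      fun r s c d => (hSw r s c d).neg
    -- Uses `η V = S v - S (∂η) κ`, which is `V = S ∂κ` rewritten through the derivative of the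
    -- localised component.
    have h8 : ∀ r, conv (fun y => η y * V r y) (pderiv r (scaleKernel ρ ε)) y =
        ∑ s, ∑ c, ∑ d, (conv (fun y => S r s c d y * v s c d y) (pderiv r (scaleKernel ρ ε)) y -
          conv (fun y => S r s c d y * pderiv s η y * κ y c d) (pderiv r (scaleKernel ρ ε)) y) := by
      intro r
      have hdiff : ∀ s c d, LocallyIntegrable fun y => S r s c d y * v s c d y +
          -(S r s c d y * pderiv s η y * κ y c d) := fun s c d => (hSv r s c d).add (hSn r s c d)
      have e1 : (fun y => η y * V r y) = fun y => ∑ s, ∑ c, ∑ d, (S r s c d y * v s c d y +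
          -(S r s c d y * pderiv s η y * κ y c d)) := by
        funext y
        rw [hVS, Finset.mul_sum]
        refine Finset.sum_congr rfl fun s _ => ?_
        rw [Finset.mul_sum]
        refine Finset.sum_congr rfl fun c _ => ?_
        rw [Finset.mul_sum]
        refine Finset.sum_congr rfl fun d _ => ?_
        simp only [hv]; ring
      have li2 : ∀ s c, LocallyIntegrable fun y => ∑ d, (S r s c d y * v s c d y +
          -(S r s c d y * pderiv s η y * κ y c d)) := fun s c =>
        locallyIntegrable_finsetSum _ fun d _ => hdiff s c d
      have li1 : ∀ s, LocallyIntegrable fun y => ∑ c, ∑ d, (S r s c d y * v s c d y +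
          -(S r s c d y * pderiv s η y * κ y c d)) := fun s =>
        locallyIntegrable_finsetSum _ fun c _ => li2 s c
      rw [e1, conv_sum _ (fun s _ => li1 s) (hκc r) (hκs r)]
      refine Finset.sum_congr rfl fun s _ => ?_
      rw [conv_sum _ (fun c _ => li2 s c) (hκc r) (hκs r)]
      refine Finset.sum_congr rfl fun c _ => ?_
      rw [conv_sum _ (fun d _ => hdiff s c d) (hκc r) (hκs r)]
      refine Finset.sum_congr rfl fun d _ => ?_
      rw [conv_add (hSv r s c d) (hSn r s c d) (hκc r) (hκs r), sub_eq_add_neg]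
      congr 1
      simp only [conv_apply, neg_mul, integral_neg]
    beta_reduce
    rw [symbD2_sub h5 h6]
    have h9 : symbD2 (k ε) (fun c d => conv (fun y => η y * κ y c d) (scaleKernel ρ ε)) y =
        ∑ r, ∑ s, ∑ c, ∑ d, (LowRegPMT.symb (fun a b => mUp (k ε) a b y) r s c d *
          conv (v s c d) (pderiv r (scaleKernel ρ ε)) y) := by
      simp only [symbD2, h7]
    rw [h9, mollifiedCurvature]
    simp only [h8]
    -- The three contributions telescope: the symbol of `k ε` is exchanged for `S`, then `S` is
    -- moved inside the convolution, and what remains is the mollification of `η V`.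
    have e3 : ∀ r s c d, (LowRegPMT.symb (fun a b => mUp (k ε) a b y) r s c d - S r s c d y) *
          conv (v s c d) (pderiv r (scaleKernel ρ ε)) y + commutator (S r s c d) (v s c d) ρ r ε y +
        conv (fun y => S r s c d y * pderiv s η y * κ y c d) (pderiv r (scaleKernel ρ ε)) y =
        LowRegPMT.symb (fun a b => mUp (k ε) a b y) r s c d *
          conv (v s c d) (pderiv r (scaleKernel ρ ε)) y -
        (conv (fun y => S r s c d y * v s c d y) (pderiv r (scaleKernel ρ ε)) y -
          conv (fun y => S r s c d y * pderiv s η y * κ y c d) (pderiv r (scaleKernel ρ ε)) y) := by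
      intro r s c d
      rw [commutator]; ring
    simp only [e3, Finset.sum_sub_distrib]
    ring
  -- The limits of the lower-order terms, the commutators, the correction and the zeroth-order
  -- mollification cancel pointwise.
  · simp only [LowRegPMT.lowTerms]
    have e5 : ∑ r, V r y * pderiv r η y = ∑ r, ∑ s, ∑ c, ∑ d, S r s c d y * κ' s c d y *
        pderiv r η y := by
      simp only [hVS, Finset.sum_mul]
    change _ + F y * η y + _ - _ = 0
    rw [e5]
    have e6 : ∀ a b c d : ℝ, a + b + c - (-d + b) = a + c + d := fun a b c d => by ring
    rw [e6]
    simp only [← Finset.sum_add_distrib]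
    refine Finset.sum_eq_zero fun r _ => Finset.sum_eq_zero fun s _ =>
      Finset.sum_eq_zero fun c _ => Finset.sum_eq_zero fun d _ => ?_
    change η y * S' r s c d r y * κ' s c d y - S r s c d y * _ + _ + _ = 0
    simp only [hv]
    ring

end MetricConv

end CurvatureComparison

/-! ### Functions and tensors read in a chart -/

section ChartFunctions

set_option linter.unusedSectionVars false

variable {n : ℕ}

/-- A smooth function with values in `[0, 1]`, equal to `1` near `S` and compactly supported in
`U`. -/
structure IsBump (S U : Set (Euc n)) (β : Euc n → ℝ) : Prop where
  smooth : ContDiff ℝ ∞ β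
  compact : HasCompactSupport β
  supp : tsupport β ⊆ U
  nonneg : ∀ y, 0 ≤ β y
  le_one : ∀ y, β y ≤ 1
  one : ∀ᶠ y in 𝓝ˢ S, β y = 1

theorem exists_isBump {S U : Set (Euc n)} (hS : IsCompact S) (hU : IsOpen U) (h : S ⊆ U) :
    ∃ β, IsBump S U β := by
  obtain ⟨T, hT, hST, hTU⟩ := exists_compact_between hS hU h
  obtain ⟨f, h1, h0, hf⟩ := exists_contMDiffMap_one_nhds_of_subset_interior (n := (⊤ : ℕ∞)) 𝓘(ℝ, Euc n)
    hS.isClosed hST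
  have hsub : tsupport (f : Euc n → ℝ) ⊆ T := closure_minimal
    (fun x hx => by_contra fun hxT => hx (h0 x hxT)) hT.isClosed
  exact ⟨f, f.contMDiff.contDiff, hT.of_isClosed_subset (isClosed_tsupport _) hsub, hsub.trans hTU,
    fun y => (hf y).1, fun y => (hf y).2, h1⟩

variable {M : Type*} [TopologicalSpace M] [ChartedSpace (Euc n) M]

/-- A function read in a chart, extended by zero. -/
def pushFun (e : Chart n M) (f : M → ℝ) : Euc n → ℝ := e.target.indicator fun y => f (e.symm y)

variable {e e' : Chart n M} {f : M → ℝ}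

theorem pushFun_apply {y : Euc n} (hy : y ∈ e.target) : pushFun e f y = f (e.symm y) :=
  indicator_of_mem hy _

theorem tsupport_pushFun_subset (hf : HasCompactSupport f) (hs : tsupport f ⊆ e.source) :
    tsupport (pushFun e f) ⊆ e '' tsupport f := by
  refine closure_minimal (fun y hy => ?_)
    (hf.isCompact.image_of_continuousOn (e.continuousOn.mono hs)).isClosed
  have hyt : y ∈ e.target := mem_of_indicator_ne_zero hy
  rw [Function.mem_support, pushFun_apply hyt] at hy
  exact ⟨e.symm y, subset_tsupport _ hy, e.right_inv hyt⟩

theorem tsupport_pushFun_subset_target (hf : HasCompactSupport f) (hs : tsupport f ⊆ e.source) :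
    tsupport (pushFun e f) ⊆ e.target := by
  refine (tsupport_pushFun_subset hf hs).trans ?_
  rintro _ ⟨x, hx, rfl⟩
  exact e.map_source (hs hx)

theorem hasCompactSupport_pushFun (hf : HasCompactSupport f) (hs : tsupport f ⊆ e.source) :
    HasCompactSupport (pushFun e f) :=
  (hf.isCompact.image_of_continuousOn (e.continuousOn.mono hs)).of_isClosed_subset
    (isClosed_tsupport _) (tsupport_pushFun_subset hf hs)

theorem continuousOn_gLow {τ : TensorField02 n M} [IsManifold 𝓘(ℝ, Euc n) ∞ M]
    (he : IsSmoothChart e) (hτ : Continuous (tensorSection τ)) (a b : Fin n) :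
    ContinuousOn (gLow τ e a b) e.target := fun y hy => by
  have h := (contMDiffAt_tensorSection_iff_chart τ he hy (r := 0) (by simp)).1
    ((contMDiff_zero_iff.2 hτ).contMDiffAt) a b
  exact h.continuousAt.continuousWithinAt

theorem continuous_tensorSection [IsManifold 𝓘(ℝ, Euc n) ∞ M] (g : C0Metric n M) :
    Continuous (tensorSection g.inner) := g.continuous

theorem coordMatrix_posDef [IsManifold 𝓘(ℝ, Euc n) ∞ M] (g : C0Metric n M) (he : IsSmoothChart e)
    {y : Euc n} (hy : y ∈ e.target) : (coordMatrix g.inner e y).PosDef := by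
  refine Matrix.PosDef.of_dotProduct_mulVec_pos
    (by simpa using coordMatrix_isSymm e g.symm y) fun v hv => ?_
  set w : Euc n := WithLp.toLp 2 v with hw
  have hw0 : w ≠ 0 := fun h => hv (by funext i; exact congrArg (fun z : Euc n => z i) h)
  have h1 : star v ⬝ᵥ (coordMatrix g.inner e y).mulVec v = chartPush g.inner e y w w := by
    rw [bilin_eq_sum (chartPush g.inner e y)]
    simp only [dotProduct, Matrix.mulVec, Finset.mul_sum, coordMatrix, Matrix.of_apply, hw,
      star_trivial]
    exact Finset.sum_congr rfl fun a _ => Finset.sum_congr rfl fun b _ => by ring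
  rw [h1, chartPush_apply]
  refine g.pos _ _ fun h => hw0 ?_
  have h2 : MDifferentiableAt 𝓘(ℝ, Euc n) 𝓘(ℝ, Euc n) e (e.symm y) :=
    (contMDiffAt_of_mem_maximalAtlas he (e.map_target hy)).mdifferentiableAt (by simp)
  have h3 : MDifferentiableAt 𝓘(ℝ, Euc n) 𝓘(ℝ, Euc n) e.symm y :=
    (contMDiffAt_symm_of_mem_maximalAtlas he hy).mdifferentiableAt (by simp)
  have h4 := mfderiv_comp y h2 h3
  have h5 : (e ∘ e.symm) =ᶠ[𝓝 y] id := by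
    filter_upwards [e.open_target.mem_nhds hy] with z hz using e.right_inv hz
  rw [h5.mfderiv_eq, mfderiv_id] at h4
  have h6 := congrArg (fun L : Euc n →L[ℝ] Euc n => L w) h4
  have h7 : w = (mfderiv 𝓘(ℝ, Euc n) 𝓘(ℝ, Euc n) e (e.symm y))
      (mfderiv 𝓘(ℝ, Euc n) 𝓘(ℝ, Euc n) e.symm y w) := h6
  rw [h7, h]
  exact map_zero _

variable [IsManifold 𝓘(ℝ, Euc n) ∞ M]

theorem contDiffOn_comp_symm (he : IsSmoothChart e) (hf : ContMDiff 𝓘(ℝ, Euc n) 𝓘(ℝ, ℝ) ∞ f) :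
    ContDiffOn ℝ ∞ (fun y => f (e.symm y)) e.target :=
  contMDiffOn_iff_contDiffOn.1 (hf.comp_contMDiffOn (contMDiffOn_symm_of_mem_maximalAtlas he))

theorem contDiff_pushFun (he : IsSmoothChart e) (hf : ContMDiff 𝓘(ℝ, Euc n) 𝓘(ℝ, ℝ) ∞ f)
    (hc : HasCompactSupport f) (hs : tsupport f ⊆ e.source) : ContDiff ℝ ∞ (pushFun e f) := by
  rw [contDiff_iff_contDiffAt]
  intro y
  by_cases hy : y ∈ tsupport (pushFun e f)
  · have hyt := tsupport_pushFun_subset_target hc hs hy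
    refine ((contDiffOn_comp_symm he hf).contDiffAt (e.open_target.mem_nhds hyt)).congr_of_eventuallyEq ?_
    filter_upwards [e.open_target.mem_nhds hyt] with z hz using pushFun_apply hz
  · exact contDiffAt_const.congr_of_eventuallyEq (notMem_tsupport_iff_eventuallyEq.1 hy)

theorem isCutoff_mul_comp_symm (he : IsSmoothChart e) {β : Euc n → ℝ} (hβ : ContDiff ℝ ∞ β)
    (hβc : HasCompactSupport β) (hβs : tsupport β ⊆ e.target)
    (hf : ContMDiff 𝓘(ℝ, Euc n) 𝓘(ℝ, ℝ) ∞ f) (hs : tsupport f ⊆ e'.source) :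
    IsCutoff (e.symm.trans e') (fun y => β y * f (e.symm y)) := by
  refine ⟨contDiff_mul_of_tsupport e.open_target hβ hβs (contDiffOn_comp_symm he hf), hβc.mul_right,
    fun y hy => ?_⟩
  have hyt : y ∈ e.target := hβs (closure_mono (Function.support_mul_subset_left _ _) hy)
  refine mem_transition_source.2 ⟨hyt, hs (by_contra fun h => ?_)⟩
  have h1 : ∀ᶠ z in 𝓝 y, f (e.symm z) = 0 := (e.continuousAt_symm hyt).eventually
    (notMem_tsupport_iff_eventuallyEq.1 h)
  exact notMem_tsupport_iff_eventuallyEq.2 (h1.mono fun z hz => by simp [hz]) hy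

end ChartFunctions

/-! ### The regularised tensor in a chart -/

section RegularisedTensor

set_option linter.unusedSectionVars false

variable {n : ℕ}

theorem memLp_mul_of_restrict {q : ℝ≥0∞} {S : Set (Euc n)} (hS : MeasurableSet S) {H w : Euc n → ℝ}
    (hw : MemLp w q (volume.restrict S)) (hH : Continuous H) (hc : HasCompactSupport H)
    (hs : tsupport H ⊆ S) : MemLp (fun y => H y * w y) q volume := by
  have h1 : MemLp (S.indicator w) q volume := (memLp_indicator_iff_restrict hS).2 hw
  have h2 : (fun y => H y * w y) = fun y => S.indicator w y * H y := by
    funext y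
    by_cases hy : y ∈ S
    · rw [indicator_of_mem hy, mul_comm]
    · rw [image_eq_zero_of_notMem_tsupport fun h => hy (hs h)]; simp
  rw [h2]
  exact (MemLp.of_continuous_compact (q := ⊤) hH hc).mul (p := q) (q := ⊤) h1

variable {M : Type*} [TopologicalSpace M] [ChartedSpace (Euc n) M] [IsManifold 𝓘(ℝ, Euc n) ∞ M]
  {e : Chart n M} {τ : TensorField02 n M}

/-- Leibniz rule for weak derivatives: test the chart-local weak derivative `w` with `H φ`, which is
supported in the chart. The global weak derivative is `H w + (∂ₖH) g_{cd}`. -/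
theorem hasWeakPartial_mul_gLow {p : ℝ} (hp : 1 ≤ p) (he : IsSmoothChart e) (hτ : Continuous (tensorSection τ))
    (hW : MemW1pLoc τ p) {H : Euc n → ℝ} (hH : ContDiff ℝ ∞ H) (hc : HasCompactSupport H)
    (hs : tsupport H ⊆ e.target) (c d k : Fin n) :
    ∃ v : Euc n → ℝ, MemLp v (ENNReal.ofReal p) volume ∧
      HasWeakPartial k (fun y => H y * gLow τ e c d y) v := by
  obtain ⟨w, ⟨-, -, hw⟩, hL⟩ := hW e he c d k
  obtain ⟨-, hwL⟩ := hL _ hs hc.isCompact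
  have hg := continuousOn_gLow he hτ c d
  have hHk := contDiff_pderiv (k := k) hH
  have hHkc := hasCompactSupport_pderiv (k := k) hc
  have hHks : tsupport (pderiv k H) ⊆ e.target := tsupport_pderiv_subset.trans hs
  have h1 := memLp_mul_of_restrict (isClosed_tsupport H).measurableSet hwL hH.continuous hc Subset.rfl
  have hcg := continuous_mul_of_tsupport e.open_target hHk.continuous hHks hg
  have h2 : MemLp (fun y => pderiv k H y * gLow τ e c d y) (ENNReal.ofReal p) volume :=
    MemLp.of_continuous_compact hcg hHkc.mul_right
  refine ⟨_, h1.add h2, fun φ hφ hφc => ?_⟩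
  have hHφ : ContDiff ℝ ∞ (fun y => H y * φ y) := hH.mul hφ
  have hHφs : tsupport (fun y => H y * φ y) ⊆ e.target :=
    (closure_mono (Function.support_mul_subset_left _ _)).trans hs
  have hHφc : HasCompactSupport (fun y => H y * φ y) := hc.mul_right
  have h3 := hw ⟨fun y => H y * φ y, hHφ, hHφc, hHφs⟩
  have h3' : ∫ y in e.target, gLow τ e c d y * pderiv k (fun y => H y * φ y) y =
      -∫ y in e.target, w y * (H y * φ y) := h3
  have e1 : ∀ y, pderiv k (fun y => H y * φ y) y = pderiv k H y * φ y + H y * pderiv k φ y :=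
    fun y => pderiv_mul (hH.differentiable (by simp) y) (hφ.differentiable (by simp) y)
  rw [setIntegral_eq_integral_of_forall_compl_eq_zero (fun y hy => by
      rw [image_eq_zero_of_notMem_tsupport fun h => hy (hHφs (tsupport_pderiv_subset h)), mul_zero]),
    setIntegral_eq_integral_of_forall_compl_eq_zero (fun y hy => by
      rw [image_eq_zero_of_notMem_tsupport fun h => hy (hs h)]; simp)] at h3'
  have i1 : Integrable fun y => H y * gLow τ e c d y * pderiv k φ y :=
    ((continuous_mul_of_tsupport e.open_target hH.continuous hs hg).mul
      (contDiff_pderiv hφ).continuous).integrable_of_hasCompactSupport hc.mul_right.mul_right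
  have i2 : Integrable fun y => pderiv k H y * gLow τ e c d y * φ y :=
    (hcg.mul hφ.continuous).integrable_of_hasCompactSupport hHkc.mul_right.mul_right
  have i3 : Integrable fun y => H y * w y * φ y := by
    have hm : MemLp φ ⊤ volume := MemLp.of_continuous_compact hφ.continuous hφc
    have h5 : LocallyIntegrable (fun y => H y * w y) := h1.locallyIntegrable (by
      rw [← ENNReal.ofReal_one]; exact ENNReal.ofReal_le_ofReal hp)
    simpa [mul_comm] using h5.integrable_smul_left_of_hasCompactSupport hφ.continuous hφc
  have e2 : ∫ y, gLow τ e c d y * pderiv k (fun y => H y * φ y) y =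
      (∫ y, pderiv k H y * gLow τ e c d y * φ y) + ∫ y, H y * gLow τ e c d y * pderiv k φ y := by
    rw [← integral_add i2 i1]
    exact integral_congr_ae (ae_of_all _ fun y => by beta_reduce; rw [e1]; ring)
  have e3 : ∫ y, (H y * w y + pderiv k H y * gLow τ e c d y) * φ y =
      (∫ y, w y * (H y * φ y)) + ∫ y, pderiv k H y * gLow τ e c d y * φ y := by
    have : ∀ y, w y * (H y * φ y) = H y * w y * φ y := fun y => by ring
    simp only [this]
    rw [← integral_add i3 i2]
    exact integral_congr_ae (ae_of_all _ fun y => by ring)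
  simp only [Pi.add_apply]
  rw [e3]
  linarith

end RegularisedTensor

/-! ### The regularised tensor in coordinates and its Sobolev convergence -/

namespace RegularisationData

set_option linter.unusedSectionVars false

variable {n : ℕ} {M : Type*} [TopologicalSpace M] [ChartedSpace (Euc n) M]
  {K : Set M} (D : RegularisationData n M K)

theorem isMollifier : IsMollifier D.ρ := ⟨D.ρ_smooth, D.ρ_nonneg, D.ρ_supp, D.ρ_integral⟩

theorem χ_eq_one_of_mem {i : Fin D.m} {x : M} (hx : x ∈ tsupport (D.η i)) : D.χ i x = 1 :=
  (D.χ_eq_one i).self_of_nhdsSet x hx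

theorem η_compact (i : Fin D.m) : HasCompactSupport (D.η i) :=
  (D.χ_compact i).of_isClosed_subset (isClosed_tsupport _) fun x hx =>
    subset_tsupport _ (by rw [Function.mem_support, D.χ_eq_one_of_mem hx]; exact one_ne_zero)

theorem χ_mul_η (i : Fin D.m) (x : M) : D.χ i x * D.η i x = D.η i x := by
  by_cases hx : x ∈ tsupport (D.η i)
  · rw [D.χ_eq_one_of_mem hx, one_mul]
  · rw [image_eq_zero_of_notMem_tsupport hx, mul_zero]

theorem localised_eq (τ : TensorField02 n M) (i : Fin D.m) (c d : Fin n) :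
    D.localised τ i c d = fun y => pushFun (D.ψ i) (D.η i) y * gLow τ (D.ψ i) c d y := by
  funext y
  by_cases hy : y ∈ (D.ψ i).target
  · simp [localised, pushFun, hy]
  · simp [localised, pushFun, hy]

/-- The components of the mollified tensor in the `i`-th chart. -/
def moll (τ : TensorField02 n M) (i : Fin D.m) (c d : Fin n) (ε : ℝ) : Euc n → ℝ :=
  conv (D.localised τ i c d) (scaleKernel D.ρ ε)

theorem mollified_apply (τ : TensorField02 n M) (ε : ℝ) (i : Fin D.m) (y v w : Euc n) :
    D.mollified τ ε i y v w = ∑ c, ∑ d, v c * w d * D.moll τ i c d ε y := by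
  simp only [mollified, sum_apply, smul_apply]
  refine Finset.sum_congr rfl fun c _ => Finset.sum_congr rfl fun d _ => ?_
  have h : dxTensor c d v w = v c * w d := by simp [dxTensor]
  rw [h, smul_eq_mul, mul_comm]
  rfl

theorem regularise_apply (τ : TensorField02 n M) (ε : ℝ) (x : M)
    (v w : TangentSpace 𝓘(ℝ, Euc n) x) :
    D.regularise τ ε x v w = D.ηC x * τ x v w +
      ∑ i, D.χ i x * chartPull (D.mollified τ ε i) (D.ψ i) x v w := by
  simp [regularise, sum_apply, smul_apply]

variable [IsManifold 𝓘(ℝ, Euc n) ∞ M] {e : Chart n M}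

theorem coordMatrix_regularise (τ : TensorField02 n M) (ε : ℝ) (he : IsSmoothChart e) {y : Euc n}
    (hy : y ∈ e.target) (a b : Fin n) :
    coordMatrix (D.regularise τ ε) e y a b = D.ηC (e.symm y) * coordMatrix τ e y a b +
      ∑ i, ∑ c, ∑ d, D.χ i (e.symm y) * jac (e.symm.trans (D.ψ i)) c a y *
        jac (e.symm.trans (D.ψ i)) d b y * D.moll τ i c d ε ((e.symm.trans (D.ψ i)) y) := by
  simp only [coordMatrix, Matrix.of_apply]
  rw [chartPush_apply, D.regularise_apply]
  congr 1
  refine Finset.sum_congr rfl fun i _ => ?_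
  by_cases hx : D.χ i (e.symm y) = 0
  · simp [hx]
  have hφ : y ∈ (e.symm.trans (D.ψ i)).source :=
    mem_transition_source.2 ⟨hy, D.χ_supp i (subset_tsupport _ hx)⟩
  have h1 := chartPush_transition (chartPull (D.mollified τ ε i) (D.ψ i)) (D.ψ_smooth i) he hφ
    (stdVec a) (stdVec b)
  have hd : DifferentiableAt ℝ (e.symm.trans (D.ψ i)) y :=
    ((contDiffOn_transition (D.ψ_smooth i) he).contDiffAt
      ((e.symm.trans (D.ψ i)).open_source.mem_nhds hφ)).differentiableAt (by simp)
  rw [chartPush_apply, chartPush_chartPull _ (D.ψ_smooth i)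
    ((e.symm.trans (D.ψ i)).map_source hφ).1, mollified_apply] at h1
  rw [h1, Finset.mul_sum]
  refine Finset.sum_congr rfl fun c _ => ?_
  rw [Finset.mul_sum]
  refine Finset.sum_congr rfl fun d _ => ?_
  rw [fderiv_stdVec_apply hd, fderiv_stdVec_apply hd]
  simp only [jacMat, Matrix.of_apply, jac]
  ring

variable {τ : TensorField02 n M}

theorem localised_continuous (hτ : Continuous (tensorSection τ)) (i : Fin D.m) (c d : Fin n) :
    Continuous (D.localised τ i c d) := by
  rw [localised_eq]
  exact continuous_mul_of_tsupport (D.ψ i).open_target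
    (contDiff_pushFun (D.ψ_smooth i) (D.η_smooth i) (D.η_compact i) (D.η_supp i)).continuous
    (tsupport_pushFun_subset_target (D.η_compact i) (D.η_supp i))
    (continuousOn_gLow (D.ψ_smooth i) hτ c d)

theorem localised_compact (i : Fin D.m) (c d : Fin n) :
    HasCompactSupport (D.localised τ i c d) := by
  rw [localised_eq]
  exact (hasCompactSupport_pushFun (D.η_compact i) (D.η_supp i)).mul_right

theorem tsupport_localised (i : Fin D.m) (c d : Fin n) :
    tsupport (D.localised τ i c d) ⊆ tsupport (pushFun (D.ψ i) (D.η i)) := by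
  rw [localised_eq]
  exact closure_mono (Function.support_mul_subset_left _ _)

theorem sobConv_moll {p : ℝ} (hp : 1 ≤ p) (hτ : Continuous (tensorSection τ)) (hW : MemW1pLoc τ p)
    (i : Fin D.m) (c d : Fin n) : ∃ v : Fin n → Euc n → ℝ,
      (∀ k, MemLp (v k) (ENNReal.ofReal p) volume) ∧
      (∀ k, HasWeakPartial k (D.localised τ i c d) (v k)) ∧
      SobConv (ENNReal.ofReal p) (D.moll τ i c d) (D.localised τ i c d) v := by
  have h := fun k => hasWeakPartial_mul_gLow hp (D.ψ_smooth i) hτ hW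
    (contDiff_pushFun (D.ψ_smooth i) (D.η_smooth i) (D.η_compact i) (D.η_supp i))
    (hasCompactSupport_pushFun (D.η_compact i) (D.η_supp i))
    (tsupport_pushFun_subset_target (D.η_compact i) (D.η_supp i)) c d k
  choose v hv hw using h
  rw [← localised_eq] at hw
  exact ⟨v, hv, hw, SobConv.conv D.isMollifier (by
    rw [← ENNReal.ofReal_one]; exact ENNReal.ofReal_le_ofReal hp) ENNReal.ofReal_ne_top
    (D.localised_continuous hτ i c d) (D.localised_compact i c d) hv hw⟩

/-- Without mollification the localised pieces reassemble the tensor: `χ_i η_i = η_i` and `∑ η_i = 1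
- η_𝒞`. -/
theorem sum_localised (he : IsSmoothChart e) {y : Euc n} (hy : y ∈ e.target) (a b : Fin n) :
    ∑ i, ∑ c, ∑ d, D.χ i (e.symm y) * jac (e.symm.trans (D.ψ i)) c a y *
        jac (e.symm.trans (D.ψ i)) d b y * D.localised τ i c d ((e.symm.trans (D.ψ i)) y) =
      (1 - D.ηC (e.symm y)) * coordMatrix τ e y a b := by
  have h0 : 1 - D.ηC (e.symm y) = ∑ i, D.η i (e.symm y) := by
    rw [← D.sum_eq_one (e.symm y)]; ring
  rw [h0, Finset.sum_mul]
  refine Finset.sum_congr rfl fun i _ => ?_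
  by_cases hx : D.χ i (e.symm y) = 0
  · rw [← D.χ_mul_η i, hx]; simp
  have hφ : y ∈ (e.symm.trans (D.ψ i)).source :=
    mem_transition_source.2 ⟨hy, D.χ_supp i (subset_tsupport _ hx)⟩
  have ht : (e.symm.trans (D.ψ i)) y ∈ (D.ψ i).target := ((e.symm.trans (D.ψ i)).map_source hφ).1
  have hχ : D.η i (e.symm y) = D.χ i (e.symm y) * D.η i (e.symm y) := (D.χ_mul_η i _).symm
  rw [coordMatrix_transition τ (D.ψ_smooth i) he hφ, Matrix.mul_apply, hχ, Finset.mul_sum,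
    Finset.sum_comm]
  refine Finset.sum_congr rfl fun d _ => ?_
  rw [Matrix.mul_apply, Finset.sum_mul, Finset.mul_sum]
  refine Finset.sum_congr rfl fun c _ => ?_
  rw [D.localised_eq]
  beta_reduce
  rw [pushFun_apply ht, symm_transition hφ]
  simp only [jacMat, Matrix.of_apply, jac, gLow, Matrix.transpose_apply]
  ring

/-- The coefficients of the transport of a `(0,2)`-tensor from the `i`-th chart to the chart `e`,
cut off by `β`. -/
def coef (e : Chart n M) (β : Euc n → ℝ) (i : Fin D.m) (a b c d : Fin n) (y : Euc n) : ℝ :=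
  β y * D.χ i (e.symm y) * jac (e.symm.trans (D.ψ i)) c a y * jac (e.symm.trans (D.ψ i)) d b y

theorem isCutoff_coef (he : IsSmoothChart e) {β : Euc n → ℝ} (hβ : ContDiff ℝ ∞ β)
    (hβc : HasCompactSupport β) (hβs : tsupport β ⊆ e.target) (i : Fin D.m) (a b c d : Fin n) :
    IsCutoff (e.symm.trans (D.ψ i)) (D.coef e β i a b c d) :=
  have h := isSmoothTransition (D.ψ_smooth i) he
  ((isCutoff_mul_comp_symm he hβ hβc hβs (D.χ_smooth i) (D.χ_supp i)).mul
    (h.jac_contDiffOn c a)).mul (h.jac_contDiffOn d b)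

theorem cut_regularise (he : IsSmoothChart e) {β : Euc n → ℝ}
    (hβs : tsupport β ⊆ e.target) (ε : ℝ) (a b : Fin n) (y : Euc n) :
    β y * coordMatrix (D.regularise τ ε) e y a b =
      β y * (D.ηC (e.symm y) * gLow τ e a b y) +
      ∑ i, ∑ c, ∑ d, transport (D.coef e β i a b c d) (e.symm.trans (D.ψ i)) (D.moll τ i c d ε) y := by
  by_cases hy : y ∈ tsupport β
  · rw [D.coordMatrix_regularise τ ε he (hβs hy), mul_add, Finset.mul_sum]
    congr 1
    refine Finset.sum_congr rfl fun i _ => ?_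
    rw [Finset.mul_sum]
    refine Finset.sum_congr rfl fun c _ => ?_
    rw [Finset.mul_sum]
    refine Finset.sum_congr rfl fun d _ => ?_
    simp only [transport, coef]
    ring
  · simp [transport, coef, image_eq_zero_of_notMem_tsupport hy]

/-- The same decomposition as for the regularised tensor, with mollified pieces replaced by the
original ones. Convergence can therefore be read off piece by piece. -/
theorem cut_limit (he : IsSmoothChart e) {β : Euc n → ℝ}
    (hβs : tsupport β ⊆ e.target) (a b : Fin n) (y : Euc n) :
    β y * coordMatrix τ e y a b =
      β y * (D.ηC (e.symm y) * gLow τ e a b y) +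
      ∑ i, ∑ c, ∑ d, transport (D.coef e β i a b c d) (e.symm.trans (D.ψ i))
        (D.localised τ i c d) y := by
  by_cases hy : y ∈ tsupport β
  · have h1 : ∑ i, ∑ c, ∑ d, transport (D.coef e β i a b c d) (e.symm.trans (D.ψ i))
        (D.localised τ i c d) y = β y * ((1 - D.ηC (e.symm y)) * coordMatrix τ e y a b) := by
      rw [← D.sum_localised he (hβs hy), Finset.mul_sum]
      refine Finset.sum_congr rfl fun i _ => ?_
      rw [Finset.mul_sum]
      refine Finset.sum_congr rfl fun c _ => ?_
      rw [Finset.mul_sum]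
      refine Finset.sum_congr rfl fun d _ => ?_
      simp only [transport, coef]
      ring
    rw [h1, gLow]
    ring
  · simp [transport, coef, image_eq_zero_of_notMem_tsupport hy]

/-- On the closed support of `η_𝒞`, which avoids `K`, the tensor is smooth; off that support the
product vanishes locally. -/
theorem contDiffOn_ηC_mul (he : IsSmoothChart e)
    (hs : ∀ x ∈ Kᶜ, ContMDiffAt 𝓘(ℝ, Euc n) (𝓘(ℝ, Euc n).prod 𝓘(ℝ, Euc n →L[ℝ] Euc n →L[ℝ] ℝ)) ∞
      (tensorSection τ) x) (a b : Fin n) :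
    ContDiffOn ℝ ∞ (fun y => D.ηC (e.symm y) * gLow τ e a b y) e.target := by
  intro y hy
  by_cases hx : e.symm y ∈ tsupport D.ηC
  · have h1 := (contMDiffAt_tensorSection_iff_chart τ he hy le_rfl).1 (hs _ (D.ηC_supp hx)) a b
    exact (contDiffOn_comp_symm he D.ηC_smooth y hy).mul h1.contDiffWithinAt
  · have h1 : ∀ᶠ z in 𝓝 y, D.ηC (e.symm z) = 0 := (e.continuousAt_symm hy).eventually
      (notMem_tsupport_iff_eventuallyEq.1 hx)
    refine (contDiffAt_const (c := (0 : ℝ))).congr_of_eventuallyEq ?_ |>.contDiffWithinAt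
    exact h1.mono fun z hz => by simp [hz]

theorem sobConv_cut {p : ℝ} (hp : 1 ≤ p) (hτ : Continuous (tensorSection τ)) (hW : MemW1pLoc τ p)
    (hs : ∀ x ∈ Kᶜ, ContMDiffAt 𝓘(ℝ, Euc n) (𝓘(ℝ, Euc n).prod 𝓘(ℝ, Euc n →L[ℝ] Euc n →L[ℝ] ℝ)) ∞
      (tensorSection τ) x) (he : IsSmoothChart e) {β : Euc n → ℝ} (hβ : ContDiff ℝ ∞ β)
    (hβc : HasCompactSupport β) (hβs : tsupport β ⊆ e.target) (a b : Fin n) :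
    ∃ f', SobConv (ENNReal.ofReal p) (fun ε y => β y * coordMatrix (D.regularise τ ε) e y a b)
      (fun y => β y * coordMatrix τ e y a b) f' := by
  have hP : 1 ≤ ENNReal.ofReal p := by
    rw [← ENNReal.ofReal_one]; exact ENNReal.ofReal_le_ofReal hp
  have h0 : SobConv (ENNReal.ofReal p) (fun _ y => β y * (D.ηC (e.symm y) * gLow τ e a b y)) _ _ :=
    SobConv.of_compact (contDiff_mul_of_tsupport e.open_target hβ hβs (D.contDiffOn_ηC_mul he hs a b))
      hβc.mul_right
  choose v _ _ hv using fun i c d => D.sobConv_moll hp hτ hW i c d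
  have h1 := SobConv.sum hP Finset.univ fun i _ => SobConv.sum hP Finset.univ fun c _ =>
    SobConv.sum hP Finset.univ fun d _ => (hv i c d).transport hP
      (isSmoothTransition (D.ψ_smooth i) he) (D.isCutoff_coef he hβ hβc hβs i a b c d)
  exact ⟨_, (h0.add hP h1).congr
    (Eventually.of_forall fun ε y => (D.cut_regularise he hβs ε a b y).symm)
    (fun y => (D.cut_limit he hβs a b y).symm) fun _ => ae_eq_refl _⟩

end RegularisationData

/-! ### Determinants, inverses and positivity -/

section MatrixFamilies

variable {n : ℕ} {P : ℝ≥0∞}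

namespace SobConv

theorem exists_prod (hP : 1 ≤ P) {ι : Type*} (s : Finset ι) {F : ι → ℝ → Euc n → ℝ}
    {f : ι → Euc n → ℝ} (h : ∀ i ∈ s, ∃ f', SobConv P (F i) (f i) f') :
    ∃ f', SobConv P (fun ε x => ∏ i ∈ s, F i ε x) (fun x => ∏ i ∈ s, f i x) f' := by
  classical
  induction s using Finset.induction_on with
  | empty => exact ⟨_, by simpa using const (n := n) (P := P) 1⟩
  | insert i s hi ih =>
    obtain ⟨f', hf'⟩ := ih fun j hj => h j (Finset.mem_insert_of_mem hj)
    obtain ⟨g', hg'⟩ := h i (Finset.mem_insert_self i s)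
    simp only [Finset.prod_insert hi]
    exact ⟨_, hg'.mul hP hf'⟩

theorem exists_det (hP : 1 ≤ P) {k : ℝ → Euc n → Matrix (Fin n) (Fin n) ℝ}
    {κ : Euc n → Matrix (Fin n) (Fin n) ℝ}
    (h : ∀ a b, ∃ f', SobConv P (fun ε y => k ε y a b) (fun y => κ y a b) f') :
    ∃ f', SobConv P (fun ε y => (k ε y).det) (fun y => (κ y).det) f' := by
  simp only [Matrix.det_apply']
  choose f' hf' using fun σ : Equiv.Perm (Fin n) =>
    exists_prod hP Finset.univ fun i _ => h (σ i) i
  exact ⟨_, SobConv.sum hP Finset.univ fun σ _ => (hf' σ).const_mul hP _⟩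

theorem exists_adjugate (hP : 1 ≤ P) {k : ℝ → Euc n → Matrix (Fin n) (Fin n) ℝ}
    {κ : Euc n → Matrix (Fin n) (Fin n) ℝ}
    (h : ∀ a b, ∃ f', SobConv P (fun ε y => k ε y a b) (fun y => κ y a b) f') (a b : Fin n) :
    ∃ f', SobConv P (fun ε y => (k ε y).adjugate a b) (fun y => (κ y).adjugate a b) f' := by
  simp only [Matrix.adjugate_apply]
  refine exists_det hP fun c d => ?_
  by_cases hc : c = b
  · subst hc
    simp only [Matrix.updateRow_self]
    exact ⟨_, const _⟩
  · simpa only [Matrix.updateRow_ne hc] using h c d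

theorem eventually_le_abs (hF : ∃ f', SobConv P (n := n) F f f') {c : ℝ} (hc : 0 < c)
    (hfc : ∀ x, c ≤ |f x|) : ∀ᶠ ε in 𝓝[>] (0 : ℝ), ∀ x, F ε x ≠ 0 := by
  obtain ⟨f', hF⟩ := hF
  obtain ⟨hlow, -⟩ := hF.unif.inv hF.cont hF.eventually_continuous hc hfc
  exact hlow.mono fun ε h1 x h => by
    have := h1 x; rw [h, abs_zero] at this; linarith

end SobConv

/-- Cramer's rule: determinant and adjugate are polynomials in the entries, so `SobConv` passes to
them. The lower bound on the limit determinant lets it be inverted. -/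
theorem exists_metricConv (hP : 1 ≤ P) {k : ℝ → Euc n → Matrix (Fin n) (Fin n) ℝ}
    {κ : Euc n → Matrix (Fin n) (Fin n) ℝ}
    (h : ∀ a b, ∃ f', SobConv P (fun ε y => k ε y a b) (fun y => κ y a b) f')
    (hs : ∀ ε y, (k ε y).IsSymm) (hs' : ∀ y, (κ y).IsSymm)
    {c : ℝ} (hc : 0 < c) (hdet : ∀ y, c ≤ |(κ y).det|) :
    ∃ κ' γ', MetricConv P k κ κ' γ' := by
  obtain ⟨D', hD⟩ := SobConv.exists_det hP h
  choose A' hA using SobConv.exists_adjugate hP h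
  have hU : ∀ a b, ∃ f', SobConv P (fun ε => mUp (k ε) a b) (mUp κ a b) f' := fun a b =>
    ⟨_, ((hD.inv hP hc hdet).mul hP (hA a b)).congr
      (Eventually.of_forall fun ε y => (mUp_eq (k ε) a b y).symm)
      (fun y => (mUp_eq κ a b y).symm) fun _ => ae_eq_refl _⟩
  choose κ' hκ using h
  choose γ' hγ using hU
  exact ⟨fun c a b => κ' a b c, fun c a b => γ' a b c, fun a b => hκ a b, fun a b => hγ a b,
    Eventually.of_forall hs, hs', SobConv.eventually_le_abs ⟨_, hD⟩ hc hdet⟩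

/-- The quadratic form attains a positive minimum on the compact set `T × sphere`; homogeneity of
degree two extends the bound to all vectors. -/
theorem exists_pos_lower_on {κ : Euc n → Matrix (Fin n) (Fin n) ℝ} {T : Set (Euc n)}
    (hT : IsCompact T) (hκ : ∀ a b, ContinuousOn (fun y => κ y a b) T)
    (hpos : ∀ y ∈ T, (κ y).PosDef) :
    ∃ c > 0, ∀ y ∈ T, ∀ v : Euc n, c * ‖v‖ ^ 2 ≤ ∑ a, ∑ b, v a * v b * κ y a b := by
  set Q : Euc n × Euc n → ℝ := fun z => ∑ a, ∑ b, z.2 a * z.2 b * κ z.1 a b with hQ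
  have hcont : ContinuousOn Q (T ×ˢ Metric.sphere 0 1) := by
    refine continuousOn_finsetSum _ fun a _ => continuousOn_finsetSum _ fun b _ => ?_
    refine ContinuousOn.mul (by fun_prop) ((hκ a b).comp continuousOn_fst fun z hz => hz.1)
  have hQpos : ∀ z ∈ T ×ˢ Metric.sphere (0 : Euc n) 1, 0 < Q z := by
    rintro ⟨y, v⟩ ⟨hy, hv⟩
    have hv0 : (fun i => v i) ≠ 0 := fun h => by
      have : v = 0 := by ext i; exact congrFun h i
      simp [this] at hv
    have h1 := (hpos y hy).dotProduct_mulVec_pos hv0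
    refine h1.trans_eq ?_
    simp only [dotProduct, Matrix.mulVec, Finset.mul_sum, star_trivial, Q]
    exact Finset.sum_congr rfl fun a _ => Finset.sum_congr rfl fun b _ => by ring
  have hscale : ∀ c : ℝ, (∀ z ∈ T ×ˢ Metric.sphere (0 : Euc n) 1, c ≤ Q z) →
      ∀ y ∈ T, ∀ v : Euc n, c * ‖v‖ ^ 2 ≤ ∑ a, ∑ b, v a * v b * κ y a b := by
    intro c h y hy v
    by_cases hv : v = 0
    · simp [hv]
    have hv' : 0 < ‖v‖ := norm_pos_iff.2 hv
    have h1 := h (y, ‖v‖⁻¹ • v) ⟨hy, by simp [norm_smul, hv'.ne']⟩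
    have h2 : Q (y, ‖v‖⁻¹ • v) = (‖v‖ ^ 2)⁻¹ * ∑ a, ∑ b, v a * v b * κ y a b := by
      simp only [Q, Finset.mul_sum, PiLp.smul_apply, smul_eq_mul]
      exact Finset.sum_congr rfl fun a _ => Finset.sum_congr rfl fun b _ => by ring
    rw [h2, ← div_eq_inv_mul, le_div_iff₀ (by positivity)] at h1
    exact h1
  -- The product is empty if `T` is empty or `n = 0`; then any constant works.
  rcases (T ×ˢ Metric.sphere (0 : Euc n) 1).eq_empty_or_nonempty with he | hne
  · exact ⟨1, one_pos, hscale 1 fun z hz => by rw [he] at hz; exact hz.elim⟩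
  · obtain ⟨z, hz, hmin⟩ := (hT.prod (isCompact_sphere 0 1)).exists_isMinOn hne hcont
    exact ⟨Q z, hQpos z hz, hscale _ fun w hw => hmin hw⟩

theorem pos_of_close {k κ : Matrix (Fin n) (Fin n) ℝ} {c : ℝ} {v : Euc n}
    (hv : v ≠ 0) (hκ : c * ‖v‖ ^ 2 ≤ ∑ a, ∑ b, v a * v b * κ a b) {δ : ℝ}
    (hδ : ∀ a b, |k a b - κ a b| ≤ δ) (hc : n * n * δ < c) :
    0 < ∑ a, ∑ b, v a * v b * k a b := by
  have hv' : 0 < ‖v‖ ^ 2 := by have := norm_pos_iff.2 hv; positivity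
  have hva : ∀ a, |v a| ≤ ‖v‖ := fun a => PiLp.norm_apply_le v a
  have h1 : |∑ a, ∑ b, v a * v b * (k a b - κ a b)| ≤ ∑ _a : Fin n, ∑ _b : Fin n, ‖v‖ ^ 2 * δ := by
    refine (Finset.abs_sum_le_sum_abs _ _).trans (Finset.sum_le_sum fun a _ =>
      (Finset.abs_sum_le_sum_abs _ _).trans (Finset.sum_le_sum fun b _ => ?_))
    rw [abs_mul, abs_mul, sq]
    exact mul_le_mul (mul_le_mul (hva a) (hva b) (abs_nonneg _) (norm_nonneg _)) (hδ a b)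
      (abs_nonneg _) (by positivity)
  have h2 : ∑ a, ∑ b, v a * v b * k a b =
      ∑ a, ∑ b, v a * v b * κ a b + ∑ a, ∑ b, v a * v b * (k a b - κ a b) := by
    simp only [← Finset.sum_add_distrib]
    exact Finset.sum_congr rfl fun a _ => Finset.sum_congr rfl fun b _ => by ring
  have h3 := (abs_le.1 h1).1
  simp only [Finset.sum_const, Finset.card_univ, Fintype.card_fin, nsmul_eq_mul] at h3
  rw [h2]
  nlinarith

theorem isVonNBounded_of_pos (B : Euc n →L[ℝ] Euc n →L[ℝ] ℝ) (hs : ∀ v w, B v w = B w v)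
    (hB : ∀ v, v ≠ 0 → 0 < B v v) : Bornology.IsVonNBounded ℝ {v : Euc n | B v v < 1} := by
  have hM : (Matrix.of fun a b => B (stdVec a) (stdVec b)).PosDef := by
    refine Matrix.PosDef.of_dotProduct_mulVec_pos (by ext a b; simp [hs]) fun v hv => ?_
    have hw0 : WithLp.toLp 2 v ≠ 0 := fun h =>
      hv (by funext i; exact congrArg (fun z : Euc n => z i) h)
    refine (hB _ hw0).trans_eq ?_
    rw [bilin_eq_sum B]
    simp only [dotProduct, Matrix.mulVec, Finset.mul_sum, Matrix.of_apply, star_trivial]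
    exact Finset.sum_congr rfl fun a _ => Finset.sum_congr rfl fun b _ => by ring
  obtain ⟨c, hc, h⟩ := exists_pos_lower_on (κ := fun _ => Matrix.of fun a b => B (stdVec a) (stdVec b))
    (isCompact_singleton (x := (0 : Euc n))) (fun a b => continuousOn_const) fun _ _ => hM
  rw [NormedSpace.isVonNBounded_iff]
  -- If `‖v‖ > c⁻¹ + 1`, then `c ‖v‖² > c⁻¹ + 2 + c > 1`, which contradicts `B v v < 1`.
  refine (Metric.isBounded_closedBall (x := (0 : Euc n)) (r := c⁻¹ + 1)).subset fun v hv => ?_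
  have h1 := h 0 rfl v
  simp only [Matrix.of_apply] at h1
  rw [← bilin_eq_sum B] at h1
  have hv' : B v v < 1 := hv
  rw [mem_closedBall_zero_iff]
  by_contra hlt
  push Not at hlt
  have hci : 0 < c⁻¹ := inv_pos.2 hc
  have h2 : c * c⁻¹ = 1 := mul_inv_cancel₀ hc.ne'
  nlinarith [norm_nonneg v]

end MatrixFamilies

/-! ### The regularised metrics in a chart, cut off to metrics on `ℝⁿ` -/

section ChartMetric

set_option linter.unusedSectionVars false

variable {n : ℕ} {M : Type*} [TopologicalSpace M] [ChartedSpace (Euc n) M]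

/-- A tensor read in a chart and interpolated with the Euclidean metric away from the chart. -/
def chartMat (τ : TensorField02 n M) (e : Chart n M) (β : Euc n → ℝ) (y : Euc n) :
    Matrix (Fin n) (Fin n) ℝ := β y • coordMatrix τ e y + (1 - β y) • 1

variable {τ : TensorField02 n M} {e : Chart n M} {β : Euc n → ℝ}

theorem chartMat_apply (a b : Fin n) (y : Euc n) : chartMat τ e β y a b =
    β y * coordMatrix τ e y a b + (1 - β y) * (1 : Matrix (Fin n) (Fin n) ℝ) a b := by
  simp [chartMat]

theorem chartMat_eq {y : Euc n} (hy : β y = 1) : chartMat τ e β y = coordMatrix τ e y := by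
  simp [chartMat, hy]

theorem chartMat_isSymm (hτ : ∀ x v w, τ x v w = τ x w v) (y : Euc n) :
    (chartMat τ e β y).IsSymm :=
  ((coordMatrix_isSymm e hτ y).smul _).add (Matrix.isSymm_one.smul _)

variable [IsManifold 𝓘(ℝ, Euc n) ∞ M]

theorem chartMat_posDef (g : C0Metric n M) (he : IsSmoothChart e) {S : Set (Euc n)}
    (hβ : IsBump S e.target β) (y : Euc n) : (chartMat g.inner e β y).PosDef := by
  unfold chartMat
  by_cases hy : β y = 0
  · simpa [hy] using Matrix.PosDef.one
  · have hyt := hβ.supp (subset_tsupport _ hy)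
    exact ((coordMatrix_posDef g he hyt).smul ((hβ.nonneg y).lt_of_ne' hy)).add_posSemidef
      (Matrix.PosSemidef.one.smul (sub_nonneg.2 (hβ.le_one y)))

theorem continuous_chartMat (hτ : Continuous (tensorSection τ)) (he : IsSmoothChart e)
    {S : Set (Euc n)} (hβ : IsBump S e.target β) (a b : Fin n) :
    Continuous fun y => chartMat τ e β y a b := by
  simp only [chartMat_apply]
  exact (continuous_mul_of_tsupport e.open_target hβ.smooth.continuous hβ.supp
    (continuousOn_gLow he hτ a b)).add ((continuous_const.sub hβ.smooth.continuous).mul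
    continuous_const)

/-- Off the compact support of `β` the matrix is the identity, and on it the positive determinant
has a minimum. Interpolating with the Euclidean metric serves to make this bound global on `ℝⁿ`. -/
theorem exists_det_lower (g : C0Metric n M) (he : IsSmoothChart e) {S : Set (Euc n)}
    (hβ : IsBump S e.target β) : ∃ c > 0, ∀ y, c ≤ |(chartMat g.inner e β y).det| := by
  have hc : Continuous fun y => (chartMat g.inner e β y).det :=
    Continuous.matrix_det (continuous_matrix fun a b =>
      continuous_chartMat (continuous_tensorSection g) he hβ a b)
  have hpos := fun y => (chartMat_posDef g he hβ y).det_pos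
  have hout : ∀ y, y ∉ tsupport β → (chartMat g.inner e β y).det = 1 := fun y hy => by
    simp [chartMat, image_eq_zero_of_notMem_tsupport hy]
  rcases (tsupport β).eq_empty_or_nonempty with h | h
  · exact ⟨1, one_pos, fun y => by rw [hout y (by simp [h]), abs_one]⟩
  · obtain ⟨z, -, hmin⟩ := hβ.compact.isCompact.exists_isMinOn h hc.continuousOn
    refine ⟨min 1 (chartMat g.inner e β z).det, lt_min one_pos (hpos z), fun y => ?_⟩
    rw [abs_of_pos (hpos y)]
    by_cases hy : y ∈ tsupport β
    · exact (min_le_right _ _).trans (hmin hy)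
    · rw [hout y hy]; exact min_le_left _ _

theorem IsSmoothMetricOn.contMDiffAt {g : C0Metric n M} {U : Set M} (hU : IsOpen U)
    (h : IsSmoothMetricOn g U) {x : M} (hx : x ∈ U) :
    ContMDiffAt 𝓘(ℝ, Euc n) (𝓘(ℝ, Euc n).prod 𝓘(ℝ, Euc n →L[ℝ] Euc n →L[ℝ] ℝ)) ∞
      (tensorSection g.inner) x := (h x hx).contMDiffAt (hU.mem_nhds hx)

theorem pos_of_chartPush (he : IsSmoothChart e) {x : M} (hx : x ∈ e.source)
    (h : ∀ v : Euc n, v ≠ 0 → 0 < chartPush τ e (e x) v v) :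
    ∀ w : TangentSpace 𝓘(ℝ, Euc n) x, w ≠ 0 → 0 < τ x w w := by
  -- Stated at points of the form `e.symm y`, where `chartPush` lives, so that passing to `x` is a
  -- single rewrite at the end.
  have key : ∀ y ∈ e.target, (∀ v : Euc n, v ≠ 0 → 0 < chartPush τ e y v v) →
      ∀ w : TangentSpace 𝓘(ℝ, Euc n) (e.symm y), w ≠ 0 → 0 < τ (e.symm y) w w := by
    intro y hy h w hw
    have h2 : MDifferentiableAt 𝓘(ℝ, Euc n) 𝓘(ℝ, Euc n) e (e.symm y) :=
      (contMDiffAt_of_mem_maximalAtlas he (e.map_target hy)).mdifferentiableAt (by simp)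
    have h3 : MDifferentiableAt 𝓘(ℝ, Euc n) 𝓘(ℝ, Euc n) e.symm (e (e.symm y)) :=
      (contMDiffAt_symm_of_mem_maximalAtlas he
        (e.map_source (e.map_target hy))).mdifferentiableAt (by simp)
    have h4 := mfderiv_comp (e.symm y) h3 h2
    have h5 : (e.symm ∘ e) =ᶠ[𝓝 (e.symm y)] id := by
      filter_upwards [e.open_source.mem_nhds (e.map_target hy)] with z hz using e.left_inv hz
    rw [h5.mfderiv_eq, mfderiv_id] at h4
    have h6 : w = (mfderiv 𝓘(ℝ, Euc n) 𝓘(ℝ, Euc n) e.symm (e (e.symm y)))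
        (mfderiv 𝓘(ℝ, Euc n) 𝓘(ℝ, Euc n) e (e.symm y) w) :=
      congrArg (fun L : Euc n →L[ℝ] Euc n => L w) h4
    have h7 : ∀ u : Euc n, w = (mfderiv 𝓘(ℝ, Euc n) 𝓘(ℝ, Euc n) e.symm (e (e.symm y))) u →
        0 < τ (e.symm y) (mfderiv 𝓘(ℝ, Euc n) 𝓘(ℝ, Euc n) e.symm y u)
          (mfderiv 𝓘(ℝ, Euc n) 𝓘(ℝ, Euc n) e.symm y u) := fun u hu => by
      rw [← chartPush_apply]
      refine h u fun h0 => hw ?_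
      rw [hu, h0]; exact map_zero _
    replace h7 := h7 _ h6
    rw [e.right_inv hy] at h6
    have h8 : ∀ u : Euc n, w = u → 0 < τ (e.symm y) u u → 0 < τ (e.symm y) w w := by
      rintro u rfl h; exact h
    exact h8 _ h6 h7
  have := key (e x) (e.map_source hx) h
  rwa [e.left_inv hx] at this

end ChartMetric

/-! ### Smoothness, convergence and positivity of the regularised metric -/

namespace RegularisationData

variable {n : ℕ} {M : Type*} [TopologicalSpace M] [ChartedSpace (Euc n) M]
  {K : Set M} (D : RegularisationData n M K) {τ : TensorField02 n M}

theorem localised_symm (hs : ∀ x v w, τ x v w = τ x w v) (i : Fin D.m) (c d : Fin n) :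
    D.localised τ i c d = D.localised τ i d c := by
  simp only [localised_eq, gLow]
  funext y
  rw [(coordMatrix_isSymm (D.ψ i) hs y).apply d c]

theorem regularise_symm (hs : ∀ x v w, τ x v w = τ x w v) (ε : ℝ) (x : M)
    (v w : TangentSpace 𝓘(ℝ, Euc n) x) :
    D.regularise τ ε x v w = D.regularise τ ε x w v := by
  have h : ∀ i y (a b : Euc n), D.mollified τ ε i y a b = D.mollified τ ε i y b a := by
    intro i y a b
    rw [mollified_apply, mollified_apply, Finset.sum_comm]
    refine Finset.sum_congr rfl fun c _ => Finset.sum_congr rfl fun d _ => ?_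
    rw [moll, D.localised_symm hs i d c, moll]
    ring
  rw [regularise_apply, regularise_apply, hs x v w]
  congr 1
  refine Finset.sum_congr rfl fun i _ => ?_
  congr 1
  exact h i _ _ _

variable [IsManifold 𝓘(ℝ, Euc n) ∞ M] {e : Chart n M} {β : Euc n → ℝ}

theorem contDiff_moll (hτ : Continuous (tensorSection τ)) (i : Fin D.m) (c d : Fin n) {ε : ℝ}
    (hε : 0 < ε) : ContDiff ℝ ∞ (D.moll τ i c d ε) :=
  contDiff_conv (D.localised_continuous hτ i c d).locallyIntegrable
    (D.isMollifier.scale_contDiff ε) (D.isMollifier.scale_compact hε)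

theorem contMDiffAt_regularise (hτ : Continuous (tensorSection τ))
    (hs : ∀ x ∈ Kᶜ, ContMDiffAt 𝓘(ℝ, Euc n) (𝓘(ℝ, Euc n).prod 𝓘(ℝ, Euc n →L[ℝ] Euc n →L[ℝ] ℝ)) ∞
      (tensorSection τ) x) {ε : ℝ} (hε : 0 < ε) (x : M) :
    ContMDiffAt 𝓘(ℝ, Euc n) (𝓘(ℝ, Euc n).prod 𝓘(ℝ, Euc n →L[ℝ] Euc n →L[ℝ] ℝ)) ∞
      (tensorSection (D.regularise τ ε)) x := by
  set e := chartAt (Euc n) x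
  have he : IsSmoothChart e := IsSmoothChart.chartAt x
  have hx : x ∈ e.source := mem_chart_source _ x
  obtain ⟨β, hβ⟩ := exists_isBump (isCompact_singleton (x := e x)) e.open_target
    (singleton_subset_iff.2 (e.map_source hx))
  have h1 : ∀ᶠ y in 𝓝 (e x), β y = 1 := by simpa using hβ.one
  have key : ∀ a b, ContDiffAt ℝ ∞ (gLow (D.regularise τ ε) e a b) (e x) := by
    intro a b
    have h2 : ContDiff ℝ ∞ fun y => β y * coordMatrix (D.regularise τ ε) e y a b := by
      simp only [D.cut_regularise he hβ.supp]
      refine (contDiff_mul_of_tsupport e.open_target hβ.smooth hβ.supp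
        (D.contDiffOn_ηC_mul he hs a b)).add ?_
      exact ContDiff.sum fun i _ => ContDiff.sum fun c _ => ContDiff.sum fun d _ =>
        transport_contDiff (isSmoothTransition (D.ψ_smooth i) he)
          (D.isCutoff_coef he hβ.smooth hβ.compact hβ.supp i a b c d) (D.contDiff_moll hτ i c d hε)
    refine h2.contDiffAt.congr_of_eventuallyEq ?_
    filter_upwards [h1] with y hy
    rw [hy, one_mul, gLow]
  have := (contMDiffAt_tensorSection_iff_chart (D.regularise τ ε) he (e.map_source hx) le_rfl).2 key
  rwa [e.left_inv hx] at this

theorem sobConv_chartMat {g : C0Metric n M} {p : ℝ} (hp : 1 ≤ p)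
    (hW : MemW1pLoc g.inner p) (hs : IsSmoothMetricOn g Kᶜ) (hK : IsClosed K) (he : IsSmoothChart e)
    {S : Set (Euc n)} (hβ : IsBump S e.target β) (a b : Fin n) :
    ∃ f', SobConv (ENNReal.ofReal p) (fun ε y => chartMat (D.regularise g.inner ε) e β y a b)
      (fun y => chartMat g.inner e β y a b) f' := by
  have hP : 1 ≤ ENNReal.ofReal p := by
    rw [← ENNReal.ofReal_one]; exact ENNReal.ofReal_le_ofReal hp
  obtain ⟨f', hf⟩ := D.sobConv_cut hp (continuous_tensorSection g) hW
    (fun x hx => hs.contMDiffAt hK.isOpen_compl hx) he hβ.smooth hβ.compact hβ.supp a b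
  have h1 : SobConv (ENNReal.ofReal p) (fun _ => β) β _ := SobConv.of_compact hβ.smooth hβ.compact
  have h2 := hf.add hP (((SobConv.const 1).sub hP h1).mul hP
    (SobConv.const ((1 : Matrix (Fin n) (Fin n) ℝ) a b)))
  exact ⟨_, h2.congr (Eventually.of_forall fun ε y => (chartMat_apply a b y).symm)
    (fun y => (chartMat_apply a b y).symm) fun _ => ae_eq_refl _⟩

theorem exists_metricConv_chartMat {g : C0Metric n M} {p : ℝ} (hp : 1 ≤ p)
    (hW : MemW1pLoc g.inner p) (hs : IsSmoothMetricOn g Kᶜ) (hK : IsClosed K) (he : IsSmoothChart e)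
    {S : Set (Euc n)} (hβ : IsBump S e.target β) :
    ∃ κ' γ', MetricConv (ENNReal.ofReal p) (fun ε => chartMat (D.regularise g.inner ε) e β)
      (chartMat g.inner e β) κ' γ' := by
  obtain ⟨c, hc, hdet⟩ := exists_det_lower g he hβ
  exact exists_metricConv (by rw [← ENNReal.ofReal_one]; exact ENNReal.ofReal_le_ofReal hp)
    (D.sobConv_chartMat hp hW hs hK he hβ)
    (fun ε y => chartMat_isSymm (D.regularise_symm g.symm ε) y) (fun y => chartMat_isSymm g.symm y)
    hc hdet

/-- On a compact subset of a chart `g` is bounded below by a multiple of the Euclidean metric, and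
the components converge uniformly. -/
theorem eventually_chartPush_pos {g : C0Metric n M} {p : ℝ} (hp : 1 ≤ p)
    (hW : MemW1pLoc g.inner p) (hs : IsSmoothMetricOn g Kᶜ) (hK : IsClosed K) (he : IsSmoothChart e)
    {S : Set (Euc n)} (hS : IsCompact S) (hSe : S ⊆ e.target) :
    ∀ᶠ ε in 𝓝[>] (0 : ℝ), ∀ y ∈ S, ∀ v : Euc n, v ≠ 0 →
      0 < chartPush (D.regularise g.inner ε) e y v v := by
  obtain ⟨β, hβ⟩ := exists_isBump hS e.open_target hSe
  obtain ⟨c, hc, hlow⟩ := exists_pos_lower_on (κ := chartMat g.inner e β) hS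
    (fun a b => (continuous_chartMat (continuous_tensorSection g) he hβ a b).continuousOn)
    fun y _ => chartMat_posDef g he hβ y
  -- An entrywise error `δ` changes the quadratic form by at most `n² δ ‖v‖²`, and `n² δ < c` for
  -- this choice.
  have hδ : 0 < c / (n * n + 1) := by positivity
  have h1 : ∀ a b, ∀ᶠ ε in 𝓝[>] (0 : ℝ), ∀ y,
      |chartMat (D.regularise g.inner ε) e β y a b - chartMat g.inner e β y a b| ≤
        c / (n * n + 1) := fun a b => by
    obtain ⟨f', hf⟩ := D.sobConv_chartMat hp hW hs hK he hβ a b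
    exact hf.unif.eventually_abs_sub_le hf.cont hf.eventually_continuous hδ
  filter_upwards [eventually_all.2 fun a => eventually_all.2 fun b => h1 a b] with ε h y hy v hv
  have h2 := pos_of_close hv (hlow y hy v) (fun a b => h a b y) (by
    rw [← mul_div_assoc, div_lt_iff₀ (by positivity)]; nlinarith)
  rw [chartMat_eq (hβ.one.self_of_nhdsSet y hy)] at h2
  rw [bilin_eq_sum]
  exact h2

/-- Positivity needs an argument only on the finitely many compact supports of the `χ_i`. At any
other point every `η_i` vanishes too, so `η_𝒞 = 1` and the regularised tensor equals `g`. -/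
theorem eventually_exists_smoothMetric {g : C0Metric n M} {p : ℝ} (hp : 1 ≤ p)
    (hW : MemW1pLoc g.inner p) (hs : IsSmoothMetricOn g Kᶜ) (hK : IsClosed K) :
    ∀ᶠ ε in 𝓝[>] (0 : ℝ), ∃ h : SmoothMetric n M, ∀ x, h.inner x = D.regularise g.inner ε x := by
  have h1 : ∀ i, ∀ᶠ ε in 𝓝[>] (0 : ℝ), ∀ y ∈ D.ψ i '' tsupport (D.χ i), ∀ v : Euc n, v ≠ 0 →
      0 < chartPush (D.regularise g.inner ε) (D.ψ i) y v v := fun i =>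
    D.eventually_chartPush_pos hp hW hs hK (D.ψ_smooth i)
      ((D.χ_compact i).isCompact.image_of_continuousOn ((D.ψ i).continuousOn.mono (D.χ_supp i)))
      (by rintro _ ⟨x, hx, rfl⟩; exact (D.ψ i).map_source (D.χ_supp i hx))
  filter_upwards [eventually_all.2 h1, self_mem_nhdsWithin] with ε h2 hε
  have hpos : ∀ (x : M) (w : TangentSpace 𝓘(ℝ, Euc n) x), w ≠ 0 →
      0 < D.regularise g.inner ε x w w := by
    intro x
    by_cases hx : ∃ i, x ∈ tsupport (D.χ i)
    · obtain ⟨i, hi⟩ := hx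
      exact pos_of_chartPush (D.ψ_smooth i) (D.χ_supp i hi) (h2 i _ ⟨x, hi, rfl⟩)
    · push Not at hx
      intro w hw
      have h3 : ∀ i, D.χ i x = 0 := fun i => image_eq_zero_of_notMem_tsupport (hx i)
      have h4 : D.ηC x = 1 := by
        have := D.sum_eq_one x
        rwa [Finset.sum_eq_zero fun i _ => by rw [← D.χ_mul_η, h3, zero_mul], add_zero] at this
      rw [regularise_apply]
      simp only [h3, h4, zero_mul, Finset.sum_const_zero, add_zero, one_mul]
      exact g.pos x w hw
  exact ⟨{ inner := D.regularise g.inner ε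
           symm := D.regularise_symm g.symm ε
           pos := hpos
           isVonNBounded := fun x => isVonNBounded_of_pos (D.regularise g.inner ε x)
            (D.regularise_symm g.symm ε x) (hpos x)
           contMDiff := fun x => D.contMDiffAt_regularise (continuous_tensorSection g)
            (fun x hx => hs.contMDiffAt hK.isOpen_compl hx) hε x }, fun x => rfl⟩

end RegularisationData

/-! ### Principal terms under change of charts -/

section PrincipalTransport

variable {n : ℕ} {P Q : ℝ≥0∞}

theorem symbD2_sum {ι : Type*} (t : Finset ι) {k : Euc n → Matrix (Fin n) (Fin n) ℝ}
    {w : ι → Fin n → Fin n → Euc n → ℝ} (hw : ∀ i ∈ t, ∀ c d, ContDiff ℝ ∞ (w i c d)) (y : Euc n) :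
    symbD2 k (fun c d z => ∑ i ∈ t, w i c d z) y = ∑ i ∈ t, symbD2 k (w i) y := by
  classical
  induction t using Finset.induction_on with
  | empty =>
    have h0 : ∀ s : Fin n, pderiv s (fun _ : Euc n => (0 : ℝ)) = fun _ => 0 := fun s =>
      funext fun z => pderiv_const 0
    simp [symbD2, h0]
  | insert i t hi ih =>
    have h1 : ∀ c d, ContDiff ℝ ∞ (fun z => ∑ j ∈ t, w j c d z) := fun c d =>
      ContDiff.sum fun j hj => hw j (Finset.mem_insert_of_mem hj) c d
    have h2 : ∀ c d, ContDiff ℝ ∞ (fun z => -w i c d z) := fun c d =>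
      (hw i (Finset.mem_insert_self i t) c d).neg
    have h3 := symbD2_sub (k := k) h1 h2 y
    have h4 := symbD2_sub (k := k) (v := fun _ _ _ => 0)
      (fun _ _ => contDiff_const) (hw i (Finset.mem_insert_self i t)) y
    have h0 : symbD2 k (fun _ _ _ => 0) y = 0 := by
      have h0 : ∀ s : Fin n, pderiv s (fun _ : Euc n => (0 : ℝ)) = fun _ => 0 := fun s =>
        funext fun z => pderiv_const 0
      simp [symbD2, h0]
    simp only [zero_sub, h0] at h4
    rw [Finset.sum_insert hi, ← ih fun j hj => hw j (Finset.mem_insert_of_mem hj)]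
    simp only [Finset.sum_insert hi]
    rw [h4, sub_neg_eq_add] at h3
    rw [add_comm, ← h3]
    congr 1
    funext c d z
    ring

theorem sum_quadruple_comm (G : Fin n → Fin n → Fin n → Fin n → ℝ) :
    ∑ p, ∑ q, ∑ a, ∑ b, G p q a b = ∑ a, ∑ b, ∑ p, ∑ q, G p q a b := by
  have := Finset.sum_comm (s := (Finset.univ : Finset (Fin n × Fin n)))
    (t := (Finset.univ : Finset (Fin n × Fin n))) (f := fun u v => G u.1 u.2 v.1 v.2)
  simpa only [Fintype.sum_prod_type] using this

theorem sum_octuple_comm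
    (G : Fin n → Fin n → Fin n → Fin n → Fin n → Fin n → Fin n → Fin n → ℝ) :
    ∑ p, ∑ q, ∑ a, ∑ b, ∑ r, ∑ s, ∑ c, ∑ f, G p q a b r s c f =
      ∑ r, ∑ s, ∑ c, ∑ f, ∑ a, ∑ b, ∑ p, ∑ q, G p q a b r s c f := by
  have := Finset.sum_comm (s := (Finset.univ : Finset (Fin n × Fin n × Fin n × Fin n)))
    (t := (Finset.univ : Finset (Fin n × Fin n × Fin n × Fin n)))
    (f := fun u v => G u.1 u.2.1 u.2.2.1 u.2.2.2 v.1 v.2.1 v.2.2.1 v.2.2.2)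
  simp only [Fintype.sum_prod_type] at this
  rw [this]
  refine Finset.sum_congr rfl fun r _ => Finset.sum_congr rfl fun s _ =>
    Finset.sum_congr rfl fun c _ => Finset.sum_congr rfl fun f _ => ?_
  exact sum_quadruple_comm fun p q a b => G p q a b r s c f

/-- The symbol and the leading part of the second derivatives transform as contragredient tensors,
so their contraction is invariant. The errors are bounded symbols times the lower-order terms of
`second_deriv_transport`, which vanish because `d → 0` in `W^{1,P}`. -/
theorem MetricConv.transport_symbD2 [e : ExponentPair P Q]
    {φ : OpenPartialHomeomorph (Euc n) (Euc n)} (hφ : IsSmoothTransition φ) {α : Euc n → ℝ}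
    (hα : IsCutoff φ α) {k kk : ℝ → Euc n → Matrix (Fin n) (Fin n) ℝ}
    {κ : Euc n → Matrix (Fin n) (Fin n) ℝ} {κ' γ' : Fin n → Fin n → Fin n → Euc n → ℝ}
    (h : MetricConv P k κ κ' γ') {d : Fin n → Fin n → ℝ → Euc n → ℝ}
    (hd : ∀ a b, SobConv P (d a b) (fun _ => 0) (fun _ _ => 0))
    (hk : ∀ᶠ ε in 𝓝[>] (0 : ℝ), ∀ y, α y ≠ 0 →
      k ε y = jacMat φ y * kk ε (φ y) * (jacMat φ y).transpose) :
    LpTo Q (fun ε y => transport α φ (symbD2 (kk ε) (fun a b => d a b ε)) y -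
      symbD2 (k ε) (fun c f z => ∑ a, ∑ b,
        transport (fun y => α y * jac φ a c y * jac φ b f y) φ (d a b ε) z) y) (fun _ => 0) := by
  have hP : 1 ≤ P := e.one_le'
  have hQ := e.one_le
  have hcut : ∀ a b c f, IsCutoff φ (fun y => α y * jac φ a c y * jac φ b f y) := fun a b c f =>
    (hα.mul (hφ.jac_contDiffOn a c)).mul (hφ.jac_contDiffOn b f)
  set T : Fin n → Fin n → Fin n → Fin n → ℝ → Euc n → ℝ := fun a b c f ε z =>
    transport (fun y => α y * jac φ a c y * jac φ b f y) φ (d a b ε) z with hT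
  set E : Fin n → Fin n → Fin n → Fin n → Fin n → Fin n → ℝ → Euc n → ℝ := fun r s a b c f ε y =>
    ∑ p, ∑ q, α y * jac φ a c y * jac φ b f y * jac φ q s y * jac φ p r y *
        pderiv p (pderiv q (d a b ε)) (φ y) with hE
  have h2 : ∀ r s a b c f, LpTo Q (fun ε y => pderiv r (pderiv s (T a b c f ε)) y -
      E r s a b c f ε y) (fun _ => 0) := fun r s a b c f =>
    (hd a b).second_deriv_transport hφ (hcut a b c f) r s
  have h3 : LpTo Q (fun ε y => ∑ r, ∑ s, ∑ c, ∑ f,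
      LowRegPMT.symb (fun a b => mUp (k ε) a b y) r s c f *
      ∑ a, ∑ b, -(pderiv r (pderiv s (T a b c f ε)) y - E r s a b c f ε y)) (fun _ => 0) := by
    have := LpTo.sum hQ Finset.univ fun r _ => LpTo.sum hQ Finset.univ fun s _ =>
      LpTo.sum hQ Finset.univ fun c _ => LpTo.sum hQ Finset.univ fun f _ =>
      (h.symb hP r s c f).unif.bdd_mul hQ (LpTo.sum hQ Finset.univ fun a _ =>
        LpTo.sum hQ Finset.univ fun b _ => (h2 r s a b c f).neg)
    simpa using this
  refine h3.congr_left ?_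
  filter_upwards [hk, eventually_all.2 fun a => eventually_all.2 fun b => (hd a b).smooth]
    with ε hkε hsm y
  have hTs : ∀ a b c f, ContDiff ℝ ∞ (T a b c f ε) := fun a b c f =>
    transport_contDiff hφ (hcut a b c f) (hsm a b)
  have e1 : symbD2 (k ε) (fun c f z => ∑ a, ∑ b, T a b c f ε z) y =
      ∑ r, ∑ s, ∑ c, ∑ f, LowRegPMT.symb (fun a b => mUp (k ε) a b y) r s c f *
        ∑ a, ∑ b, pderiv r (pderiv s (T a b c f ε)) y := by
    have d1 : ∀ a b c f z, DifferentiableAt ℝ (fun z => T a b c f ε z) z := fun a b c f z =>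
      (hTs a b c f).differentiable (by simp) z
    have d2 : ∀ s a b c f z, DifferentiableAt ℝ (fun z => pderiv s (T a b c f ε) z) z :=
      fun s a b c f z => (contDiff_pderiv (hTs a b c f)).differentiable (by simp) z
    have h5 : ∀ s c f, pderiv s (fun z => ∑ a, ∑ b, T a b c f ε z) =
        fun z => ∑ a, ∑ b, pderiv s (T a b c f ε) z := fun s c f => funext fun z => by
      rw [pderiv_sum _ fun a _ => DifferentiableAt.fun_sum fun b _ => d1 a b c f z]
      exact Finset.sum_congr rfl fun a _ => pderiv_sum _ fun b _ => d1 a b c f z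
    unfold symbD2
    refine Finset.sum_congr rfl fun r _ => Finset.sum_congr rfl fun s _ =>
      Finset.sum_congr rfl fun c _ => Finset.sum_congr rfl fun f _ => ?_
    rw [h5, pderiv_sum _ fun a _ => DifferentiableAt.fun_sum fun b _ => d2 s a b c f y]
    congr 1
    exact Finset.sum_congr rfl fun a _ => pderiv_sum _ fun b _ => d2 s a b c f y
  -- The exact identity behind the invariance: the Jacobians produced by the symbol of `kk ε` are
  -- those accompanying the leading second derivatives in `E`.
  have e2 : transport α φ (symbD2 (kk ε) (fun a b => d a b ε)) y =
      ∑ r, ∑ s, ∑ c, ∑ f, LowRegPMT.symb (fun a b => mUp (k ε) a b y) r s c f *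
        ∑ a, ∑ b, E r s a b c f ε y := by
    by_cases hy : α y = 0
    · simp [transport, hE, hy]
    have hys : y ∈ φ.source := hα.supp (subset_tsupport _ hy)
    set J := jacMat φ y with hJ
    have hdet : IsUnit J.det := (det_jacMat_ne_zero hφ hys).isUnit
    have hdet' : IsUnit J.transpose.det := by rwa [Matrix.det_transpose]
    have hinv : (kk ε (φ y))⁻¹ = J.transpose * (k ε y)⁻¹ * J := by
      rw [hkε y hy, Matrix.mul_inv_rev, Matrix.mul_inv_rev, ← Matrix.mul_assoc, ← Matrix.mul_assoc,
        Matrix.mul_nonsing_inv _ hdet', Matrix.one_mul, Matrix.mul_assoc,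
        Matrix.nonsing_inv_mul _ hdet, Matrix.mul_one]
    have hs : ∀ p q a b, LowRegPMT.symb (fun a b => mUp (kk ε) a b (φ y)) p q a b =
        ∑ r, ∑ s, ∑ c, ∑ f, LowRegPMT.symb (fun a b => mUp (k ε) a b y) r s c f *
          (jac φ p r y * jac φ q s y * jac φ a c y * jac φ b f y) := by
      intro p q a b
      have : (fun a b => mUp (kk ε) a b (φ y)) = J.transpose * (k ε y)⁻¹ * J := hinv
      rw [this, symb_pullback]
      rfl
    simp only [transport, symbD2, hs, hE, Finset.mul_sum, Finset.sum_mul]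
    rw [sum_octuple_comm]
    refine Finset.sum_congr rfl fun r _ => Finset.sum_congr rfl fun s _ =>
      Finset.sum_congr rfl fun c _ => Finset.sum_congr rfl fun f _ =>
      Finset.sum_congr rfl fun a _ => Finset.sum_congr rfl fun b _ =>
      Finset.sum_congr rfl fun p _ => Finset.sum_congr rfl fun q _ => ?_
    ring
  rw [e1, e2]
  simp only [← Finset.sum_sub_distrib, ← mul_sub]
  refine Finset.sum_congr rfl fun r _ => Finset.sum_congr rfl fun s _ =>
    Finset.sum_congr rfl fun c _ => Finset.sum_congr rfl fun f _ => ?_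
  congr 1
  refine Finset.sum_congr rfl fun a _ => Finset.sum_congr rfl fun b _ => ?_
  ring

end PrincipalTransport

/-! ### The scalar curvature of the regularised metrics in a chart -/

section ChartCurvature

set_option linter.unusedSectionVars false

variable {n : ℕ}

theorem IsRegularAt.congr {k k' : Euc n → Matrix (Fin n) (Fin n) ℝ} {y : Euc n}
    (h : IsRegularAt k y) (hk : k =ᶠ[𝓝 y] k') : IsRegularAt k' y := by
  refine ⟨?_, hk.self_of_nhds ▸ h.det_ne⟩
  filter_upwards [h.eventually_smooth, hk.eventually_nhds] with z h1 h2 a b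
  exact (h1 a b).congr_of_eventuallyEq (h2.mono fun w hw => congrFun (congrFun hw.symm a) b)

theorem symbD2_neg {k : Euc n → Matrix (Fin n) (Fin n) ℝ} {w : Fin n → Fin n → Euc n → ℝ}
    (y : Euc n) : symbD2 k (fun c d z => -w c d z) y = -symbD2 k w y := by
  have h : ∀ (s : Fin n) (u : Euc n → ℝ), pderiv s (fun z => -u z) = fun z => -pderiv s u z :=
    fun s u => funext fun z => pderiv_neg
  simp only [symbD2, h, mul_neg, Finset.sum_neg_distrib]

variable {M : Type*} [TopologicalSpace M] [ChartedSpace (Euc n) M]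
  [IsManifold 𝓘(ℝ, Euc n) ∞ M] {e e' : Chart n M} {β β' : Euc n → ℝ}

theorem chartMat_transition (τ : TensorField02 n M) (he : IsSmoothChart e) (he' : IsSmoothChart e')
    {y : Euc n} (hy : y ∈ (e'.symm.trans e).source) (h1 : ∀ᶠ z in 𝓝 y, β' z = 1)
    (h2 : ∀ᶠ z in 𝓝 ((e'.symm.trans e) y), β z = 1) :
    ∀ᶠ z in 𝓝 y, chartMat τ e' β' z = jacMat (e'.symm.trans e) z *
      chartMat τ e β ((e'.symm.trans e) z) * (jacMat (e'.symm.trans e) z).transpose := by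
  filter_upwards [h1, ((e'.symm.trans e).continuousAt hy).eventually h2,
    (e'.symm.trans e).open_source.mem_nhds hy] with z hz1 hz2 hz3
  rw [chartMat_eq hz1, chartMat_eq hz2, coordMatrix_transition τ he he' hz3]

theorem tsupport_mul_comp_symm {f : M → ℝ} (hβs : tsupport β ⊆ e.target) {y : Euc n}
    (hy : y ∈ tsupport fun y => β y * f (e.symm y)) : y ∈ tsupport β ∧ e.symm y ∈ tsupport f := by
  have hyt : y ∈ tsupport β := closure_mono (Function.support_mul_subset_left _ _) hy
  refine ⟨hyt, by_contra fun h => ?_⟩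
  have h1 : ∀ᶠ z in 𝓝 y, f (e.symm z) = 0 := (e.continuousAt_symm (hβs hyt)).eventually
    (notMem_tsupport_iff_eventuallyEq.1 h)
  exact notMem_tsupport_iff_eventuallyEq.2 (h1.mono fun z hz => by simp [hz]) hy

end ChartCurvature

/-! ### Auxiliary cut-offs and the global comparison of curvatures -/

namespace RegularisationData

set_option linter.unusedSectionVars false

variable {n : ℕ} {M : Type*} [TopologicalSpace M] [ChartedSpace (Euc n) M]
  {K : Set M} (D : RegularisationData n M K)

/-- The open set on which the `i`-th cut-off function, read in the `i`-th chart, is `1`. -/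
def plateau (i : Fin D.m) : Set (Euc n) :=
  interior {y | y ∈ (D.ψ i).target ∧ D.χ i ((D.ψ i).symm y) = 1}

theorem plateau_subset_target (i : Fin D.m) : D.plateau i ⊆ (D.ψ i).target :=
  fun _ hy => (interior_subset hy).1

theorem plateau_subset_image (i : Fin D.m) : D.plateau i ⊆ D.ψ i '' tsupport (D.χ i) :=
  fun y hy => ⟨(D.ψ i).symm y, subset_tsupport _ (by
    rw [Function.mem_support, (interior_subset hy).2]; exact one_ne_zero),
    (D.ψ i).right_inv (interior_subset hy).1⟩

theorem image_η_subset_plateau (i : Fin D.m) : D.ψ i '' tsupport (D.η i) ⊆ D.plateau i := by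
  rintro _ ⟨x, hx, rfl⟩
  have hxs := D.η_supp i hx
  have hyt := (D.ψ i).map_source hxs
  have h1 : ∀ᶠ x' in 𝓝 ((D.ψ i).symm (D.ψ i x)), D.χ i x' = 1 := by
    rw [(D.ψ i).left_inv hxs]
    exact (D.χ_eq_one i).filter_mono (nhds_le_nhdsSet hx)
  rw [plateau, mem_interior_iff_mem_nhds]
  filter_upwards [(D.ψ i).open_target.mem_nhds hyt,
    ((D.ψ i).continuousAt_symm hyt).eventually h1] with z h2 h3 using ⟨h2, h3⟩

theorem isCompact_image_η (i : Fin D.m) : IsCompact (D.ψ i '' tsupport (D.η i)) :=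
  (D.η_compact i).isCompact.image_of_continuousOn ((D.ψ i).continuousOn.mono (D.η_supp i))

theorem isCompact_image_χ (i : Fin D.m) : IsCompact (D.ψ i '' tsupport (D.χ i)) :=
  (D.χ_compact i).isCompact.image_of_continuousOn ((D.ψ i).continuousOn.mono (D.χ_supp i))

theorem image_χ_subset_target (i : Fin D.m) : D.ψ i '' tsupport (D.χ i) ⊆ (D.ψ i).target := by
  rintro _ ⟨x, hx, rfl⟩
  exact (D.ψ i).map_source (D.χ_supp i hx)

/-- Auxiliary cut-off functions in the charts: `β i` is `1` near the support of `χ i`, and `ζ i` is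
`1` near the support of `η i` and supported where `χ i = 1`. -/
structure Cutoffs where
  β : Fin D.m → Euc n → ℝ
  ζ : Fin D.m → Euc n → ℝ
  bump_β : ∀ i, IsBump (D.ψ i '' tsupport (D.χ i)) (D.ψ i).target (β i)
  bump_ζ : ∀ i, IsBump (D.ψ i '' tsupport (D.η i)) (D.plateau i) (ζ i)

theorem nonempty_cutoffs : Nonempty D.Cutoffs := by
  choose β hβ using fun i =>
    exists_isBump (D.isCompact_image_χ i) (D.ψ i).open_target (D.image_χ_subset_target i)
  choose ζ hζ using fun i =>
    exists_isBump (D.isCompact_image_η i) isOpen_interior (D.image_η_subset_plateau i)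
  exact ⟨⟨β, ζ, hβ, hζ⟩⟩

variable {D} (C : D.Cutoffs)

theorem Cutoffs.β_eq_one {i : Fin D.m} {y : Euc n} (hy : y ∈ D.ψ i '' tsupport (D.χ i)) :
    ∀ᶠ z in 𝓝 y, C.β i z = 1 := (C.bump_β i).one.filter_mono (nhds_le_nhdsSet hy)

theorem Cutoffs.β_eq_one_of_mem_tsupport {i : Fin D.m} {y : Euc n} (hy : y ∈ tsupport (C.ζ i)) :
    ∀ᶠ z in 𝓝 y, C.β i z = 1 :=
  C.β_eq_one (D.plateau_subset_image i ((C.bump_ζ i).supp hy))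

theorem Cutoffs.supp_target (i : Fin D.m) : tsupport (C.ζ i) ⊆ (D.ψ i).target :=
  (C.bump_ζ i).supp.trans (D.plateau_subset_target i)

/-- The regularised metric in the `i`-th chart, as a metric on `ℝⁿ`. -/
def Cutoffs.mat (τ : TensorField02 n M) (i : Fin D.m) : Euc n → Matrix (Fin n) (Fin n) ℝ :=
  chartMat τ (D.ψ i) (C.β i)

variable [IsManifold 𝓘(ℝ, Euc n) ∞ M]

theorem contDiff_push_η (i : Fin D.m) : ContDiff ℝ ∞ (pushFun (D.ψ i) (D.η i)) :=
  contDiff_pushFun (D.ψ_smooth i) (D.η_smooth i) (D.η_compact i) (D.η_supp i)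

theorem compact_push_η (i : Fin D.m) : HasCompactSupport (pushFun (D.ψ i) (D.η i)) :=
  hasCompactSupport_pushFun (D.η_compact i) (D.η_supp i)

theorem tsupport_push_η (i : Fin D.m) : tsupport (pushFun (D.ψ i) (D.η i)) ⊆ D.plateau i :=
  (tsupport_pushFun_subset (D.η_compact i) (D.η_supp i)).trans (D.image_η_subset_plateau i)

theorem Cutoffs.push_η_mul_mat (τ : TensorField02 n M) (i : Fin D.m) (a b : Fin n) :
    (fun y => pushFun (D.ψ i) (D.η i) y * C.mat τ i y a b) = D.localised τ i a b := by
  rw [D.localised_eq]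
  funext y
  by_cases hy : y ∈ tsupport (pushFun (D.ψ i) (D.η i))
  · rw [mat, chartMat_eq (C.β_eq_one (D.plateau_subset_image i (D.tsupport_push_η i hy))).self_of_nhds]
    rfl
  · rw [image_eq_zero_of_notMem_tsupport hy, zero_mul, zero_mul]

theorem Cutoffs.isRegularAt_mat {g : C0Metric n M} (hs : IsSmoothMetricOn g Kᶜ) (hK : IsClosed K)
    (j : Fin D.m) {y : Euc n} (hy : y ∈ tsupport (C.ζ j)) (hx : (D.ψ j).symm y ∈ Kᶜ) :
    IsRegularAt (C.mat g.inner j) y := by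
  have hyt := C.supp_target j hy
  refine (isRegularAt_of_contMDiff (D.ψ_smooth j) hyt ?_
    (coordMatrix_posDef g (D.ψ_smooth j) hyt).det_pos.ne').congr ?_
  · filter_upwards [hK.isOpen_compl.mem_nhds hx] with x hx using hs.contMDiffAt hK.isOpen_compl hx
  · filter_upwards [C.β_eq_one_of_mem_tsupport hy] with z hz using (chartMat_eq hz).symm

/-- The mollification of the curvature density `ηᵢ R[g]` in the `i`-th chart. -/
def mollCurv (C : D.Cutoffs) (τ : TensorField02 n M) (κ' γ' : Fin n → Fin n → Fin n → Euc n → ℝ)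
    (i : Fin D.m) : ℝ → Euc n → ℝ :=
  mollifiedCurvature D.ρ (pushFun (D.ψ i) (D.η i))
    (fun r y => algV (fun a b => mUp (C.mat τ i) a b y) (fun c a b => κ' c a b y) r)
    (fun y => algF (fun a b => mUp (C.mat τ i) a b y) (fun c a b => γ' c a b y)
      (fun c a b => κ' c a b y))

/-- Both `η_i g_ε` and the mollification of `η_i g` converge to `η_i g` in the sense of `SobConv`.
Since the limit gradient is unique, their difference tends to zero together with its first
derivatives. -/
theorem Cutoffs.sobConv_defect {P Q : ℝ≥0∞} [ep : ExponentPair P Q] {g : C0Metric n M} {p : ℝ}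
    (hp : 1 ≤ p) (hP : P = ENNReal.ofReal p) (hW : MemW1pLoc g.inner p) {i : Fin D.m}
    {κ' γ' : Fin n → Fin n → Fin n → Euc n → ℝ}
    (hM : MetricConv P (fun ε => C.mat (D.regularise g.inner ε) i) (C.mat g.inner i) κ' γ')
    (a b : Fin n) :
    SobConv P (fun ε z => pushFun (D.ψ i) (D.η i) z * C.mat (D.regularise g.inner ε) i z a b -
      D.moll g.inner i a b ε z) (fun _ => 0) (fun _ _ => 0) := by
  have hP1 : 1 ≤ P := ep.one_le'
  obtain ⟨v, -, -, hv⟩ := D.sobConv_moll hp (continuous_tensorSection g) hW i a b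
  rw [← hP] at hv
  have h1 : SobConv P (fun _ => pushFun (D.ψ i) (D.η i)) (pushFun (D.ψ i) (D.η i)) _ :=
    SobConv.of_compact (D.contDiff_push_η i) (D.compact_push_η i)
  have h2 := h1.mul hP1 (hM.low a b)
  have h3 := h2.congr (h := D.localised g.inner i a b) (Eventually.of_forall fun _ _ => rfl)
    (fun y => congrFun (C.push_η_mul_mat g.inner i a b) y) fun _ => ae_eq_refl _
  refine (h3.sub hP1 hv).congr (Eventually.of_forall fun _ _ => rfl) (fun y => sub_self _) fun k => ?_
  filter_upwards [h3.deriv_unique hP1 hv k] with y hy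
  rw [hy, sub_self]

/-- Apply the chart comparison to every `η_i`, transport it to the `j`-th chart and add the
comparison for the smooth part `η_𝒞`. The curvature terms add up to `R[g_ε]` by coordinate
invariance and the partition of unity. The second-order terms add up to zero because the defects do,
by the definition of `g_ε`. -/
theorem Cutoffs.lpTo_curvature {P Q : ℝ≥0∞} [ep : ExponentPair P Q] {g : C0Metric n M} {p : ℝ}
    (hp : 1 ≤ p) (hP : P = ENNReal.ofReal p) (hW : MemW1pLoc g.inner p)
    (hs : IsSmoothMetricOn g Kᶜ) (hK : IsClosed K)
    {κ' γ' : Fin D.m → Fin n → Fin n → Fin n → Euc n → ℝ}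
    (hM : ∀ i, MetricConv P (fun ε => C.mat (D.regularise g.inner ε) i) (C.mat g.inner i)
      (κ' i) (γ' i)) (j : Fin D.m) :
    LpTo Q (fun ε y => C.ζ j y * mScal (C.mat (D.regularise g.inner ε) j) y -
      ∑ i, transport (fun y => C.ζ j y * D.χ i ((D.ψ j).symm y)) ((D.ψ j).symm.trans (D.ψ i))
        (mollCurv C g.inner (κ' i) (γ' i) i ε) y -
      C.ζ j y * D.ηC ((D.ψ j).symm y) * mScal (C.mat g.inner j) y) (fun _ => 0) := by
  have hP1 : 1 ≤ P := ep.one_le'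
  have hQ := ep.one_le
  set φ := fun i => (D.ψ j).symm.trans (D.ψ i) with hφdef
  set α : Fin D.m → Euc n → ℝ := fun i y => C.ζ j y * D.χ i ((D.ψ j).symm y) with hα
  set θ : Euc n → ℝ := fun y => C.ζ j y * D.ηC ((D.ψ j).symm y) with hθ
  set H : Fin D.m → Euc n → ℝ := fun i => pushFun (D.ψ i) (D.η i) with hH
  set k : ℝ → Fin D.m → Euc n → Matrix (Fin n) (Fin n) ℝ := fun ε i =>
    C.mat (D.regularise g.inner ε) i with hk
  set κ : Fin D.m → Euc n → Matrix (Fin n) (Fin n) ℝ := fun i => C.mat g.inner i with hκ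
  set d : Fin D.m → Fin n → Fin n → ℝ → Euc n → ℝ := fun i a b ε z =>
    H i z * k ε i z a b - D.moll g.inner i a b ε z with hd
  have hφ : ∀ i, IsSmoothTransition (φ i) := fun i => isSmoothTransition (D.ψ_smooth i) (D.ψ_smooth j)
  have hcut : ∀ i, IsCutoff (φ i) (α i) := fun i =>
    isCutoff_mul_comp_symm (D.ψ_smooth j) (C.bump_ζ j).smooth (C.bump_ζ j).compact (C.supp_target j)
      (D.χ_smooth i) (D.χ_supp i)
  have hdS : ∀ i a b, SobConv P (d i a b) (fun _ => 0) (fun _ _ => 0) := fun i a b =>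
    C.sobConv_defect (Q := Q) hp hP hW (hM i) a b
  have hαsupp : ∀ i y, α i y ≠ 0 → y ∈ tsupport (C.ζ j) ∧ y ∈ (φ i).source ∧
      φ i y ∈ D.ψ i '' tsupport (D.χ i) := by
    intro i y hy
    have h1 := left_ne_zero_of_mul hy
    have h2 := right_ne_zero_of_mul hy
    exact ⟨subset_tsupport _ h1, (hcut i).supp (subset_tsupport _ hy),
      ⟨(D.ψ j).symm y, subset_tsupport _ h2, rfl⟩⟩
  have htrans : ∀ ε i y, α i y ≠ 0 → ∀ᶠ z in 𝓝 y,
      k ε j z = jacMat (φ i) z * k ε i (φ i z) * (jacMat (φ i) z).transpose := by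
    intro ε i y hy
    obtain ⟨h1, h2, h3⟩ := hαsupp i y hy
    exact chartMat_transition _ (D.ψ_smooth i) (D.ψ_smooth j) h2 (C.β_eq_one_of_mem_tsupport h1)
      (C.β_eq_one h3)
  -- The comparison of `η_i R[g_ε]` with the mollified curvature, made in the `i`-th chart and
  -- transported.
  have hA : ∀ i, LpTo Q (fun ε => transport (α i) (φ i) fun y => H i y * mScal (k ε i) y -
      mollCurv C g.inner (κ' i) (γ' i) i ε y - symbD2 (k ε i) (fun a b => d i a b ε) y)
      (fun _ => 0) := fun i => by
    have h1 := (hM i).sub_mollifiedCurvature (Q := Q) D.isMollifier (D.contDiff_push_η i)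
      (D.compact_push_η i)
    have h2 := h1.transport (hφ i) (hcut i)
    have h3 : ∀ a b, (fun y => H i y * κ i y a b) = D.localised g.inner i a b := fun a b =>
      C.push_η_mul_mat g.inner i a b
    simp only [hH, hκ] at h3
    simp only [h3] at h2
    exact h2.congr (Eventually.of_forall fun ε => ae_eq_refl _)
      (Eventually.of_forall fun y => by simp [transport])
  -- The leftover principal term of the `i`-th chart, rewritten as a principal term of the `j`-th
  -- chart.
  have hB : ∀ i, LpTo Q (fun ε y => transport (α i) (φ i) (symbD2 (k ε i) fun a b => d i a b ε) y -
      symbD2 (k ε j) (fun c f z => ∑ a, ∑ b,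
        transport (D.coef (D.ψ j) (C.ζ j) i c f a b) (φ i) (d i a b ε) z) y) (fun _ => 0) := fun i =>
    (hM j).transport_symbD2 (hφ i) (hcut i) (hdS i)
      (Eventually.of_forall fun ε y hy => (htrans ε i y hy).self_of_nhds)
  have hθs : ∀ y ∈ tsupport θ, y ∈ tsupport (C.ζ j) ∧ (D.ψ j).symm y ∈ tsupport D.ηC := fun y hy =>
    tsupport_mul_comp_symm (C.supp_target j) hy
  -- The part weighted by `η_𝒞`, where `g` is smooth and is compared with itself without
  -- mollification.
  have hC := (hM j).local_smooth (Q := Q) (θ := θ)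
    (contDiff_mul_of_tsupport (D.ψ j).open_target (C.bump_ζ j).smooth (C.supp_target j)
      (contDiffOn_comp_symm (D.ψ_smooth j) D.ηC_smooth)) (C.bump_ζ j).compact.mul_right
    fun y hy => C.isRegularAt_mat hs hK j (hθs y hy).1 (D.ηC_supp (hθs y hy).2)
  have hsum := (LpTo.sum hQ Finset.univ fun i _ => (hA i).add hQ (hB i)).add hQ hC
  refine (hsum.congr_left ?_).congr (Eventually.of_forall fun _ => ae_eq_refl _)
    (Eventually.of_forall fun y => by simp)
  filter_upwards [self_mem_nhdsWithin, eventually_all.2 fun i => (hM i).regular,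
    eventually_all.2 fun i => eventually_all.2 fun a => eventually_all.2 fun b => (hdS i a b).smooth]
    with ε hε hreg hdsm y
  set W : Fin D.m → Fin n → Fin n → Euc n → ℝ := fun i c f z => ∑ a, ∑ b,
        transport (D.coef (D.ψ j) (C.ζ j) i c f a b) (φ i) (d i a b ε) z with hW'
  have hWs : ∀ i c f, ContDiff ℝ ∞ (W i c f) := fun i c f =>
    ContDiff.sum fun a _ => ContDiff.sum fun b _ => transport_contDiff (hφ i)
      (D.isCutoff_coef (D.ψ_smooth j) (C.bump_ζ j).smooth (C.bump_ζ j).compact (C.supp_target j)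
        i c f a b) (hdsm i a b)
  have hHφ : ∀ i z, α i z * H i (φ i z) = C.ζ j z * D.η i ((D.ψ j).symm z) := by
    intro i z
    by_cases hz : α i z = 0
    · rw [hz, zero_mul]
      rcases mul_eq_zero.1 hz with h | h
      · rw [h, zero_mul]
      · rw [← D.χ_mul_η, h, zero_mul, mul_zero]
    obtain ⟨h1, h2, h3⟩ := hαsupp i z hz
    rw [hH]
    beta_reduce
    rw [pushFun_apply (D.image_χ_subset_target i h3), symm_transition h2, hα, mul_assoc, D.χ_mul_η]
  have hηsum : ∀ x, ∑ i, D.η i x = 1 - D.ηC x := fun x => by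
    rw [← D.sum_eq_one x]; ring
  -- Each transported curvature is `ζ_j η_i R[g_ε]` by coordinate invariance; summing over `i`
  -- leaves the weight `1 - η_𝒞`.
  have e1 : ∑ i, transport (α i) (φ i) (fun y => H i y * mScal (k ε i) y) y =
      C.ζ j y * mScal (k ε j) y - θ y * mScal (k ε j) y := by
    have h1 : ∀ i, transport (α i) (φ i) (fun y => H i y * mScal (k ε i) y) y =
        C.ζ j y * D.η i ((D.ψ j).symm y) * mScal (k ε j) y := by
      intro i
      rw [← hHφ, transport]
      by_cases hy : α i y = 0
      · simp [hy]
      obtain ⟨h1, h2, h3⟩ := hαsupp i y hy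
      rw [mScal_pullback (k' := k ε j) (hreg i (φ i y)) (Eventually.of_forall fun z =>
        chartMat_isSymm (D.regularise_symm g.symm ε) z) (by
          filter_upwards [(φ i).open_source.mem_nhds h2] with z hz using
            (hφ i).smooth.contDiffAt ((φ i).open_source.mem_nhds hz))
        (det_jacMat_ne_zero (hφ i) h2) (htrans ε i y hy)]
      ring
    simp only [h1, ← Finset.sum_mul, ← Finset.mul_sum, hηsum, hθ]
    ring
  -- The exact cancellation of the defects. The sum of the `W i` is `ζ_j (1 - η_𝒞) g_ε - (ζ_j g_ε -
  -- ζ_j η_𝒞 g)`, that is `-ζ_j η_𝒞 (g_ε - g)`.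
  have e2 : symbD2 (k ε j) (fun c f z => θ z * k ε j z c f - θ z * κ j z c f) y =
      -∑ i, symbD2 (k ε j) (W i) y := by
    rw [← symbD2_sum Finset.univ (fun i _ => hWs i), ← symbD2_neg]
    congr 1
    funext c f z
    have h1 := D.cut_regularise (τ := g.inner) (D.ψ_smooth j) (C.supp_target j) ε c f z
    by_cases hz : C.ζ j z = 0
    · simp [hθ, hW', hz, transport, coef]
    have hβ1 : C.β j z = 1 := (C.β_eq_one_of_mem_tsupport (subset_tsupport _ hz)).self_of_nhds
    have hkj : k ε j z = coordMatrix (D.regularise g.inner ε) (D.ψ j) z := chartMat_eq hβ1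
    have hκj : κ j z = coordMatrix g.inner (D.ψ j) z := chartMat_eq hβ1
    have h2 : ∀ i, W i c f z = C.ζ j z * D.η i ((D.ψ j).symm z) * k ε j z c f -
        ∑ a, ∑ b, transport (D.coef (D.ψ j) (C.ζ j) i c f a b) (φ i) (D.moll g.inner i a b ε) z := by
      intro i
      have h3 : ∑ a, ∑ b, D.coef (D.ψ j) (C.ζ j) i c f a b z * (H i (φ i z) * k ε i (φ i z) a b) =
          C.ζ j z * D.η i ((D.ψ j).symm z) * k ε j z c f := by
        rw [← hHφ]
        by_cases hαz : α i z = 0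
        · have : ∀ a b, D.coef (D.ψ j) (C.ζ j) i c f a b z = 0 := fun a b => by
            have h0 : C.ζ j z * D.χ i ((D.ψ j).symm z) = 0 := hαz
            simp [coef, h0]
          simp [this, hαz]
        rw [(htrans ε i z hαz).self_of_nhds, Matrix.mul_apply, Finset.mul_sum, Finset.sum_comm]
        refine Finset.sum_congr rfl fun b _ => ?_
        rw [Matrix.mul_apply, Finset.sum_mul, Finset.mul_sum]
        refine Finset.sum_congr rfl fun a _ => ?_
        simp only [coef, hα, jacMat, Matrix.of_apply, jac, Matrix.transpose_apply, hφdef]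
        ring
      rw [← h3]
      simp only [hW', transport, hd, mul_sub, Finset.sum_sub_distrib]
    simp only [h2, Finset.sum_sub_distrib, ← Finset.sum_mul, ← Finset.mul_sum, hηsum]
    have h4 : ∑ i, ∑ a, ∑ b, transport (D.coef (D.ψ j) (C.ζ j) i c f a b) (φ i)
        (D.moll g.inner i a b ε) z = C.ζ j z * k ε j z c f -
        C.ζ j z * (D.ηC ((D.ψ j).symm z) * κ j z c f) := by
      rw [hkj, hκj]
      exact eq_sub_of_add_eq' h1.symm
    rw [h4, hθ]
    ring
  have e3 : ∀ i, transport (α i) (φ i) (fun y => H i y * mScal (k ε i) y -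
      mollCurv C g.inner (κ' i) (γ' i) i ε y - symbD2 (k ε i) (fun a b => d i a b ε) y) y =
      transport (α i) (φ i) (fun y => H i y * mScal (k ε i) y) y -
      transport (α i) (φ i) (mollCurv C g.inner (κ' i) (γ' i) i ε) y -
      transport (α i) (φ i) (symbD2 (k ε i) (fun a b => d i a b ε)) y := fun i => by
    simp only [transport]; ring
  simp only [e3, Finset.sum_add_distrib, Finset.sum_sub_distrib]
  rw [e1]
  have e4 := e2
  simp only [hk, hκ] at e4 ⊢
  rw [e4]
  ring

end RegularisationData

/-! ### Distributional and classical nonnegativity of the scalar curvature -/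

section WeakPartial

set_option linter.unusedSectionVars false

variable {n : ℕ} {Ω : TopologicalSpace.Opens (Euc n)} {k : Fin n} {u v w : Euc n → ℝ}

theorem setIntegral_mul_eq {U : Set (Euc n)} {u φ : Euc n → ℝ} (h : tsupport φ ⊆ U) :
    ∫ y in U, u y * φ y = ∫ y, u y * φ y :=
  setIntegral_eq_integral_of_forall_compl_eq_zero fun y hy => by
    rw [image_eq_zero_of_notMem_tsupport fun h' => hy (h h'), mul_zero]

/-- The value of `weakPartial` is an arbitrary choice; uniqueness shows that it does not matter up
to null sets. -/
theorem IsWeakPartial.weakPartial_eq (h : IsWeakPartial Ω k u v) :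
    ∀ᵐ y, y ∈ (Ω : Set (Euc n)) → weakPartial Ω k u y = v y := by
  have hex : ∃ w, IsWeakPartial Ω k u w := ⟨v, h⟩
  have hdef : weakPartial Ω k u = hex.choose := by rw [weakPartial, dif_pos hex]
  obtain ⟨-, hw, hwφ⟩ := hex.choose_spec
  rw [hdef]
  refine ae_eq_of_weak_partial Ω.isOpen hw h.2.1 fun φ hφ hc hs => ?_
  have h1 := hwφ ⟨φ, hφ, hc, hs⟩
  have h2 := h.2.2 ⟨φ, hφ, hc, hs⟩
  have h3 : ∫ y in (Ω : Set (Euc n)), hex.choose y * φ y = ∫ y in (Ω : Set (Euc n)), v y * φ y :=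
    neg_injective (h1.symm.trans h2)
  rwa [setIntegral_mul_eq hs, setIntegral_mul_eq hs] at h3

theorem HasWeakPartial.isWeakPartial (h : HasWeakPartial k u v) (hu : LocallyIntegrable u)
    (hv : LocallyIntegrable v) (hw : ∀ y ∈ (Ω : Set (Euc n)), w y = u y) :
    IsWeakPartial Ω k w v := by
  refine ⟨fun x hx => ?_, hv.locallyIntegrableOn _, fun φ => ?_⟩
  · obtain ⟨s, hs, hi⟩ := hu x
    obtain ⟨t, hts, hto, hxt⟩ := mem_nhds_iff.1 hs
    exact ⟨t ∩ Ω, inter_mem (nhdsWithin_le_nhds (hto.mem_nhds hxt)) self_mem_nhdsWithin,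
      (hi.mono_set (inter_subset_left.trans hts)).congr_fun (fun y hy => (hw y hy.2).symm)
        (hto.inter Ω.isOpen).measurableSet⟩
  · have h1 := h φ φ.contDiff φ.hasCompactSupport
    rw [setIntegral_mul_eq φ.tsupport_subset, ← h1,
      setIntegral_congr_fun (g := fun y => u y * pderiv k φ y) Ω.isOpen.measurableSet
        fun y hy => by beta_reduce; rw [hw y hy]]
    exact setIntegral_mul_eq (tsupport_pderiv_subset.trans φ.tsupport_subset)

theorem isWeakPartial_of_contDiffOn (hu : ContDiffOn ℝ ∞ u Ω) : IsWeakPartial Ω k u (pderiv k u) := by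
  have hd := contDiffOn_pderiv (k := k) Ω.isOpen hu
  refine ⟨hu.continuousOn.locallyIntegrableOn Ω.isOpen.measurableSet,
    hd.continuousOn.locallyIntegrableOn Ω.isOpen.measurableSet, fun φ => ?_⟩
  have hφ := φ.contDiff
  have hs := φ.tsupport_subset
  have hc := φ.hasCompactSupport
  rw [setIntegral_mul_eq hs, setIntegral_mul_eq (tsupport_pderiv_subset.trans hs)]
  have h1 := integral_pderiv_eq_zero (k := k) (contDiff_mul_of_tsupport Ω.isOpen hφ hs hu) hc.mul_right
  have h2 : ∀ y, pderiv k (fun y => φ y * u y) y = pderiv k φ y * u y + φ y * pderiv k u y := by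
    intro y
    by_cases hy : y ∈ tsupport φ
    · exact pderiv_mul (hφ.differentiable (by simp) y)
        ((hu.contDiffAt (Ω.isOpen.mem_nhds (hs hy))).differentiableAt (by simp))
    · have h0 := notMem_tsupport_iff_eventuallyEq.1 hy
      have h3 : (fun y => φ y * u y) =ᶠ[𝓝 y] fun _ => 0 := h0.mono fun z hz => by simp [hz]
      have h4 : (φ : Euc n → ℝ) =ᶠ[𝓝 y] fun _ => 0 := h0
      rw [pderiv_congr h3, pderiv_congr h4, pderiv_const, image_eq_zero_of_notMem_tsupport hy]
      simp
  simp only [h2] at h1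
  have i1 : Integrable fun y => pderiv k φ y * u y :=
    (continuous_mul_of_tsupport Ω.isOpen (contDiff_pderiv hφ).continuous
      (tsupport_pderiv_subset.trans hs) hu.continuousOn).integrable_of_hasCompactSupport
      (hasCompactSupport_pderiv hc).mul_right
  have i2 : Integrable fun y => φ y * pderiv k u y :=
    (continuous_mul_of_tsupport Ω.isOpen hφ.continuous hs
      hd.continuousOn).integrable_of_hasCompactSupport hc.mul_right
  rw [integral_add i1 i2] at h1
  simp only [mul_comm (u _), mul_comm (pderiv k u _)]
  linarith

variable {M : Type*} [TopologicalSpace M] [ChartedSpace (Euc n) M] {τ : TensorField02 n M}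
  {e : Chart n M}

/-- Any weak derivatives may be used in the pairing, in particular those supplied by `MetricConv` or
the classical ones. The compact support of `f` extends the integral to `ℝⁿ`. -/
theorem distScalarCurvature_eq {κ' γ' : Fin n → Fin n → Fin n → Euc n → ℝ}
    (hlow : ∀ c a b, IsWeakPartial (chartTarget e) c (gLow τ e a b) (κ' c a b))
    (hup : ∀ c a b, IsWeakPartial (chartTarget e) c (gUp τ e a b) (γ' c a b))
    (f : 𝓓(chartTarget e, ℝ)) :
    distScalarCurvature τ e f = ∫ y,
      (-(∑ r, algV (fun a b => gUp τ e a b y) (fun c a b => κ' c a b y) r * pderiv r f y) +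
        algF (fun a b => gUp τ e a b y) (fun c a b => γ' c a b y) (fun c a b => κ' c a b y) * f y) := by
  have h1 : ∀ᵐ y, ∀ c a b, y ∈ e.target → weakPartial (chartTarget e) c (gLow τ e a b) y = κ' c a b y :=
    ae_all_iff.2 fun c => ae_all_iff.2 fun a => ae_all_iff.2 fun b => (hlow c a b).weakPartial_eq
  have h2 : ∀ᵐ y, ∀ c a b, y ∈ e.target → weakPartial (chartTarget e) c (gUp τ e a b) y = γ' c a b y :=
    ae_all_iff.2 fun c => ae_all_iff.2 fun a => ae_all_iff.2 fun b => (hup c a b).weakPartial_eq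
  rw [← setIntegral_eq_integral_of_forall_compl_eq_zero (s := e.target) fun y hy => by
    have hs := f.tsupport_subset
    have h0 : ∀ r, pderiv r f y = 0 := fun r => image_eq_zero_of_notMem_tsupport fun h' =>
      hy (hs (tsupport_pderiv_subset h'))
    rw [image_eq_zero_of_notMem_tsupport fun h' => hy (hs h')]
    simp [h0]]
  refine setIntegral_congr_ae e.open_target.measurableSet ?_
  filter_upwards [h1, h2] with y hy1 hy2 hy
  have e1 : (fun c a b => weakPartial (chartTarget e) c (gLow τ e a b) y) = fun c a b => κ' c a b y :=
    funext fun c => funext fun a => funext fun b => hy1 c a b hy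
  have e2 : (fun c a b => weakPartial (chartTarget e) c (gUp τ e a b) y) = fun c a b => γ' c a b y :=
    funext fun c => funext fun a => funext fun b => hy2 c a b hy
  have e3 : ∀ r, fieldV τ e r y = algV (fun a b => gUp τ e a b y)
      (fun c a b => weakPartial (chartTarget e) c (gLow τ e a b) y) r := fun r => rfl
  have e4 : fieldF τ e y = algF (fun a b => gUp τ e a b y)
      (fun c a b => weakPartial (chartTarget e) c (gUp τ e a b) y)
      (fun c a b => weakPartial (chartTarget e) c (gLow τ e a b) y) := rfl
  simp only [e3, e4, e1, e2]

/-- Where the metric is smooth, nonnegativity in the sense of distributions is pointwise. -/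
theorem mScal_nonneg_of_weak (h : ∀ y ∈ e.target, IsRegularAt (coordMatrix τ e) y)
    (hR : ∀ f : 𝓓(chartTarget e, ℝ), (∀ y, 0 ≤ f y) → 0 ≤ distScalarCurvature τ e f) {y : Euc n}
    (hy : y ∈ e.target) : 0 ≤ mScal (coordMatrix τ e) y := by
  set k := coordMatrix τ e with hk
  have hsc : ∀ y ∈ e.target, ContDiffAt ℝ ∞ (mScal k) y := fun y hy => by
    have hc := fun m i j => (h y hy).chr m i j
    refine ContDiffAt.sum fun i _ => ContDiffAt.sum fun j _ => ((h y hy).up i j).mul ?_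
    exact (ContDiffAt.sum fun m _ => (contDiffAt_pderiv (hc m i j)).sub
      (contDiffAt_pderiv (hc m i m))).add (ContDiffAt.sum fun m _ => ContDiffAt.sum fun s _ =>
      ((hc m m s).mul (hc s i j)).sub ((hc m j s).mul (hc s i m)))
  set V : Fin n → Euc n → ℝ := fun r z => algV (fun a b => mUp k a b z)
      (fun c a b => mDeriv k c a b z) r with hV
  have hVs : ∀ r, ContDiffOn ℝ ∞ (V r) e.target := fun r y hy => by
    have hc := fun m i j => (h y hy).chr m i j
    exact (ContDiffAt.sum fun i _ => ContDiffAt.sum fun j _ => (((h y hy).up i j).mul (hc r i j)).sub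
      (((h y hy).up i r).mul (hc j i j))).contDiffWithinAt
  have key : ∀ f : 𝓓(chartTarget e, ℝ), (∀ y, 0 ≤ f y) → 0 ≤ ∫ y, f y * mScal k y := by
    intro f hf
    have hφ := f.contDiff
    have hs : tsupport f ⊆ e.target := f.tsupport_subset
    have hc := f.hasCompactSupport
    have h1 := hR f hf
    rw [distScalarCurvature_eq (κ' := fun c a b => mDeriv k c a b)
      (γ' := fun c a b => pderiv c (mUp k a b))
      (fun c a b => isWeakPartial_of_contDiffOn fun y hy => ((h y hy).smooth a b).contDiffWithinAt)
      (fun c a b => isWeakPartial_of_contDiffOn fun y hy => ((h y hy).up a b).contDiffWithinAt)] at h1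
    have h2 : ∀ r, ∫ y, pderiv r (fun z => f z * V r z) y = 0 := fun r =>
      integral_pderiv_eq_zero (contDiff_mul_of_tsupport e.open_target hφ hs (hVs r)) hc.mul_right
    have i2 : ∀ r, Integrable (pderiv r (fun z => f z * V r z)) := fun r =>
      (contDiff_pderiv (contDiff_mul_of_tsupport e.open_target hφ hs (hVs r))).continuous.integrable_of_hasCompactSupport
        (hasCompactSupport_pderiv hc.mul_right)
    have i1 : Integrable fun y => f y * mScal k y :=
      (continuous_mul_of_tsupport e.open_target hφ.continuous hs fun y hy =>
        (hsc y hy).continuousAt.continuousWithinAt).integrable_of_hasCompactSupport hc.mul_right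
    -- Subtracting the divergence of `f V`, whose integral vanishes, turns the classical integrand
    -- into the distributional one.
    have h3 : ∫ y, f y * mScal k y = ∫ y, (f y * mScal k y - ∑ r, pderiv r (fun z => f z * V r z) y) := by
      rw [integral_sub i1 (integrable_finsetSum _ fun r _ => i2 r), integral_finsetSum _ fun r _ => i2 r]
      simp [h2]
    rw [h3]
    refine h1.trans_eq (integral_congr_ae (ae_of_all _ fun y => ?_))
    beta_reduce
    by_cases hy : y ∈ tsupport f
    · have hyt := hs hy
      rw [mScal_eq_div (h y hyt)]
      have h4 : ∀ r, pderiv r (fun z => f z * V r z) y =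
          pderiv r f y * V r y + f y * pderiv r (V r) y := fun r =>
        pderiv_mul (hφ.differentiable (by simp) y)
          (((hVs r).contDiffAt (e.open_target.mem_nhds hyt)).differentiableAt (by simp))
      simp only [h4, Finset.sum_add_distrib, mul_add, Finset.mul_sum]
      have e5 : ∑ r, algV (fun a b => gUp τ e a b y) (fun c a b => mDeriv k c a b y) r * pderiv r f y =
          ∑ r, pderiv r f y * V r y := Finset.sum_congr rfl fun r _ => mul_comm _ _
      have e6 : (fun a b => gUp τ e a b y) = fun a b => mUp k a b y := rfl
      have e7 : ∑ r, f y * pderiv r (fun z => algV (fun a b => mUp k a b z)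
          (fun c a b => mDeriv k c a b z) r) y = ∑ r, f y * pderiv r (V r) y := rfl
      rw [e5, e6, e7]
      ring
    · have h0 := notMem_tsupport_iff_eventuallyEq.1 hy
      have h3 : ∀ r, (fun y => f y * V r y) =ᶠ[𝓝 y] fun _ => 0 := fun r => h0.mono fun z hz => by simp [hz]
      have h4 : (f : Euc n → ℝ) =ᶠ[𝓝 y] fun _ => 0 := h0
      simp only [pderiv_congr (h3 _), pderiv_congr h4, pderiv_const, image_eq_zero_of_notMem_tsupport hy]
      simp
  -- If `R < 0` at a point, then by continuity also near it, and a bump function supported there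
  -- would have a negative pairing.
  by_contra hneg
  push Not at hneg
  have hN : {z | z ∈ e.target ∧ mScal k z < 0} ∈ 𝓝 y := by
    filter_upwards [e.open_target.mem_nhds hy, (hsc y hy).continuousAt.eventually (gt_mem_nhds hneg)]
      with z h1 h2 using ⟨h1, h2⟩
  obtain ⟨β, hβ⟩ := exists_isBump (isCompact_singleton (x := y)) isOpen_interior
    (singleton_subset_iff.2 (mem_interior_iff_mem_nhds.2 hN))
  have hβs : tsupport β ⊆ {z | z ∈ e.target ∧ mScal k z < 0} := hβ.supp.trans interior_subset
  have h1 := key ⟨β, hβ.smooth, hβ.compact, fun z hz => (hβs hz).1⟩ hβ.nonneg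
  have h1' : 0 ≤ ∫ y, β y * mScal k y := h1
  have hcont : Continuous fun y => β y * -mScal k y :=
    (continuous_mul_of_tsupport e.open_target hβ.smooth.continuous (fun z hz => (hβs hz).1)
      fun y hy => (hsc y hy).continuousAt.continuousWithinAt.neg)
  have hβy : β y = 1 := hβ.one.self_of_nhdsSet y rfl
  have h2 := hcont.integral_pos_of_hasCompactSupport_nonneg_nonzero (μ := volume) (x := y)
    hβ.compact.mul_right (fun z => ?_) (by simp [hβy, hneg.ne])
  · simp only [mul_neg, integral_neg] at h2
    linarith
  · by_cases hz : z ∈ tsupport β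
    · simpa using mul_nonpos_of_nonneg_of_nonpos (hβ.nonneg z) (hβs hz).2.le
    · simp [image_eq_zero_of_notMem_tsupport hz]

end WeakPartial

/-! ### Sign of the mollified curvature -/

namespace RegularisationData

set_option linter.unusedSectionVars false

variable {n : ℕ} {M : Type*} [TopologicalSpace M] [ChartedSpace (Euc n) M]
  {K : Set M} {D : RegularisationData n M K} (C : D.Cutoffs) [IsManifold 𝓘(ℝ, Euc n) ∞ M]

/-- The value at `z` is the pairing of `R[g]` with `f = η_i ρ_ε(z - ·)`: the product rule for `∂f`,
with its sign from the reflected kernel, reproduces the terms of `mollifiedCurvature`. The support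
of `f` lies in the chart whatever `z` is. -/
theorem Cutoffs.mollCurv_nonneg {P Q : ℝ≥0∞} [ep : ExponentPair P Q] {g : C0Metric n M}
    (hR : ScalarCurvatureNonneg g.inner) {i : Fin D.m}
    {κ' γ' : Fin n → Fin n → Fin n → Euc n → ℝ}
    (hM : MetricConv P (fun ε => C.mat (D.regularise g.inner ε) i) (C.mat g.inner i) κ' γ')
    {ε : ℝ} (hε : 0 < ε) (z : Euc n) : 0 ≤ mollCurv C g.inner κ' γ' i ε z := by
  have hP : 1 ≤ P := ep.one_le'
  set κ := C.mat g.inner i with hκ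
  set H := pushFun (D.ψ i) (D.η i) with hH
  have hHs : ContDiff ℝ ∞ H := D.contDiff_push_η i
  have hHc : HasCompactSupport H := D.compact_push_η i
  set σ := scaleKernel D.ρ ε with hσdef
  have hσ : ContDiff ℝ ∞ σ := D.isMollifier.scale_contDiff ε
  set V : Fin n → Euc n → ℝ := fun r y =>
    algV (fun a b => mUp κ a b y) (fun c a b => κ' c a b y) r with hV
  set F : Euc n → ℝ := fun y => algF (fun a b => mUp κ a b y) (fun c a b => γ' c a b y)
    (fun c a b => κ' c a b y) with hF
  have hVl : ∀ r, LocallyIntegrable (V r) := fun r =>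
    (hM.algV hP r).memLp.locallyIntegrable hP
  have hFl : LocallyIntegrable F := (hM.algF (Q := Q)).memLp.locallyIntegrable ep.one_le
  have hI : ∀ {u φ : Euc n → ℝ}, LocallyIntegrable u → Continuous φ → HasCompactSupport φ →
      Integrable fun t => u t * φ t := fun hu hφ hc => by
    simpa [mul_comm] using hu.integrable_smul_left_of_hasCompactSupport hφ hc
  -- The chart is restricted to the plateau. There the interpolated matrix equals the metric
  -- components, so the weak derivatives known on `ℝⁿ` serve in the chart.
  set U : Set M := (D.ψ i).source ∩ D.ψ i ⁻¹' D.plateau i with hU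
  have hUo : IsOpen U := (D.ψ i).isOpen_inter_preimage isOpen_interior
  set e := (D.ψ i).restr U with he
  have hes : IsSmoothChart e := (D.ψ_smooth i).restr hUo
  have het : ∀ y, y ∈ e.target ↔ y ∈ D.plateau i := by
    intro y
    rw [he, (D.ψ i).restr_target, hUo.interior_eq]
    constructor
    · rintro ⟨h1, h2⟩
      have h3 : D.ψ i ((D.ψ i).symm y) ∈ D.plateau i := h2.2
      rwa [(D.ψ i).right_inv h1] at h3
    · intro h
      have h1 := D.plateau_subset_target i h
      refine ⟨h1, (D.ψ i).map_target h1, ?_⟩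
      rw [mem_preimage, (D.ψ i).right_inv h1]
      exact h
  have hmat : ∀ y ∈ e.target, coordMatrix g.inner e y = κ y := fun y hy =>
    (chartMat_eq (C.β_eq_one (D.plateau_subset_image i ((het y).1 hy))).self_of_nhds).symm
  have hlow : ∀ c a b, IsWeakPartial (chartTarget e) c (gLow g.inner e a b) (κ' c a b) := fun c a b =>
    ((hM.low a b).hasWeakPartial hP c).isWeakPartial (hM.low a b).cont.locallyIntegrable
      (((hM.low a b).deriv c).memLp.locallyIntegrable hP) fun y hy => by rw [gLow, hmat y hy]
  have hup : ∀ c a b, IsWeakPartial (chartTarget e) c (gUp g.inner e a b) (γ' c a b) := fun c a b =>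
    ((hM.up a b).hasWeakPartial hP c).isWeakPartial (hM.up a b).cont.locallyIntegrable
      (((hM.up a b).deriv c).memLp.locallyIntegrable hP) fun y hy => by rw [gUp, hmat y hy]; rfl
  have hτs : ContDiff ℝ ∞ fun t => σ (z - t) := hσ.comp (contDiff_const.sub contDiff_id)
  set f : Euc n → ℝ := fun t => H t * σ (z - t) with hf
  have hfs : ContDiff ℝ ∞ f := hHs.mul hτs
  have hfc : HasCompactSupport f := hHc.mul_right
  have hft : tsupport f ⊆ e.target := fun y hy => (het y).2 (D.tsupport_push_η i
    (closure_mono (Function.support_mul_subset_left _ _) hy))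
  have hfnn : ∀ y, 0 ≤ f y := fun y => mul_nonneg
    (indicator_nonneg (fun y _ => D.η_nonneg i _) y) (D.isMollifier.scale_nonneg hε _)
  have hfd : ∀ r t, pderiv r f t = pderiv r H t * σ (z - t) - H t * pderiv r σ (z - t) := by
    intro r t
    rw [hf, pderiv_mul (hHs.differentiable (by simp) t) (hτs.differentiable (by simp) t),
      pderiv_comp_sub_left (hσ.differentiable (by simp))]
    ring
  have h1 := hR e hes ⟨f, hfs, hfc, hft⟩ hfnn
  rw [distScalarCurvature_eq hlow hup] at h1
  refine h1.trans_eq ?_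
  have hdτ : ∀ r, Continuous fun t => pderiv r σ (z - t) := fun r =>
    (contDiff_pderiv hσ).continuous.comp (continuous_const.sub continuous_id)
  have i1 : ∀ r, Integrable fun t => H t * V r t * pderiv r σ (z - t) := fun r => by
    have := hI (hVl r) (hHs.continuous.mul (hdτ r)) hHc.mul_right
    exact this.congr (ae_of_all _ fun t => by simp only [Pi.mul_apply]; ring)
  have i2 : Integrable fun t => (-(∑ r, V r t * pderiv r H t) + F t * H t) * σ (z - t) := by
    have h2 : ∀ r, Integrable fun t => V r t * (pderiv r H t * σ (z - t)) := fun r =>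
      hI (hVl r) ((contDiff_pderiv hHs).continuous.mul hτs.continuous)
        (hasCompactSupport_pderiv hHc).mul_right
    have h3 := hI hFl hfs.continuous hfc
    refine ((integrable_finsetSum Finset.univ fun r _ => h2 r).neg.add h3).congr
      (ae_of_all _ fun t => ?_)
    simp only [Pi.add_apply, Pi.neg_apply, hf, add_mul, neg_mul, Finset.sum_mul]
    congr 1
    · exact congrArg Neg.neg (Finset.sum_congr rfl fun r _ => by ring)
    · ring
  rw [mollCurv, mollifiedCurvature]
  simp only [conv_apply]
  have e1 : ∑ r, ∫ t, H t * V r t * pderiv r σ (z - t) =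
      ∫ t, ∑ r, H t * V r t * pderiv r σ (z - t) := (integral_finsetSum _ fun r _ => i1 r).symm
  refine Eq.trans ?_ ((congrArg₂ (· + ·) e1 rfl).trans
    (integral_add (integrable_finsetSum _ fun r _ => i1 r) i2).symm).symm
  refine integral_congr_ae ?_
  filter_upwards with y
  have e3 : ∀ r, pderiv r (⟨f, hfs, hfc, hft⟩ : 𝓓(chartTarget e, ℝ)) y = pderiv r f y := fun r => rfl
  by_cases hy : y ∈ e.target
  · have e2 : (fun a b => gUp g.inner e a b y) = fun a b => mUp κ a b y := by
      funext a b; rw [gUp, hmat y hy]; rfl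
    have e4 : ∑ r, V r y * pderiv r f y = ∑ r, V r y * pderiv r H y * σ (z - y) -
        ∑ r, H y * V r y * pderiv r σ (z - y) := by
      rw [← Finset.sum_sub_distrib]
      exact Finset.sum_congr rfl fun r _ => by rw [hfd]; ring
    have e5 : ∑ r, algV (fun a b => mUp κ a b y) (fun c a b => κ' c a b y) r *
        pderiv r (⟨f, hfs, hfc, hft⟩ : 𝓓(chartTarget e, ℝ)) y = ∑ r, V r y * pderiv r f y := rfl
    have e6 : (⟨f, hfs, hfc, hft⟩ : 𝓓(chartTarget e, ℝ)) y = H y * σ (z - y) := rfl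
    rw [e2, e5, e4, e6, ← Finset.sum_mul]
    ring
  · have h2 : y ∉ tsupport H := fun h => hy ((het y).2 (D.tsupport_push_η i h))
    have h3 : ∀ r, pderiv r H y = 0 := fun r => image_eq_zero_of_notMem_tsupport fun h =>
      h2 (tsupport_pderiv_subset h)
    have h4 : ∀ r, pderiv r f y = 0 := fun r => by
      rw [hfd, h3, image_eq_zero_of_notMem_tsupport h2]; ring
    have e6 : (⟨f, hfs, hfc, hft⟩ : 𝓓(chartTarget e, ℝ)) y = H y * σ (z - y) := rfl
    simp only [e3, h3, h4, e6, image_eq_zero_of_notMem_tsupport h2]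
    simp

end RegularisationData

section ClassicalSign

set_option linter.unusedSectionVars false

variable {n : ℕ} {M : Type*} [TopologicalSpace M] [ChartedSpace (Euc n) M]
  [IsManifold 𝓘(ℝ, Euc n) ∞ M] {e : Chart n M}

/-- The distributional inequality holds in every smooth chart, hence in the restriction of `e` to
`U`, where the metric is smooth throughout. -/
theorem mScal_nonneg {g : C0Metric n M} (hR : ScalarCurvatureNonneg g.inner) {U : Set M}
    (hU : IsOpen U) (hs : IsSmoothMetricOn g U) (he : IsSmoothChart e) {y : Euc n}
    (hy : y ∈ e.target) (hyU : e.symm y ∈ U) : 0 ≤ mScal (coordMatrix g.inner e) y := by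
  have hmem : ∀ z, z ∈ (e.restr U).target ↔ z ∈ e.target ∧ e.symm z ∈ U := fun z => by
    rw [e.restr_target, hU.interior_eq]; rfl
  refine mScal_nonneg_of_weak (e := e.restr U) (fun z hz => ?_) (hR _ (he.restr hU))
    ((hmem y).2 ⟨hy, hyU⟩)
  obtain ⟨h1, h2⟩ := (hmem z).1 hz
  refine isRegularAt_of_contMDiff he h1 ?_ (coordMatrix_posDef g he h1).det_pos.ne'
  filter_upwards [hU.mem_nhds h2] with x hx using hs.contMDiffAt hU hx

end ClassicalSign

/-! ### The Riemannian volume in a chart -/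

section Volume

set_option linter.unusedSectionVars false

variable {n : ℕ} {M : Type*} [TopologicalSpace M] [ChartedSpace (Euc n) M]
  [IsManifold 𝓘(ℝ, Euc n) ∞ M] [T2Space M] [MeasurableSpace M] [BorelSpace M]

theorem measurableSet_inter_preimage {X : Type*} [TopologicalSpace X] [MeasurableSpace X]
    [BorelSpace X] {Y : Type*} [TopologicalSpace Y] [MeasurableSpace Y] [BorelSpace Y] {T : Set X}
    (hT : MeasurableSet T) {F : X → Y} (hF : ContinuousOn F T) {B : Set Y} (hB : MeasurableSet B) :
    MeasurableSet (T ∩ F ⁻¹' B) := by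
  have h : MeasurableSet (T.domRestrict F ⁻¹' B) := hF.domRestrict.measurable hB
  have h2 := hT.subtype_image h
  convert h2 using 1
  ext x
  exact ⟨fun h => ⟨⟨x, h.1⟩, h.2, rfl⟩, fun ⟨y, hy, hx⟩ => hx ▸ ⟨y.2, hy⟩⟩

/-- On the compact set `T ∩ tsupport f` the density is bounded and the coordinate change distorts
Lebesgue measure boundedly. Keeping the factor `e '' (T ∩ tsupport f)` in the bound shows that the
piece does not charge `T` when the two sets are disjoint. -/
theorem chartDensity_le (g : C0Metric n M) {e₀ e : Chart n M} (he₀ : IsSmoothChart e₀)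
    (he : IsSmoothChart e) {f : M → ℝ} (hf : Continuous f) (hfs : tsupport f ⊆ e₀.source)
    {T : Set M} (hT : IsCompact T) (hTe : T ⊆ e.source) :
    ∃ a : ℝ≥0∞, a ≠ ⊤ ∧ ∀ B : Set (Euc n), MeasurableSet B →
      ((volume.restrict e₀.target).withDensity fun y =>
        ENNReal.ofReal (f (e₀.symm y) * √(coordMatrix g.inner e₀ y).det))
        (e₀.symm ⁻¹' (T ∩ e ⁻¹' B)) ≤ a * volume (B ∩ e '' (T ∩ tsupport f)) := by
  set w : Euc n → ℝ := fun y => f (e₀.symm y) * √(coordMatrix g.inner e₀ y).det with hw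
  set φ := e₀.symm.trans e with hφ
  set S : Set (Euc n) := e₀ '' (T ∩ tsupport f) with hS
  have hTf : IsCompact (T ∩ tsupport f) := hT.inter_right (isClosed_tsupport f)
  have hSc : IsCompact S := hTf.image_of_continuousOn
    (e₀.continuousOn.mono (inter_subset_right.trans hfs))
  have hSt : S ⊆ e₀.target := by
    rintro _ ⟨x, hx, rfl⟩; exact e₀.map_source (hfs hx.2)
  have hSφ : S ⊆ φ.source := by
    rintro _ ⟨x, hx, rfl⟩
    refine mem_transition_source.2 ⟨e₀.map_source (hfs hx.2), ?_⟩
    rw [e₀.left_inv (hfs hx.2)]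
    exact hTe hx.1
  have hwc : ContinuousOn w e₀.target := by
    refine (hf.comp_continuousOn e₀.continuousOn_symm).mul
      (Real.continuous_sqrt.comp_continuousOn ?_)
    have h : ContinuousOn (fun y => coordMatrix g.inner e₀ y) e₀.target :=
      continuousOn_pi.2 fun a => continuousOn_pi.2 fun b =>
        continuousOn_gLow he₀ (continuous_tensorSection g) a b
    exact (Continuous.matrix_det continuous_id).comp_continuousOn h
  obtain ⟨b, hb⟩ := hSc.exists_bound_of_continuousOn (hwc.mono hSt)
  obtain ⟨c, hc, -, hle⟩ := (isSmoothTransition he he₀).map_restrict_le hSc hSφ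
  refine ⟨ENNReal.ofReal b * c, ENNReal.mul_ne_top ENNReal.ofReal_ne_top hc, fun B hB => ?_⟩
  set A := T ∩ e ⁻¹' B with hA
  have hAm : MeasurableSet A :=
    measurableSet_inter_preimage hT.isClosed.measurableSet (e.continuousOn.mono hTe) hB
  have hA' : MeasurableSet (e₀.target ∩ e₀.symm ⁻¹' A) :=
    measurableSet_inter_preimage e₀.open_target.measurableSet e₀.continuousOn_symm hAm
  set ν := (volume.restrict e₀.target).withDensity fun y => ENNReal.ofReal (w y) with hν
  have h0 : ν e₀.targetᶜ = 0 := withDensity_absolutelyContinuous _ _ (by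
    rw [Measure.restrict_apply e₀.open_target.measurableSet.compl]; simp)
  have h1 : ν (e₀.symm ⁻¹' A) ≤ ν (e₀.target ∩ e₀.symm ⁻¹' A) := by
    calc ν (e₀.symm ⁻¹' A) ≤ ν (e₀.target ∩ e₀.symm ⁻¹' A ∪ e₀.targetᶜ) :=
          measure_mono fun y hy => by
            by_cases hyt : y ∈ e₀.target
            · exact Or.inl ⟨hyt, hy⟩
            · exact Or.inr hyt
      _ ≤ _ := (measure_union_le _ _).trans_eq (by rw [h0, add_zero])
  refine h1.trans ?_
  rw [hν, withDensity_apply _ hA', Measure.restrict_restrict hA']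
  have hset : e₀.target ∩ e₀.symm ⁻¹' A ∩ e₀.target = e₀.target ∩ e₀.symm ⁻¹' A :=
    inter_eq_left.2 inter_subset_left
  rw [hset]
  have h2 : ∀ y ∈ e₀.target ∩ e₀.symm ⁻¹' A, ENNReal.ofReal (w y) ≤
      (S ∩ φ ⁻¹' B).indicator (fun _ => ENNReal.ofReal b) y := by
    rintro y ⟨hyt, hyA⟩
    by_cases hy : e₀.symm y ∈ tsupport f
    · have hyS : y ∈ S := ⟨e₀.symm y, ⟨hyA.1, hy⟩, e₀.right_inv hyt⟩
      have hm : y ∈ S ∩ φ ⁻¹' B := ⟨hyS, hyA.2⟩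
      rw [indicator_of_mem hm]
      exact ENNReal.ofReal_le_ofReal ((le_abs_self _).trans (hb y hyS))
    · simp [hw, image_eq_zero_of_notMem_tsupport hy]
  have hSB : MeasurableSet (S ∩ φ ⁻¹' B) :=
    measurableSet_inter_preimage hSc.measurableSet (φ.continuousOn.mono hSφ) hB
  calc ∫⁻ y in e₀.target ∩ e₀.symm ⁻¹' A, ENNReal.ofReal (w y)
      ≤ ∫⁻ y in e₀.target ∩ e₀.symm ⁻¹' A, (S ∩ φ ⁻¹' B).indicator (fun _ => ENNReal.ofReal b) y :=
        setLIntegral_mono' hA' h2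
    _ ≤ ∫⁻ y, (S ∩ φ ⁻¹' B).indicator (fun _ => ENNReal.ofReal b) y := setLIntegral_le_lintegral _ _
    _ = ENNReal.ofReal b * volume (S ∩ φ ⁻¹' B) := lintegral_indicator_const hSB _
    _ ≤ ENNReal.ofReal b * volume (S ∩ φ ⁻¹' (B ∩ e '' (T ∩ tsupport f))) := by
        refine mul_le_mul_right (measure_mono ?_) _
        rintro _ ⟨⟨x, hx, rfl⟩, hyB⟩
        refine ⟨⟨x, hx, rfl⟩, hyB, x, hx, ?_⟩
        exact (congrArg e (e₀.left_inv (hfs hx.2))).symm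
    _ ≤ ENNReal.ofReal b * (c * volume (B ∩ e '' (T ∩ tsupport f))) := by
        gcongr
        have h3 := hle (B ∩ e '' (T ∩ tsupport f))
        rwa [Measure.map_apply_of_aemeasurable
          ((φ.continuousOn.mono hSφ).aemeasurable hSc.measurableSet) (hB.inter
            (hTf.image_of_continuousOn (e.continuousOn.mono
              (inter_subset_left.trans hTe))).measurableSet),
          Measure.restrict_apply' hSc.measurableSet, inter_comm] at h3
    _ = _ := by rw [mul_assoc]

variable [SigmaCompactSpace M]

/-- By local finiteness only finitely many pieces of the partition of unity meet the compact set
`T`, and each is dominated by Lebesgue measure. Upper bounds on `L^q` norms need nothing more. -/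
theorem riemannianVolume_map_le (g : C0Metric n M) {e : Chart n M} (he : IsSmoothChart e)
    {T : Set M} (hT : IsCompact T) (hTe : T ⊆ e.source) :
    ∃ c : ℝ≥0∞, c ≠ ⊤ ∧ c ≠ 0 ∧ ((riemannianVolume g).restrict T).map e ≤ c • volume := by
  set η := (SmoothPartitionOfUnity.exists_isSubordinate_chartAt_source 𝓘(ℝ, Euc n) M).choose with hη
  have hsub := (SmoothPartitionOfUnity.exists_isSubordinate_chartAt_source 𝓘(ℝ, Euc n) M).choose_spec
  have hfin : {c : M | (tsupport (η c) ∩ T).Nonempty}.Finite :=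
    η.locallyFinite.closure.finite_nonempty_inter_compact hT
  choose a ha hle using fun c : M => chartDensity_le g (IsSmoothChart.chartAt c) he
    (η c).contMDiff.continuous (hsub c) hT hTe
  -- The summand `1` keeps the constant nonzero.
  refine ⟨∑ c ∈ hfin.toFinset, a c + 1, ?_, by simp, Measure.le_iff.2 fun B hB => ?_⟩
  · exact ENNReal.add_ne_top.2 ⟨ENNReal.sum_ne_top.2 fun c _ => ha c, ENNReal.one_ne_top⟩
  have hAm : MeasurableSet (T ∩ e ⁻¹' B) :=
    measurableSet_inter_preimage hT.isClosed.measurableSet (e.continuousOn.mono hTe) hB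
  rw [Measure.map_apply_of_aemeasurable
    ((e.continuousOn.mono hTe).aemeasurable hT.isClosed.measurableSet) hB,
    Measure.restrict_apply' hT.isClosed.measurableSet, inter_comm, riemannianVolume,
    Measure.sum_apply _ hAm]
  set ν : M → Measure (Euc n) := fun c =>
    (volume.restrict (chartAt (Euc n) c).target).withDensity fun y =>
        ENNReal.ofReal (η c ((chartAt (Euc n) c).symm y) *
          √(coordMatrix g.inner (chartAt (Euc n) c) y).det) with hν
  -- `Measure.map` is zero for a map that is not a.e. measurable, so the upper bound holds without
  -- settling the measurability of the globally defined inverse chart.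
  have hbound : ∀ c, (ν c).map (chartAt (Euc n) c).symm (T ∩ e ⁻¹' B) ≤
      ν c ((chartAt (Euc n) c).symm ⁻¹' (T ∩ e ⁻¹' B)) := by
    intro c
    by_cases hm : AEMeasurable (chartAt (Euc n) c).symm (ν c)
    · rw [Measure.map_apply_of_aemeasurable hm hAm]
    · rw [Measure.map_of_not_aemeasurable hm]; simp
  have hzero : ∀ c ∉ hfin.toFinset, (ν c).map (chartAt (Euc n) c).symm (T ∩ e ⁻¹' B) = 0 := by
    intro c hc
    have he : T ∩ tsupport (η c) = ∅ := by
      by_contra h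
      obtain ⟨x, hx⟩ := nonempty_iff_ne_empty.2 h
      exact hc (hfin.mem_toFinset.2 ⟨x, hx.2, hx.1⟩)
    have h := (hbound c).trans (hle c B hB)
    rw [he, image_empty, inter_empty, measure_empty, mul_zero] at h
    exact le_antisymm h zero_le
  calc ∑' c, (ν c).map (chartAt (Euc n) c).symm (T ∩ e ⁻¹' B)
      = ∑ c ∈ hfin.toFinset, (ν c).map (chartAt (Euc n) c).symm (T ∩ e ⁻¹' B) :=
        tsum_eq_sum hzero
    _ ≤ ∑ c ∈ hfin.toFinset, a c * volume B :=
        Finset.sum_le_sum fun c _ => ((hbound c).trans (hle c B hB)).trans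
          (mul_le_mul_right (measure_mono inter_subset_left) _)
    _ ≤ (∑ c ∈ hfin.toFinset, a c + 1) * volume B := by
        rw [add_mul, Finset.sum_mul]; exact le_self_add
    _ = _ := by simp

end Volume

/-! ### The negative part of the scalar curvature -/

section ScalarCurvature

set_option linter.unusedSectionVars false

variable {n : ℕ} {M : Type*} [TopologicalSpace M] [ChartedSpace (Euc n) M]

theorem scalarCurvature_congr {τ τ' : TensorField02 n M} {x : M} (h : ∀ᶠ x' in 𝓝 x, τ x' = τ' x') :
    scalarCurvature τ x = scalarCurvature τ' x := by
  set e := chartAt (Euc n) x with he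
  have hx : x ∈ e.source := mem_chart_source _ x
  have h1 : coordMatrix τ e =ᶠ[𝓝 (e x)] coordMatrix τ' e := by
    have h2 : ∀ᶠ x' in 𝓝 (e.symm (e x)), τ x' = τ' x' := by rwa [e.left_inv hx]
    filter_upwards [(e.continuousAt_symm (e.map_source hx)).eventually h2] with y hy using
      coordMatrix_congr hy
  exact mScal_congr h1

variable [IsManifold 𝓘(ℝ, Euc n) ∞ M]

theorem scalarCurvature_nonneg {g : C0Metric n M} (hR : ScalarCurvatureNonneg g.inner) {U : Set M}
    (hU : IsOpen U) (hs : IsSmoothMetricOn g U) {x : M} (hx : x ∈ U) :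
    0 ≤ scalarCurvature g.inner x :=
  mScal_nonneg hR hU hs (IsSmoothChart.chartAt x) ((chartAt (Euc n) x).map_source
    (mem_chart_source _ x)) (by rwa [(chartAt (Euc n) x).left_inv (mem_chart_source _ x)])

end ScalarCurvature

theorem exponentPair_ofReal {p : ℝ} (hp : 2 ≤ p) :
    ExponentPair (ENNReal.ofReal p) (ENNReal.ofReal (p / 2)) where
  holder := ⟨by
    rw [ENNReal.ofReal_div_of_pos two_pos, ENNReal.inv_div (by simp) (by simp),
      ENNReal.div_eq_inv_mul, ENNReal.ofReal_ofNat, mul_comm, two_mul]⟩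
  one_le := by
    rw [← ENNReal.ofReal_one]; exact ENNReal.ofReal_le_ofReal (by linarith)
  ne_top := ENNReal.ofReal_ne_top

/-! ### The lower bound for the scalar curvature and the conclusion -/

namespace RegularisationData

set_option linter.unusedSectionVars false

variable {n : ℕ} {M : Type*} [TopologicalSpace M] [ChartedSpace (Euc n) M]
  {K : Set M} {D : RegularisationData n M K} (C : D.Cutoffs) [IsManifold 𝓘(ℝ, Euc n) ∞ M]

theorem mollCurv_eq_zero (τ : TensorField02 n M) (κ' γ' : Fin n → Fin n → Fin n → Euc n → ℝ)
    (i : Fin D.m) {ε : ℝ} (hε : 0 < ε) {z : Euc n}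
    (hz : z ∉ Metric.cthickening ε (D.ψ i '' tsupport (D.η i))) :
    mollCurv C τ κ' γ' i ε z = 0 := by
  have hH := tsupport_pushFun_subset (D.η_compact i) (D.η_supp i)
  have key : ∀ u : Euc n → ℝ, (∀ y, y ∉ tsupport (pushFun (D.ψ i) (D.η i)) → u y = 0) →
      z ∉ Metric.cthickening ε (tsupport u) := fun u hu h =>
    hz (Metric.cthickening_subset_of_subset ε ((closure_minimal (fun y (hy : u y ≠ 0) => by_contra fun h' =>
      hy (hu y h')) (isClosed_tsupport _)).trans hH) h)
  rw [mollCurv, mollifiedCurvature, Finset.sum_eq_zero fun r _ => conv_eq_zero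
    (fun w hw => D.isMollifier.scale_pderiv_norm_le hε hw) (key _ fun y hy => by
      rw [image_eq_zero_of_notMem_tsupport hy, zero_mul]), conv_eq_zero
    (fun w hw => D.isMollifier.scale_norm_le hε hw) (key _ fun y hy => by
      have h0 : ∀ r, pderiv r (pushFun (D.ψ i) (D.η i)) y = 0 := fun r =>
        image_eq_zero_of_notMem_tsupport fun h => hy (tsupport_pderiv_subset h)
      simp [h0, image_eq_zero_of_notMem_tsupport hy]), add_zero]

theorem moll_eq_zero (τ : TensorField02 n M) (i : Fin D.m) (c d : Fin n) {ε : ℝ} (hε : 0 < ε)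
    {z : Euc n} (hz : z ∉ Metric.cthickening ε (D.ψ i '' tsupport (D.η i))) :
    D.moll τ i c d ε z = 0 :=
  conv_eq_zero (fun _ hw => D.isMollifier.scale_norm_le hε hw) fun h =>
    hz (Metric.cthickening_subset_of_subset ε ((D.tsupport_localised i c d).trans
      (tsupport_pushFun_subset (D.η_compact i) (D.η_supp i))) h)

/-- The error term in the lower bound for the scalar curvature in the `j`-th chart. -/
def Cutoffs.err (τ : TensorField02 n M) (κ' γ' : Fin D.m → Fin n → Fin n → Fin n → Euc n → ℝ)
    (j : Fin D.m) (ε : ℝ) (y : Euc n) : ℝ :=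
  C.ζ j y * mScal (C.mat (D.regularise τ ε) j) y -
    ∑ i, transport (fun y => C.ζ j y * D.χ i ((D.ψ j).symm y)) ((D.ψ j).symm.trans (D.ψ i))
      (mollCurv C τ (κ' i) (γ' i) i ε) y -
    C.ζ j y * D.ηC ((D.ψ j).symm y) * mScal (C.mat τ j) y

/-- Where `ζ_j = 1` the error is `R[g_ε]` minus the mollified curvatures minus `η_𝒞 R[g]`, and the
subtracted terms are nonnegative for small `ε`. -/
theorem Cutoffs.eventually_err_le {P Q : ℝ≥0∞} [ep : ExponentPair P Q] {g : C0Metric n M}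
    (hs : IsSmoothMetricOn g Kᶜ) (hK : IsClosed K) (hR : ScalarCurvatureNonneg g.inner)
    {κ' γ' : Fin D.m → Fin n → Fin n → Fin n → Euc n → ℝ}
    (hM : ∀ i, MetricConv P (fun ε => C.mat (D.regularise g.inner ε) i) (C.mat g.inner i)
      (κ' i) (γ' i)) :
    ∀ᶠ ε in 𝓝[>] (0 : ℝ), ∀ j, ∀ x ∈ (D.ψ j).source, C.ζ j (D.ψ j x) = 1 →
      C.err g.inner κ' γ' j ε (D.ψ j x) ≤ scalarCurvature (D.regularise g.inner ε) x := by
  have h1 : ∀ i, ∀ᶠ ε in 𝓝[>] (0 : ℝ),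
      Metric.cthickening ε (D.ψ i '' tsupport (D.η i)) ⊆ D.plateau i := fun i => by
    obtain ⟨δ, hδ, h⟩ := (D.isCompact_image_η i).exists_cthickening_subset_open isOpen_interior
      (D.image_η_subset_plateau i)
    filter_upwards [tendsto_scaleKernel_radius 1 hδ] with ε h2
    exact (Metric.cthickening_mono (by linarith) _).trans h
  filter_upwards [self_mem_nhdsWithin, eventually_all.2 h1, eventually_all.2 fun i => (hM i).det_ne]
    with ε hε hcth hdet j x hx hζ
  have hε : 0 < ε := hε
  set y := D.ψ j x with hy
  have hyt : y ∈ (D.ψ j).target := (D.ψ j).map_source hx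
  have hxy : (D.ψ j).symm y = x := (D.ψ j).left_inv hx
  have hys : y ∈ tsupport (C.ζ j) := subset_tsupport _ (by
    rw [Function.mem_support, hζ]; exact one_ne_zero)
  have hβ := C.β_eq_one_of_mem_tsupport hys
  have hmat : ∀ τ : TensorField02 n M, mScal (C.mat τ j) y = mScal (coordMatrix τ (D.ψ j)) y :=
    fun τ => mScal_congr (hβ.mono fun z hz => chartMat_eq hz)
  have hRε : scalarCurvature (D.regularise g.inner ε) x = mScal (C.mat (D.regularise g.inner ε) j) y := by
    rw [hmat, ← scalarCurvature_eq_mScal (D.ψ_smooth j) hyt (Eventually.of_forall fun x' =>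
      D.contMDiffAt_regularise (continuous_tensorSection g)
        (fun x hx => hs.contMDiffAt hK.isOpen_compl hx) hε x') (D.regularise_symm g.symm ε), hxy]
    have := hdet j y
    rwa [Cutoffs.mat, chartMat_eq hβ.self_of_nhds] at this
  have hA : 0 ≤ ∑ i, transport (fun y => C.ζ j y * D.χ i ((D.ψ j).symm y))
      ((D.ψ j).symm.trans (D.ψ i)) (mollCurv C g.inner (κ' i) (γ' i) i ε) y := by
    refine Finset.sum_nonneg fun i _ => ?_
    rw [transport, hζ, one_mul, hxy]
    have hφ : ((D.ψ j).symm.trans (D.ψ i)) y = D.ψ i x := by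
      rw [← hxy]; rfl
    rw [hφ]
    by_cases hχ : D.χ i x = 0
    · simp [hχ]
    -- The cut-off `χ_i` has no assumed sign. For small `ε` the mollified curvature is supported in
    -- the plateau, where `χ_i = 1`.
    by_cases hz : D.ψ i x ∈ Metric.cthickening ε (D.ψ i '' tsupport (D.η i))
    · have h2 := (interior_subset (hcth i hz)).2
      rw [(D.ψ i).left_inv (D.χ_supp i (subset_tsupport _ hχ))] at h2
      rw [h2, one_mul]
      exact C.mollCurv_nonneg (Q := Q) hR (hM i) hε _
    · rw [mollCurv_eq_zero C g.inner _ _ i hε hz, mul_zero]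
  have hB : 0 ≤ D.ηC x * mScal (C.mat g.inner j) y := by
    by_cases h0 : D.ηC x = 0
    · simp [h0]
    · refine mul_nonneg (D.ηC_nonneg x) ?_
      rw [hmat]
      exact mScal_nonneg hR hK.isOpen_compl hs (D.ψ_smooth j) hyt (by
        rw [hxy]; exact D.ηC_supp (subset_tsupport _ h0))
  rw [Cutoffs.err, hRε, hζ, hxy, one_mul, one_mul]
  linarith

/-- For small `ε` the mollified pieces live where the `ζ_j` equal `1`. At any other point they
vanish nearby, as do all the `η_i`. Hence `g_ε = g` near that point, which lies in the support of
`η_𝒞`, so outside `K`. -/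
theorem Cutoffs.eventually_nonneg_away {g : C0Metric n M}
    (hs : IsSmoothMetricOn g Kᶜ) (hK : IsClosed K) (hR : ScalarCurvatureNonneg g.inner) :
    ∀ᶠ ε in 𝓝[>] (0 : ℝ), ∀ x, (∀ j, x ∈ (D.ψ j).source → C.ζ j (D.ψ j x) ≠ 1) →
      0 ≤ scalarCurvature (D.regularise g.inner ε) x := by
  have h1 : ∀ i, ∀ᶠ ε in 𝓝[>] (0 : ℝ),
      Metric.cthickening ε (D.ψ i '' tsupport (D.η i)) ⊆ {z | C.ζ i z = 1} := fun i => by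
    obtain ⟨δ, hδ, h⟩ := (D.isCompact_image_η i).exists_cthickening_subset_open isOpen_interior
      (subset_interior_iff_mem_nhdsSet.2 (C.bump_ζ i).one)
    filter_upwards [tendsto_scaleKernel_radius 1 hδ] with ε h2
    exact ((Metric.cthickening_mono (by linarith) _).trans h).trans interior_subset
  filter_upwards [self_mem_nhdsWithin, eventually_all.2 h1] with ε hε hcth x hx
  have hε : 0 < ε := hε
  have hηx : ∀ i, x ∉ tsupport (D.η i) := fun i hi => hx i (D.η_supp i hi)
    ((C.bump_ζ i).one.self_of_nhdsSet _ ⟨x, hi, rfl⟩)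
  have hη : ∀ᶠ x' in 𝓝 x, ∀ i, D.η i x' = 0 := eventually_all.2 fun i =>
    notMem_tsupport_iff_eventuallyEq.1 (hηx i)
  have hηC : ∀ᶠ x' in 𝓝 x, D.ηC x' = 1 := hη.mono fun x' h => by
    have := D.sum_eq_one x'
    rwa [Finset.sum_eq_zero fun i _ => h i, add_zero] at this
  -- Equality of the tensors is needed on a neighbourhood, since curvature involves derivatives. The
  -- complement of the closed thickening is open, and so is that of the support of `χ_i`.
  have hmoll : ∀ i, ∀ᶠ x' in 𝓝 x, D.χ i x' = 0 ∨ ∀ c d, D.moll g.inner i c d ε (D.ψ i x') = 0 := by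
    intro i
    by_cases hi : x ∈ tsupport (D.χ i)
    · have hxs := D.χ_supp i hi
      have h2 : D.ψ i x ∉ Metric.cthickening ε (D.ψ i '' tsupport (D.η i)) := fun h =>
        hx i hxs (hcth i h)
      filter_upwards [((D.ψ i).continuousAt hxs).eventually
        (Metric.isClosed_cthickening.isOpen_compl.mem_nhds h2)] with x' hx'
      exact Or.inr fun c d => D.moll_eq_zero g.inner i c d hε hx'
    · filter_upwards [notMem_tsupport_iff_eventuallyEq.1 hi] with x' hx' using Or.inl hx'
  have heq : ∀ᶠ x' in 𝓝 x, D.regularise g.inner ε x' = g.inner x' := by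
    filter_upwards [hηC, eventually_all.2 hmoll] with x' h2 h3
    ext v w
    rw [D.regularise_apply, h2, one_mul, Finset.sum_eq_zero fun i _ => ?_, add_zero]
    rcases h3 i with h4 | h4
    · rw [h4, zero_mul]
    · have h5 : ∀ v w : Euc n, D.mollified g.inner ε i (D.ψ i x') v w = 0 := fun v w => by
        rw [mollified_apply]; simp [h4]
      exact mul_eq_zero_of_right _ (h5 _ _)
  rw [scalarCurvature_congr heq]
  exact scalarCurvature_nonneg hR hK.isOpen_compl hs (D.ηC_supp (subset_tsupport _ (by
    rw [Function.mem_support, hηC.self_of_nhds]; exact one_ne_zero)))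

/-- The negative part is at most the sum of the absolute errors on the compact sets `T j`. There the
`L^{p/2}` norm for `μ_g` is controlled by the Lebesgue norm in the chart, which tends to zero. -/
theorem tendsto_eLpNorm_scalarCurvature [T2Space M] [SigmaCompactSpace M] [MeasurableSpace M]
    [BorelSpace M] (D : RegularisationData n M K) {p : ℝ} (hp : 2 ≤ p) {g : C0Metric n M}
    (hW : MemW1pLoc g.inner p) (hK : IsCompact K) (hs : IsSmoothMetricOn g Kᶜ)
    (hR : ScalarCurvatureNonneg g.inner) :
    Tendsto (fun ε : ℝ => eLpNorm (fun x => max (-scalarCurvature (D.regularise g.inner ε) x) 0)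
      (ENNReal.ofReal (p / 2)) (riemannianVolume g)) (𝓝[>] (0 : ℝ)) (𝓝 0) := by
  have ep := exponentPair_ofReal hp
  set P := ENNReal.ofReal p with hP
  set Q := ENNReal.ofReal (p / 2) with hQ
  set μ := riemannianVolume g
  obtain ⟨C⟩ := D.nonempty_cutoffs
  choose κ' γ' hM using fun i => D.exists_metricConv_chartMat (one_le_two.trans hp) hW hs hK.isClosed
    (D.ψ_smooth i) (C.bump_β i)
  have hE : ∀ j, LpTo Q (C.err g.inner κ' γ' j) (fun _ => 0) := fun j =>
    C.lpTo_curvature (Q := Q) (one_le_two.trans hp) hP hW hs hK.isClosed hM j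
  set T : Fin D.m → Set M := fun j => (D.ψ j).symm '' tsupport (C.ζ j) with hT
  have hTc : ∀ j, IsCompact (T j) := fun j => (C.bump_ζ j).compact.isCompact.image_of_continuousOn
    ((D.ψ j).continuousOn_symm.mono (C.supp_target j))
  have hTs : ∀ j, T j ⊆ (D.ψ j).source := by
    rintro j _ ⟨y, hy, rfl⟩; exact (D.ψ j).map_target (C.supp_target j hy)
  have hTm : ∀ j, MeasurableSet (T j) := fun j => (hTc j).isClosed.measurableSet
  choose c hc hc0 hle using fun j => riemannianVolume_map_le g (D.ψ_smooth j) (hTc j) (hTs j)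
  have hae : ∀ j, AEMeasurable (D.ψ j) (μ.restrict (T j)) := fun j =>
    ((D.ψ j).continuousOn.mono (hTs j)).aemeasurable (hTm j)
  have hlim : Tendsto (fun ε : ℝ => ∑ j, c j ^ (1 / Q).toReal *
      eLpNorm (C.err g.inner κ' γ' j ε) Q volume) (𝓝[>] 0) (𝓝 0) := by
    have h : ∀ j, Tendsto (fun ε : ℝ => c j ^ (1 / Q).toReal *
        eLpNorm (C.err g.inner κ' γ' j ε) Q volume) (𝓝[>] 0) (𝓝 0) := fun j => by
      have h1 := (hE j).tendsto
      simp only [sub_zero] at h1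
      have := ENNReal.Tendsto.const_mul (a := c j ^ (1 / Q).toReal) h1
        (Or.inr (ENNReal.rpow_ne_top_of_nonneg ENNReal.toReal_nonneg (hc j)))
      simpa using this
    simpa using tendsto_finsetSum Finset.univ fun j _ => h j
  refine tendsto_of_tendsto_of_tendsto_of_le_of_le' tendsto_const_nhds hlim
    (Eventually.of_forall fun _ => zero_le) ?_
  filter_upwards [C.eventually_err_le (Q := Q) hs hK.isClosed hR hM,
    C.eventually_nonneg_away hs hK.isClosed hR,
    eventually_all.2 fun j => (hE j).eventually_memLp] with ε h1 h2 h3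
  set G : Fin D.m → M → ℝ := fun j => (T j).indicator fun x => C.err g.inner κ' γ' j ε (D.ψ j x)
    with hG
  have hcomp := fun j => eLpNorm_comp_le (hae j) (hc0 j) (hle j) (q := Q) (h3 j).1
  have hGm : ∀ j, AEStronglyMeasurable (G j) μ := fun j =>
    (aestronglyMeasurable_indicator_iff (hTm j)).2 (hcomp j).1
  calc eLpNorm (fun x => max (-scalarCurvature (D.regularise g.inner ε) x) 0) Q μ
      ≤ eLpNorm (∑ j, fun x => ‖G j x‖) Q μ := by
        refine eLpNorm_mono fun x => ?_
        rw [Finset.sum_apply, Real.norm_of_nonneg (le_max_right _ _),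
          Real.norm_of_nonneg (Finset.sum_nonneg fun _ _ => norm_nonneg _)]
        refine max_le ?_ (Finset.sum_nonneg fun _ _ => norm_nonneg _)
        -- If some `ζ_j` equals `1` at the point, the error in that chart bounds the negative part;
        -- otherwise the curvature is nonnegative.
        by_cases hx : ∃ j, x ∈ (D.ψ j).source ∧ C.ζ j (D.ψ j x) = 1
        · obtain ⟨j, hxj, hζ⟩ := hx
          have hxT : x ∈ T j := ⟨D.ψ j x, subset_tsupport _ (by
            rw [Function.mem_support, hζ]; exact one_ne_zero), (D.ψ j).left_inv hxj⟩
          have h4 := h1 j x hxj hζ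
          refine le_trans ?_ (Finset.single_le_sum (f := fun j => ‖G j x‖)
            (fun _ _ => norm_nonneg _) (Finset.mem_univ j))
          simp only [hG, indicator_of_mem hxT, Real.norm_eq_abs]
          linarith [neg_abs_le (C.err g.inner κ' γ' j ε (D.ψ j x))]
        · push Not at hx
          have := h2 x hx
          exact (neg_nonpos.2 this).trans (Finset.sum_nonneg fun _ _ => norm_nonneg _)
    _ ≤ ∑ j, eLpNorm (fun x => ‖G j x‖) Q μ :=
        eLpNorm_sum_le (fun j _ => (hGm j).norm) ep.one_le
    _ ≤ ∑ j, c j ^ (1 / Q).toReal * eLpNorm (C.err g.inner κ' γ' j ε) Q volume := by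
        refine Finset.sum_le_sum fun j _ => ?_
        rw [eLpNorm_norm, hG, eLpNorm_indicator_eq_eLpNorm_restrict (hTm j)]
        exact (hcomp j).2

end RegularisationData

end LowRegPMT

end

theorem mainTheorem3 {n : ℕ} (hn : 3 ≤ n) {M : Type*} [TopologicalSpace M] [T2Space M]
    [SigmaCompactSpace M] [ChartedSpace (LowRegPMT.Euc n) M]
    [IsManifold 𝓘(ℝ, LowRegPMT.Euc n) ∞ M] [MeasurableSpace M] [BorelSpace M]
    (p : ℝ) (hp : 2 ≤ p) (g : LowRegPMT.C0Metric n M)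
    (hW : LowRegPMT.MemW1pLoc g.inner p)
    (hcomplete : LowRegPMT.IsCompleteMetric g)
    (hflat : LowRegPMT.IsAsymptoticallyFlat g)
    (K : Set M) (hK : IsCompact K) (hsmooth : LowRegPMT.IsSmoothMetricOn g Kᶜ)
    (hR : LowRegPMT.ScalarCurvatureNonneg g.inner)
    (D : LowRegPMT.RegularisationData n M K) :
    (∀ᶠ ε in 𝓝[>] (0 : ℝ), ∃ h : LowRegPMT.SmoothMetric n M,
      ∀ x, h.inner x = D.regularise g.inner ε x) ∧
    Tendsto (fun ε : ℝ =>
        eLpNorm (fun x => max (-LowRegPMT.scalarCurvature (D.regularise g.inner ε) x) 0)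
          (ENNReal.ofReal (p / 2)) (LowRegPMT.riemannianVolume g))
      (𝓝[>] (0 : ℝ)) (𝓝 0) := by
  exact ⟨D.eventually_exists_smoothMetric (one_le_two.trans hp) hW hsmooth hK.isClosed,
    D.tendsto_eLpNorm_scalarCurvature hp hW hK hsmooth hR⟩
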